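/- **Setting.** Write $q=e^{2\pi i\tau}$, $y=e^{2\pi i z}$. Identify $\mathbb R^4=\mathbb C^2$, on which $SU(2)$ acts by matrices. Let $\Gamma\subset\Pi_L\oplus\Pi_R=\mathbb C^2\oplus\mathbb C^2$ be a lattice that is even and unimodular for the form $k^2=|k_L|^2-|k_R|^2$ of signature $(4,4)$ (the winding–momentum lattice of an arbitrary $N=(4,4)$ sigma model on $T^4$), and let $$G_0=\bigl(SU(2)_L\times SU(2)_R\bigr)\cap O(\Gamma)=\{g=(g_L,g_R)\in SU(2)\times SU(2): g\Gamma=\Gamma\}.$$ For a lattice $L\subset\mathbb C^2\oplus\mathbb C^2$, let $\mathcal H_L$ be the Ramond Fock space $$\mathcal H_L=\mathbb C[L]\otimes\Lambda^\bullet(\text{fermionic creation modes})\otimes \mathrm{Sym}^\bullet(\text{bosonic creation modes}),$$ with fermionic modes $\chi^i_{-n}$ $(n\ge 0)$, $\chi^{i*}_{-n}$ $(n\ge1)$ and bosonic modes $j^i_{-n}, j^{i*}_{-n}$ $(n\ge 1)$, $i=1,2$, and a second (right) copy $\tilde\chi,\tilde j$ of all of these. A mode with index $-n$ has energy $n$;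 $\mathbb C[L]$ has basis $V_k$, $k=(k_L,k_R)\in L$, of energies $(|k_L|^2/2,|k_R|^2/2)$; the lowest ground state has energies $(\frac14,\frac14)$. Let $L_0,\tilde L_0$ be the total left and right energies. Let $J_0^3$ be the operator that has value $-1$ on the lowest ground state, with $\chi^i$ and $\chi^{i*}$ of charges $+1,-1$ and everything else neutral; let $(-1)^F$ be the parity of the number of fermionic modes. Given $g=(g_L,g_R)\in SU(2)^2$ with $gL=L$, a lift of $g$ acts on $\mathcal H_L$ by $V_k\mapsto\xi_g(k)V_{gk}$, by $g_L$ on the doublets $\chi^i_{-n},j^i_{-n}$, by $\overline{g_L}$ on $\chi^{i*}_{-n},j^{i*}_{-n}$, similarly by $g_R$ on the right, multiplicatively, fixing the lowest ground state. Here $\xi_g:L\to U(1)$ satisfies $\xi_g(k)\xi_g(k')/\xi_g(k+k')=\epsilon(k,k')/\epsilon(gk,gk')$ for a $U(1)$-valued 2-cocycle $\epsilon$ on $L$ with $\epsilon(k,k')=(-1)^{(k,k')}\epsilon(k',k)$, where $(\cdot,\cdot)$ is the form of $L$; the lift is *standard* if $\xi_g=1$ on $L^g$. The space $\mathcal H_\Gamma$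 is the RR sector of the sigma model, and the twined elliptic genus of (a lift of) $g\in G_0$ is $$\phi_g^G(\tau,z)=\mathrm{Tr}_{\mathcal H_\Gamma}\bigl[g(-1)^Fy^{J_0^3}q^{L_0-\frac{6}{24}}\bar q^{\tilde L_0-\frac{6}{24}}\bigr].$$ For an $E_8$ root lattice $\Lambda\subset\mathbb C^2\oplus\mathbb C^2=\mathbb R^8$ with the Euclidean form, $\mathcal H_\Lambda$ is the canonically twisted module of the $E_8$ lattice VOSA $V^f_{E_8}$, and $$Z_g(\tau,z)=\mathrm{Tr}_{\mathcal H_\Lambda}\bigl[g(-1)^Fy^{J_0^{3}}q^{L_0+\tilde L_0-\frac{12}{24}}\bigr].$$ (All modes are chiral in $V^f_{E_8}$, so that $L_0+\tilde L_0$ is its full $L_0$.) **Theorem.** For every such $\Gamma$ there is a copy $\Lambda\subset\mathbb C^2\oplus\mathbb C^2$ of the $E_8$ root lattice that is preserved by $G_0$, so that $G_0\subset SO(8)\cap \mathrm{Aut}(\Lambda)=W^+(E_8)$ acts on $V^f_{E_8}$ by the same representation on $\mathbb C^2\oplus\mathbb C^2$ as on the sigma model, and such that for every $g\in G_0$, for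 all standard lifts of $g$ to the two theories, and for all $\tau$ with $\operatorname{Im}\tau>0$ and all $z\in\mathbb C$, the sums over joint eigenvalues that define the two traces converge absolutely and $$Z_g(\tau,z)=\phi_g^G(\tau,z).$$ -/

import Mathlib

open scoped TensorProduct ComplexConjugate

noncomputable section

namespace TorusModel

/-! ### Lattices and symmetry groups -/

/-- A Euclidean four-space `ℝ⁴`, in complex coordinates `ℂ²` adapted to the splitting
`SO(4) = (SU(2)^A × SU(2)^J)/±1`: the factor `SU(2)^A` is `SU(2)` acting on `ℂ²` by matrices, and
the R-symmetry group `SU(2)^J` is its commutant in `SO(4)`. -/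
abbrev FourSpace := Fin 2 → ℂ

/-- `Π = Π_L ⊕ Π_R` (and `F = X ⊕ X̄` on the VOSA side). -/
abbrev Ambient := FourSpace × FourSpace

abbrev SU2 := Matrix.specialUnitaryGroup (Fin 2) ℂ

/-- The Euclidean inner product of `ℝ⁴ = ℂ²`. -/
def dot (x y : FourSpace) : ℝ := ∑ i, (x i * conj (y i)).re

/-- The form `k_L · k'_L - k_R · k'_R` of signature `(4,4)`. -/
def narainForm (v w : Ambient) : ℝ := dot v.1 w.1 - dot v.2 w.2

/-- The form `k_L · k'_L + k_R · k'_R` of signature `(8,0)`. -/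
def euclideanForm (v w : Ambient) : ℝ := dot v.1 w.1 + dot v.2 w.2

/-- The winding-momentum (Narain) lattice of a sigma model on `T⁴`: an even unimodular lattice of
signature `(4,4)` placed in `Π_L ⊕ Π_R`. As the lattice varies, all relative positions of
`Π_L`, `Π_R`, hence all sigma models, occur. -/
structure IsNarainLattice (Γ : Submodule ℤ Ambient) : Prop where
  discrete : DiscreteTopology Γ
  span_eq_top : Submodule.span ℝ (Γ : Set Ambient) = ⊤
  even : ∀ v ∈ Γ, ∃ n : ℤ, narainForm v v = 2 * n
  selfDual : ∀ v, v ∈ Γ ↔ ∀ w ∈ Γ, ∃ n : ℤ, narainForm v w = n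

/-- A copy of the `E₈` root lattice in the Euclidean space `X ⊕ X̄ = ℝ⁸`: it has a basis of simple
roots of type `E₈`. -/
def IsE8Lattice (Λ : Submodule ℤ Ambient) : Prop :=
  ∃ b : Module.Basis (Fin 8) ℤ Λ, ∀ i j, euclideanForm (b i) (b j) = (CartanMatrix.E₈ i j : ℝ)

/-- The vector representation `ρ_ψ` of `SU(2)_L^A × SU(2)_R^A` on `Π_L ⊕ Π_R`. -/
def act (g : SU2 × SU2) (v : Ambient) : Ambient :=
  (g.1.1.mulVec v.1, g.2.1.mulVec v.2)

lemma act_one (v : Ambient) : act 1 v = v := by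
  simp [act]

lemma act_mul (g h : SU2 × SU2) (v : Ambient) : act (g * h) v = act g (act h v) := by
  simp only [act, Matrix.mulVec_mulVec]
  rfl

/-- `(SU(2)_L^A × SU(2)_R^A) ∩ O(L)`. These maps preserve both forms and have determinant one. -/
def latticeSymmetries (L : Submodule ℤ Ambient) : Subgroup (SU2 × SU2) where
  carrier := {g | ∀ v, act g v ∈ L ↔ v ∈ L}
  one_mem' v := by rw [act_one]
  mul_mem' {g h} hg hh v := by rw [act_mul, hg, hh]
  inv_mem' {g} hg v := by rw [← hg, ← act_mul, mul_inv_cancel, act_one]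

/-- The group `G₀` of the sigma model with winding-momentum lattice `Γ`. -/
abbrev G0 (Γ : Submodule ℤ Ambient) : Subgroup (SU2 × SU2) := latticeSymmetries Γ

/-- The automorphism of `L` given by a symmetry. -/
def latticeAct {L : Submodule ℤ Ambient} {g : SU2 × SU2} (hg : g ∈ latticeSymmetries L)
    (k : L) : L :=
  ⟨act g k, (hg k).2 k.2⟩

/-! ### Cocycles and standard lifts -/

/-- `ε` is a cocycle for the vertex operators `V_k`, `k ∈ L`, where `L` carries the form `B`. -/
structure IsCocycle (B : Ambient → Ambient → ℝ) (L : Submodule ℤ Ambient)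
    (ε : L → L → Circle) : Prop where
  comm : ∀ (v w : L) (n : ℤ), B v w = n → (ε v w : ℂ) = (-1 : ℂ) ^ n * ε w v
  assoc : ∀ u v w : L, ε u v * ε (u + v) w = ε u (v + w) * ε v w

/-- `ξ` defines a standard lift `V_k ↦ ξ(k) V_{g(k)}` of `g`: it is compatible with the cocycle
and trivial on the vectors fixed by `g`. -/
structure IsStandardLift {L : Submodule ℤ Ambient} (ε : L → L → Circle)
    {g : SU2 × SU2} (hg : g ∈ latticeSymmetries L) (ξ : L → Circle) : Prop where
  compat : ∀ v w : L,
    ξ v * ξ w / ξ (v + w) = ε v w / ε (latticeAct hg v) (latticeAct hg w)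
  fixed : ∀ v : L, latticeAct hg v = v → ξ v = 1

/-! ### The Fock space -/

inductive Side
  | left
  | right

/-- The `SU(2)`-doublets of fermionic creation operators in the Ramond sector: `chi s n` stands for
`χ^i_{-n}` with `n ≥ 0` and `chiStar s n` for `χ^{i*}_{-(n+1)}`, where `i = 1, 2`, for the left- or
right-moving fermions. The zero modes `χ^i_0` create the `2⁴` ground states from the one of
lowest charges `|-½,-½;-½,-½⟩`, and the `χ^{i*}_0` are the annihilation operators. -/
inductive FermionMode
  | chi (s : Side) (n : ℕ)
  | chiStar (s : Side) (n : ℕ)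

/-- The doublets of bosonic creation operators: `j s n` and `jStar s n` stand for the complex
combinations `j^i_{-(n+1)}` and `j^{i*}_{-(n+1)}` of the currents. -/
inductive BosonMode
  | j (s : Side) (n : ℕ)
  | jStar (s : Side) (n : ℕ)

/-- The fermionic Fock space over the lowest Ramond ground state. -/
abbrev FermionSpace := ExteriorAlgebra ℂ (FermionMode × Fin 2 →₀ ℂ)

/-- The bosonic Fock space over its vacuum. -/
abbrev BosonSpace := MvPolynomial (BosonMode × Fin 2) ℂ

/-- The Ramond sector built on the lattice `L`: all fermionic and bosonic oscillators applied to
the ground states `|k; s⟩ = V_k |s⟩`. For the winding-momentum lattice this is the RR sector of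
the sigma model; for an `E₈` lattice in `X ⊕ X̄` it is the canonically twisted module of
`V^f_{E₈}`, where the modes of `Side.left` are those of the fermions `γ^i` and bosons along `X` and
the modes of `Side.right` those of the `γ̄^i` and the bosons along `X̄`. -/
abbrev StateSpace (L : Submodule ℤ Ambient) :=
  (L →₀ ℂ) ⊗[ℂ] (FermionSpace ⊗[ℂ] BosonSpace)

/-- The linear map that acts on the doublet `m` of modes by the matrix `c m`. -/
def fermionOneParticle (c : FermionMode → Matrix (Fin 2) (Fin 2) ℂ) :
    (FermionMode × Fin 2 →₀ ℂ) →ₗ[ℂ] (FermionMode × Fin 2 →₀ ℂ) :=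
  Finsupp.linearCombination ℂ fun p => ∑ i, Finsupp.single (p.1, i) (c p.1 i p.2)

/-- Its multiplicative extension to the Fock space; the lowest ground state is fixed. -/
def fermionOp (c : FermionMode → Matrix (Fin 2) (Fin 2) ℂ) : FermionSpace →ₗ[ℂ] FermionSpace :=
  (ExteriorAlgebra.map (fermionOneParticle c)).toLinearMap

/-- The operator that acts on the doublet `m` of modes by the matrix `c m`, extended
multiplicatively to the Fock space; the vacuum is fixed. -/
def bosonOp (c : BosonMode → Matrix (Fin 2) (Fin 2) ℂ) : BosonSpace →ₗ[ℂ] BosonSpace :=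
  (MvPolynomial.aeval fun p : BosonMode × Fin 2 =>
    ∑ i, MvPolynomial.C (c p.1 i p.2) * (MvPolynomial.X (p.1, i) : BosonSpace)).toLinearMap

/-! ### Operators on the Ramond sector -/

/-- The component of `g` on the left or on the right. -/
def component (g : SU2 × SU2) : Side → Matrix (Fin 2) (Fin 2) ℂ
  | .left => g.1.1
  | .right => g.2.1

/-- `g` acts on `(χ¹, χ²)` by its matrix and on `(χ^{1*}, χ^{2*})` by the complex conjugate. -/
def fermionRep (g : SU2 × SU2) : FermionMode → Matrix (Fin 2) (Fin 2) ℂ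
  | .chi s _ => component g s
  | .chiStar s _ => (component g s).map conj

/-- The same on the currents, so that the supercurrents are preserved. -/
def bosonRep (g : SU2 × SU2) : BosonMode → Matrix (Fin 2) (Fin 2) ℂ
  | .j s _ => component g s
  | .jStar s _ => (component g s).map conj

/-- `V_k ↦ ξ(k) V_{g(k)}`. -/
def latticeOp {L : Submodule ℤ Ambient} {g : SU2 × SU2} (hg : g ∈ latticeSymmetries L)
    (ξ : L → Circle) : (L →₀ ℂ) →ₗ[ℂ] (L →₀ ℂ) :=
  Finsupp.linearCombination ℂ fun k => Finsupp.single (latticeAct hg k) (ξ k : ℂ)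

/-- The action on the Ramond sector of the lift of `g` with phases `ξ`. -/
def symmetryOp {L : Submodule ℤ Ambient} {g : SU2 × SU2} (hg : g ∈ latticeSymmetries L)
    (ξ : L → Circle) : StateSpace L →ₗ[ℂ] StateSpace L :=
  TensorProduct.map (latticeOp hg ξ)
    (TensorProduct.map (fermionOp (fermionRep g)) (bosonOp (bosonRep g)))

/-- The fermion parity `(-1)^F`; it is `+1` on the lowest ground state, whose left and right
charges are both `-1`. -/
def parityOp (L : Submodule ℤ Ambient) : StateSpace L →ₗ[ℂ] StateSpace L :=
  TensorProduct.map LinearMap.id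
    (TensorProduct.map (fermionOp fun _ => -1) LinearMap.id)

/-- `t ^ (½ k_L²) u ^ (½ k_R²)`. -/
def latticeWeight (t u : ℝ) (k : Ambient) : ℝ :=
  t ^ (dot k.1 k.1 / 2) * u ^ (dot k.2 k.2 / 2)

/-- A mode with energy `n` on the left (right) scales with `t ^ n` (`u ^ n`); moreover the
left-moving `χ^i`, `χ^{i*}` have charges `1`, `-1` under `J₀³`. -/
def fermionWeight (t u y : ℝ) : FermionMode → ℝ
  | .chi .left n => t ^ n * y
  | .chi .right n => u ^ n
  | .chiStar .left n => t ^ (n + 1) * y⁻¹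
  | .chiStar .right n => u ^ (n + 1)

def bosonWeight (t u : ℝ) : BosonMode → ℝ
  | .j .left n => t ^ (n + 1)
  | .j .right n => u ^ (n + 1)
  | .jStar .left n => t ^ (n + 1)
  | .jStar .right n => u ^ (n + 1)

def latticeScaling (L : Submodule ℤ Ambient) (t u : ℝ) : (L →₀ ℂ) →ₗ[ℂ] (L →₀ ℂ) :=
  Finsupp.linearCombination ℂ fun k => Finsupp.single k (latticeWeight t u k : ℂ)

/-- The operator `t^{L₀} u^{L̃₀} y^{J₀³}` for `t, u, y > 0`. Here `L₀` is the energy carried by the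
modes of `Side.left` and `½ k_L²`, and `L̃₀` that carried by the modes of `Side.right` and `½ k_R²`.
The lowest ground state has `L₀ = L̃₀ = 4/16` (four Ramond fermions each) and `J₀³ = -1`. -/
def scalingOp (L : Submodule ℤ Ambient) (t u y : ℝ) : StateSpace L →ₗ[ℂ] StateSpace L :=
  ((t ^ (1 / 4 : ℝ) * u ^ (1 / 4 : ℝ) * y⁻¹ : ℝ) : ℂ) •
    TensorProduct.map (latticeScaling L t u)
      (TensorProduct.map
        (fermionOp fun m => (fermionWeight t u y m : ℂ) • 1)
        (bosonOp fun m => (bosonWeight t u m : ℂ) • 1))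

/-! ### Symmetries commute with the gradings -/

lemma dot_mulVec (A : SU2) (x : FourSpace) : dot (A.1.mulVec x) (A.1.mulVec x) = dot x x := by
  have h : (star A.1) * A.1 = 1 :=
    Matrix.mem_unitaryGroup_iff'.1 (Matrix.specialUnitaryGroup_le_unitaryGroup A.2)
  have key : ∀ y : FourSpace, dot y y = (dotProduct y (star y)).re := by
    intro y
    simp [dot, dotProduct]
  rw [key, key, Matrix.star_mulVec, dotProduct_comm, ← Matrix.dotProduct_mulVec,
    Matrix.mulVec_mulVec, ← Matrix.star_eq_conjTranspose, h, Matrix.one_mulVec, dotProduct_comm]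

lemma fermionOneParticle_comp (c d : FermionMode → Matrix (Fin 2) (Fin 2) ℂ) :
    fermionOneParticle c ∘ₗ fermionOneParticle d = fermionOneParticle fun m => c m * d m := by
  refine Finsupp.lhom_ext' fun p => LinearMap.ext_ring ?_
  simp [fermionOneParticle, Matrix.mul_apply, Fin.sum_univ_two, mul_comm]
  abel

lemma fermionOp_comp (c d : FermionMode → Matrix (Fin 2) (Fin 2) ℂ) :
    fermionOp c ∘ₗ fermionOp d = fermionOp fun m => c m * d m := by
  rw [fermionOp, fermionOp, fermionOp, ← fermionOneParticle_comp,
    ← ExteriorAlgebra.map_comp_map, AlgHom.comp_toLinearMap]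

lemma bosonOp_comp (c d : BosonMode → Matrix (Fin 2) (Fin 2) ℂ) :
    bosonOp c ∘ₗ bosonOp d = bosonOp fun m => c m * d m := by
  rw [bosonOp, bosonOp, bosonOp, ← AlgHom.comp_toLinearMap]
  refine congrArg AlgHom.toLinearMap (MvPolynomial.algHom_ext fun p => ?_)
  simp only [AlgHom.comp_apply, MvPolynomial.aeval_X, MvPolynomial.aeval_C, map_add, map_mul,
    Fin.sum_univ_two, Matrix.mul_apply, MvPolynomial.algebraMap_eq]
  ring

lemma latticeOp_comm {L : Submodule ℤ Ambient} {g : SU2 × SU2} (hg : g ∈ latticeSymmetries L)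
    (ξ : L → Circle) (t u : ℝ) :
    latticeOp hg ξ ∘ₗ latticeScaling L t u = latticeScaling L t u ∘ₗ latticeOp hg ξ := by
  refine Finsupp.lhom_ext' fun k => LinearMap.ext_ring ?_
  have h : latticeWeight t u (latticeAct hg k) = latticeWeight t u k := by
    simp only [latticeWeight, latticeAct, act, dot_mulVec]
  simp [latticeOp, latticeScaling, h, mul_comm]

/-- `ĝ (-1)^F`. -/
def twiningOp {L : Submodule ℤ Ambient} {g : SU2 × SU2} (hg : g ∈ latticeSymmetries L)
    (ξ : L → Circle) : StateSpace L →ₗ[ℂ] StateSpace L :=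
  symmetryOp hg ξ ∘ₗ parityOp L

lemma twiningOp_comm {L : Submodule ℤ Ambient} {g : SU2 × SU2} (hg : g ∈ latticeSymmetries L)
    (ξ : L → Circle) (t u y : ℝ) (v : StateSpace L) :
    scalingOp L t u y (twiningOp hg ξ v) = twiningOp hg ξ (scalingOp L t u y v) := by
  have h : scalingOp L t u y ∘ₗ twiningOp hg ξ = twiningOp hg ξ ∘ₗ scalingOp L t u y := by
    simp only [scalingOp, twiningOp, symmetryOp, parityOp, LinearMap.smul_comp,
      LinearMap.comp_smul, ← TensorProduct.map_comp, LinearMap.comp_id, fermionOp_comp,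
      bosonOp_comp, latticeOp_comm, smul_mul_assoc, mul_smul_comm, one_mul, mul_one]
  exact LinearMap.congr_fun h v

/-! ### Twined traces -/

/-- The joint eigenspace with `L₀ = h`, `L̃₀ = h'`, `J₀³ = j`. -/
def weightSpace (L : Submodule ℤ Ambient) (h h' : ℝ) (j : ℤ) : Submodule ℂ (StateSpace L) where
  carrier := {v | ∀ t u y : ℝ, 0 < t → 0 < u → 0 < y →
    scalingOp L t u y v = ((t ^ h * u ^ h' * y ^ j : ℝ) : ℂ) • v}
  zero_mem' := by simp
  add_mem' hv hw t u y ht hu hy := by rw [map_add, hv t u y ht hu hy, hw t u y ht hu hy, smul_add]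
  smul_mem' c v hv t u y ht hu hy := by rw [map_smul, hv t u y ht hu hy, smul_comm]

/-- The joint eigenspace with `L₀ + L̃₀ = h` and `J₀³ = j`. For the twisted module of `V^f_{E₈}`,
in which all modes are chiral, `L₀ + L̃₀` is the operator called `L₀` there, and `J₀³` is
`J₀^{X,3}`. -/
def chiralWeightSpace (L : Submodule ℤ Ambient) (h : ℝ) (j : ℤ) :
    Submodule ℂ (StateSpace L) where
  carrier := {v | ∀ t y : ℝ, 0 < t → 0 < y →
    scalingOp L t t y v = ((t ^ h * y ^ j : ℝ) : ℂ) • v}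
  zero_mem' := by simp
  add_mem' hv hw t y ht hy := by rw [map_add, hv t y ht hy, hw t y ht hy, smul_add]
  smul_mem' c v hv t y ht hy := by rw [map_smul, hv t y ht hy, smul_comm]

lemma twiningOp_mem_weightSpace {L : Submodule ℤ Ambient} {g : SU2 × SU2}
    (hg : g ∈ latticeSymmetries L) (ξ : L → Circle) (h h' : ℝ) (j : ℤ) :
    ∀ v ∈ weightSpace L h h' j, twiningOp hg ξ v ∈ weightSpace L h h' j := by
  intro v hv t u y ht hu hy
  rw [twiningOp_comm, hv t u y ht hu hy, map_smul]

lemma twiningOp_mem_chiralWeightSpace {L : Submodule ℤ Ambient} {g : SU2 × SU2}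
    (hg : g ∈ latticeSymmetries L) (ξ : L → Circle) (h : ℝ) (j : ℤ) :
    ∀ v ∈ chiralWeightSpace L h j, twiningOp hg ξ v ∈ chiralWeightSpace L h j := by
  intro v hv t y ht hy
  rw [twiningOp_comm, hv t y ht hy, map_smul]

/-- The contribution of the eigenspace `(L₀, L̃₀, J₀³) = (h, h', j)` to the twined elliptic genus,
with `q = e^{2πiτ}`, `y = e^{2πiz}` and `c = c̃ = 6`. -/
def genusTerm {Γ : Submodule ℤ Ambient} {g : SU2 × SU2} (hg : g ∈ latticeSymmetries Γ)
    (ξ : Γ → Circle) (τ z : ℂ) (w : ℝ × ℝ × ℤ) : ℂ :=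
  LinearMap.trace ℂ _
      ((twiningOp hg ξ).restrict (twiningOp_mem_weightSpace hg ξ w.1 w.2.1 w.2.2)) *
    Complex.exp (2 * Real.pi * Complex.I * z * w.2.2) *
    Complex.exp (2 * Real.pi * Complex.I * τ * (w.1 - 6 / 24 : ℝ)) *
    Complex.exp (-2 * Real.pi * Complex.I * conj τ * (w.2.1 - 6 / 24 : ℝ))

/-- The twined elliptic genus `φ_g(τ,z) = Tr_RR [g (-1)^F y^{J₀³} q^{L₀-c/24} q̄^{L̃₀-c̃/24}]`. -/
def twinedEllipticGenus {Γ : Submodule ℤ Ambient} {g : SU2 × SU2}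
    (hg : g ∈ latticeSymmetries Γ) (ξ : Γ → Circle) (τ z : ℂ) : ℂ :=
  ∑' w, genusTerm hg ξ τ z w

/-- The contribution of the eigenspace with weight `h` and charge `j` to the twined trace of the
twisted module, with `c = 12`. -/
def traceTerm {Λ : Submodule ℤ Ambient} {g : SU2 × SU2} (hg : g ∈ latticeSymmetries Λ)
    (ξ : Λ → Circle) (τ z : ℂ) (w : ℝ × ℤ) : ℂ :=
  LinearMap.trace ℂ _
      ((twiningOp hg ξ).restrict (twiningOp_mem_chiralWeightSpace hg ξ w.1 w.2)) *
    Complex.exp (2 * Real.pi * Complex.I * z * w.2) *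
    Complex.exp (2 * Real.pi * Complex.I * τ * (w.1 - 12 / 24 : ℝ))

/-- The twined trace `Z_g(τ,z) = Tr_tw [g (-1)^F y^{J₀^{X,3}} q^{L₀-c/24}]`. -/
def twinedTrace {Λ : Submodule ℤ Ambient} {g : SU2 × SU2}
    (hg : g ∈ latticeSymmetries Λ) (ξ : Λ → Circle) (τ z : ℂ) : ℂ :=
  ∑' w, traceTerm hg ξ τ z w

end TorusModel

end

/-! Identify each ℂ² with ℍ so that SU(2) acts by left multiplication with unit quaternions; a unit
other than 1 then fixes only 0.

The traces. In a basis of lattice vectors times oscillator states that diagonalizes g on the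
doublets, ĝ(-1)^F permutes basis vectors up to scalars. Hence only lattice vectors fixed by g
contribute, and there ξ = 1. Exchanging a right-moving boson with the fermion of equal energy and
equal g-eigenvalue keeps all weights and flips the sign, so excited right-moving oscillators cancel.
If g_R = 1, a right-moving zero mode cancels what remains and both traces vanish. If g_R ≠ 1, fixed
vectors are purely left-moving, the right-moving energy is 1/4 = 6/24, and the two traces are the
same sum once Γ and Λ have the same fixed vectors (`traceTerm_eq_genusTerm`). If g_L ≠ 1 as well,
both fixed lattices are 0. So Λ must be G₀-stable and have the same left-moving vectors as Γ
whenever G₀ contains some (1,b) with b ≠ 1; this is `exists_e8_lattice`.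

The lattice. The ring of pairs of quaternions that preserve Γ is closed under conjugation, because Γ
is self-dual. A symmetry with traces (a,b) therefore gives a central multiplication (a,b) on Γ, and
a+b and ab are integers. Minkowski's theorem excludes (a-b)² = 1, and |a|,|b| ≤ 2 leaves a short
list (`tracePair_of_int`). `exists_isMate` treats it case by case: a unit c+(a,b) of norm -1 twists
the Narain form into a definite form on Γ itself (`isMate_twist`); for traces ±√3 the group is so
small that an explicit lattice serves (`exists_isMate_of_sqrt_three`); if (1,-1) acts, Γ is
unimodular for the Euclidean form, and an even neighbour replaces it when it is odd
(`exists_isMate_of_two`); if (1,ω) acts with ω of order three, the right-moving sublattice is A₂ ⊕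
A₂, and its glue is twisted by 1+f for a complex structure f, which multiplies norms by 2 ≡ -1 mod 3
(`exists_isMate_of_complexStructure`); (ω,1) is the mirror image; otherwise every symmetry has two
equal integral traces, and explicit lattices serve again (`HasIntTraces.exists_lattice`). Rescaling
the two factors finally makes the definite form Euclidean.

Recognizing E₈. In an even unimodular definite lattice of rank eight, Minkowski's theorem produces
eight orthogonal roots. The lattice is then given by a binary code, which is forced to be the
extended Hamming code, and explicit matrices yield simple roots (`exists_cartan_basis`). -/

noncomputable section
namespace TorusModel

/-! ### Minkowski's theorem for Gram matrices -/

open MeasureTheory in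
/-- Minkowski's theorem for the quadratic form of a positive definite matrix `A`. -/
lemma exists_int_vec_lt_of_volume {r : ℕ} (A : Matrix (Fin r) (Fin r) ℝ) (hA : A.PosDef)
    {ρ : ℝ} (hρ : 0 ≤ ρ)
    (h : ENNReal.ofReal (√A.det) * 2 ^ r < volume (Metric.ball (0 : EuclideanSpace ℝ (Fin r)) ρ)) :
    ∃ n : Fin r → ℤ, n ≠ 0 ∧ (∑ i, ∑ j, (n i : ℝ) * A i j * n j) < ρ ^ 2 := by
  classical
  -- With A = BᵀB the quadratic form becomes the squared Euclidean length on the lattice spanned by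
  -- the columns of B, whose covolume is √(det A).
  obtain ⟨B, hB⟩ : ∃ B : Matrix (Fin r) (Fin r) ℝ, A = star B * B := by
    open scoped MatrixOrder in
    exact CStarAlgebra.nonneg_iff_eq_star_mul_self.1 hA.posSemidef.nonneg
  have hdet : A.det = B.det ^ 2 := by
    rw [hB, Matrix.det_mul, Matrix.star_eq_conjTranspose, Matrix.det_conjTranspose]
    simp [sq]
  have hBdet : B.det ≠ 0 := by
    intro h0
    have := hA.det_pos
    rw [hdet, h0] at this
    simp at this
  have hli : LinearIndependent ℝ B.transpose.row := by
    rw [Matrix.linearIndependent_rows_iff_isUnit, Matrix.isUnit_iff_isUnit_det]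
    simpa using hBdet
  let b : Module.Basis (Fin r) ℝ (Fin r → ℝ) := basisOfPiSpaceOfLinearIndependent hli
  have hb : ∀ i j, b i j = B j i := fun i j =>
    congrFun (congrFun (coe_basisOfPiSpaceOfLinearIndependent hli) i) j
  have hvol : volume (ZSpan.fundamentalDomain b) = ENNReal.ofReal (√A.det) := by
    rw [ZSpan.volume_fundamentalDomain, hdet, Real.sqrt_sq_eq_abs]
    congr 2
    rw [← Matrix.det_transpose]
    congr 1
    ext i j
    simp [hb]
  have hball : volume {x : Fin r → ℝ | ∑ i, x i ^ 2 < ρ ^ 2} =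
      volume (Metric.ball (0 : EuclideanSpace ℝ (Fin r)) ρ) := by
    rw [← (PiLp.volume_preserving_toLp (Fin r)).measure_preimage
      measurableSet_ball.nullMeasurableSet, EuclideanSpace.ball_zero_eq _ hρ]
    rfl
  have hconv : Convex ℝ {x : Fin r → ℝ | ∑ i, x i ^ 2 < ρ ^ 2} := by
    have := (convex_ball (0 : EuclideanSpace ℝ (Fin r)) ρ).linear_preimage
      (WithLp.linearEquiv 2 ℝ (Fin r → ℝ)).symm.toLinearMap
    rw [EuclideanSpace.ball_zero_eq _ hρ] at this
    exact this
  have hcount : Countable (Submodule.span ℤ (Set.range b)).toAddSubgroup :=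
    inferInstanceAs (Countable (Submodule.span ℤ (Set.range b)))
  obtain ⟨⟨x, hx⟩, hx0, hxs⟩ := exists_ne_zero_mem_lattice_of_measure_mul_two_pow_lt_measure
    (L := (Submodule.span ℤ (Set.range b)).toAddSubgroup)
    (ZSpan.isAddFundamentalDomain b volume)
    (s := {x : Fin r → ℝ | ∑ i, x i ^ 2 < ρ ^ 2})
    (fun x hx => by simpa using hx) hconv (by simpa [hvol, hball] using h)
  have hx' : x ∈ Submodule.span ℤ (Set.range b) := hx
  obtain ⟨n, hn⟩ := (Submodule.mem_span_range_iff_exists_fun ℤ).1 hx'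
  refine ⟨n, fun h0 => hx0 ?_, ?_⟩
  · have : x = 0 := by rw [← hn]; simp [h0]
    simpa using this
  · have hx2 : ∑ k, x k ^ 2 < ρ ^ 2 := hxs
    refine lt_of_eq_of_lt ?_ hx2
    have hxk : ∀ k, x k = ∑ i, (n i : ℝ) * B k i := fun k => by
      rw [← hn, Finset.sum_apply]
      simp [hb]
    have hAij : ∀ i j, A i j = ∑ k, B k i * B k j := fun i j => by
      rw [hB, Matrix.mul_apply]
      simp
    simp_rw [hxk, sq, Finset.sum_mul_sum, hAij, Finset.mul_sum, Finset.sum_mul]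
    rw [Finset.sum_comm (γ := Fin r) (s := Finset.univ) (t := Finset.univ)
      (f := fun k i => ∑ j, (n i : ℝ) * B k i * (n j * B k j))]
    refine Finset.sum_congr rfl fun i _ => ?_
    rw [Finset.sum_comm]
    exact Finset.sum_congr rfl fun k _ => Finset.sum_congr rfl fun j _ => by ring

/-- The squared volume of the unit ball, bounded below by an integer. -/
def ballBound (r : ℕ) : ℕ := [0, 3, 9, 17, 24, 27, 26, 22, 16].getD r 0

-- For radius 2 the factors 2^r cancel, and Minkowski's condition reads det < V_r² with V_r the
-- volume of the unit ball. The table holds integers strictly below V_r²; in rank one V_1² = 4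
-- exactly, whence the entry 3.
open MeasureTheory in
lemma volume_ball_two (r : ℕ) (h1 : 1 ≤ r) (h8 : r ≤ 8) (d : ℝ) (hd : d ≤ ballBound r) :
    ENNReal.ofReal (√d) * 2 ^ r < volume (Metric.ball (0 : EuclideanSpace ℝ (Fin r)) 2) := by
  have hpi := Real.pi_gt_d2
  have hpi2 : 9.8 < Real.pi ^ 2 := by nlinarith
  have hpi3 : 30.9 < Real.pi ^ 3 := by nlinarith
  have hpi4 : 97 < Real.pi ^ 4 := by nlinarith
  have key : ∀ v : ℝ, 0 < v → (ballBound r : ℝ) < v ^ 2 →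
      volume (Metric.ball (0 : EuclideanSpace ℝ (Fin r)) 2) =
        ENNReal.ofReal 2 ^ r * ENNReal.ofReal v →
      ENNReal.ofReal (√d) * 2 ^ r < volume (Metric.ball (0 : EuclideanSpace ℝ (Fin r)) 2) := by
    intro v hv hvd hvol
    rw [hvol, mul_comm]
    simp only [ENNReal.ofReal_ofNat]
    refine (ENNReal.mul_lt_mul_iff_right (by simp) (by finiteness)).2 ?_
    rw [ENNReal.ofReal_lt_ofReal_iff hv, Real.sqrt_lt' hv]
    linarith
  have even : ∀ k : ℕ, r = 2 * k → 0 < k → (ballBound r : ℝ) < (Real.pi ^ k / (k.factorial : ℝ))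
      ^ 2 →
      ENNReal.ofReal (√d) * 2 ^ r < volume (Metric.ball (0 : EuclideanSpace ℝ (Fin r)) 2) := by
    intro k hk hk0 hlt
    have : Nonempty (Fin r) := ⟨⟨0, h1⟩⟩
    refine key _ (by positivity) hlt ?_
    rw [InnerProductSpace.volume_ball_of_dim_even (k := k) (by simpa using hk)]
    simp
  have odd : ∀ k : ℕ, r = 2 * k + 1 →
      (ballBound r : ℝ) < (Real.pi ^ k * 2 ^ (k + 1) / (r.doubleFactorial : ℝ)) ^ 2 →
      ENNReal.ofReal (√d) * 2 ^ r < volume (Metric.ball (0 : EuclideanSpace ℝ (Fin r)) 2) := by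
    intro k hk hlt
    refine key _ (by positivity) hlt ?_
    rw [InnerProductSpace.volume_ball_of_dim_odd (k := k) (by simpa using hk)]
    simp
  interval_cases r
  · refine odd 0 rfl ?_
    norm_num [ballBound, Nat.doubleFactorial]
  · refine even 1 rfl one_pos ?_
    norm_num [ballBound, Nat.factorial]
    nlinarith
  · refine odd 1 rfl ?_
    norm_num [ballBound, Nat.doubleFactorial]
    nlinarith
  · refine even 2 rfl two_pos ?_
    norm_num [ballBound, Nat.factorial]
    nlinarith
  · refine odd 2 rfl ?_
    norm_num [ballBound, Nat.doubleFactorial]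
    nlinarith
  · refine even 3 rfl (by norm_num) ?_
    norm_num [ballBound, Nat.factorial]
    nlinarith
  · refine odd 3 rfl ?_
    norm_num [ballBound, Nat.doubleFactorial]
    nlinarith
  · refine even 4 rfl (by norm_num) ?_
    norm_num [ballBound, Nat.factorial]
    nlinarith

-- The volume is 2π² > 16. In rank four and determinant one this yields a nonzero vector of norm
-- less than 2, which an even lattice does not have.
open MeasureTheory in
lemma volume_ball_sqrt_two :
    ENNReal.ofReal (√1) * 2 ^ 4 < volume (Metric.ball (0 : EuclideanSpace ℝ (Fin 4)) (√2)) := by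
  have hpi := Real.pi_gt_d2
  rw [InnerProductSpace.volume_ball_of_dim_even (k := 2) (by simp)]
  have h2 : (2 : ENNReal) ^ 4 = ENNReal.ofReal 16 := by norm_num
  rw [finrank_euclideanSpace, Fintype.card_fin, ← ENNReal.ofReal_pow (by positivity),
    ← ENNReal.ofReal_mul (by positivity), h2, ← ENNReal.ofReal_mul (by positivity),
    show (√2 : ℝ) ^ 4 = (√2 ^ 2) ^ 2 by ring, Real.sq_sqrt (by norm_num)]
  refine (ENNReal.ofReal_lt_ofReal_iff (by positivity)).2 ?_
  norm_num [Nat.factorial]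
  nlinarith

/-! ### Short vectors in integral lattices -/

section ShortVectors

variable {V : Type*} [AddCommGroup V] [Module ℝ V] {B : V →ₗ[ℝ] V →ₗ[ℝ] ℝ}

lemma form_sum_sum {r : ℕ} (c : Fin r → V) (x y : Fin r → ℝ) :
    B (∑ i, x i • c i) (∑ j, y j • c j) = ∑ i, ∑ j, x i * B (c i) (c j) * y j := by
  simp only [map_sum, map_smul, LinearMap.sum_apply, LinearMap.smul_apply, smul_eq_mul,
    Finset.mul_sum]
  rw [Finset.sum_comm]
  exact Finset.sum_congr rfl fun i _ => Finset.sum_congr rfl fun j _ => by ring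

/-- The Gram matrix of `ℤ`-independent vectors is positive definite if it is integral. -/
lemma gram_posDef (hsymm : ∀ v w, B v w = B w v) (hpos : ∀ v, v ≠ 0 → 0 < B v v)
    {r : ℕ} {c : Fin r → V} (hc : ∀ n : Fin r → ℤ, ∑ i, (n i : ℝ) • c i = 0 → n = 0)
    {G : Matrix (Fin r) (Fin r) ℤ} (hG : ∀ i j, B (c i) (c j) = G i j) :
    (G.map (Int.cast : ℤ → ℝ)).PosDef := by
  have hnn : ∀ v, 0 ≤ B v v := fun v => by
    by_cases h : v = 0
    · simp [h]
    · exact (hpos v h).le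
  have hpsd : (G.map (Int.cast : ℤ → ℝ)).PosSemidef := by
    refine Matrix.PosSemidef.of_dotProduct_mulVec_nonneg ?_ fun x => ?_
    · ext i j
      simp [← hG, hsymm (c i) (c j)]
    · have := hnn (∑ i, x i • c i)
      rw [form_sum_sum] at this
      simpa [dotProduct, Matrix.mulVec, Finset.mul_sum, hG, mul_assoc] using this
  -- Independence is known only over ℤ. It suffices, because a degenerate integral matrix has a
  -- nonzero integral kernel vector.
  rw [hpsd.posDef_iff_det_ne_zero]
  have hcast : (G.map (Int.cast : ℤ → ℝ)).det = (G.det : ℝ) := by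
    exact ((Int.castRingHom ℝ).map_det G).symm
  rw [hcast]
  intro h0
  obtain ⟨n, hn0, hn⟩ := Matrix.exists_mulVec_eq_zero_iff.2 (Int.cast_eq_zero.1 h0)
  refine hn0 (hc n ?_)
  by_contra hne
  have h1 := hpos _ hne
  rw [form_sum_sum] at h1
  have h2 : ∀ i, ∑ j, (G i j : ℝ) * n j = 0 := fun i => by
    have := congrFun hn i
    simp only [Matrix.mulVec, dotProduct, Pi.zero_apply] at this
    exact_mod_cast this
  simp only [hG, mul_assoc, ← Finset.mul_sum, h2, mul_zero, Finset.sum_const_zero,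
    lt_self_iff_false] at h1

lemma exists_short_of_volume (hsymm : ∀ v w, B v w = B w v) (hpos : ∀ v, v ≠ 0 → 0 < B v v)
    {r : ℕ} {c : Fin r → V} (hc : ∀ n : Fin r → ℤ, ∑ i, (n i : ℝ) • c i = 0 → n = 0)
    {G : Matrix (Fin r) (Fin r) ℤ} (hG : ∀ i j, B (c i) (c j) = G i j) {ρ : ℝ} (hρ : 0 ≤ ρ)
    (h : ENNReal.ofReal (√(G.det : ℝ)) * 2 ^ r <
      MeasureTheory.volume (Metric.ball (0 : EuclideanSpace ℝ (Fin r)) ρ)) :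
    ∃ n : Fin r → ℤ, ∑ i, (n i : ℝ) • c i ≠ 0 ∧
      B (∑ i, (n i : ℝ) • c i) (∑ i, (n i : ℝ) • c i) < ρ ^ 2 := by
  have hdet : (G.map (Int.cast : ℤ → ℝ)).det = (G.det : ℝ) :=
    ((Int.castRingHom ℝ).map_det G).symm
  obtain ⟨n, hn0, hn⟩ := exists_int_vec_lt_of_volume _ (gram_posDef hsymm hpos hc hG) hρ
    (by rwa [hdet])
  refine ⟨n, fun h0 => hn0 (hc n h0), ?_⟩
  rw [form_sum_sum]
  simpa [hG] using hn

/-- A positive definite even lattice of small determinant contains a root. -/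
lemma exists_root_of_det_le (hsymm : ∀ v w, B v w = B w v) (hpos : ∀ v, v ≠ 0 → 0 < B v v)
    {r : ℕ} (h1 : 1 ≤ r) (h8 : r ≤ 8) {c : Fin r → V}
    (hc : ∀ n : Fin r → ℤ, ∑ i, (n i : ℝ) • c i = 0 → n = 0)
    {G : Matrix (Fin r) (Fin r) ℤ} (hG : ∀ i j, B (c i) (c j) = G i j)
    (heven : ∀ n : Fin r → ℤ, ∃ m : ℤ,
      B (∑ i, (n i : ℝ) • c i) (∑ i, (n i : ℝ) • c i) = 2 * m)
    (hdet : G.det ≤ ballBound r) :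
    ∃ n : Fin r → ℤ, B (∑ i, (n i : ℝ) • c i) (∑ i, (n i : ℝ) • c i) = 2 := by
  -- Radius 2 bounds the norm strictly by 4, and the only even integer strictly between 0 and 4 is
  -- 2.
  obtain ⟨n, hn0, hn⟩ := exists_short_of_volume hsymm hpos hc hG (ρ := 2) (by norm_num)
    (volume_ball_two r h1 h8 _ (by exact_mod_cast hdet))
  refine ⟨n, ?_⟩
  obtain ⟨m, hm⟩ := heven n
  have hp := hpos _ hn0
  rw [hm] at hp hn ⊢
  have h3 : 0 < m := by exact_mod_cast (by linarith : (0 : ℝ) < m)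
  have h4 : m < 2 := by exact_mod_cast (by linarith : (m : ℝ) < 2)
  have : m = 1 := by lia
  simp [this]

end ShortVectors

end TorusModel
end

noncomputable section
namespace TorusModel

set_option linter.unusedSectionVars false
set_option linter.unusedSimpArgs false

/-! ### Determinants of sublattices of unimodular lattices -/

section Unimodular

variable {L : Type*} [AddCommGroup L] [Module.Free ℤ L] [Module.Finite ℤ L]
  {Q : L →ₗ[ℤ] L →ₗ[ℤ] ℤ}

/-- The Gram matrix of a family of vectors. -/
def gram {ι : Type*} (Q : L →ₗ[ℤ] L →ₗ[ℤ] ℤ) (c : ι → L) : Matrix ι ι ℤ :=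
  Matrix.of fun i j => Q (c i) (c j)

lemma Int.abs_le_abs_of_mul_eq {a b c : ℤ} (h : a * b = c) (hc : c ≠ 0) : |b| ≤ |c| := by
  have ha : a ≠ 0 := by rintro rfl; simp at h; exact hc h.symm
  rw [← h, abs_mul]
  have := Int.one_le_abs ha
  nlinarith [abs_nonneg b]

/-- A primitive sublattice whose dual is mapped into it by the adjoint of `θ` has determinant at
most `|det θ|`. -/
lemma abs_det_gram_le (hunim : ∀ f : L →ₗ[ℤ] ℤ, ∃ y, ∀ x, Q y x = f x)
    (K : Submodule ℤ L) [Module.Free ℤ (L ⧸ K)] {r : ℕ} (c : Module.Basis (Fin r) ℤ K)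
    (θ : K →ₗ[ℤ] K) (hθ : ∀ y : L, ∃ n : K, ∀ x : K, Q n x = Q y (θ x))
    (hdet : LinearMap.det θ ≠ 0) :
    |(gram Q fun i => (c i : L)).det| ≤ |LinearMap.det θ| := by
  classical
  -- Primitivity extends the dual basis of `K` to functionals on `L`, and unimodularity represents
  -- these by vectors `y j`. The coordinates of the `n j` form an integral matrix N with N · Gram =
  -- [θ], so the determinant of the Gram matrix divides det θ.
  let b := Module.Basis.sumQuot c (Module.Free.chooseBasis ℤ (L ⧸ K))
  have hb : ∀ (x : K) j, b.coord (Sum.inl j) x = c.repr x j := fun x j =>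
    Module.Basis.sumQuot_repr_inl _ _ _ _
  choose y hy using fun j => hunim (b.coord (Sum.inl j))
  choose n hn using fun j => hθ (y j)
  let N : Matrix (Fin r) (Fin r) ℤ := Matrix.of fun j l => c.repr (n j) l
  have key : N * gram Q (fun i => (c i : L)) = LinearMap.toMatrix c c θ := by
    ext j i
    rw [LinearMap.toMatrix_apply, ← hb, ← hy, ← hn, Matrix.mul_apply]
    have h := congrArg (fun z : K => Q (z : L) (c i)) (c.sum_repr (n j))
    simpa [N, gram, -Module.Basis.sum_repr] using h
  have h2 := congrArg Matrix.det key
  rw [Matrix.det_mul, LinearMap.det_toMatrix] at h2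
  exact Int.abs_le_abs_of_mul_eq h2 hdet

lemma det_gram_basis (hunim : ∀ f : L →ₗ[ℤ] ℤ, ∃ y, ∀ x, Q y x = f x)
    {ι : Type*} [Fintype ι] [DecidableEq ι] (b : Module.Basis ι ℤ L) :
    |(gram Q b).det| = 1 := by
  choose y hy using fun j => hunim (b.coord j)
  let N : Matrix ι ι ℤ := Matrix.of fun j l => b.repr (y j) l
  have key : N * gram Q b = 1 := by
    ext j i
    rw [Matrix.mul_apply, Matrix.one_apply]
    have h := congrArg (fun z : L => Q z (b i)) (b.sum_repr (y j))
    have h2 : Q (y j) (b i) = if j = i then 1 else 0 := by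
      rw [hy]
      simp [Finsupp.single_apply, eq_comm]
    rw [← h2, ← h]
    simp [N, gram, -Module.Basis.sum_repr]
  have h2 := congrArg Matrix.det key
  rw [Matrix.det_mul, Matrix.det_one] at h2
  exact Int.isUnit_iff_abs_eq.1 (IsUnit.of_mul_eq_one_right _ h2)

/-- Orthogonal roots. -/
def OrthRoots (Q : L →ₗ[ℤ] L →ₗ[ℤ] ℤ) {k : ℕ} (v : Fin k → L) : Prop :=
  ∀ i j, Q (v i) (v j) = if i = j then 2 else 0

/-- The pairing with a family of vectors. -/
def pairing (Q : L →ₗ[ℤ] L →ₗ[ℤ] ℤ) {k : ℕ} (v : Fin k → L) : L →ₗ[ℤ] (Fin k → ℤ) :=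
  LinearMap.pi fun i => Q (v i)

lemma finrank_range_pairing {k : ℕ} {v : Fin k → L} (hv : OrthRoots Q v) :
    Module.finrank ℤ (LinearMap.range (pairing Q v)) = k := by
  apply le_antisymm
  · simpa using (LinearMap.range (pairing Q v)).finrank_le
  · let ψ : (Fin k → ℤ) →ₗ[ℤ] L := Fintype.linearCombination ℤ v
    have hψ : ∀ n i, pairing Q v (ψ n) i = 2 * n i := fun n i => by
      simp [pairing, ψ, Fintype.linearCombination_apply, hv i]
      ring
    have hinj : Function.Injective ((pairing Q v).rangeRestrict ∘ₗ ψ) := by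
      intro n m h
      funext i
      have h2 : pairing Q v (ψ n) = pairing Q v (ψ m) := congrArg Subtype.val h
      have := congrFun h2 i
      rw [hψ, hψ] at this
      lia
    simpa using LinearMap.finrank_le_finrank_of_injective hinj

lemma free_quotient_ker {M : Type*} [AddCommGroup M] [Module.Free ℤ M] [Module.Finite ℤ M]
    (f : L →ₗ[ℤ] M) : Module.Free ℤ (L ⧸ LinearMap.ker f) :=
  Module.Free.of_equiv f.quotKerEquivRange.symm

lemma finrank_ker_pairing {k : ℕ} {v : Fin k → L} (hv : OrthRoots Q v) :
    Module.finrank ℤ (LinearMap.ker (pairing Q v)) + k = Module.finrank ℤ L := by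
  have h1 := Submodule.finrank_quotient_add_finrank (LinearMap.ker (pairing Q v))
  rw [(pairing Q v).quotKerEquivRange.finrank_eq, finrank_range_pairing hv] at h1
  lia

/-- In a unimodular lattice, the orthogonal complement of `k` orthogonal roots has determinant at
most `2 ^ k`. -/
lemma det_gram_orthogonal_le (hunim : ∀ f : L →ₗ[ℤ] ℤ, ∃ y, ∀ x, Q y x = f x)
    (hsymm : ∀ x y, Q x y = Q y x)
    {k : ℕ} {v : Fin k → L} (hv : OrthRoots Q v) {r : ℕ}
    (c : Module.Basis (Fin r) ℤ (LinearMap.ker (pairing Q v))) :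
    |(gram Q fun i => (c i : L)).det| ≤ 2 ^ k := by
  classical
  have := free_quotient_ker (pairing Q v)
  have hk : Module.finrank ℤ (L ⧸ LinearMap.ker (pairing Q v)) = k := by
    rw [(pairing Q v).quotKerEquivRange.finrank_eq, finrank_range_pairing hv]
  let q : Module.Basis (Fin k) ℤ (L ⧸ LinearMap.ker (pairing Q v)) :=
    (Module.finBasis ℤ _).reindex (finCongr hk)
  let b := Module.Basis.sumQuot c q
  have hb : ∀ i, b (Sum.inl i) = c i := fun i => Module.Basis.sumQuot_inl _ _ _
  -- `P` expresses the roots modulo their complement K. From P N = 2 it follows that det P divides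
  -- 2^k. The change from the basis of L to (basis of K, roots) is block triangular with determinant
  -- det P, so det(K) · 2^k = (det P)² ≤ 4^k up to sign.
  let P : Matrix (Fin k) (Fin k) ℤ := Matrix.of fun i j => b.repr (v i) (Sum.inr j)
  let R : Matrix (Fin k) (Fin r) ℤ := Matrix.of fun i j => b.repr (v i) (Sum.inl j)
  let N : Matrix (Fin k) (Fin k) ℤ := Matrix.of fun j i => Q (v i) (b (Sum.inr j))
  have hvb : ∀ i, v i = ∑ j, R i j • (c j : L) + ∑ j, P i j • b (Sum.inr j) := fun i => by
    conv_lhs => rw [← b.sum_repr (v i)]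
    simp [Fintype.sum_sum_type, R, P, hb, -Module.Basis.sum_repr]
  have hcv : ∀ i j, Q (v i) (c j) = 0 := fun i j => by
    have := (c j).2
    exact congrFun (LinearMap.mem_ker.1 this) i
  have hPN : P * N = (2 : ℤ) • (1 : Matrix (Fin k) (Fin k) ℤ) := by
    ext i l
    have h1 := hv l i
    rw [hvb i] at h1
    simp only [map_add, map_sum, map_smul, hcv, smul_eq_mul, mul_zero, Finset.sum_const_zero,
      zero_add] at h1
    rw [Matrix.mul_apply]
    simp only [N, Matrix.of_apply, h1, Matrix.smul_apply, Matrix.one_apply, eq_comm (a := i)]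
    split_ifs <;> simp
  have hP : |P.det| ≤ 2 ^ k := by
    have h2 := congrArg Matrix.det hPN
    rw [Matrix.det_mul, Matrix.det_smul, Matrix.det_one, mul_comm] at h2
    simpa using Int.abs_le_abs_of_mul_eq h2 (by simp)
  let T : Matrix (Fin r ⊕ Fin k) (Fin r ⊕ Fin k) ℤ := Matrix.fromBlocks 1 0 R P
  let d : Fin r ⊕ Fin k → L := Sum.elim (fun i => (c i : L)) v
  have hd : ∀ i, d i = ∑ j, T i j • b j := by
    rintro (i | i)
    · simp [d, T, Fintype.sum_sum_type, hb, Matrix.one_apply]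
    · simp [d, T, Fintype.sum_sum_type, hb, hvb i]
  have hgram : gram Q d = T * gram Q b * T.transpose := by
    ext i j
    simp only [gram, Matrix.of_apply, hd i, hd j, Matrix.mul_apply, Matrix.transpose_apply,
      map_sum, map_smul, LinearMap.sum_apply, LinearMap.smul_apply, smul_eq_mul, Finset.sum_mul,
      Finset.mul_sum]
    exact Finset.sum_congr rfl fun _ _ => Finset.sum_congr rfl fun _ _ => by ring
  have hgram2 : gram Q d = Matrix.fromBlocks (gram Q fun i => (c i : L)) 0 0
      ((2 : ℤ) • (1 : Matrix (Fin k) (Fin k) ℤ)) := by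
    ext (i | i) (j | j)
    · simp [gram, d]
    · simp [gram, d, hsymm _ (v j), hcv]
    · simp [gram, d, hcv]
    · simp only [gram, d, Matrix.of_apply, Sum.elim_inr, hv i j, Matrix.fromBlocks_apply₂₂,
        Matrix.smul_apply, Matrix.one_apply]
      split_ifs <;> simp
  have h3 := congrArg Matrix.det hgram
  rw [hgram2, Matrix.det_fromBlocks_zero₂₁, Matrix.det_mul, Matrix.det_mul, Matrix.det_transpose,
    Matrix.det_smul, Matrix.det_one, Matrix.det_fromBlocks_zero₁₂, Matrix.det_one, one_mul,
    mul_one, Fintype.card_fin] at h3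
  have h4 := congrArg abs h3
  rw [abs_mul, abs_mul, abs_mul, det_gram_basis hunim b, mul_one, abs_of_pos (by positivity : (0
      : ℤ) < 2 ^ k)] at h4
  have h5 : (0 : ℤ) < 2 ^ k := by positivity
  nlinarith [abs_nonneg P.det]

end Unimodular

section Roots

variable {L : Type*} [AddCommGroup L] [Module.Free ℤ L] [Module.Finite ℤ L]
  {Q : L →ₗ[ℤ] L →ₗ[ℤ] ℤ}
  {V : Type*} [AddCommGroup V] [Module ℝ V] {B : V →ₗ[ℝ] V →ₗ[ℝ] ℝ}

/-- A positive definite even sublattice of small determinant contains a root. -/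
lemma exists_root_of_det_gram_le (hsymm : ∀ v w, B v w = B w v) (hpos : ∀ v, v ≠ 0 → 0 < B v v)
    (K : Submodule ℤ L) (e : K →+ V) (he : Function.Injective e)
    (hQ : ∀ x y : K, B (e x) (e y) = Q x y) (heven : ∀ x ∈ K, Even (Q x x))
    {r : ℕ} (h1 : 1 ≤ r) (h8 : r ≤ 8) (c : Module.Basis (Fin r) ℤ K)
    (hdet : |(gram Q fun i => (c i : L)).det| ≤ ballBound r) :
    ∃ x ∈ K, Q x x = 2 := by
  have hsum : ∀ n : Fin r → ℤ, ∑ i, (n i : ℝ) • e (c i) = e (∑ i, n i • c i) := fun n => by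
    simp [map_sum, Int.cast_smul_eq_zsmul]
  have hc : ∀ n : Fin r → ℤ, ∑ i, (n i : ℝ) • e (c i) = 0 → n = 0 := fun n hn => by
    rw [hsum, map_eq_zero_iff e he] at hn
    exact funext fun i => Fintype.linearIndependent_iff.1 c.linearIndependent n hn i
  have hev : ∀ n : Fin r → ℤ, ∃ m : ℤ,
      B (∑ i, (n i : ℝ) • e (c i)) (∑ i, (n i : ℝ) • e (c i)) = 2 * m := fun n => by
    obtain ⟨m, hm⟩ := heven _ (∑ i, n i • c i).2
    exact ⟨m, by rw [hsum, hQ, hm]; push_cast; ring⟩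
  obtain ⟨n, hn⟩ := exists_root_of_det_le hsymm hpos h1 h8 (c := fun i => e (c i))
    (G := gram Q fun i => (c i : L)) hc (fun i j => by simp [hQ, gram]) hev
    ((le_abs_self _).trans hdet)
  refine ⟨_, (∑ i, n i • c i).2, ?_⟩
  rw [hsum, hQ] at hn
  exact_mod_cast hn

end Roots

end TorusModel
end

noncomputable section
namespace TorusModel

set_option linter.unusedSectionVars false

/-! ### Uniqueness of the `E₈` lattice -/

section Frame

variable {L : Type*} [AddCommGroup L] [Module.Free ℤ L] [Module.Finite ℤ L]
  {Q : L →ₗ[ℤ] L →ₗ[ℤ] ℤ}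
  {V : Type*} [AddCommGroup V] [Module ℝ V] {B : V →ₗ[ℝ] V →ₗ[ℝ] ℝ}

lemma mem_ker_pairing {k : ℕ} {v : Fin k → L} {x : L} :
    x ∈ LinearMap.ker (pairing Q v) ↔ ∀ i, Q (v i) x = 0 := by
  rw [LinearMap.mem_ker, funext_iff]
  rfl

lemma OrthRoots.snoc (hsymm : ∀ x y, Q x y = Q y x) {k : ℕ} {v : Fin k → L} (hv : OrthRoots Q v)
    {x : L} (hx : ∀ i, Q (v i) x = 0) (hx2 : Q x x = 2) :
    OrthRoots Q (Fin.snoc v x : Fin (k + 1) → L) := by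
  intro i j
  refine Fin.lastCases ?_ (fun i => ?_) i <;> refine Fin.lastCases ?_ (fun j => ?_) j
  · simp [hx2]
  · simp [hsymm x, hx, Fin.ext_iff]
    lia
  · simp [hx, Fin.ext_iff]
    lia
  · simp [hv i j, Fin.ext_iff]

/-- Twice the orthogonal projection away from orthogonal roots. -/
lemma two_smul_sub_mem_ker {k : ℕ} {v : Fin k → L}
    (hv : OrthRoots Q v) (y : L) :
    (2 : ℤ) • y - ∑ i, Q (v i) y • v i ∈ LinearMap.ker (pairing Q v) := by
  rw [mem_ker_pairing]
  intro i
  simp [hv i]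
  ring

lemma det_two_smul {K : Type*} [AddCommGroup K] [Module.Free ℤ K] [Module.Finite ℤ K] :
    LinearMap.det ((2 : ℤ) • (LinearMap.id : K →ₗ[ℤ] K)) = 2 ^ Module.finrank ℤ K := by
  rw [LinearMap.det_smul, LinearMap.det_id, mul_one]

/-- Roots are added one at a time. The complement of k orthogonal roots has rank 8-k and determinant
at most min(2^k, 2^(8-k)): the first bound is its index computation, the second comes from θ = 2,
since twice the projection of a lattice vector stays in the lattice. This is always within the
Minkowski bound, so the complement contains a root. -/
lemma exists_orthRoots (hunim : ∀ f : L →ₗ[ℤ] ℤ, ∃ y, ∀ x, Q y x = f x)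
    (hsymm : ∀ x y, Q x y = Q y x) (hsymmB : ∀ v w, B v w = B w v)
    (hpos : ∀ v, v ≠ 0 → 0 < B v v) (e : L →+ V) (he : Function.Injective e)
    (hQ : ∀ x y, B (e x) (e y) = Q x y) (heven : ∀ x, Even (Q x x))
    (hrank : Module.finrank ℤ L = 8) :
    ∀ k ≤ 8, ∃ v : Fin k → L, OrthRoots Q v := by
  intro k
  induction k with
  | zero => exact fun _ => ⟨Fin.elim0, fun i => i.elim0⟩
  | succ k ih =>
    intro hk
    obtain ⟨v, hv⟩ := ih (by lia)
    have hfree := free_quotient_ker (pairing Q v)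
    have hr : Module.finrank ℤ (LinearMap.ker (pairing Q v)) = 8 - k := by
      have := finrank_ker_pairing hv
      lia
    let c : Module.Basis (Fin (8 - k)) ℤ (LinearMap.ker (pairing Q v)) :=
      (Module.finBasis ℤ _).reindex (finCongr hr)
    have h1 := det_gram_orthogonal_le hunim hsymm hv c
    have h2 : |(gram Q fun i => (c i : L)).det| ≤ 2 ^ (8 - k) := by
      have := abs_det_gram_le (Q := Q) hunim (LinearMap.ker (pairing Q v)) c
        ((2 : ℤ) • LinearMap.id) (fun y => ⟨⟨_, two_smul_sub_mem_ker hv y⟩, fun x => ?_⟩) ?_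
      · rwa [det_two_smul, hr, abs_of_pos (by positivity : (0 : ℤ) < 2 ^ (8 - k))] at this
      · have := mem_ker_pairing.1 x.2
        simp [this]
      · rw [det_two_smul]
        positivity
    have h3 : |(gram Q fun i => (c i : L)).det| ≤ ballBound (8 - k) := by
      have hk8 : k < 8 := hk
      clear_value c
      interval_cases k <;> norm_num [ballBound] at h1 h2 ⊢ <;> lia
    obtain ⟨x, hx, hx2⟩ := exists_root_of_det_gram_le hsymmB hpos (LinearMap.ker (pairing Q v))
      (e.comp (LinearMap.ker (pairing Q v)).subtype.toAddMonoidHom)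
      (he.comp (Submodule.subtype_injective _)) (fun x y => hQ x y) (fun x _ => heven x)
      (by lia) (by lia) c h3
    exact ⟨_, hv.snoc hsymm (mem_ker_pairing.1 hx) hx2⟩

end Frame

/-! ### The binary code of a frame of eight orthogonal roots. -/

section Code

variable {L : Type*} [AddCommGroup L] {Q : L →ₗ[ℤ] L →ₗ[ℤ] ℤ} {v : Fin 8 → L}

/-- The set of indices with odd pairing. -/
def oddSet (Q : L →ₗ[ℤ] L →ₗ[ℤ] ℤ) (v : Fin 8 → L) (y : L) : Finset (Fin 8) :=
  Finset.univ.filter fun i => Odd (Q (v i) y)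

lemma four_mul_form (hfull : ∀ x, (2 : ℤ) • x = ∑ i, Q (v i) x • v i)
    (x y : L) : 2 * Q x y = ∑ i, Q (v i) x * Q (v i) y := by
  have := congrArg (fun z => Q z y) (hfull x)
  simpa using this

lemma form_of_two_smul (hv : OrthRoots Q v) {x y : L} {m n : Fin 8 → ℤ}
    (hx : (2 : ℤ) • x = ∑ i, m i • v i) (hy : (2 : ℤ) • y = ∑ i, n i • v i) :
    2 * Q x y = ∑ i, m i * n i := by
  have h1 : Q ((2 : ℤ) • x) ((2 : ℤ) • y) = ∑ i, m i * (n i * 2) := by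
    rw [hx, hy]
    simp only [map_sum, map_smul, LinearMap.sum_apply, LinearMap.smul_apply, smul_eq_mul, hv _ _]
    simp
    exact Finset.sum_congr rfl fun _ _ => by ring
  simp only [map_smul, LinearMap.smul_apply, smul_eq_mul, ← mul_assoc, ← Finset.sum_mul] at h1
  lia

/-- The word of a lattice vector. -/
lemma exists_word (hfull : ∀ x, (2 : ℤ) • x = ∑ i, Q (v i) x • v i) (y : L) :
    ∃ x : L, (2 : ℤ) • x = ∑ i, (if i ∈ oddSet Q v y then (1 : ℤ) else 0) • v i := by
  refine ⟨y - ∑ i, (Q (v i) y / 2) • v i, ?_⟩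
  rw [smul_sub, hfull, Finset.smul_sum, ← Finset.sum_sub_distrib]
  refine Finset.sum_congr rfl fun i _ => ?_
  rw [smul_smul, ← sub_smul]
  congr 1
  simp only [oddSet, Finset.mem_filter, Finset.mem_univ, true_and]
  split_ifs with h
  · obtain ⟨m, hm⟩ := h
    lia
  · rw [Int.not_odd_iff_even] at h
    obtain ⟨m, hm⟩ := h
    lia

lemma even_card_inter (hv : OrthRoots Q v) (hfull : ∀ x, (2 : ℤ) • x = ∑ i, Q (v i) x • v i)
    (y z : L) : Even (oddSet Q v y ∩ oddSet Q v z).card := by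
  obtain ⟨a, ha⟩ := exists_word hfull y
  obtain ⟨b, hb⟩ := exists_word hfull z
  have := form_of_two_smul hv ha hb
  simp only [mul_ite, mul_one, mul_zero, ← ite_and, Finset.sum_boole] at this
  have h2 : (Finset.univ.filter fun i => i ∈ oddSet Q v z ∧ i ∈ oddSet Q v y) =
      oddSet Q v y ∩ oddSet Q v z := by
    ext i; simp [and_comm]
  rw [h2] at this
  exact ⟨(Q a b).toNat, by lia⟩

lemma four_dvd_card (hv : OrthRoots Q v) (hfull : ∀ x, (2 : ℤ) • x = ∑ i, Q (v i) x • v i)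
    (heven : ∀ x, Even (Q x x)) (y : L) : 4 ∣ (oddSet Q v y).card := by
  obtain ⟨a, ha⟩ := exists_word hfull y
  have := form_of_two_smul hv ha ha
  simp only [mul_ite, mul_one, mul_zero, ← ite_and, Finset.sum_boole, and_self] at this
  have h2 : (Finset.univ.filter fun i => i ∈ oddSet Q v y) = oddSet Q v y := by
    ext i; simp
  rw [h2] at this
  obtain ⟨m, hm⟩ := heven a
  exact ⟨m.toNat, by lia⟩

/-- The functional Q(z,·)/2 is integral, hence represented by some y by unimodularity; definiteness
then forces 2y = z. -/
lemma exists_half (hunim : ∀ f : L →ₗ[ℤ] ℤ, ∃ y, ∀ x, Q y x = f x)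
    (hdef : ∀ x, Q x x = 0 → x = 0) {z : L} (hz : ∀ y, Even (Q z y)) :
    ∃ y, (2 : ℤ) • y = z := by
  choose f hf using hz
  have hf2 : ∀ y, 2 * f y = Q z y := fun y => by rw [hf]; ring
  obtain ⟨y, hy⟩ := hunim
    { toFun := f
      map_add' := fun a b => by
        have := hf2 (a + b); have := hf2 a; have := hf2 b
        simp only [map_add] at *; lia
      map_smul' := fun m a => by
        have h1 := hf2 (m • a); have h2 := hf2 a
        simp only [map_smul, smul_eq_mul, RingHom.id_apply] at *
        rw [← h2] at h1
        lia }
  refine ⟨y, ?_⟩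
  rw [← sub_eq_zero]
  apply hdef
  have h : ∀ x, Q ((2 : ℤ) • y - z) x = 0 := fun x => by
    have := hf2 x
    have := hy x
    simp only [map_sub, map_smul, LinearMap.sub_apply, LinearMap.smul_apply, smul_eq_mul,
      LinearMap.coe_mk, AddHom.coe_mk] at *
    lia
  exact h _

/-- Any two coordinates are separated by a word. -/
lemma exists_separating (hunim : ∀ f : L →ₗ[ℤ] ℤ, ∃ y, ∀ x, Q y x = f x) (hv : OrthRoots Q v)
    (hdef : ∀ x, Q x x = 0 → x = 0) (heven : ∀ x, Even (Q x x)) {i j : Fin 8} (hij : i ≠ j) :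
    ∃ y, ¬ (i ∈ oddSet Q v y ↔ j ∈ oddSet Q v y) := by
  by_contra! h
  -- If no word separated i and j, the vector v i - v j would pair evenly with the whole lattice and
  -- be of the form 2y; then y would have norm 1, which is odd.
  obtain ⟨y, hy⟩ := exists_half hunim hdef (z := v i - v j) fun y => by
    have := h y
    simp only [oddSet, Finset.mem_filter, Finset.mem_univ, true_and] at this
    simp only [map_sub, LinearMap.sub_apply]
    grind
  have h1 : Q ((2 : ℤ) • y) ((2 : ℤ) • y) = 4 := by
    rw [hy]
    simp [hv _ _, hij, hij.symm]
  obtain ⟨m, hm⟩ := heven y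
  simp only [map_smul, LinearMap.smul_apply, smul_eq_mul] at h1
  lia

/-- Modulo 2 the pairing of Σ v i with y is Σ Q(v i, y)² = 2 Q(y,y), hence even. -/
lemma exists_allOnes (hunim : ∀ f : L →ₗ[ℤ] ℤ, ∃ y, ∀ x, Q y x = f x)
    (hfull : ∀ x, (2 : ℤ) • x = ∑ i, Q (v i) x • v i)
    (hdef : ∀ x, Q x x = 0 → x = 0) : ∃ y, (2 : ℤ) • y = ∑ i, v i := by
  refine exists_half hunim hdef fun y => ?_
  have h1 := four_mul_form hfull y y
  have h2 : Even (∑ i, (Q (v i) y * Q (v i) y - Q (v i) y)) := by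
    refine Finset.even_sum _ fun i _ => ?_
    have := Int.even_mul_pred_self (Q (v i) y)
    rwa [mul_sub, mul_one] at this
  rw [Finset.sum_sub_distrib, ← h1] at h2
  simp only [map_sum, LinearMap.sum_apply]
  simpa [Int.even_sub] using h2

/-- The size is divisible by 4, and a word that separates two coordinates is neither empty nor full.
-/
lemma card_oddSet_eq_four (hv : OrthRoots Q v)
    (hfull : ∀ x, (2 : ℤ) • x = ∑ i, Q (v i) x • v i) (heven : ∀ x, Even (Q x x)) {y : L}
    {i j : Fin 8} (h : ¬ (i ∈ oddSet Q v y ↔ j ∈ oddSet Q v y)) : (oddSet Q v y).card = 4 := by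
  have h1 := four_dvd_card hv hfull heven y
  have h2 : (oddSet Q v y).card ≤ 8 := by simpa using (oddSet Q v y).card_le_univ
  have h3 : (oddSet Q v y).card ≠ 0 := fun h0 => by
    rw [Finset.card_eq_zero] at h0
    simp [h0] at h
  have h4 : (oddSet Q v y).card ≠ 8 := fun h0 => by
    have : oddSet Q v y = Finset.univ := (Finset.card_eq_iff_eq_univ _).1 (by simpa using h0)
    simp [this] at h
  lia

/-- A set of even intersection with another that separates two of its elements, in a set with at
most four elements, has intersection of size two. -/
lemma card_inter_eq_two {S T : Finset (Fin 8)} (hS : S.card = 4) (he : Even (S ∩ T).card)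
    {i j : Fin 8} (hi : i ∈ S) (hj : j ∈ S) (h : ¬ (i ∈ T ↔ j ∈ T)) : (S ∩ T).card = 2 := by
  have h1 : (S ∩ T).card ≤ 4 := hS ▸ Finset.card_le_card Finset.inter_subset_left
  have h2 : (S ∩ T).card ≠ 0 := fun h0 => by
    rw [Finset.card_eq_zero, Finset.eq_empty_iff_forall_notMem] at h0
    have := h0 i; have := h0 j
    simp_all
  have h3 : (S ∩ T).card ≠ 4 := fun h0 => by
    have := Finset.eq_of_subset_of_card_le (Finset.inter_subset_left (s₁ := S) (s₂ := T)) (by lia)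
    have h4 : i ∈ S ∩ T := by rw [this]; exact hi
    have h5 : j ∈ S ∩ T := by rw [this]; exact hj
    simp_all
  obtain ⟨m, hm⟩ := he
  lia

/-- Inclusion-exclusion: with sizes 4, 2 and 1 the three sets cut the eight points into eight
regions of one point each, so membership in them is a three-bit label. -/
lemma exists_labelling {S T U : Finset (Fin 8)} (hS : S.card = 4) (hT : T.card = 4)
    (hU : U.card = 4) (hST : (S ∩ T).card = 2) (hSU : (S ∩ U).card = 2) (hTU : (T ∩ U).card = 2)
    (hSTU : (S ∩ T ∩ U).card = 1) (a b c : Bool) :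
    ∃ i, (i ∈ S ↔ a) ∧ (i ∈ T ↔ b) ∧ (i ∈ U ↔ c) := by
  have key : ∀ X : Finset (Fin 8), X.card ≠ 0 → ∃ i, i ∈ X := fun X hX => by
    rwa [Finset.card_ne_zero] at hX
  have e1 := Finset.card_inter_add_card_sdiff (S ∩ T) U
  have e2 := Finset.card_inter_add_card_sdiff (S ∩ U) T
  have e3 := Finset.card_inter_add_card_sdiff (T ∩ U) S
  have e4 := Finset.card_inter_add_card_sdiff S T
  have e5 := Finset.card_inter_add_card_sdiff (S \ T) U
  have e6 := Finset.card_inter_add_card_sdiff T S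
  have e7 := Finset.card_inter_add_card_sdiff (T \ S) U
  have e8 := Finset.card_inter_add_card_sdiff U S
  have e9 := Finset.card_inter_add_card_sdiff (U \ S) T
  have e10 := Finset.card_compl_add_card (S ∪ T ∪ U)
  have e11 := Finset.card_union_add_card_inter (S ∪ T) U
  have e12 := Finset.card_union_add_card_inter S T
  have e13 : (S ∪ T) ∩ U = (S ∩ U) ∪ (T ∩ U) := Finset.union_inter_distrib_right _ _ _
  have e14 := Finset.card_union_add_card_inter (S ∩ U) (T ∩ U)
  have f1 : S ∩ U ∩ T = S ∩ T ∩ U := by ext; grind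
  have f2 : T ∩ U ∩ S = S ∩ T ∩ U := by ext; grind
  have f3 : (S \ T) ∩ U = (S ∩ U) \ T := by ext; grind
  have f4 : (T \ S) ∩ U = (T ∩ U) \ S := by ext; grind
  have f5 : (U \ S) ∩ T = (T ∩ U) \ S := by ext; grind
  have f6 : T ∩ S = S ∩ T := Finset.inter_comm _ _
  have f7 : U ∩ S = S ∩ U := Finset.inter_comm _ _
  have f8 : S ∩ U ∩ (T ∩ U) = S ∩ T ∩ U := by ext; grind
  simp only [f1, f2, f3, f4, f5, f6, f7, f8, e13, Fintype.card_fin] at *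
  cases a <;> cases b <;> cases c
  · obtain ⟨i, hi⟩ := key (S ∪ T ∪ U)ᶜ (by lia)
    exact ⟨i, by clear * - hi; simp at hi ⊢; tauto⟩
  · obtain ⟨i, hi⟩ := key ((U \ S) \ T) (by lia)
    exact ⟨i, by clear * - hi; simp at hi ⊢; tauto⟩
  · obtain ⟨i, hi⟩ := key ((T \ S) \ U) (by lia)
    exact ⟨i, by clear * - hi; simp at hi ⊢; tauto⟩
  · obtain ⟨i, hi⟩ := key ((T ∩ U) \ S) (by lia)
    exact ⟨i, by clear * - hi; simp at hi ⊢; tauto⟩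
  · obtain ⟨i, hi⟩ := key ((S \ T) \ U) (by lia)
    exact ⟨i, by clear * - hi; simp at hi ⊢; tauto⟩
  · obtain ⟨i, hi⟩ := key ((S ∩ U) \ T) (by lia)
    exact ⟨i, by clear * - hi; simp at hi ⊢; tauto⟩
  · obtain ⟨i, hi⟩ := key ((S ∩ T) \ U) (by lia)
    exact ⟨i, by clear * - hi; simp at hi ⊢; tauto⟩
  · obtain ⟨i, hi⟩ := key (S ∩ T ∩ U) (by lia)
    exact ⟨i, by clear * - hi; simp at hi ⊢; tauto⟩

/-- The words of the extended Hamming code that generate it. -/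
def hammingWord : Matrix (Fin 4) (Fin 8) ℤ :=
  !![0, 1, 0, 1, 0, 1, 0, 1;
     0, 0, 1, 1, 0, 0, 1, 1;
     0, 0, 0, 0, 1, 1, 1, 1;
     1, 1, 1, 1, 1, 1, 1, 1]

lemma hammingWord_eq (l : Fin 8) :
    (hammingWord 0 l = if l.val.testBit 0 = true then 1 else 0) ∧
      (hammingWord 1 l = if l.val.testBit 1 = true then 1 else 0) ∧
      (hammingWord 2 l = if l.val.testBit 2 = true then 1 else 0) ∧ hammingWord 3 l = 1 := by
  fin_cases l <;> simp [hammingWord] <;> decide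

lemma eq_of_testBit {l m : Fin 8} (h0 : l.val.testBit 0 = true ↔ m.val.testBit 0 = true)
    (h1 : l.val.testBit 1 = true ↔ m.val.testBit 1 = true)
    (h2 : l.val.testBit 2 = true ↔ m.val.testBit 2 = true) : l = m := by
  revert l m
  decide

/-- A system of orthogonal roots of a definite even unimodular lattice of rank eight can be labelled
such that the lattice is given by the Hamming code. -/
lemma exists_hamming (hunim : ∀ f : L →ₗ[ℤ] ℤ, ∃ y, ∀ x, Q y x = f x) (hv : OrthRoots Q v)
    (hfull : ∀ x, (2 : ℤ) • x = ∑ i, Q (v i) x • v i)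
    (hdef : ∀ x, Q x x = 0 → x = 0) (heven : ∀ x, Even (Q x x)) :
    ∃ (σ : Fin 8 ≃ Fin 8) (x : Fin 4 → L),
      ∀ i, (2 : ℤ) • x i = ∑ l, hammingWord i l • v (σ l) := by
  -- Each new word separates two points of the intersection found so far and, by evenness of
  -- intersections, halves it: the sizes are 4, 2, 1. The points are then labelled by their
  -- membership pattern, and σ sends a binary number to the point with that pattern.
  obtain ⟨y, hy⟩ := exists_separating hunim hv hdef heven (i := 0) (j := 1) (by decide)
  have hS := card_oddSet_eq_four hv hfull heven hy
  obtain ⟨p, hp, q, hq, hpq⟩ := Finset.one_lt_card.1 (by lia : 1 < (oddSet Q v y).card)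
  obtain ⟨z, hz⟩ := exists_separating hunim hv hdef heven hpq
  have hT := card_oddSet_eq_four hv hfull heven hz
  have hST := card_inter_eq_two hS (even_card_inter hv hfull y z) hp hq hz
  obtain ⟨p', hp', q', hq', hpq'⟩ :=
    Finset.one_lt_card.1 (by lia : 1 < (oddSet Q v y ∩ oddSet Q v z).card)
  obtain ⟨u, hu⟩ := exists_separating hunim hv hdef heven hpq'
  have hU := card_oddSet_eq_four hv hfull heven hu
  have hSU := card_inter_eq_two hS (even_card_inter hv hfull y u) (Finset.mem_inter.1 hp').1
    (Finset.mem_inter.1 hq').1 hu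
  have hTU := card_inter_eq_two hT (even_card_inter hv hfull z u) (Finset.mem_inter.1 hp').2
    (Finset.mem_inter.1 hq').2 hu
  have hSTU : (oddSet Q v y ∩ oddSet Q v z ∩ oddSet Q v u).card = 1 := by
    have h1 : oddSet Q v y ∩ oddSet Q v z = {p', q'} := by
      refine (Finset.eq_of_subset_of_card_le ?_ ?_).symm
      · intro x hx
        simp only [Finset.mem_insert, Finset.mem_singleton] at hx
        rcases hx with rfl | rfl <;> assumption
      · rw [hST, Finset.card_pair hpq']
    rw [h1]
    by_cases h2 : p' ∈ oddSet Q v u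
    · have h3 : q' ∉ oddSet Q v u := by tauto
      simp [h2, h3, Finset.insert_inter_of_mem, Finset.singleton_inter_of_notMem]
    · have h3 : q' ∈ oddSet Q v u := by tauto
      simp [h2, h3, Finset.insert_inter_of_notMem, Finset.singleton_inter_of_mem]
  have hlab := exists_labelling hS hT hU hST hSU hTU hSTU
  choose w hw using hlab
  let σ : Fin 8 → Fin 8 := fun l => w (l.val.testBit 0) (l.val.testBit 1) (l.val.testBit 2)
  have hσ : ∀ l, (σ l ∈ oddSet Q v y ↔ l.val.testBit 0 = true) ∧
      (σ l ∈ oddSet Q v z ↔ l.val.testBit 1 = true) ∧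
      (σ l ∈ oddSet Q v u ↔ l.val.testBit 2 = true) := fun l => hw _ _ _
  have hinj : Function.Injective σ := by
    intro l m h
    have h1 := hσ l
    have h2 := hσ m
    rw [h] at h1
    exact eq_of_testBit (h1.1.symm.trans h2.1) (h1.2.1.symm.trans h2.2.1)
      (h1.2.2.symm.trans h2.2.2)
  let e : Fin 8 ≃ Fin 8 := Equiv.ofBijective σ (Finite.injective_iff_bijective.1 hinj)
  obtain ⟨a, ha⟩ := exists_word hfull y
  obtain ⟨b, hb⟩ := exists_word hfull z
  obtain ⟨c, hc⟩ := exists_word hfull u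
  obtain ⟨d, hd⟩ := exists_allOnes hunim hfull hdef
  refine ⟨e, ![a, b, c, d], fun i => ?_⟩
  have he : ∀ l, e l = σ l := fun l => rfl
  have hbit := hammingWord_eq
  fin_cases i
  · simp only [Fin.zero_eta, Matrix.cons_val_zero, ha]
    rw [← e.sum_comp]
    simp only [he, (hσ _).1, (hbit _).1]
  · simp only [Fin.mk_one, Matrix.cons_val_one, Matrix.cons_val_zero, hb]
    rw [← e.sum_comp]
    simp only [he, (hσ _).2.1, (hbit _).2.1]
  · simp only [Fin.reduceFinMk, Matrix.cons_val, hc]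
    rw [← e.sum_comp]
    simp only [he, (hσ _).2.2, (hbit _).2.2.1]
  · simp only [Fin.reduceFinMk, Matrix.cons_val, hd]
    rw [← e.sum_comp]
    simp only [(hbit _).2.2.2, one_smul]

end Code

end TorusModel
end

noncomputable section
namespace TorusModel

/-! ### A basis of simple roots -/

/-- The coordinates of twice the simple roots of `E₈` in a frame of orthogonal roots. -/
def simpleRootCoord : Matrix (Fin 8) (Fin 8) ℤ :=
  !![2, 0, 0, 0, 0, 0, 0, 0;
     0, 0, -1, 1, 1, 1, 0, 0;
     -1, 1, 1, 1, 0, 0, 0, 0;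
     0, 0, 0, -2, 0, 0, 0, 0;
     0, 0, -1, 1, -1, -1, 0, 0;
     0, -1, 1, 0, 1, 0, 0, 1;
     0, 0, 0, 0, 0, 0, 0, -2;
     0, 0, 0, 0, -1, 1, 1, 1]

/-- Together with `simpleRootShift` this writes the simple roots as integral combinations of the
four code vectors and the orthogonal roots, which puts them in the lattice; `simpleRootCoord_eq` is
the check. -/
def simpleRootWord : Matrix (Fin 8) (Fin 4) ℤ :=
  !![0, 0, 0, 0; 0, 1, 1, 0; 0, 0, 1, 1; 0, 0, 0, 0; 0, 1, 1, 0; 1, 1, 1, 0; 0, 0, 0, 0;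
     0, 0, 1, 0]

def simpleRootShift : Matrix (Fin 8) (Fin 8) ℤ :=
  !![1, 0, 0, 0, 0, 0, 0, 0;
     0, 0, -1, 0, 0, 0, -1, -1;
     -1, 0, 0, 0, -1, -1, -1, -1;
     0, 0, 0, -1, 0, 0, 0, 0;
     0, 0, -1, 0, -1, -1, -1, -1;
     0, -1, 0, -1, 0, -1, -1, -1;
     0, 0, 0, 0, 0, 0, 0, -1;
     0, 0, 0, 0, -1, 0, 0, 0]

/-- The orthogonal roots in terms of the simple roots. -/
def frameCoord : Matrix (Fin 8) (Fin 8) ℤ :=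
  !![1, 0, 0, 0, 0, 0, 0, 0;
     1, 1, 2, 2, 1, 0, 0, 0;
     0, -1, 0, -1, -1, 0, 0, 0;
     0, 0, 0, -1, 0, 0, 0, 0;
     1, 2, 2, 3, 2, 2, 1, 0;
     -1, -1, -2, -3, -3, -2, -1, 0;
     2, 3, 4, 6, 5, 4, 3, 2;
     0, 0, 0, 0, 0, 0, -1, 0]

lemma simpleRootCoord_eq :
    simpleRootWord * hammingWord + (2 : ℤ) • simpleRootShift = simpleRootCoord := by
  decide +kernel

lemma simpleRootCoord_mul_transpose :
    simpleRootCoord * simpleRootCoord.transpose = (2 : ℤ) • CartanMatrix.E₈ := by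
  decide +kernel

lemma frameCoord_mul : frameCoord * simpleRootCoord = (2 : ℤ) • 1 := by
  decide +kernel

section

variable {L : Type*} [AddCommGroup L]
  {Q : L →ₗ[ℤ] L →ₗ[ℤ] ℤ}

lemma exists_simpleRoots {w : Fin 8 → L} {x : Fin 4 → L} (hw : OrthRoots Q w)
    (hx : ∀ i, (2 : ℤ) • x i = ∑ l, hammingWord i l • w l) :
    ∃ b : Fin 8 → L, (∀ i, (2 : ℤ) • b i = ∑ l, simpleRootCoord i l • w l) ∧
      ∀ i j, Q (b i) (b j) = CartanMatrix.E₈ i j := by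
  have h1 : ∀ i, (2 : ℤ) • (∑ j, simpleRootWord i j • x j + ∑ l, simpleRootShift i l • w l) =
      ∑ l, simpleRootCoord i l • w l := by
    intro i
    simp only [← simpleRootCoord_eq, Matrix.add_apply, Matrix.mul_apply, Matrix.smul_apply,
      add_smul, Finset.sum_add_distrib, smul_add, Finset.smul_sum, smul_eq_mul, Finset.sum_smul,
      mul_smul]
    congr 1
    rw [Finset.sum_comm]
    refine Finset.sum_congr rfl fun j _ => ?_
    rw [smul_comm, hx, Finset.smul_sum]
  refine ⟨_, h1, fun i j => ?_⟩
  have h2 := form_of_two_smul hw (h1 i) (h1 j)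
  have h3 := congrFun (congrFun simpleRootCoord_mul_transpose i) j
  rw [Matrix.mul_apply] at h3
  simp only [Matrix.transpose_apply, Matrix.smul_apply, smul_eq_mul] at h3
  rw [h3] at h2
  lia

variable [Module.Free ℤ L]

/-- The Cartan matrix of E₈ has determinant one, so the candidates are independent, and for every y
there are integers a i such that y - Σ a i • b i is orthogonal to all candidates. Twice the frame
roots are combinations of the candidates, so this difference is orthogonal to the frame and hence
zero. -/
lemma exists_cartan_basis_of_frame {w : Fin 8 → L} {x : Fin 4 → L} (hw : OrthRoots Q w)
    (hfull : ∀ x, (2 : ℤ) • x = ∑ i, Q (w i) x • w i)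
    (hx : ∀ i, (2 : ℤ) • x i = ∑ l, hammingWord i l • w l) :
    ∃ b : Module.Basis (Fin 8) ℤ L, ∀ i j, Q (b i) (b j) = CartanMatrix.E₈ i j := by
  obtain ⟨b, hb, hQ⟩ := exists_simpleRoots hw hx
  have hwb : ∀ l, (2 : ℤ) • w l = ∑ i, frameCoord l i • (2 : ℤ) • b i := by
    intro l
    simp only [hb, Finset.smul_sum, smul_smul]
    rw [Finset.sum_comm]
    simp only [← Finset.sum_smul]
    have h := fun j => congrFun (congrFun frameCoord_mul l) j
    simp only [Matrix.mul_apply] at h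
    simp only [h]
    simp [Matrix.one_apply]
  have h0 : ∀ z, (∀ i, Q (b i) z = 0) → z = 0 := by
    intro z hz
    have h1 : ∀ l, Q (w l) z = 0 := fun l => by
      have := congrArg (fun t => Q t z) (hwb l)
      simpa [hz] using this
    have := hfull z
    simp only [h1, zero_smul, Finset.sum_const_zero] at this
    simpa using this
  have hdet : IsUnit CartanMatrix.E₈.det := by rw [CartanMatrix.E₈_det]; exact isUnit_one
  have hli : LinearIndependent ℤ b := by
    rw [Fintype.linearIndependent_iff]
    intro a ha
    have h1 : Matrix.mulVec CartanMatrix.E₈ a = 0 := by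
      ext j
      have := congrArg (Q (b j)) ha
      simpa [hQ, Matrix.mulVec, dotProduct, mul_comm] using this
    have := Matrix.eq_zero_of_mulVec_eq_zero hdet.ne_zero h1
    exact fun i => congrFun this i
  have hsp : ⊤ ≤ Submodule.span ℤ (Set.range b) := by
    intro y _
    let a := Matrix.mulVec (CartanMatrix.E₈)⁻¹ fun i => Q (b i) y
    have ha : Matrix.mulVec CartanMatrix.E₈ a = fun i => Q (b i) y := by
      simp only [a, Matrix.mulVec_mulVec, Matrix.mul_nonsing_inv _ hdet, Matrix.one_mulVec]
    have hy : y - ∑ i, a i • b i = 0 := by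
      refine h0 _ fun j => ?_
      have := congrFun ha j
      simp only [Matrix.mulVec, dotProduct] at this
      simp [hQ, ← this, mul_comm]
    rw [sub_eq_zero.1 hy]
    exact Submodule.sum_mem _ fun i _ => Submodule.smul_mem _ _ (Submodule.subset_span ⟨i, rfl⟩)
  exact ⟨Module.Basis.mk hli hsp, by simpa using hQ⟩

variable [Module.Finite ℤ L]

/-- An even unimodular definite lattice of rank eight has a basis of simple roots of `E₈`. -/
theorem exists_cartan_basis {V : Type*} [AddCommGroup V] [Module ℝ V] {B : V →ₗ[ℝ] V →ₗ[ℝ] ℝ}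
    (hunim : ∀ f : L →ₗ[ℤ] ℤ, ∃ y, ∀ x, Q y x = f x)
    (hsymm : ∀ x y, Q x y = Q y x) (hsymmB : ∀ v w, B v w = B w v)
    (hpos : ∀ v, v ≠ 0 → 0 < B v v) (e : L →+ V) (he : Function.Injective e)
    (hQ : ∀ x y, B (e x) (e y) = Q x y) (heven : ∀ x, Even (Q x x))
    (hrank : Module.finrank ℤ L = 8) :
    ∃ b : Module.Basis (Fin 8) ℤ L, ∀ i j, Q (b i) (b j) = CartanMatrix.E₈ i j := by
  obtain ⟨v, hv⟩ := exists_orthRoots hunim hsymm hsymmB hpos e he hQ heven hrank 8 le_rfl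
  have hdef : ∀ x, Q x x = 0 → x = 0 := by
    intro x hx
    by_contra h
    have h1 := hpos (e x) (by simpa using (map_ne_zero_iff e he).2 h)
    rw [hQ, hx] at h1
    simp at h1
  have hker : ∀ x ∈ LinearMap.ker (pairing Q v), x = 0 := by
    have h1 : Module.finrank ℤ (LinearMap.ker (pairing Q v)) = 0 := by
      have := finrank_ker_pairing hv
      lia
    have h2 : LinearMap.ker (pairing Q v) = ⊥ := by
      rwa [Submodule.finrank_eq_zero] at h1
    intro x hx
    rwa [h2, Submodule.mem_bot] at hx
  have hfull : ∀ x, (2 : ℤ) • x = ∑ i, Q (v i) x • v i := fun x =>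
    sub_eq_zero.1 (hker _ (two_smul_sub_mem_ker hv x))
  obtain ⟨σ, x, hx⟩ := exists_hamming hunim hv hfull hdef heven
  refine exists_cartan_basis_of_frame (w := v ∘ σ) (x := x) (fun i j => ?_) (fun x => ?_) hx
  · simp [hv _ _]
  · rw [hfull, ← σ.sum_comp]
    rfl

end

end TorusModel
end

noncomputable section
namespace TorusModel

/-! ### Integral forms on lattices in a real vector space -/

section

variable {L V : Type*} [AddCommGroup L] [AddCommGroup V] [Module ℝ V]
  {B : V →ₗ[ℝ] V →ₗ[ℝ] ℝ}

lemma exists_intForm (e : L →+ V) (hint : ∀ x y, ∃ n : ℤ, B (e x) (e y) = n) :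
    ∃ Q : L →ₗ[ℤ] L →ₗ[ℤ] ℤ, ∀ x y, B (e x) (e y) = Q x y := by
  choose q hq using hint
  refine ⟨LinearMap.mk₂ ℤ q ?_ ?_ ?_ ?_, fun x y => hq x y⟩
  · intro x y z
    have : (q (x + y) z : ℝ) = (q x z + q y z : ℤ) := by
      push_cast
      simp only [← hq, map_add, LinearMap.add_apply]
    exact_mod_cast this
  · intro c x y
    have : (q (c • x) y : ℝ) = (c • q x y : ℤ) := by
      simp only [← hq, map_zsmul, LinearMap.smul_apply, zsmul_eq_mul, smul_eq_mul,
        Int.cast_mul]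
    exact_mod_cast this
  · intro x y z
    have : (q x (y + z) : ℝ) = (q x y + q x z : ℤ) := by
      push_cast
      simp only [← hq, map_add]
    exact_mod_cast this
  · intro c x y
    have : (q x (c • y) : ℝ) = (c • q x y : ℤ) := by
      simp only [← hq, map_zsmul, zsmul_eq_mul, smul_eq_mul, Int.cast_mul]
    exact_mod_cast this

lemma exists_eq_form [FiniteDimensional ℝ V] (hnd : ∀ v, (∀ w, B v w = 0) → v = 0)
    (f : V →ₗ[ℝ] ℝ) : ∃ v, ∀ w, B v w = f w := by
  have hinj : Function.Injective B := by
    rw [injective_iff_map_eq_zero]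
    intro v hv
    exact hnd v fun w => by rw [hv]; rfl
  have : Function.Surjective B :=
    (LinearMap.injective_iff_surjective_of_finrank_eq_finrank
      (Subspace.dual_finrank_eq (K := ℝ) (V := V)).symm).1 hinj
  obtain ⟨v, hv⟩ := this f
  exact ⟨v, fun w => by rw [hv]⟩

/-- The functional extends linearly to V, nondegeneracy represents it by a vector, and that vector
pairs integrally with the lattice, so self-duality puts it in the lattice. -/
lemma exists_dual_of_selfDual [FiniteDimensional ℝ V] (hnd : ∀ v, (∀ w, B v w = 0) → v = 0)
    (e : L →+ V) {ι : Type*} (b₀ : Module.Basis ι ℤ L) (b : Module.Basis ι ℝ V)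
    (hb : ∀ i, b i = e (b₀ i)) (hdual : ∀ v, (∀ x, ∃ n : ℤ, B v (e x) = n) → ∃ y, e y = v)
    {Q : L →ₗ[ℤ] L →ₗ[ℤ] ℤ} (hQ : ∀ x y, B (e x) (e y) = Q x y) (f : L →ₗ[ℤ] ℤ) :
    ∃ y, ∀ x, Q y x = f x := by
  obtain ⟨v, hv⟩ := exists_eq_form hnd (b.constr ℝ fun i => (f (b₀ i) : ℝ))
  have h1 : ∀ x, B v (e x) = f x := by
    have h2 : (((B v).toAddMonoidHom.comp e).toIntLinearMap : L →ₗ[ℤ] ℝ) =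
        (Algebra.linearMap ℤ ℝ).comp f := b₀.ext fun i => by
      change B v (e (b₀ i)) = (f (b₀ i) : ℝ)
      rw [← hb, hv, Module.Basis.constr_basis]
    exact fun x => LinearMap.congr_fun h2 x
  obtain ⟨y, rfl⟩ := hdual v fun x => ⟨_, h1 x⟩
  refine ⟨y, fun x => ?_⟩
  have := h1 x
  rw [hQ] at this
  exact_mod_cast this

end

/-- In a Euclidean space of dimension eight, every even self-dual lattice has a basis of simple
roots of `E₈`. -/
theorem exists_cartan_basis_of_even_selfDual {V : Type*} [NormedAddCommGroup V] [NormedSpace ℝ V]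
    [FiniteDimensional ℝ V] (hV : Module.finrank ℝ V = 8) {B : V →ₗ[ℝ] V →ₗ[ℝ] ℝ}
    (hsymm : ∀ v w, B v w = B w v) (hpos : ∀ v, v ≠ 0 → 0 < B v v) (L : Submodule ℤ V)
    (heven : ∀ v ∈ L, ∃ n : ℤ, B v v = 2 * n)
    (hdual : ∀ v, v ∈ L ↔ ∀ w ∈ L, ∃ n : ℤ, B v w = n) :
    ∃ b : Module.Basis (Fin 8) ℤ L, ∀ i j, B (b i) (b j) = (CartanMatrix.E₈ i j : ℝ) := by
  have hcont : Continuous fun v => B v v := by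
    have := B.toContinuousBilinearMap.continuous
    exact (B.toContinuousBilinearMap.continuous.clm_apply continuous_id)
  -- By evenness 0 is the only lattice vector of norm less than 2.
  have hdisc : DiscreteTopology L := by
    refine discreteTopology_of_isOpen_singleton_zero ?_
    have h1 : IsOpen {x : L | B x x < 2} :=
      isOpen_lt (hcont.comp continuous_subtype_val) continuous_const
    convert h1
    ext x
    simp only [Set.mem_singleton_iff, Set.mem_ofPred_eq]
    constructor
    · rintro rfl
      simp
    · intro hx
      by_contra h0
      have h2 := hpos x (by simpa using h0)
      obtain ⟨n, hn⟩ := heven x x.2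
      rw [hn] at hx h2
      have h3 : n < 1 := by exact_mod_cast (by linarith : (n : ℝ) < 1)
      have h4 : 0 < n := by exact_mod_cast (by linarith : (0 : ℝ) < n)
      lia
  -- A nonzero vector orthogonal to the lattice would have all its real multiples in the lattice by
  -- self-duality, among them one of norm 1, against evenness.
  have hspan : Submodule.span ℝ (L : Set V) = ⊤ := by
    by_contra hne
    obtain ⟨f, hf0, hf⟩ := Submodule.exists_dual_map_eq_bot_of_lt_top (lt_top_iff_ne_top.2 hne)
      inferInstance
    obtain ⟨v, hv⟩ := exists_eq_form (B := B) (fun v hv => by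
      by_contra h0
      exact (hpos v h0).ne' (hv v)) f
    have hv0 : v ≠ 0 := by
      rintro rfl
      exact hf0 (LinearMap.ext fun w => by rw [← hv]; simp)
    have hfL : ∀ w ∈ L, f w = 0 := fun w hw => by
      have : f w ∈ Submodule.map f (Submodule.span ℝ (L : Set V)) :=
        Submodule.mem_map_of_mem (Submodule.subset_span hw)
      rwa [hf, Submodule.mem_bot] at this
    have h1 : ∀ t : ℝ, t • v ∈ L := fun t => (hdual _).2 fun w hw => ⟨0, by simp [hv, hfL w hw]⟩
    obtain ⟨n, hn⟩ := heven _ (h1 (√(1 / B v v)))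
    have h2 : √(1 / B v v) * √(1 / B v v) = 1 / B v v :=
      Real.mul_self_sqrt (one_div_nonneg.2 (hpos v hv0).le)
    rw [map_smul, map_smul, LinearMap.smul_apply, smul_smul, h2, smul_eq_mul,
      one_div_mul_cancel (hpos v hv0).ne'] at hn
    have : (1 : ℤ) = 2 * n := by exact_mod_cast hn
    lia
  have hlat : IsZLattice ℝ L := ⟨hspan⟩
  have hfin := instModuleFinite_of_discrete_submodule L
  have hfree := instModuleFree_of_discrete_submodule L
  have hrank : Module.finrank ℤ L = 8 := by rw [ZLattice.rank ℝ L, hV]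
  let b₀ : Module.Basis (Fin 8) ℤ L := (Module.finBasis ℤ L).reindex (finCongr hrank)
  obtain ⟨Q, hQ⟩ := exists_intForm (B := B) L.subtype.toAddMonoidHom
    fun x y => (hdual x).1 x.2 y y.2
  refine (exists_cartan_basis (Q := Q) (B := B) (exists_dual_of_selfDual
    (fun v hv => by
      by_contra h0
      exact (hpos v h0).ne' (hv v)) L.subtype.toAddMonoidHom b₀ (b₀.ofZLatticeBasis ℝ L)
    (fun i => by simp) (fun v hv => ⟨⟨v, (hdual v).2 fun w hw => hv ⟨w, hw⟩⟩, rfl⟩) hQ)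
    (fun x y => ?_) hsymm hpos L.subtype.toAddMonoidHom (Submodule.subtype_injective L)
    hQ (fun x => ?_) hrank).imp fun b hb i j => ?_
  · have := hQ x y
    rw [hsymm, hQ] at this
    exact_mod_cast this.symm
  · obtain ⟨n, hn⟩ := heven x x.2
    have := hQ x x
    refine ⟨n, ?_⟩
    have h3 : (Q x x : ℝ) = 2 * n := by rw [← this]; exact hn
    have h4 : Q x x = 2 * n := by exact_mod_cast h3
    lia
  · rw [← hb]
    exact hQ _ _

end TorusModel
end

noncomputable section
namespace TorusModel

/-! ### Lattices in pairs of quaternions -/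

open scoped Quaternion

/-- Pairs of quaternions. -/
abbrev H2 := ℍ[ℝ] × ℍ[ℝ]

/-- The form `α ⟨v₁, w₁⟩ + β ⟨v₂, w₂⟩`. -/
def form (α β : ℝ) : H2 →ₗ[ℝ] H2 →ₗ[ℝ] ℝ :=
  α • (innerₗ ℍ[ℝ]).compl₁₂ (LinearMap.fst ℝ _ _) (LinearMap.fst ℝ _ _) +
    β • (innerₗ ℍ[ℝ]).compl₁₂ (LinearMap.snd ℝ _ _) (LinearMap.snd ℝ _ _)

lemma form_apply (α β : ℝ) (v w : H2) :
    form α β v w = α * (v.1 * star w.1).re + β * (v.2 * star w.2).re := by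
  simp [form, Quaternion.inner_def]

lemma form_symm (α β : ℝ) (v w : H2) : form α β v w = form α β w v := by
  simp [form, real_inner_comm]

lemma form_mul_left (α β : ℝ) (x v w : H2) :
    form α β (x * v) w = form α β v (star x * w) := by
  simp [form_apply]
  ring

lemma form_mul_right (α β : ℝ) (x v w : H2) :
    form α β v (x * w) = form α β (star x * v) w := by
  rw [form_mul_left, star_star]

/-- A pair of real scalars. -/
def realPair (a b : ℝ) : H2 := ((a : ℍ[ℝ]), (b : ℍ[ℝ]))

@[simp] lemma realPair_fst (a b : ℝ) : (realPair a b).1 = a := rfl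
@[simp] lemma realPair_snd (a b : ℝ) : (realPair a b).2 = b := rfl

@[simp] lemma star_realPair (a b : ℝ) : star (realPair a b) = realPair a b := by
  simp [realPair, Prod.star_def]

lemma realPair_mul (a b c d : ℝ) : realPair a b * realPair c d = realPair (a * c) (b * d) := by
  simp [realPair]

lemma realPair_add (a b c d : ℝ) : realPair a b + realPair c d = realPair (a + c) (b + d) := by
  simp [realPair]

lemma realPair_neg (a b : ℝ) : -realPair a b = realPair (-a) (-b) := by
  simp [realPair]

lemma realPair_one : realPair 1 1 = 1 := by
  simp [realPair, Prod.ext_iff]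

lemma realPair_intCast (n : ℤ) : realPair n n = n := by
  refine Prod.ext ?_ ?_ <;> ext <;> simp

lemma form_realPair_mul (α β a b : ℝ) (v w : H2) :
    form α β (realPair a b * v) w = form (α * a) (β * b) v w := by
  simp [form_apply]
  ring

lemma form_definite {α β : ℝ} (hα : α ≠ 0) (hβ : β ≠ 0) {v : H2} (hv : ∀ w, form α β v w = 0) :
    v = 0 := by
  have h1 := hv (v.1, 0)
  have h2 := hv (0, v.2)
  simp only [form_apply, star_zero, mul_zero, Quaternion.re_zero, add_zero, zero_add,
    mul_eq_zero, hα, hβ, false_or, ← Quaternion.inner_def, inner_self_eq_zero] at h1 h2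
  exact Prod.ext h1 h2

/-- `L` is even and self-dual for the form `B`. -/
structure IsEvenSelfDual {V : Type*} [AddCommGroup V] [Module ℝ V] (B : V →ₗ[ℝ] V →ₗ[ℝ] ℝ)
    (L : Submodule ℤ V) : Prop where
  even : ∀ v ∈ L, ∃ n : ℤ, B v v = 2 * n
  selfDual : ∀ v, v ∈ L ↔ ∀ w ∈ L, ∃ n : ℤ, B v w = n

/-- The lattice `L` is the `ℤ`-span of a real basis. -/
structure IsFullLattice (L : Submodule ℤ H2) : Prop where
  discrete : DiscreteTopology L
  span_eq_top : Submodule.span ℝ (L : Set H2) = ⊤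

/-- The ring of pairs of quaternions that preserve a lattice. -/
def stabilizer (L : Submodule ℤ H2) : Subring H2 where
  carrier := {x | ∀ v ∈ L, x * v ∈ L}
  mul_mem' hx hy v hv := by rw [mul_assoc]; exact hx _ (hy _ hv)
  one_mem' v hv := by rwa [one_mul]
  add_mem' hx hy v hv := by rw [add_mul]; exact L.add_mem (hx _ hv) (hy _ hv)
  zero_mem' v hv := by rw [zero_mul]; exact L.zero_mem
  neg_mem' hx v hv := by rw [neg_mul]; exact L.neg_mem (hx _ hv)

section

variable {α β : ℝ} {L : Submodule ℤ H2}

/-- Multiplications by x and `star x` are adjoint for every form `form α β`, and a self-dual lattice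
preserved by a map is preserved by its adjoint. -/
lemma star_mem_stabilizer (hL : IsEvenSelfDual (form α β) L) {x : H2} (hx : x ∈ stabilizer L) :
    star x ∈ stabilizer L := by
  intro v hv
  rw [hL.selfDual]
  intro w hw
  rw [form_mul_left, star_star]
  exact (hL.selfDual v).1 hv _ (hx _ hw)

lemma add_star_eq (x : H2) : x + star x = realPair (2 * x.1.re) (2 * x.2.re) := by
  refine Prod.ext ?_ ?_ <;> ext <;> simp <;> ring

/-- The pair of traces of an element of the stabilizer. -/
lemma trace_mem_stabilizer (hL : IsEvenSelfDual (form α β) L) {x : H2} (hx : x ∈ stabilizer L) :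
    realPair (2 * x.1.re) (2 * x.2.re) ∈ stabilizer L := by
  rw [← add_star_eq]
  exact (stabilizer L).add_mem hx (star_mem_stabilizer hL hx)

end

/-! ### Arithmetic of real multiplications -/

lemma exists_int_eq_of_isIntegral {x : ℝ} (hx : IsIntegral ℤ x) {k n : ℤ} (hk : k ≠ 0)
    (h : k * x = n) : ∃ m : ℤ, x = m := by
  have h1 : x = algebraMap ℚ ℝ (n / k) := by
    have : (k : ℝ) ≠ 0 := by exact_mod_cast hk
    simp [← h]
    field_simp
  rw [h1, isIntegral_algebraMap_iff (algebraMap ℚ ℝ).injective] at hx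
  obtain ⟨m, hm⟩ := IsIntegrallyClosed.isIntegral_iff.1 hx
  refine ⟨m, ?_⟩
  rw [h1, ← hm]
  simp

section

variable {L : Submodule ℤ H2} {a b : ℝ}

lemma IsFullLattice.finite (hL : IsFullLattice L) : Module.Finite ℤ L :=
  have := hL.discrete
  instModuleFinite_of_discrete_submodule L

/-- The projection of the lattice to either factor is a nonzero finitely generated ℤ-module stable
under the scalar a, respectively b. -/
lemma isIntegral_of_mem_stabilizer (hL : IsFullLattice L) (h : realPair a b ∈ stabilizer L) :
    IsIntegral ℤ a ∧ IsIntegral ℤ b := by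
  have hfin := hL.finite
  have hfg : L.FG := Module.Finite.iff_fg.1 hfin
  constructor
  · refine isIntegral_of_smul_mem_submodule (M := ℍ[ℝ]) (R := ℤ)
      (L.map (AddMonoidHom.fst ℍ[ℝ] ℍ[ℝ]).toIntLinearMap) ?_ (hfg.map _) a ?_
    · intro h0
      have h1 : (L : Set H2) ⊆ LinearMap.ker (LinearMap.fst ℝ ℍ[ℝ] ℍ[ℝ]) := by
        intro v hv
        have : v.1 ∈ L.map (AddMonoidHom.fst ℍ[ℝ] ℍ[ℝ]).toIntLinearMap := ⟨v, hv, rfl⟩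
        rwa [h0, Submodule.mem_bot] at this
      have h2 := Submodule.span_le.2 h1
      rw [hL.span_eq_top] at h2
      have h3 : ((1, 0) : H2) ∈ LinearMap.ker (LinearMap.fst ℝ ℍ[ℝ] ℍ[ℝ]) := h2 trivial
      simp at h3
    · rintro _ ⟨v, hv, rfl⟩
      refine ⟨_, h v hv, ?_⟩
      simp [Quaternion.coe_mul_eq_smul]
  · refine isIntegral_of_smul_mem_submodule (M := ℍ[ℝ]) (R := ℤ)
      (L.map (AddMonoidHom.snd ℍ[ℝ] ℍ[ℝ]).toIntLinearMap) ?_ (hfg.map _) b ?_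
    · intro h0
      have h1 : (L : Set H2) ⊆ LinearMap.ker (LinearMap.snd ℝ ℍ[ℝ] ℍ[ℝ]) := by
        intro v hv
        have : v.2 ∈ L.map (AddMonoidHom.snd ℍ[ℝ] ℍ[ℝ]).toIntLinearMap := ⟨v, hv, rfl⟩
        rwa [h0, Submodule.mem_bot] at this
      have h2 := Submodule.span_le.2 h1
      rw [hL.span_eq_top] at h2
      have h3 : ((0, 1) : H2) ∈ LinearMap.ker (LinearMap.snd ℝ ℍ[ℝ] ℍ[ℝ]) := h2 trivial
      simp at h3
    · rintro _ ⟨v, hv, rfl⟩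
      refine ⟨_, h v hv, ?_⟩
      simp [Quaternion.coe_mul_eq_smul]

/-- Multiplication by (a,b) is an endomorphism of a lattice of rank eight, and its trace is 4a + 4b.
Together with integrality this makes a + b an integer in `exists_int_add`. -/
lemma exists_int_four_mul_add (hL : IsFullLattice L) (h : realPair a b ∈ stabilizer L) :
    ∃ n : ℤ, 4 * (a + b) = n := by
  have := hL.discrete
  have : IsZLattice ℝ L := ⟨hL.span_eq_top⟩
  have := hL.finite
  have := instModuleFree_of_discrete_submodule L
  let b₀ := Module.Free.chooseBasis ℤ L
  let T : H2 →ₗ[ℝ] H2 := (a • LinearMap.id).prodMap (b • LinearMap.id)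
  have hT : ∀ v, T v = realPair a b * v := fun v => by
    refine Prod.ext ?_ ?_
    · simp [T, Quaternion.coe_mul_eq_smul]
    · simp [T, Quaternion.coe_mul_eq_smul]
  have h1 : LinearMap.trace ℝ H2 T = 4 * (a + b) := by
    rw [LinearMap.trace_prodMap', map_smul, map_smul, LinearMap.trace_id,
      Quaternion.finrank_eq_four]
    simp
    ring
  rw [← h1, LinearMap.trace_eq_matrix_trace ℝ (b₀.ofZLatticeBasis ℝ L)]
  refine ⟨∑ i, b₀.repr ⟨realPair a b * b₀ i, h _ (b₀ i).2⟩ i, ?_⟩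
  rw [Matrix.trace, Int.cast_sum]
  refine Finset.sum_congr rfl fun i _ => ?_
  rw [Matrix.diag_apply, LinearMap.toMatrix_apply, Module.Basis.ofZLatticeBasis_apply, hT,
    ← Module.Basis.ofZLatticeBasis_repr_apply ℝ L]

lemma exists_int_add (hL : IsFullLattice L) (h : realPair a b ∈ stabilizer L) :
    ∃ n : ℤ, a + b = n := by
  obtain ⟨n, hn⟩ := exists_int_four_mul_add hL h
  obtain ⟨ha, hb⟩ := isIntegral_of_mem_stabilizer hL h
  exact exists_int_eq_of_isIntegral (ha.add hb) (k := 4) (n := n) (by decide) (by exact_mod_cast hn)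

/-- The element (a²,b²) also lies in the stabilizer, and 2ab = (a+b)² - (a²+b²). -/
lemma exists_int_mul (hL : IsFullLattice L) (h : realPair a b ∈ stabilizer L) :
    ∃ n : ℤ, a * b = n := by
  obtain ⟨m, hm⟩ := exists_int_add hL h
  have h2 := (stabilizer L).mul_mem h h
  rw [realPair_mul] at h2
  obtain ⟨n, hn⟩ := exists_int_add hL h2
  obtain ⟨ha, hb⟩ := isIntegral_of_mem_stabilizer hL h
  refine exists_int_eq_of_isIntegral (ha.mul hb) (k := 2) (n := m ^ 2 - n) (by decide) ?_
  push_cast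
  rw [← hm, ← hn]
  ring

end

end TorusModel
end

noncomputable section
namespace TorusModel
open scoped Quaternion

/-! ### Euclidean lattices with the symmetries of a Narain lattice -/

/-- The lattice `M` is even and self-dual for a definite form, has all the symmetries of `Γ`, and
agrees with `Γ` on the vectors that are fixed by a symmetry acting only on the right. -/
structure IsMate (Γ M : Submodule ℤ H2) (α β : ℝ) : Prop where
  pos_left : 0 < α
  pos_right : 0 < β
  evenSelfDual : IsEvenSelfDual (form α β) M
  stable : ∀ g ∈ stabilizer Γ, star g * g = 1 → g ∈ stabilizer M
  fixed : ∀ b : ℍ[ℝ], b ≠ 1 → ((1, b) : H2) ∈ stabilizer Γ → star b * b = 1 → ∀ v : ℍ[ℝ],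
    (((v, 0) : H2) ∈ M ↔ ((v, 0) : H2) ∈ Γ) ∧
      (((v, 0) : H2) ∈ Γ → α * Quaternion.normSq v = Quaternion.normSq v)

lemma form_self_left (α β : ℝ) (v : ℍ[ℝ]) :
    form α β ((v, 0) : H2) (v, 0) = α * Quaternion.normSq v := by
  simp [form_apply, Quaternion.self_mul_star]

section

variable {Γ : Submodule ℤ H2}

/-- If the real multiplication by a unit `c + g + g⁻¹` of norm `-1` preserves the lattice, then the
twisted form is definite. -/
lemma isMate_twist (hL : IsFullLattice Γ) (hΓ : IsEvenSelfDual (form 1 (-1)) Γ) {g : H2}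
    (hg : g ∈ stabilizer Γ) {c : ℤ} (hpos : 0 < c + 2 * g.1.re)
    (h : (c + 2 * g.1.re) * (c + 2 * g.2.re) = -1) :
    IsMate Γ Γ (c + 2 * g.1.re) (-(c + 2 * g.2.re)) := by
  set a := 2 * g.1.re with ha
  set b := 2 * g.2.re with hb
  have ht := trace_mem_stabilizer hΓ hg
  obtain ⟨s, hs⟩ := exists_int_add hL ht
  rw [← ha, ← hb] at hs
  have hx : realPair (c + a) (c + b) ∈ stabilizer Γ := by
    rw [← realPair_add, realPair_intCast]
    exact (stabilizer Γ).add_mem (intCast_mem _ c) ht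
  -- The conjugate of x = (c+a, c+b) is an integer minus x. Since the product of the two entries is
  -- -1, the inverse of x is minus its conjugate; hence multiplication by x is an automorphism of Γ,
  -- and the twisted form is again self-dual.
  have hx' : realPair (c + b) (c + a) ∈ stabilizer Γ := by
    have : realPair (c + b) (c + a) = ((2 * c + s : ℤ) : H2) - realPair (c + a) (c + b) := by
      rw [← realPair_intCast, sub_eq_add_neg, realPair_neg, realPair_add]
      push_cast
      rw [← hs]
      congr 1 <;> ring
    rw [this]
    exact (stabilizer Γ).sub_mem (intCast_mem _ _) hx
  have hform : ∀ v w, form (c + a) (-(c + b)) v w =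
      form 1 (-1) (realPair (c + a) (c + b) * v) w := fun v w => by
    rw [form_realPair_mul]
    congr 3 <;> ring
  have hE : IsEvenSelfDual (form (c + a) (-(c + b))) Γ := by
    constructor
    · intro v hv
      obtain ⟨n, hn⟩ := hΓ.even v hv
      obtain ⟨k, hk⟩ := (hΓ.selfDual v).1 hv _ (hg v hv)
      refine ⟨c * n + k, ?_⟩
      -- Evenness: the twisted norm of v is c⟨v,v⟩ + ⟨gv,v⟩ + ⟨ḡv,v⟩ = c⟨v,v⟩ + 2⟨gv,v⟩.
      have h1 : realPair (c + a) (c + b) * v = (c : ℝ) • v + g * v + star g * v := by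
        rw [← realPair_add, realPair_intCast, ← add_star_eq, add_mul, add_mul, add_assoc]
        congr 1
        refine Prod.ext ?_ ?_ <;> ext <;> simp
      rw [hform, h1, map_add, map_add, map_smul, LinearMap.add_apply, LinearMap.add_apply,
        LinearMap.smul_apply, hn, form_mul_left _ _ (star g), star_star, form_symm _ _ (g * v), hk]
      push_cast
      rw [smul_eq_mul]
      ring
    · intro v
      simp only [hform]
      rw [← hΓ.selfDual]
      refine ⟨fun hv => hx v hv, fun hv => ?_⟩
      have h1 := hx' _ hv
      rw [← mul_assoc, realPair_mul, mul_comm (c + b : ℝ), h] at h1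
      have h2 : realPair (-1) (-1) * v = -v := by
        rw [← realPair_neg, realPair_one, neg_one_mul]
      rw [h2] at h1
      simpa using Γ.neg_mem h1
  refine ⟨hpos, by nlinarith, hE, fun g hg _ => hg, fun b' _ _ _ v => ⟨Iff.rfl, fun hv => ?_⟩⟩
  -- A nonzero left-moving vector has integral norm for both forms, so c + a is rational, hence an
  -- integer, hence so is c + b. A positive integer whose product with another integer is -1 equals
  -- 1, and the twist does not change the left-moving norm.
  by_cases hv0 : Quaternion.normSq v = 0
  · simp [hv0]
  obtain ⟨n, hn⟩ := hΓ.even _ hv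
  obtain ⟨m, hm⟩ := hE.even _ hv
  rw [form_self_left] at hn hm
  have hn0 : n ≠ 0 := by
    rintro rfl
    simp at hn
    exact hv0 (by simp [hn])
  obtain ⟨k, hk⟩ := exists_int_eq_of_isIntegral (isIntegral_of_mem_stabilizer hL hx).1 hn0 (n := m)
    (by rw [one_mul] at hn; rw [hn] at hm; linarith)
  have hl : (c : ℝ) + b = (2 * c + s - k : ℤ) := by
    push_cast
    rw [← hk, ← hs]
    ring
  rw [hk, hl] at h
  rw [hk] at hpos
  have h1 : k * (2 * c + s - k) = -1 := by exact_mod_cast h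
  have h2 : 0 < k := by exact_mod_cast hpos
  have h3 : k = 1 := by
    rcases Int.isUnit_iff.1 (IsUnit.of_mul_eq_one (a := k) (-(2 * c + s - k)) (by linarith)) with
        h | h
    · exact h
    · lia
  rw [hk, h3]
  simp

/-! ### The possible traces -/

lemma normSq_eq_one {q : ℍ[ℝ]} (hq : star q * q = 1) : Quaternion.normSq q = 1 := by
  have h := congrArg (fun x : ℍ[ℝ] => x.re) (Quaternion.star_mul_self q)
  rw [hq] at h
  simpa using h.symm

lemma re_sq_le_one {q : ℍ[ℝ]} (hq : star q * q = 1) : q.re ^ 2 ≤ 1 := by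
  have h := normSq_eq_one hq
  rw [Quaternion.normSq_def'] at h
  nlinarith [sq_nonneg q.imI, sq_nonneg q.imJ, sq_nonneg q.imK]

lemma eq_one_of_re {q : ℍ[ℝ]} (hq : star q * q = 1) (h1 : q.re = 1) : q = 1 := by
  have h := normSq_eq_one hq
  rw [Quaternion.normSq_def', h1] at h
  have h2 : q.imI = 0 := by nlinarith [sq_nonneg q.imI, sq_nonneg q.imJ, sq_nonneg q.imK]
  have h3 : q.imJ = 0 := by nlinarith [sq_nonneg q.imI, sq_nonneg q.imJ, sq_nonneg q.imK]
  have h4 : q.imK = 0 := by nlinarith [sq_nonneg q.imI, sq_nonneg q.imJ, sq_nonneg q.imK]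
  ext <;> simp [*]

/-- The possible pairs of traces of a symmetry. -/
inductive TracePair : ℝ → ℝ → Prop
  | twist (a b : ℝ) (c : ℤ) (h : (c + a) * (c + b) = -1) : TracePair a b
  | sqrt_three (a : ℝ) (h : a ^ 2 = 3) : TracePair a (-a)
  | diag (i : ℤ) : TracePair i i
  | left_zero : TracePair 2 0
  | neg_left_zero : TracePair (-2) 0
  | right_zero : TracePair 0 2
  | neg_right_zero : TracePair 0 (-2)
  | left_one : TracePair 2 (-1)
  | neg_left_one : TracePair (-2) 1
  | right_one : TracePair (-1) 2
  | neg_right_one : TracePair 1 (-2)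
  | antidiag : TracePair 2 (-2)
  | neg_antidiag : TracePair (-2) 2

/-- The numbers a and b are the roots of X² - sX + p, and both lie in [-2,2], which leaves finitely
many pairs (s,p); `h1` removes consecutive integers. The twists are p = -1, with c = 0, and (s,p) =
(0,-2), with the unit 1 ± √2. -/
lemma tracePair_of_int {a b : ℝ} {s p : ℤ} (hs : a + b = s) (hp : a * b = p)
    (ha : a ^ 2 ≤ 4) (hb : b ^ 2 ≤ 4) (h1 : (a - b) ^ 2 ≠ 1) : TracePair a b := by
  have hD : (a - b) ^ 2 = (s ^ 2 - 4 * p : ℤ) := by push_cast; rw [← hs, ← hp]; ring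
  have hb' : b = s - a := by linarith
  have c1 : 0 ≤ s ^ 2 - 4 * p := by
    have := sq_nonneg (a - b)
    rw [hD] at this
    exact_mod_cast this
  have a1 : a ≤ 2 := by nlinarith
  have a2 : -2 ≤ a := by nlinarith
  have b1 : b ≤ 2 := by nlinarith
  have b2 : -2 ≤ b := by nlinarith
  have c2 : 0 ≤ 4 - 2 * s + p := by
    have : (0 : ℝ) ≤ (4 - 2 * s + p : ℤ) := by
      push_cast
      rw [← hs, ← hp]
      nlinarith
    exact_mod_cast this
  have c3 : 0 ≤ 4 + 2 * s + p := by
    have : (0 : ℝ) ≤ (4 + 2 * s + p : ℤ) := by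
      push_cast
      rw [← hs, ← hp]
      nlinarith
    exact_mod_cast this
  have c4 : s ≤ 4 := by exact_mod_cast (by rw [← hs]; linarith : (s : ℝ) ≤ 4)
  have c5 : -4 ≤ s := by exact_mod_cast (by rw [← hs]; linarith : (-4 : ℝ) ≤ s)
  have c6 : p ≤ 4 := by exact_mod_cast (by rw [← hp]; nlinarith : (p : ℝ) ≤ 4)
  have c7 : -4 ≤ p := by exact_mod_cast (by rw [← hp]; nlinarith : (-4 : ℝ) ≤ p)
  have c8 : s ^ 2 - 4 * p ≠ 1 := by
    intro h
    rw [h] at hD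
    exact h1 (by simpa using hD)
  by_cases t0 : p = -1
  · exact .twist a b 0 (by simp [hp, t0])
  have hq : a ^ 2 - s * a + p = 0 := by rw [← hs, ← hp]; ring
  have hroot : ∀ u v : ℤ, s = u + v → p = u * v → (a = u ∧ b = v) ∨ (a = v ∧ b = u) := by
    intro u v hu hv
    have h2 : (a - u) * (a - v) = 0 := by
      rw [hu, hv] at hq
      push_cast at hq
      linarith
    rw [hu] at hb'
    push_cast at hb'
    rcases mul_eq_zero.1 h2 with h | h
    · left
      constructor <;> linarith
    · right
      constructor <;> linarith
  by_cases t1 : s = 0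
  · have hba : b = -a := by rw [hb', t1]; simp
    subst t1
    by_cases t2 : p = -2
    · exact .twist a b 1 (by rw [hba]; rw [hba, t2] at hp; push_cast at *; linarith)
    by_cases t3 : p = -3
    · rw [hba]
      exact .sqrt_three a (by rw [hba, t3] at hp; push_cast at *; linarith)
    by_cases t4 : p = -4
    · rcases hroot 2 (-2) (by lia) (by lia) with ⟨rfl, rfl⟩ | ⟨rfl, rfl⟩
      · exact_mod_cast TracePair.antidiag
      · exact_mod_cast TracePair.neg_antidiag
    · have t5 : p = 0 := by lia
      rcases hroot 0 0 (by lia) (by lia) with ⟨rfl, rfl⟩ | ⟨rfl, rfl⟩ <;> exact .diag 0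
  · have : s = 1 ∧ p = -2 ∨ s = -1 ∧ p = -2 ∨ s = 2 ∧ p = 0 ∨ s = -2 ∧ p = 0 ∨ s = 2 ∧ p = 1 ∨
        s = -2 ∧ p = 1 ∨ s = 4 ∧ p = 4 ∨ s = -4 ∧ p = 4 := by
      clear hD hq hroot hs hp hb'
      interval_cases s <;> lia
    rcases this with ⟨h, h'⟩ | ⟨h, h'⟩ | ⟨h, h'⟩ | ⟨h, h'⟩ | ⟨h, h'⟩ | ⟨h, h'⟩ | ⟨h, h'⟩ | ⟨h, h'⟩
    · rcases hroot 2 (-1) (by lia) (by lia) with ⟨rfl, rfl⟩ | ⟨rfl, rfl⟩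
      · exact_mod_cast TracePair.left_one
      · exact_mod_cast TracePair.right_one
    · rcases hroot (-2) 1 (by lia) (by lia) with ⟨rfl, rfl⟩ | ⟨rfl, rfl⟩
      · exact_mod_cast TracePair.neg_left_one
      · exact_mod_cast TracePair.neg_right_one
    · rcases hroot 2 0 (by lia) (by lia) with ⟨rfl, rfl⟩ | ⟨rfl, rfl⟩
      · exact_mod_cast TracePair.left_zero
      · exact_mod_cast TracePair.right_zero
    · rcases hroot (-2) 0 (by lia) (by lia) with ⟨rfl, rfl⟩ | ⟨rfl, rfl⟩
      · exact_mod_cast TracePair.neg_left_zero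
      · exact_mod_cast TracePair.neg_right_zero
    · rcases hroot 1 1 (by lia) (by lia) with ⟨rfl, rfl⟩ | ⟨rfl, rfl⟩ <;> exact .diag 1
    · rcases hroot (-1) (-1) (by lia) (by lia) with ⟨rfl, rfl⟩ | ⟨rfl, rfl⟩ <;> exact .diag (-1)
    · rcases hroot 2 2 (by lia) (by lia) with ⟨rfl, rfl⟩ | ⟨rfl, rfl⟩ <;> exact .diag 2
    · rcases hroot (-2) (-2) (by lia) (by lia) with ⟨rfl, rfl⟩ | ⟨rfl, rfl⟩ <;> exact .diag (-2)

end

end TorusModel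
end

noncomputable section
namespace TorusModel
open scoped Quaternion

/-! ### Short vectors in the right-moving sublattice -/

lemma IsEvenSelfDual.neg {α β : ℝ} {L : Submodule ℤ H2} (hL : IsEvenSelfDual (form α β) L) :
    IsEvenSelfDual (form (-α) (-β)) L := by
  have h : ∀ v w, form (-α) (-β) v w = -form α β v w := fun v w => by
    simp only [form_apply]
    ring
  constructor
  · intro v hv
    obtain ⟨n, hn⟩ := hL.even v hv
    exact ⟨-n, by rw [h, hn]; push_cast; ring⟩
  · intro v
    rw [hL.selfDual]
    refine forall₂_congr fun w _ => ⟨fun ⟨n, hn⟩ => ⟨-n, by rw [h, hn]; push_cast; ring⟩,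
      fun ⟨n, hn⟩ => ⟨-n, ?_⟩⟩
    rw [h] at hn
    push_cast
    linarith

lemma innerₗ_symm (v w : ℍ[ℝ]) : innerₗ ℍ[ℝ] v w = innerₗ ℍ[ℝ] w v :=
  real_inner_comm w v

lemma free_submodule {L : Type*} [AddCommGroup L] [Module.Free ℤ L] [Module.Finite ℤ L]
    (K : Submodule ℤ L) : Module.Free ℤ K ∧ Module.Finite ℤ K ∧ Module.IsTorsionFree ℤ L :=
  ⟨inferInstance, inferInstance, inferInstance⟩

/-- The ℤ-rank of a discrete subgroup equals the dimension of its real span. -/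
lemma finrank_le_of_le {L : Submodule ℤ H2} (hL : IsFullLattice L) (K : Submodule ℤ L)
    (W : Submodule ℝ H2) (hK : ∀ x ∈ K, (x : H2) ∈ W) :
    Module.finrank ℤ K ≤ Module.finrank ℝ W := by
  have := hL.discrete
  have hle : (K.map L.subtype : Set H2) ⊆ L := by
    rintro _ ⟨x, _, rfl⟩
    exact x.2
  have hd : DiscreteTopology (Submodule.span ℤ (K.map L.subtype : Set H2)) := by
    rw [Submodule.span_eq]
    exact DiscreteTopology.of_subset this hle
  have h1 := Real.finrank_eq_int_finrank_of_discrete hd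
  rw [Set.finrank, Set.finrank, Submodule.span_eq,
    ← (K.equivMapOfInjective L.subtype L.injective_subtype).finrank_eq] at h1
  rw [← h1]
  refine Submodule.finrank_mono (Submodule.span_le.2 ?_)
  rintro _ ⟨x, hx, rfl⟩
  exact hK x hx

lemma finrank_range_inl :
    Module.finrank ℝ (LinearMap.range (LinearMap.inl ℝ ℍ[ℝ] ℍ[ℝ])) = 4 := by
  rw [LinearMap.finrank_range_of_inj LinearMap.inl_injective, Quaternion.finrank_eq_four]

lemma finrank_range_inr :
    Module.finrank ℝ (LinearMap.range (LinearMap.inr ℝ ℍ[ℝ] ℍ[ℝ])) = 4 := by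
  rw [LinearMap.finrank_range_of_inj LinearMap.inr_injective, Quaternion.finrank_eq_four]

section

variable {Γ : Submodule ℤ H2}

lemma IsFullLattice.exists_inner_ne_zero (hL : IsFullLattice Γ) {u : ℍ[ℝ]} (hu : u ≠ 0) :
    ∃ y ∈ Γ, inner ℝ y.2 u ≠ 0 := by
  by_contra! h
  have h1 : Submodule.span ℝ (Γ : Set H2) ≤
      LinearMap.ker (((innerₗ ℍ[ℝ]).flip u).comp (LinearMap.snd ℝ ℍ[ℝ] ℍ[ℝ])) :=
    Submodule.span_le.2 fun y hy => h y hy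
  rw [hL.span_eq_top] at h1
  have h2 : ((0, u) : H2) ∈ LinearMap.ker
    (((innerₗ ℍ[ℝ]).flip u).comp (LinearMap.snd ℝ ℍ[ℝ] ℍ[ℝ])) := h1 trivial
  simp at h2
  exact hu h2

lemma exists_inner_eq_zero {k : ℕ} (hk : k < 4) (v : Fin k → ℍ[ℝ]) :
    ∃ u : ℍ[ℝ], u ≠ 0 ∧ ∀ i, inner ℝ (v i) u = 0 := by
  have h := LinearMap.ker_ne_bot_of_finrank_lt
    (f := (LinearMap.pi fun i => innerₗ ℍ[ℝ] (v i) : ℍ[ℝ] →ₗ[ℝ] (Fin k → ℝ)))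
    (by rw [Quaternion.finrank_eq_four, Module.finrank_fin_fun]; exact hk)
  obtain ⟨u, hu, hu0⟩ := Submodule.exists_mem_ne_zero_of_ne_bot h
  exact ⟨u, hu0, fun i => congrFun (LinearMap.mem_ker.1 hu) i⟩

/-- The integral form of a self-dual lattice is unimodular. -/
lemma exists_unimodular_intForm {α β : ℝ} (hα : α ≠ 0) (hβ : β ≠ 0) (hL : IsFullLattice Γ)
    (hΓ : IsEvenSelfDual (form α β) Γ) :
    ∃ Q : Γ →ₗ[ℤ] Γ →ₗ[ℤ] ℤ, (∀ x y : Γ, form α β x y = Q x y) ∧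
      ∀ f : Γ →ₗ[ℤ] ℤ, ∃ y, ∀ x, Q y x = f x := by
  have := hL.discrete
  have : IsZLattice ℝ Γ := ⟨hL.span_eq_top⟩
  have := hL.finite
  have := instModuleFree_of_discrete_submodule Γ
  obtain ⟨Q, hQ⟩ := exists_intForm (B := form α β) Γ.subtype.toAddMonoidHom
    fun x y => (hΓ.selfDual x).1 x.2 y y.2
  refine ⟨Q, hQ, exists_dual_of_selfDual (fun v hv => form_definite hα hβ hv)
    Γ.subtype.toAddMonoidHom (Module.Free.chooseBasis ℤ Γ)
    ((Module.Free.chooseBasis ℤ Γ).ofZLatticeBasis ℝ Γ) (fun i => by simp)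
    (fun v hv => ⟨⟨v, (hΓ.selfDual v).2 fun w hw => hv ⟨w, hw⟩⟩, rfl⟩) hQ⟩

/-- The embedding of a sublattice of right-moving vectors. -/
def rightEmbedding (K : Submodule ℤ Γ) : K →+ ℍ[ℝ] :=
  (AddMonoidHom.snd ℍ[ℝ] ℍ[ℝ]).comp
    (Γ.subtype.toAddMonoidHom.comp K.subtype.toAddMonoidHom)

lemma rightEmbedding_apply {K : Submodule ℤ Γ} (x : K) : rightEmbedding K x = (x : H2).2 := rfl

lemma rightEmbedding_injective {K : Submodule ℤ Γ} (hK : ∀ x ∈ K, (x : H2).1 = 0) :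
    Function.Injective (rightEmbedding K) := fun x y h =>
  Subtype.ext (Subtype.ext (Prod.ext ((hK x x.2).trans (hK y y.2).symm) h))

lemma inner_rightEmbedding {K : Submodule ℤ Γ} (hK : ∀ x ∈ K, (x : H2).1 = 0) (x y : K) :
    innerₗ ℍ[ℝ] (rightEmbedding K x) (rightEmbedding K y) =
      form (-1) 1 ((x : Γ) : H2) ((y : Γ) : H2) := by
  simp [form_apply, hK x x.2, rightEmbedding_apply, Quaternion.inner_def]

lemma finrank_right_le {K : Submodule ℤ Γ} (hL : IsFullLattice Γ)
    (hK : ∀ x ∈ K, (x : H2).1 = 0) : Module.finrank ℤ K ≤ 4 := by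
  rw [← finrank_range_inr]
  exact finrank_le_of_le hL K _ fun x hx => ⟨(x : H2).2, Prod.ext (hK x hx).symm rfl⟩

lemma finrank_left_le {K : Submodule ℤ Γ} (hL : IsFullLattice Γ)
    (hK : ∀ x ∈ K, (x : H2).2 = 0) : Module.finrank ℤ K ≤ 4 := by
  rw [← finrank_range_inl]
  exact finrank_le_of_le hL K _ fun x hx => ⟨(x : H2).1, Prod.ext rfl (hK x hx).symm⟩

/-- A primitive sublattice of right-moving vectors whose dual is mapped into it by the adjoint of a
map of small determinant contains a root. -/
lemma exists_root_right (hL : IsFullLattice Γ) (hΓ : IsEvenSelfDual (form (-1) 1) Γ)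
    (K : Submodule ℤ Γ) (hfree : Module.Free ℤ (Γ ⧸ K)) (hK : ∀ x ∈ K, (x : H2).1 = 0)
    (hne : K ≠ ⊥) (θ : K →ₗ[ℤ] K)
    (hθ : ∀ y : Γ, ∃ n : K, ∀ x : K, form (-1) 1 ((n : Γ) : H2) ((x : Γ) : H2) =
      form (-1) 1 (y : H2) ((θ x : Γ) : H2))
    (hdet0 : LinearMap.det θ ≠ 0) (hdet : |LinearMap.det θ| ≤ 2 ^ Module.finrank ℤ K) :
    ∃ x ∈ K, form (-1) 1 (x : H2) (x : H2) = 2 := by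
  have := hL.discrete
  have := hL.finite
  have := instModuleFree_of_discrete_submodule Γ
  obtain ⟨Q, hQ, hunim⟩ := exists_unimodular_intForm (by norm_num) (by norm_num) hL hΓ
  obtain ⟨_, _, _⟩ := free_submodule K
  have h4 := finrank_right_le hL hK
  have h1 : 1 ≤ Module.finrank ℤ K := by
    rw [Nat.one_le_iff_ne_zero, Ne, Submodule.finrank_eq_zero]
    exact hne
  have hgram := abs_det_gram_le hunim K (Module.finBasis ℤ K) θ (fun y => by
    obtain ⟨n, hn⟩ := hθ y
    refine ⟨n, fun x => ?_⟩
    have := hn x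
    rw [hQ, hQ] at this
    exact_mod_cast this) hdet0
  -- A right-moving sublattice has rank at most 4, and 2, 4, 8, 16 do not exceed 3, 9, 17, 24.
  have hb : (2 : ℤ) ^ Module.finrank ℤ K ≤ ballBound (Module.finrank ℤ K) := by
    generalize Module.finrank ℤ K = r at h1 h4
    interval_cases r <;> norm_num [ballBound]
  obtain ⟨x, hx, hx2⟩ := exists_root_of_det_gram_le (Q := Q) (B := innerₗ ℍ[ℝ])
    innerₗ_symm (fun v hv => real_inner_self_pos.2 hv) K (rightEmbedding K)
    (rightEmbedding_injective hK) (fun x y => by rw [inner_rightEmbedding hK, hQ])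
    (fun x _ => by
      obtain ⟨n, hn⟩ := hΓ.even x x.2
      rw [hQ] at hn
      have hn' : Q x x = 2 * n := by exact_mod_cast hn
      exact ⟨n, by lia⟩) h1 (by lia) (Module.finBasis ℤ K) (hgram.trans (hdet.trans hb))
  exact ⟨x, hx, by rw [hQ, hx2]; norm_num⟩

/-- Multiplication by an element of the stabilizer. -/
def stabMul {u : H2} (hu : u ∈ stabilizer Γ) : Γ →ₗ[ℤ] Γ :=
  AddMonoidHom.toIntLinearMap
    { toFun := fun x => ⟨u * x, hu x x.2⟩
      map_zero' := Subtype.ext (mul_zero u)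
      map_add' := fun x y => Subtype.ext (mul_add u x y) }

@[simp] lemma coe_stabMul {u : H2} (hu : u ∈ stabilizer Γ) (x : Γ) :
    (stabMul hu x : H2) = u * x := rfl

/-- A Narain lattice is not the direct sum of its left- and right-moving parts: these would be
even, unimodular and definite of rank four. -/
lemma realPair_zero_one_notMem (hL : IsFullLattice Γ) (hΓ : IsEvenSelfDual (form (-1) 1) Γ) :
    realPair 0 1 ∉ stabilizer Γ := by
  intro h
  have := hL.discrete
  have := hL.finite
  have : IsZLattice ℝ Γ := ⟨hL.span_eq_top⟩
  have := instModuleFree_of_discrete_submodule Γ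
  have h' : realPair 1 0 ∈ stabilizer Γ := by
    have h2 := (stabilizer Γ).sub_mem (one_mem _) h
    rwa [← realPair_one, sub_eq_add_neg, realPair_neg, realPair_add, add_neg_cancel, neg_zero,
      add_zero] at h2
  obtain ⟨Q, hQ, hunim⟩ := exists_unimodular_intForm (by norm_num) (by norm_num) hL hΓ
  let K := LinearMap.ker (stabMul h')
  have hK : ∀ x ∈ K, (x : H2).1 = 0 := fun x hx => by
    have := congrArg (fun z : Γ => (z : H2).1) (LinearMap.mem_ker.1 hx)
    simpa using this
  have hfree : Module.Free ℤ (Γ ⧸ K) := free_quotient_ker _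
  obtain ⟨_, _, _⟩ := free_submodule K
  have hrank : Module.finrank ℤ K = 4 := by
    refine le_antisymm (finrank_right_le hL hK) ?_
    have h1 := Submodule.finrank_quotient_add_finrank K
    rw [(stabMul h').quotKerEquivRange.finrank_eq, ZLattice.rank ℝ Γ, Module.finrank_prod,
      Quaternion.finrank_eq_four] at h1
    have h2 : Module.finrank ℤ (LinearMap.range (stabMul h')) ≤ 4 := by
      refine finrank_left_le hL ?_
      rintro _ ⟨x, rfl⟩
      simp
    by_contra! hlt
    exact (add_lt_add_of_le_of_lt h2 hlt).ne h1
  let c : Module.Basis (Fin 4) ℤ K := (Module.finBasis ℤ K).reindex (finCongr hrank)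
  -- The component (0,1)y lies in K and pairs with K as y does. So θ may be the identity, and K is
  -- unimodular.
  have hgram := abs_det_gram_le hunim K c LinearMap.id (fun y => by
    refine ⟨⟨stabMul h y, ?_⟩, fun x => ?_⟩
    · rw [LinearMap.mem_ker]
      refine Subtype.ext (Prod.ext ?_ ?_) <;> simp
    · have h1 := hQ (stabMul h y) x
      have h2 := hQ y x
      simp only [coe_stabMul, form_apply, hK x x.2] at h1 h2
      have : (Q (stabMul h y) x : ℝ) = Q y x := by rw [← h1, ← h2]; simp
      exact_mod_cast this) (by simp)
  rw [LinearMap.det_id, abs_one] at hgram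
  have he := rightEmbedding_injective hK
  have hsum : ∀ n : Fin 4 → ℤ, ∑ i, (n i : ℝ) • rightEmbedding K (c i) =
      rightEmbedding K (∑ i, n i • c i) := fun n => by
    simp [map_sum, Int.cast_smul_eq_zsmul]
  have hc : ∀ n : Fin 4 → ℤ, ∑ i, (n i : ℝ) • rightEmbedding K (c i) = 0 → n = 0 := fun n hn => by
    rw [hsum, map_eq_zero_iff _ he] at hn
    exact funext fun i => Fintype.linearIndependent_iff.1 c.linearIndependent n hn i
  have hG : ∀ i j, innerₗ ℍ[ℝ] (rightEmbedding K (c i)) (rightEmbedding K (c j)) =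
      gram Q (fun i => (c i : Γ)) i j := fun i j => by
    rw [inner_rightEmbedding hK, hQ]
    rfl
  have hpos := (gram_posDef (B := innerₗ ℍ[ℝ]) innerₗ_symm
    (fun v hv => real_inner_self_pos.2 hv) hc hG).det_pos
  have hdet1 : (gram Q fun i => (c i : Γ)).det = 1 := by
    have h1 : (0 : ℝ) < (gram Q fun i => (c i : Γ)).det := by
      rwa [show ((gram Q fun i => (c i : Γ)).det : ℝ) = _ from (Int.castRingHom ℝ).map_det _]
    have h2 : 0 < (gram Q fun i => (c i : Γ)).det := by exact_mod_cast h1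
    rw [abs_of_pos h2] at hgram
    lia
  -- With radius √2 the vector found has norm strictly between 0 and 2, contrary to evenness.
  obtain ⟨n, hn0, hn⟩ := exists_short_of_volume (B := innerₗ ℍ[ℝ])
    innerₗ_symm (fun v hv => real_inner_self_pos.2 hv) hc hG
    (Real.sqrt_nonneg 2) (by rw [hdet1]; simpa using volume_ball_sqrt_two)
  rw [Real.sq_sqrt (by norm_num)] at hn
  have hp := real_inner_self_pos.2 hn0
  rw [hsum] at hn hp
  rw [inner_rightEmbedding hK] at hn
  have hp' : 0 < form (-1) 1 (((∑ i, n i • c i : K) : Γ) : H2) ((∑ i, n i • c i : K) : Γ) := by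
    rw [← inner_rightEmbedding hK]
    exact hp
  obtain ⟨m, hm⟩ := hΓ.even _ (∑ i, n i • c i : K).1.2
  rw [hm] at hn hp'
  have h3 : 0 < m := by exact_mod_cast (by linarith : (0 : ℝ) < m)
  have h4 : m < 1 := by exact_mod_cast (by linarith : (m : ℝ) < 1)
  lia

end

end TorusModel
end

/-! ### Roots in orthogonal complements of right-moving vectors. -/

noncomputable section
namespace TorusModel
open scoped Quaternion

lemma free_quotient_of_saturated {L : Type*} [AddCommGroup L] [Module.Finite ℤ L]
    (K : Submodule ℤ L) (h : ∀ n : ℤ, n ≠ 0 → ∀ x, n • x ∈ K → x ∈ K) :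
    Module.Free ℤ (L ⧸ K) := by
  have : Module.IsTorsionFree ℤ (L ⧸ K) := by
    refine Module.isTorsionFree_iff_smul_eq_zero.2 fun n x => ?_
    obtain ⟨x, rfl⟩ := K.mkQ_surjective x
    intro hx
    by_cases hn : n = 0
    · exact Or.inl hn
    · rw [← map_smul, Submodule.mkQ_apply, Submodule.Quotient.mk_eq_zero] at hx
      right
      rw [Submodule.mkQ_apply, Submodule.Quotient.mk_eq_zero]
      exact h n hn x hx
  exact Module.free_of_finite_type_torsion_free'

section

variable {Γ : Submodule ℤ H2}

/-- The right-moving vectors of a lattice that are orthogonal to given vectors. -/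
def rightPerp (Γ : Submodule ℤ H2) {k : ℕ} (v : Fin k → ℍ[ℝ]) : Submodule ℤ Γ where
  carrier := {x | (x : H2).1 = 0 ∧ ∀ i, inner ℝ (v i) (x : H2).2 = 0}
  add_mem' := fun {x y} hx hy =>
    ⟨by simp [hx.1, hy.1], fun i => by simp [inner_add_right, hx.2 i, hy.2 i]⟩
  zero_mem' := ⟨rfl, fun i => by simp⟩
  smul_mem' := fun n x hx => ⟨by simp [hx.1], fun i => by
    have : ((n • x : Γ) : H2).2 = (n : ℝ) • (x : H2).2 :=
      (Int.cast_smul_eq_zsmul ℝ n (x : H2).2).symm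
    rw [this, inner_smul_right, hx.2 i, mul_zero]⟩

variable {k : ℕ} {v : Fin k → ℍ[ℝ]}

lemma rightPerp_saturated (n : ℤ) (hn : n ≠ 0) (x : Γ) (hx : n • x ∈ rightPerp Γ v) :
    x ∈ rightPerp Γ v := by
  have hn' : (n : ℝ) ≠ 0 := by exact_mod_cast hn
  have h1 : ((n • x : Γ) : H2) = (n : ℝ) • (x : H2) :=
    (Int.cast_smul_eq_zsmul ℝ n (x : H2)).symm
  obtain ⟨h2, h3⟩ := hx
  rw [h1] at h2
  refine ⟨?_, fun i => ?_⟩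
  · simpa [hn'] using h2
  · have := h3 i
    rw [h1, Prod.smul_snd, inner_smul_right] at this
    simpa [hn'] using this

/-- Elements of the stabilizer that preserve the orthogonal complement of the `v i`. -/
structure PreservesPerp (Γ : Submodule ℤ H2) {k : ℕ} (v : Fin k → ℍ[ℝ]) (u : H2) : Prop where
  mem : u ∈ stabilizer Γ
  perp : ∀ x : ℍ[ℝ], (∀ i, inner ℝ (v i) x = 0) → ∀ i, inner ℝ (v i) (u.2 * x) = 0

def PreservesPerp.map {u : H2} (hu : PreservesPerp Γ v u) : rightPerp Γ v →ₗ[ℤ] rightPerp Γ v :=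
  (stabMul hu.mem).restrict fun x hx => ⟨by simp [hx.1], hu.perp _ hx.2⟩

@[simp] lemma PreservesPerp.coe_map {u : H2} (hu : PreservesPerp Γ v u) (x : rightPerp Γ v) :
    ((hu.map x : Γ) : H2) = u * (x : Γ) := rfl

lemma rightPerp_ext {x y : rightPerp Γ v} (h : ((x : Γ) : H2).2 = ((y : Γ) : H2).2) : x = y :=
  Subtype.ext (Subtype.ext (Prod.ext (x.2.1.trans y.2.1.symm) h))

/-- The orthogonal complement of at most three vectors in the right-moving sublattice contains a
root, if its dual is mapped into it by the adjoint of a multiplication of small norm. -/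
lemma exists_root_rightPerp (hL : IsFullLattice Γ) (hΓ : IsEvenSelfDual (form (-1) 1) Γ)
    (hk : k < 4) {u η η' : H2} (hu : PreservesPerp Γ v u) (hη : PreservesPerp Γ v η)
    (hη' : PreservesPerp Γ v η') (hηη' : η.2 * η'.2 = 1) {m : ℕ} (hm0 : m ≠ 0) (hm : m ≤ 4)
    (hum : u.2 * (η.2 * u.2) = m)
    (hadj : ∀ y ∈ Γ, ∃ n : ℍ[ℝ], ((0, n) : H2) ∈ Γ ∧ (∀ i, inner ℝ (v i) n = 0) ∧
      ∀ x : ℍ[ℝ], (∀ i, inner ℝ (v i) x = 0) → inner ℝ n x = inner ℝ y.2 (u.2 * x)) :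
    ∃ x : ℍ[ℝ], ((0, x) : H2) ∈ Γ ∧ (∀ i, inner ℝ (v i) x = 0) ∧ inner ℝ x x = (2 : ℝ) := by
  have := hL.discrete
  have := hL.finite
  have := instModuleFree_of_discrete_submodule Γ
  obtain ⟨_, _, _⟩ := free_submodule (rightPerp Γ v)
  have hfree := free_quotient_of_saturated (rightPerp Γ v) rightPerp_saturated
  have hK : ∀ x ∈ rightPerp Γ v, (x : H2).1 = 0 := fun x hx => hx.1
  have hu0 : u.2 ≠ 0 := by
    intro h0
    rw [h0, zero_mul] at hum
    exact hm0 (by simpa using congrArg (fun q : ℍ[ℝ] => q.re) hum.symm)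
  have hne : rightPerp Γ v ≠ ⊥ := by
    obtain ⟨x, hx0, hx⟩ := exists_inner_eq_zero hk v
    obtain ⟨y, hy, hyx⟩ := hL.exists_inner_ne_zero (mul_ne_zero hu0 hx0)
    obtain ⟨n, hn, hn1, hn2⟩ := hadj y hy
    rw [Submodule.ne_bot_iff]
    refine ⟨⟨(0, n), hn⟩, ⟨rfl, hn1⟩, fun h0 => hyx ?_⟩
    have : n = 0 := congrArg (fun z : Γ => (z : H2).2) h0
    rw [← hn2 x hx, this, inner_zero_left]
  have hdet1 : IsUnit (LinearMap.det hη.map) := by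
    refine IsUnit.of_mul_eq_one (LinearMap.det hη'.map) ?_
    rw [← LinearMap.det_comp]
    have : hη.map ∘ₗ hη'.map = LinearMap.id := by
      refine LinearMap.ext fun x => rightPerp_ext ?_
      simp [← mul_assoc, hηη']
    rw [this, LinearMap.det_id]
  -- From u η u = m with η invertible on the complement, |det u|² = m^rank, and m ≤ 4 gives |det u|
  -- ≤ 2^rank, the bound required by `exists_root_right`.
  have hdet2 : LinearMap.det hu.map * (LinearMap.det hη.map * LinearMap.det hu.map) =
      (m : ℤ) ^ Module.finrank ℤ (rightPerp Γ v) := by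
    rw [← LinearMap.det_comp, ← LinearMap.det_comp]
    have : hu.map ∘ₗ hη.map ∘ₗ hu.map = (m : ℤ) • LinearMap.id := by
      refine LinearMap.ext fun x => rightPerp_ext ?_
      have h1 : u.2 * (η.2 * (u.2 * ((x : Γ) : H2).2)) = m * ((x : Γ) : H2).2 := by
        rw [← hum]
        noncomm_ring
      simpa using h1
    rw [this, LinearMap.det_smul, LinearMap.det_id, mul_one]
  have habs : |LinearMap.det hu.map| * |LinearMap.det hu.map| =
      (m : ℤ) ^ Module.finrank ℤ (rightPerp Γ v) := by
    have := congrArg abs hdet2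
    rwa [abs_mul, abs_mul, Int.isUnit_iff_abs_eq.1 hdet1, one_mul, abs_of_nonneg
      (by positivity : (0 : ℤ) ≤ (m : ℤ) ^ Module.finrank ℤ (rightPerp Γ v))] at this
  have hdet0 : LinearMap.det hu.map ≠ 0 := by
    intro h0
    rw [h0, abs_zero, zero_mul] at habs
    have : (m : ℤ) ≠ 0 := by exact_mod_cast hm0
    exact pow_ne_zero _ this habs.symm
  have hdet : |LinearMap.det hu.map| ≤ 2 ^ Module.finrank ℤ (rightPerp Γ v) := by
    refine (abs_le_of_sq_le_sq' ?_ (by positivity)).2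
    rw [sq, habs, ← pow_mul, mul_comm _ 2, pow_mul]
    exact pow_le_pow_left₀ (by positivity) (by exact_mod_cast hm) _
  obtain ⟨x, hx, hx2⟩ := exists_root_right hL hΓ (rightPerp Γ v) hfree hK hne hu.map (fun y => by
      obtain ⟨n, hn, hn1, hn2⟩ := hadj y y.2
      refine ⟨⟨⟨(0, n), hn⟩, rfl, hn1⟩, fun x => ?_⟩
      have := hn2 _ x.2.2
      simp only [Quaternion.inner_def] at this
      simp only [form_apply, PreservesPerp.coe_map, Prod.fst_mul, Prod.snd_mul, hK x x.2, this]
      simp) hdet0 hdet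
  refine ⟨(x : H2).2, ?_, hx.2, ?_⟩
  · have : (x : H2) = (0, (x : H2).2) := Prod.ext hx.1 rfl
    rw [← this]
    exact x.2
  · rw [form_apply, hx.1] at hx2
    simp only [zero_mul, Quaternion.re_zero, mul_zero, zero_add, one_mul] at hx2
    rwa [Quaternion.inner_def]

end

end TorusModel
end

noncomputable section
namespace TorusModel
open scoped Quaternion

/-! ### Lattices with the symmetry `(1, -1)` -/

section

variable {Γ : Submodule ℤ H2}

lemma exists_int_inner_right (hΓ : IsEvenSelfDual (form 1 (-1)) Γ) {v : ℍ[ℝ]}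
    (hv : ((0, v) : H2) ∈ Γ) {y : H2} (hy : y ∈ Γ) : ∃ n : ℤ, inner ℝ v y.2 = (n : ℝ) := by
  obtain ⟨n, hn⟩ := (hΓ.selfDual _).1 hv y hy
  refine ⟨-n, ?_⟩
  rw [form_apply] at hn
  rw [Quaternion.inner_def]
  push_cast
  simp only [zero_mul, Quaternion.re_zero, mul_zero, zero_add] at hn
  linarith

/-- For y in Γ the vector (1 - (1,-1))y = (0, 2y_R) lies in Γ. Removing from it the components along
the roots already found keeps it in Γ and makes it orthogonal to them, so twice the dual of the
complement lies in the complement. This is the hypothesis of `exists_root_rightPerp` with u = 2, η =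
1, m = 4. -/
lemma exists_orthogonal_roots_right (hL : IsFullLattice Γ)
    (hΓ : IsEvenSelfDual (form 1 (-1)) Γ) (h : realPair 1 (-1) ∈ stabilizer Γ) :
    ∀ k ≤ 4, ∃ v : Fin k → ℍ[ℝ], (∀ i, ((0, v i) : H2) ∈ Γ) ∧
      ∀ i j, inner ℝ (v i) (v j) = if i = j then (2 : ℝ) else 0 := by
  intro k
  induction k with
  | zero => exact fun _ => ⟨Fin.elim0, fun i => i.elim0, fun i => i.elim0⟩
  | succ k ih =>
    intro hk
    obtain ⟨v, hv, hvv⟩ := ih (by lia)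
    have hΓ' : IsEvenSelfDual (form (-1) 1) Γ := by simpa using hΓ.neg
    have h2 : PreservesPerp Γ v 2 := ⟨ofNat_mem _ 2, fun x hx i => by
      have : (2 : H2).2 * x = (2 : ℝ) • x := (two_mul x).trans (two_smul ℝ x).symm
      rw [this, inner_smul_right, hx i, mul_zero]⟩
    have h1 : PreservesPerp Γ v 1 := ⟨one_mem _, fun x hx i => by simpa using hx i⟩
    obtain ⟨x, hx, hxv, hxx⟩ := exists_root_rightPerp hL hΓ' (by lia) h2 h1 h1 (by simp)
      (m := 4) (by norm_num) le_rfl (by norm_num) (fun y hy => by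
        choose m hm using fun i => exists_int_inner_right hΓ (hv i) hy
        refine ⟨(2 : ℝ) • y.2 - ∑ i, (inner ℝ (v i) y.2 : ℝ) • v i, ?_, fun i => ?_, fun x hx => ?_⟩
        · have h3 : ((0, (2 : ℝ) • y.2 - ∑ i, (inner ℝ (v i) y.2 : ℝ) • v i) : H2) =
              (1 - realPair 1 (-1)) * y - ∑ i, m i • ((0, v i) : H2) := by
            refine Prod.ext ?_ ?_
            · simp [Prod.fst_sum]
            · simp only [hm, Prod.snd_sub, Prod.snd_mul, Prod.snd_sum, Prod.snd_one, realPair_snd]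
              congr 1
              · rw [Quaternion.coe_neg, Quaternion.coe_one, sub_neg_eq_add, one_add_one_eq_two,
                  two_mul, two_smul]
              · exact Finset.sum_congr rfl fun i _ => Int.cast_smul_eq_zsmul ℝ _ _
          rw [h3]
          exact Γ.sub_mem ((stabilizer Γ).sub_mem (one_mem _) h y hy)
            (Submodule.sum_mem _ fun i _ => Submodule.smul_mem _ _ (hv i))
        · simp only [inner_sub_right, inner_smul_right, inner_sum, hvv]
          simp
          ring
        · have h4 : (2 : H2).2 * x = (2 : ℝ) • x := (two_mul x).trans (two_smul ℝ x).symm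
          simp only [inner_sub_left, inner_smul_left, sum_inner, hx, h4, inner_smul_right]
          simp)
    refine ⟨Fin.snoc v x, fun i => ?_, fun i j => ?_⟩
    · refine Fin.lastCases ?_ (fun i => ?_) i
      · simpa using hx
      · simpa using hv i
    · refine Fin.lastCases ?_ (fun i => ?_) i <;> refine Fin.lastCases ?_ (fun j => ?_) j
      · simpa using hxx
      · rw [Fin.snoc_last, Fin.snoc_castSucc, real_inner_comm, hxv, if_neg (Fin.castSucc_lt_last
          j).ne']
      · simp only [Fin.snoc_last, Fin.snoc_castSucc, hxv]
        rw [if_neg (Fin.castSucc_lt_last i).ne]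
      · simp [hvv]

/-- The expansion in a frame of orthogonal vectors of norm two. -/
lemma two_smul_eq_sum {v : Fin 4 → ℍ[ℝ]}
    (hv : ∀ i j, inner ℝ (v i) (v j) = if i = j then (2 : ℝ) else 0) (x : ℍ[ℝ]) :
    (2 : ℝ) • x = ∑ i, (inner ℝ (v i) x : ℝ) • v i := by
  have hli : LinearIndependent ℝ v := linearIndependent_of_ne_zero_of_inner_eq_zero
    (fun i h0 => by
      have := hv i i
      rw [h0] at this
      simp at this) (fun i j hij => by
      change inner ℝ (v i) (v j) = 0
      rw [hv, if_neg hij])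
  have hspan := hli.span_eq_top_of_card_eq_finrank (by
    rw [Quaternion.finrank_eq_four, Fintype.card_fin])
  rw [← sub_eq_zero, ← inner_self_eq_zero (𝕜 := ℝ)]
  have h1 : ∀ z ∈ Submodule.span ℝ (Set.range v),
      inner ℝ z ((2 : ℝ) • x - ∑ i, (inner ℝ (v i) x : ℝ) • v i) = 0 := by
    intro z hz
    induction hz using Submodule.span_induction with
    | mem z hz =>
      obtain ⟨i, rfl⟩ := hz
      simp only [inner_sub_right, inner_smul_right, inner_sum, hv]
      simp
      ring
    | zero => simp
    | add y z _ _ hy hz => rw [inner_add_left, hy, hz, add_zero]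
    | smul c y _ hy => rw [inner_smul_left, hy, mul_zero]
  exact h1 _ (hspan ▸ trivial)

lemma two_mul_inner_self {v : Fin 4 → ℍ[ℝ]}
    (hv : ∀ i j, inner ℝ (v i) (v j) = if i = j then (2 : ℝ) else 0) (x : ℍ[ℝ]) :
    2 * inner ℝ x x = ∑ i, (inner ℝ (v i) x : ℝ) ^ 2 := by
  have := congrArg (fun z => inner ℝ z x) (two_smul_eq_sum hv x)
  simpa [sum_inner, inner_smul_left, sq] using this

lemma form_one_one_eq (x y : H2) : form 1 1 x y = form 1 (-1) x y + 2 * inner ℝ x.2 y.2 := by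
  simp only [form_apply, Quaternion.inner_def]
  ring

lemma form_one_one_eq_mul (x y : H2) : form 1 1 x y = form 1 (-1) (realPair 1 (-1) * x) y := by
  rw [form_realPair_mul]
  norm_num

lemma realPair_one_neg_one_mul_self (x : H2) :
    realPair 1 (-1) * (realPair 1 (-1) * x) = x := by
  rw [← mul_assoc, realPair_mul]
  norm_num [realPair_one]

/-- The Euclidean and the Narain form differ by multiplication with (1,-1), which is an automorphism
of Γ. -/
lemma selfDual_one_one (hΓ : IsEvenSelfDual (form 1 (-1)) Γ)
    (h : realPair 1 (-1) ∈ stabilizer Γ) (v : H2) :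
    v ∈ Γ ↔ ∀ w ∈ Γ, ∃ n : ℤ, form 1 1 v w = n := by
  simp only [form_one_one_eq_mul]
  rw [← hΓ.selfDual]
  refine ⟨fun hv => h v hv, fun hv => ?_⟩
  have := h _ hv
  rwa [realPair_one_neg_one_mul_self] at this

/-- The sum of the frame vectors is a characteristic vector. -/
lemma exists_characteristic (hL : IsFullLattice Γ) (hΓ : IsEvenSelfDual (form 1 (-1)) Γ)
    (h : realPair 1 (-1) ∈ stabilizer Γ) :
    ∃ C : ℍ[ℝ], ((0, C) : H2) ∈ Γ ∧ inner ℝ C C = (8 : ℝ) ∧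
      ∀ x ∈ Γ, ∃ n : ℤ, form 1 1 x x - form 1 1 (0, C) x = 2 * n := by
  obtain ⟨v, hv, hvv⟩ := exists_orthogonal_roots_right hL hΓ h 4 le_rfl
  refine ⟨∑ i, v i, ?_, ?_, fun x hx => ?_⟩
  · have : ((0, ∑ i, v i) : H2) = ∑ i, ((0, v i) : H2) := by
      refine Prod.ext ?_ ?_ <;> simp [Prod.fst_sum, Prod.snd_sum]
    rw [this]
    exact Submodule.sum_mem _ fun i _ => hv i
  · simp only [sum_inner, inner_sum, hvv]
    norm_num
  · choose m hm using fun i => exists_int_inner_right hΓ (hv i) hx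
    obtain ⟨n, hn⟩ := hΓ.even x hx
    -- The Euclidean norm is the even Narain norm plus 2|x_R|² = Σ m i², and Σ m i² ≡ Σ m i mod 2,
    -- which is the pairing with C.
    have h1 := two_mul_inner_self hvv x.2
    have h2 : form 1 1 ((0, ∑ i, v i) : H2) x = ∑ i, (m i : ℝ) := by
      simp only [form_apply, ← hm, ← Quaternion.inner_def, sum_inner]
      simp
    have h3 : Even (∑ i, (m i ^ 2 - m i)) := Finset.even_sum _ fun i _ => by
      have := Int.even_mul_pred_self (m i)
      rwa [mul_sub, mul_one, ← sq] at this
    obtain ⟨l, hl⟩ := h3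
    refine ⟨n + l, ?_⟩
    have h4 : ∑ i, ((m i : ℝ) ^ 2 - m i) = l + l := by
      exact_mod_cast congrArg (Int.cast (R := ℝ)) hl
    rw [Finset.sum_sub_distrib] at h4
    rw [form_one_one_eq x x, hn, h2, h1]
    simp only [hm]
    push_cast
    linarith

end

end TorusModel
end

/-! ### The even neighbour of an odd unimodular lattice. -/

noncomputable section
namespace TorusModel
open scoped Quaternion

section

variable {Γ : Submodule ℤ H2}

/-- Polarization: the self-dual condition for a lattice on which the form is even. -/
lemma exists_int_of_even {α β : ℝ} {M : AddSubgroup H2}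
    (heven : ∀ v ∈ M, ∃ n : ℤ, form α β v v = 2 * n) {v w : H2} (hv : v ∈ M) (hw : w ∈ M) :
    ∃ n : ℤ, form α β v w = n := by
  obtain ⟨a, ha⟩ := heven v hv
  obtain ⟨b, hb⟩ := heven w hw
  obtain ⟨c, hc⟩ := heven (v + w) (M.add_mem hv hw)
  refine ⟨c - a - b, ?_⟩
  simp only [map_add, LinearMap.add_apply] at hc
  rw [form_symm α β w v] at hc
  push_cast
  linarith

/-- The sublattice of vectors with even pairing with `C`. -/
def evenPart (Γ : Submodule ℤ H2) (C : H2) : AddSubgroup H2 where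
  carrier := {x | x ∈ Γ ∧ ∃ n : ℤ, form 1 1 C x = 2 * n}
  zero_mem' := ⟨Γ.zero_mem, 0, by simp⟩
  add_mem' := fun ⟨hx, m, hm⟩ ⟨hy, n, hn⟩ =>
    ⟨Γ.add_mem hx hy, m + n, by rw [map_add, hm, hn]; push_cast; ring⟩
  neg_mem' := fun ⟨hx, m, hm⟩ => ⟨Γ.neg_mem hx, -m, by rw [map_neg, hm]; push_cast; ring⟩

/-- The union of a subgroup and a coset of order two. -/
def adjoin (S : AddSubgroup H2) (d : H2) (hd : (2 : ℤ) • d ∈ S) : AddSubgroup H2 where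
  carrier := {x | x ∈ S ∨ x - d ∈ S}
  zero_mem' := Or.inl S.zero_mem
  add_mem' := by
    rintro x y (hx | hx) (hy | hy)
    · exact Or.inl (S.add_mem hx hy)
    · exact Or.inr (by rw [add_sub_assoc]; exact S.add_mem hx hy)
    · exact Or.inr (by rw [add_sub_right_comm]; exact S.add_mem hx hy)
    · refine Or.inl ?_
      have : x + y = (x - d) + (y - d) + (2 : ℤ) • d := by module
      rw [this]
      exact S.add_mem (S.add_mem hx hy) hd
  neg_mem' := by
    rintro x (hx | hx)
    · exact Or.inl (S.neg_mem hx)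
    · refine Or.inr ?_
      have : -x - d = -(x - d) - (2 : ℤ) • d := by module
      rw [this]
      exact S.sub_mem (S.neg_mem hx) hd

lemma form_one_one_mul_mul {g : H2} (hg : star g * g = 1) (v w : H2) :
    form 1 1 (g * v) (g * w) = form 1 1 v w := by
  rw [form_mul_left, ← mul_assoc, hg, one_mul]

/-- Γ is unimodular for the Euclidean form. If it is odd, its even vectors form the sublattice Γ₀ on
which the characteristic vector C pairs evenly. With x₀ an odd vector and c = C/2 of norm 2, the
cosets of c and of x₀ + c both complete Γ₀ to an even unimodular lattice. The coset of d = x₀ + c is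
the right choice: its vectors pair oddly with the right-moving vector C, so it adds no left-moving
vector. -/
lemma exists_isMate_of_two (hL : IsFullLattice Γ) (hΓ : IsEvenSelfDual (form 1 (-1)) Γ)
    (h : realPair 1 (-1) ∈ stabilizer Γ) : ∃ M, IsMate Γ M 1 1 := by
  have hdual := selfDual_one_one hΓ h
  by_cases hall : ∀ x ∈ Γ, ∃ n : ℤ, form 1 1 x x = 2 * n
  · exact ⟨Γ, one_pos, one_pos, ⟨hall, hdual⟩, fun g hg _ => hg,
      fun b _ _ _ v => ⟨Iff.rfl, fun _ => one_mul _⟩⟩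
  obtain ⟨C₀, hC, hCC, hchar⟩ := exists_characteristic hL hΓ h
  set C : H2 := (0, C₀) with hCdef
  have hCC' : form 1 1 C C = 8 := by
    simp only [form_apply, hCdef, ← Quaternion.inner_def, hCC]
    simp
  push Not at hall
  obtain ⟨x₀, hx₀, hodd⟩ := hall
  have hint : ∀ x ∈ Γ, ∀ y ∈ Γ, ∃ n : ℤ, form 1 1 x y = n := fun x hx => (hdual x).1 hx
  obtain ⟨k₀, hk₀⟩ := hint C hC x₀ hx₀
  obtain ⟨l₀, hl₀⟩ := hchar x₀ hx₀
  have hk₀odd : ∃ r, k₀ = 2 * r + 1 := by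
    rcases Int.even_or_odd' k₀ with ⟨r, hr | hr⟩
    · refine absurd ?_ (hodd (l₀ + r))
      rw [hk₀, hr] at hl₀
      push_cast at hl₀ ⊢
      linarith
    · exact ⟨r, hr⟩
  obtain ⟨r₀, hr₀⟩ := hk₀odd
  rw [hr₀] at hk₀
  push_cast at hk₀
  set c : H2 := (1 / 2 : ℝ) • C with hcdef
  have hcC : C = (2 : ℝ) • c := by rw [hcdef, smul_smul]; norm_num
  have hcform : ∀ w, form 1 1 c w = 1 / 2 * form 1 1 C w := fun w => by
    rw [hcdef, map_smul, LinearMap.smul_apply, smul_eq_mul]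
  have hcc : form 1 1 c c = 2 := by
    rw [hcform, form_symm, hcform, hCC']
    norm_num
  set d : H2 := x₀ + c with hddef
  have hd : (2 : ℤ) • d ∈ evenPart Γ C := by
    have h1 : (2 : ℤ) • d = (2 : ℤ) • x₀ + C := by
      rw [hddef, hcC, smul_add, ← Int.cast_smul_eq_zsmul ℝ 2 c]
      norm_num
    rw [h1]
    refine ⟨Γ.add_mem (Γ.smul_mem _ hx₀) hC, 2 * r₀ + 5, ?_⟩
    rw [map_add, map_zsmul, hk₀, hCC']
    push_cast
    simp only [zsmul_eq_mul]
    push_cast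
    ring
  have hparity : ∀ x ∈ Γ, ∀ y ∈ Γ, form 1 1 x x = form 1 1 y y →
      ∃ n : ℤ, form 1 1 C x - form 1 1 C y = 2 * n := fun x hx y hy hxy => by
    obtain ⟨m, hm⟩ := hchar x hx
    obtain ⟨n, hn⟩ := hchar y hy
    refine ⟨n - m, ?_⟩
    push_cast
    linarith
  have hdiff : ∀ x ∈ Γ, x ∈ evenPart Γ C ∨ x - x₀ ∈ evenPart Γ C := fun x hx => by
    obtain ⟨k, hk⟩ := hint C hC x hx
    rcases Int.even_or_odd' k with ⟨r, hr | hr⟩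
    · exact Or.inl ⟨hx, r, by rw [hk, hr]; push_cast; ring⟩
    · refine Or.inr ⟨Γ.sub_mem hx hx₀, r - r₀, ?_⟩
      rw [map_sub, hk, hk₀, hr]
      push_cast
      ring
  have heven : ∀ y ∈ adjoin (evenPart Γ C) d hd, ∃ n : ℤ, form 1 1 y y = 2 * n := by
    rintro y (⟨hy, n, hn⟩ | ⟨hy, n, hn⟩)
    · obtain ⟨m, hm⟩ := hchar y hy
      exact ⟨m + n, by push_cast; linarith⟩
    · have hx : y - d + x₀ ∈ Γ := Γ.add_mem hy hx₀
      have hyx : y = (y - d + x₀) + c := by rw [hddef]; abel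
      generalize y - d + x₀ = x at hx hyx
      obtain ⟨m, hm⟩ := hchar x hx
      obtain ⟨k, hk⟩ := hint C hC x hx
      refine ⟨m + k + 1, ?_⟩
      rw [hyx]
      simp only [map_add, LinearMap.add_apply, hcc, form_symm 1 1 x c, hcform x]
      push_cast
      linarith
  -- On right-moving vectors the Euclidean norm is minus the Narain norm, hence even, so they lie in
  -- Γ₀.
  have hnorm : ∀ x ∈ Γ, x.1 = 0 → ∃ n : ℤ, form 1 1 C x = 2 * n := fun x hx hx0 => by
    obtain ⟨m, hm⟩ := hchar x hx
    obtain ⟨k, hk⟩ := hΓ.even x hx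
    have h1 : form 1 1 x x = -form 1 (-1) x x := by
      simp [form_apply, hx0]
    refine ⟨-k - m, ?_⟩
    push_cast
    linarith
  refine ⟨AddSubgroup.toIntSubmodule (adjoin (evenPart Γ C) d hd), one_pos, one_pos,
    ⟨heven, fun y => ⟨fun hy w hw => exists_int_of_even heven hy hw, fun hy => ?_⟩⟩,
    fun g hg hg1 => ?_, fun b _ _ _ v => ⟨⟨?_, fun hv => Or.inl ⟨hv, 0, ?_⟩⟩, fun _ => one_mul _⟩⟩
  · have hy0 : ∀ w ∈ evenPart Γ C, ∃ n : ℤ, form 1 1 y w = n := fun w hw => hy w (Or.inl hw)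
    obtain ⟨s, hs⟩ := hy d (Or.inr (by rw [sub_self]; exact zero_mem _))
    -- A vector y that pairs integrally with Γ₀ pairs with x₀ in ½ℤ. If ⟨y,x₀⟩ is an integer then y
    -- is in Γ, otherwise y - c is; the pairing with d then puts y in Γ₀ or in d + Γ₀.
    have h2x : (2 : ℤ) • x₀ ∈ evenPart Γ C := by
      refine ⟨Γ.smul_mem _ hx₀, 2 * r₀ + 1, ?_⟩
      rw [map_zsmul, hk₀, zsmul_eq_mul]
      push_cast
      ring
    obtain ⟨k, hk⟩ := hy0 _ h2x
    rw [map_zsmul, zsmul_eq_mul] at hk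
    push_cast at hk
    rw [hddef, map_add, form_symm 1 1 y c, hcform] at hs
    rcases Int.even_or_odd' k with ⟨r, hr | hr⟩
    · have hyΓ : y ∈ Γ := by
        refine (hdual y).2 fun w hw => ?_
        rcases hdiff w hw with h1 | h1
        · exact hy0 w h1
        · obtain ⟨n, hn⟩ := hy0 _ h1
          refine ⟨n + r, ?_⟩
          rw [map_sub] at hn
          rw [hr] at hk
          push_cast at hk ⊢
          linarith
      refine Or.inl ⟨hyΓ, s - r, ?_⟩
      rw [hr] at hk
      push_cast at hk ⊢
      linarith
    · have hyΓ : y - c ∈ Γ := by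
        refine (hdual _).2 fun w hw => ?_
        rw [map_sub, LinearMap.sub_apply, hcform]
        rcases hdiff w hw with h1 | h1
        · obtain ⟨n, hn⟩ := hy0 w h1
          obtain ⟨_, m, hm⟩ := h1
          refine ⟨n - m, ?_⟩
          rw [hn, hm]
          push_cast
          ring
        · obtain ⟨n, hn⟩ := hy0 _ h1
          obtain ⟨_, m, hm⟩ := h1
          rw [map_sub] at hn hm
          refine ⟨n + r - m - r₀, ?_⟩
          rw [hr] at hk
          push_cast at hk ⊢
          linarith
      refine Or.inr ⟨?_, s - r - r₀ - 3, ?_⟩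
      · have : y - d = (y - c) - x₀ := by rw [hddef]; abel
        rw [this]
        exact Γ.sub_mem hyΓ hx₀
      · have h1 : form 1 1 C c = 4 := by
          rw [form_symm, hcform, hCC']
          norm_num
        rw [hddef, map_sub, map_add, h1, hk₀]
        rw [hr] at hk
        push_cast at hk ⊢
        linarith
  · have hmem : ∀ y ∈ evenPart Γ C, g * y ∈ evenPart Γ C := by
      rintro y ⟨hy, n, hn⟩
      obtain ⟨m, hm⟩ := hparity (g * y) (hg y hy) y hy (form_one_one_mul_mul hg1 y y)
      exact ⟨hg y hy, m + n, by push_cast; linarith⟩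
    have hgs := star_mem_stabilizer hΓ hg
    have hstar : star (star g) * star g = 1 := by
      rw [star_star]
      refine Prod.ext ?_ ?_
      · exact mul_eq_one_comm.1 (congrArg Prod.fst hg1)
      · exact mul_eq_one_comm.1 (congrArg Prod.snd hg1)
    -- The pairing of gc - c with w is half the difference of ⟨C, g⁻¹w⟩ and ⟨C, w⟩. Both have the
    -- parity of the norm of w, which g preserves.
    have hgc : g * c - c ∈ Γ := by
      refine (hdual _).2 fun w hw => ?_
      obtain ⟨m, hm⟩ := hparity (star g * w) (hgs w hw) w hw (form_one_one_mul_mul hstar w w)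
      refine ⟨m, ?_⟩
      rw [map_sub, LinearMap.sub_apply, form_mul_left, hcform, hcform]
      linarith
    have hgc' : g * c - c ∈ evenPart Γ C :=
      ⟨hgc, hnorm _ hgc (by simp [hcdef, hCdef])⟩
    have hgx : g * x₀ - x₀ ∈ evenPart Γ C := by
      refine ⟨Γ.sub_mem (hg _ hx₀) hx₀, ?_⟩
      rw [map_sub]
      exact hparity _ (hg _ hx₀) _ hx₀ (form_one_one_mul_mul hg1 _ _)
    rintro y (hy | hy)
    · exact Or.inl (hmem y hy)
    · refine Or.inr ?_
      have : g * y - d = g * (y - d) + (g * x₀ - x₀) + (g * c - c) := by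
        rw [hddef]
        noncomm_ring
      rw [this]
      exact add_mem (add_mem (hmem _ hy) hgx) hgc'
  · rintro (⟨hv, -⟩ | ⟨hv, n, hn⟩)
    · exact hv
    -- A left-moving vector has zero pairing with C, whereas ⟨C,d⟩ = (2r₀ + 1) + 4 is odd.
    · exfalso
      have hx : ((v, 0) : H2) - c ∈ Γ := by
        have : ((v, 0) : H2) - c = ((v, 0) - d) + x₀ := by rw [hddef]; abel
        rw [this]
        exact Γ.add_mem hv hx₀
      obtain ⟨m, hm⟩ := hchar _ hx
      obtain ⟨k, hk⟩ := hΓ.even _ hx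
      have h1 : form 1 1 C ((v, 0) : H2) = 0 := by simp [form_apply, hCdef]
      have h2 : form 1 1 C c = 4 := by
        rw [form_symm, hcform, hCC']
        norm_num
      have h3 : inner ℝ (((v, 0) : H2) - c).2 (((v, 0) : H2) - c).2 = (2 : ℝ) := by
        have : (((v, 0) : H2) - c).2 = -((1 / 2 : ℝ) • C₀) := by simp [hcdef, hCdef]
        rw [this, inner_neg_neg, inner_smul_left, inner_smul_right, hCC]
        norm_num
      rw [form_one_one_eq ((v, 0) - c) ((v, 0) - c), hk, h3, map_sub, h1, h2] at hm
      rw [hddef, map_sub, map_add, h1, h2, hk₀] at hn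
      have h4 : ((-(2 * r₀ + 5) : ℤ) : ℝ) = (2 * n : ℤ) := by push_cast; linarith
      have h5 : -(2 * r₀ + 5) = 2 * n := by exact_mod_cast h4
      lia
  · simp [form_apply, hCdef]

end

end TorusModel
end

noncomputable section
namespace TorusModel
open scoped Quaternion

/-! ### Quaternionic preliminaries -/

lemma inner_mul_left (q a b : ℍ[ℝ]) : inner ℝ (q * a) b = inner ℝ a (star q * b) := by
  simp [Quaternion.inner_def]
  ring

lemma inner_mul_right (q a b : ℍ[ℝ]) : inner ℝ a (q * b) = inner ℝ (star q * a) b := by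
  rw [inner_mul_left, star_star]

lemma inner_mul_mul {q : ℍ[ℝ]} (hq : star q * q = 1) (a b : ℍ[ℝ]) :
    inner ℝ (q * a) (q * b) = inner ℝ a b := by
  rw [inner_mul_left, ← mul_assoc, hq, one_mul]

lemma star_eq_neg {q : ℍ[ℝ]} (h : q.re = 0) : star q = -q := by
  ext <;> simp [h]

/-- A quaternion orthogonal to `1` and to `star w` intertwines `w` with its conjugate. -/
lemma mul_eq_star_mul {q w : ℍ[ℝ]} (h : q.re = 0) (h' : (q * w).re = 0) : q * w = star w * q := by
  have h1 := star_eq_neg h'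
  rw [star_mul, star_eq_neg h, mul_neg, neg_inj] at h1
  exact h1.symm

/-- A quaternion of order three. -/
structure IsCubeRoot (ω : ℍ[ℝ]) : Prop where
  star_mul : star ω * ω = 1
  re : ω.re = -1 / 2

namespace IsCubeRoot

variable {ω : ℍ[ℝ]} (hω : IsCubeRoot ω)
include hω

lemma star_eq : star ω = -1 - ω := by
  ext <;> simp [hω.re]
  norm_num

lemma mul_self : ω * ω = -1 - ω := by
  have h := hω.star_mul
  rw [hω.star_eq, sub_mul, neg_one_mul] at h
  rw [sub_eq_iff_eq_add] at h
  rw [eq_sub_iff_add_eq, ← sub_eq_zero]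
  rw [← sub_eq_zero] at h
  rw [← neg_eq_zero, ← h]
  noncomm_ring

lemma star_one_sub_mul : (1 - star ω) * (1 - ω) = 3 := by
  have h3 : (3 : ℍ[ℝ]) = 1 + 1 + 1 := by norm_num
  rw [sub_mul, mul_sub, mul_sub, hω.star_mul, hω.star_eq, h3]
  simp only [mul_one, one_mul]
  abel

/-- The conjugate of 1 - ω is 1 - ω times the unit -ω̄, and its norm is 3: this is the relation u η
u = m of `exists_root_rightPerp`. -/
lemma one_sub_mul_mul : (1 - ω) * (-star ω * (1 - ω)) = 3 := by
  have h3 : (3 : ℍ[ℝ]) = 1 + 1 + 1 := by norm_num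
  rw [mul_sub (-star ω), neg_mul (star ω) ω, hω.star_mul, hω.star_eq, h3]
  simp only [mul_sub, sub_mul, hω.mul_self, mul_one, one_mul, neg_sub, mul_neg]
  abel

end IsCubeRoot

section

variable {Γ : Submodule ℤ H2}

lemma PreservesPerp.one {k : ℕ} {v : Fin k → ℍ[ℝ]} : PreservesPerp Γ v 1 :=
  ⟨one_mem _, fun x hx i => by simpa using hx i⟩

lemma PreservesPerp.neg {k : ℕ} {v : Fin k → ℍ[ℝ]} {u : H2} (hu : PreservesPerp Γ v u) :
    PreservesPerp Γ v (-u) :=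
  ⟨neg_mem hu.mem, fun x hx i => by
    rw [Prod.snd_neg, neg_mul, inner_neg_right, hu.perp x hx i, neg_zero]⟩

lemma PreservesPerp.sub {k : ℕ} {v : Fin k → ℍ[ℝ]} {u u' : H2} (hu : PreservesPerp Γ v u)
    (hu' : PreservesPerp Γ v u') : PreservesPerp Γ v (u - u') :=
  ⟨sub_mem hu.mem hu'.mem, fun x hx i => by
    rw [Prod.snd_sub, sub_mul, inner_sub_right, hu.perp x hx i, hu'.perp x hx i, sub_zero]⟩

/-! ### Lattices with the symmetry `(1, ω)` -/

variable {ω : ℍ[ℝ]}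

lemma snd_mem_of_cubeRoot (h : ((1, ω) : H2) ∈ stabilizer Γ) {y : H2} (hy : y ∈ Γ) :
    ((0, (1 - ω) * y.2) : H2) ∈ Γ := by
  have := (sub_mem (one_mem (stabilizer Γ)) h) y hy
  convert this using 1
  refine Prod.ext ?_ ?_ <;> simp

lemma three_mul_snd_mem (hΓ : IsEvenSelfDual (form 1 (-1)) Γ) (hω : IsCubeRoot ω)
    (h : ((1, ω) : H2) ∈ stabilizer Γ) {y : H2} (hy : y ∈ Γ) : ((0, (3 : ℝ) • y.2) : H2) ∈ Γ := by
  have h2 : ((1, star ω) : H2) ∈ stabilizer Γ := by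
    have := star_mem_stabilizer hΓ h
    rwa [Prod.star_def, star_one] at this
  have h1 := snd_mem_of_cubeRoot h2 (snd_mem_of_cubeRoot h hy)
  convert h1 using 2
  rw [← mul_assoc, hω.star_one_sub_mul, show (3 : ℍ[ℝ]) = ((3 : ℝ) : ℍ[ℝ]) from rfl,
    Quaternion.coe_mul_eq_smul]

/-- Applied first with v = 0 and then with the root so obtained, it gives two roots whose A₂
lattices, spanned over ℤ[ω], are orthogonal. The determinant bound comes from 1 - ω: for y in Γ, (0,
(1 - ω̄) y_R) is in Γ and can be corrected along v and ωv. -/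
lemma exists_root_orthogonal (hL : IsFullLattice Γ) (hΓ : IsEvenSelfDual (form 1 (-1)) Γ)
    (hω : IsCubeRoot ω) (h : ((1, ω) : H2) ∈ stabilizer Γ) {v : ℍ[ℝ]} (hv : ((0, v) : H2) ∈ Γ)
    (hv2 : v = 0 ∨ inner ℝ v v = (2 : ℝ)) :
    ∃ x : ℍ[ℝ], ((0, x) : H2) ∈ Γ ∧ inner ℝ v x = (0 : ℝ) ∧ inner ℝ (ω * v) x = (0 : ℝ) ∧
      inner ℝ x x = (2 : ℝ) := by
  have hΓ' : IsEvenSelfDual (form (-1) 1) Γ := by simpa using hΓ.neg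
  have h' : ((1, star ω) : H2) ∈ stabilizer Γ := by
    have := star_mem_stabilizer hΓ h
    rwa [Prod.star_def, star_one] at this
  have hωv : ((0, ω * v) : H2) ∈ Γ := by
    have := h _ hv
    rwa [Prod.mk_mul_mk, mul_zero] at this
  have p1 : PreservesPerp Γ ![v, ω * v] (1, ω) := ⟨h, fun x hx i => by
    have h0 : inner ℝ v x = (0 : ℝ) := hx 0
    have h1 : inner ℝ (ω * v) x = (0 : ℝ) := hx 1
    fin_cases i
    · simp [inner_mul_right, hω.star_eq, sub_mul, inner_sub_left, inner_neg_left, h0, h1]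
    · simp [inner_mul_mul hω.star_mul, h0]⟩
  have p2 : PreservesPerp Γ ![v, ω * v] (1, star ω) := ⟨h', fun x hx i => by
    have h0 : inner ℝ v x = (0 : ℝ) := hx 0
    have h1 : inner ℝ (ω * v) x = (0 : ℝ) := hx 1
    fin_cases i
    · simp [inner_mul_right, h1]
    · simp [inner_mul_right, ← mul_assoc, hω.mul_self, sub_mul, inner_sub_left, inner_neg_left,
        h0, h1]⟩
  obtain ⟨x, hx, hx1, hx2⟩ := exists_root_rightPerp hL hΓ' (by norm_num)
    (PreservesPerp.one.sub p1) p2.neg p1.neg (by simp [hω.star_mul]) (m := 3) (by norm_num)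
    (by norm_num) hω.one_sub_mul_mul (fun y hy => by
      obtain ⟨a, ha⟩ := exists_int_inner_right hΓ hv hy
      obtain ⟨b, hb⟩ := exists_int_inner_right hΓ hωv hy
      have hvω : inner ℝ v (ω * v) = -(1 / 2) * (inner ℝ v v : ℝ) := by
        rw [real_inner_comm, Quaternion.inner_def, Quaternion.inner_def, mul_assoc,
          Quaternion.self_mul_star]
        simp [hω.re]
        ring
      have hωω : inner ℝ (ω * v) (ω * v) = (inner ℝ v v : ℝ) := inner_mul_mul hω.star_mul v v
      have h1 : inner ℝ v ((1 - star ω) * y.2) = (a - b : ℝ) := by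
        rw [inner_mul_right, star_sub, star_one, star_star, sub_mul, one_mul, inner_sub_left,
          ha, hb]
      have h2 : inner ℝ (ω * v) ((1 - star ω) * y.2) = (a + 2 * b : ℝ) := by
        rw [inner_mul_right, star_sub, star_one, star_star, sub_mul, one_mul, ← mul_assoc,
          hω.mul_self, inner_sub_left, sub_mul, neg_one_mul, inner_sub_left, inner_neg_left,
          ha, hb]
        ring
      -- The coefficients a and a + b solve the A₂ system that makes the vector orthogonal to v and
      -- ωv, whose pairings with (1 - ω̄) y_R are a - b and a + 2b.
      refine ⟨(1 - star ω) * y.2 - (a : ℝ) • v - ((a + b : ℤ) : ℝ) • (ω * v), ?_, fun i => ?_,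
        fun x hx => ?_⟩
      · have h3 := Γ.sub_mem (Γ.sub_mem (snd_mem_of_cubeRoot h' hy) (Γ.smul_mem a hv))
          (Γ.smul_mem (a + b) hωv)
        convert h3 using 1
        refine Prod.ext ?_ ?_
        · simp
        · rw [Int.cast_smul_eq_zsmul, Int.cast_smul_eq_zsmul]
          rfl
      · have e0 : inner ℝ v v = (0 : ℝ) ∧ a = 0 ∧ b = 0 ∨ inner ℝ v v = (2 : ℝ) := by
          rcases hv2 with rfl | h0
          · left
            simp at ha hb ⊢
            exact ⟨by exact_mod_cast ha.symm, by exact_mod_cast hb.symm⟩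
          · exact Or.inr h0
        fin_cases i
        · simp only [Fin.zero_eta, Matrix.cons_val_zero, inner_sub_right, h1, inner_smul_right,
            hvω]
          push_cast
          rcases e0 with ⟨-, ha0, hb0⟩ | h0
          · simp [ha0, hb0]
          · rw [h0]
            ring
        · simp only [Fin.mk_one, Matrix.cons_val_one, Matrix.cons_val_zero, inner_sub_right, h2,
            inner_smul_right, hωω, real_inner_comm v (ω * v), hvω]
          push_cast
          rcases e0 with ⟨-, ha0, hb0⟩ | h0
          · simp [ha0, hb0]
          · rw [h0]
            ring
      · have h0 : inner ℝ v x = (0 : ℝ) := hx 0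
        have h1 : inner ℝ (ω * v) x = (0 : ℝ) := hx 1
        simp only [inner_sub_left, inner_smul_left, h0, h1, mul_zero, sub_zero, inner_mul_left]
        simp)
  exact ⟨x, hx, hx1 0, hx1 1, hx2⟩

end

end TorusModel
end

/-! ### Gluing along a complex structure on the right-moving side. -/

noncomputable section
namespace TorusModel
open scoped Quaternion

section

variable {Γ : Submodule ℤ H2} {ω : ℍ[ℝ]}

/-- The lattice of pairs `(x₁, (1 + f) x₂ + γ)` with `x` in `Γ` and `γ` right-moving. -/
def glue (Γ : Submodule ℤ H2) (f : ℍ[ℝ] →ₗ[ℝ] ℍ[ℝ]) : AddSubgroup H2 where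
  carrier := {p | ∃ x ∈ Γ, x.1 = p.1 ∧ ((0, p.2 - (x.2 + f x.2)) : H2) ∈ Γ}
  zero_mem' := ⟨0, Γ.zero_mem, rfl, by simp [show ((0, 0) : H2) = 0 from rfl]⟩
  add_mem' := by
    rintro p q ⟨x, hx, hx1, hx2⟩ ⟨y, hy, hy1, hy2⟩
    refine ⟨x + y, Γ.add_mem hx hy, by simp [hx1, hy1], ?_⟩
    convert Γ.add_mem hx2 hy2 using 1
    refine Prod.ext ?_ ?_
    · simp
    · simp only [Prod.snd_add, map_add]
      abel
  neg_mem' := by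
    rintro p ⟨x, hx, hx1, hx2⟩
    refine ⟨-x, Γ.neg_mem hx, by simp [hx1], ?_⟩
    convert Γ.neg_mem hx2 using 1
    refine Prod.ext ?_ ?_
    · simp
    · simp only [Prod.snd_neg, map_neg]
      abel

lemma inner_self_snd_even (hΓ : IsEvenSelfDual (form 1 (-1)) Γ) {v : ℍ[ℝ]}
    (hv : ((0, v) : H2) ∈ Γ) : ∃ n : ℤ, inner ℝ v v = (2 * n : ℝ) := by
  obtain ⟨n, hn⟩ := hΓ.even _ hv
  refine ⟨-n, ?_⟩
  rw [form_apply] at hn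
  rw [Quaternion.inner_def]
  push_cast
  simp only [zero_mul, Quaternion.re_zero, mul_zero, zero_add] at hn
  linarith

/-- Three times a right-moving component lies in Γ, so the glue between the left and right
sublattices is 3-torsion. The map 1 + f multiplies norms by 2 ≡ -1 mod 3, so applying it on the
right turns glue for the indefinite form into glue for the definite one. It commutes with left
multiplications, so the symmetries survive, and the left-moving sublattice is untouched. -/
lemma exists_isMate_of_complexStructure (hΓ : IsEvenSelfDual (form 1 (-1)) Γ)
    (hω : IsCubeRoot ω) (h : ((1, ω) : H2) ∈ stabilizer Γ) (f : ℍ[ℝ] →ₗ[ℝ] ℍ[ℝ])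
    (hf : ∀ x y, inner ℝ (f x) (f y) = (inner ℝ x y : ℝ)) (hff : ∀ x, f (f x) = -x)
    (hfΓ : ∀ x, ((0, x) : H2) ∈ Γ → ((0, f x) : H2) ∈ Γ)
    (hcomm : ∀ q x, q * f x = f (q * x)) : ∃ M, IsMate Γ M 1 1 := by
  have hskew : ∀ x y, inner ℝ (f x) y = -(inner ℝ x (f y) : ℝ) := fun x y => by
    rw [← hf (f x) y, hff, inner_neg_left]
  have hself : ∀ x, inner ℝ (f x) x = (0 : ℝ) := fun x => by
    have h1 := hskew x x
    have h2 := real_inner_comm x (f x)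
    linarith
  have heven : ∀ p ∈ glue Γ f, ∃ n : ℤ, form 1 1 p p = 2 * n := by
    rintro p ⟨x, hx, hx1, hx2⟩
    set γ := p.2 - (x.2 + f x.2) with hγ
    have hp : p = (x.1, x.2 + f x.2 + γ) := Prod.ext hx1.symm (by rw [hγ, add_sub_cancel])
    obtain ⟨a, ha⟩ := hΓ.even x hx
    obtain ⟨b, hb⟩ := exists_int_inner_right hΓ hx2 hx
    obtain ⟨c, hc⟩ := exists_int_inner_right hΓ (hfΓ _ hx2) hx
    obtain ⟨d, hd⟩ := inner_self_snd_even hΓ hx2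
    -- The norm of p is ⟨x,x⟩ + 3|x_R|² plus twice an integer plus |γ|², and 3|x_R|² = |(1 - ω)x_R|²
    -- is even because (1 - ω)x_R is itself a right-moving lattice vector.
    obtain ⟨e, he⟩ := inner_self_snd_even hΓ (snd_mem_of_cubeRoot h hx)
    refine ⟨a + e + b - c + d, ?_⟩
    rw [inner_mul_left, ← mul_assoc, star_sub, star_one, hω.star_one_sub_mul,
      show (3 : ℍ[ℝ]) = ((3 : ℝ) : ℍ[ℝ]) from rfl, Quaternion.coe_mul_eq_smul, inner_smul_right]
      at he
    rw [form_one_one_eq, hp]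
    have h1 : form 1 (-1) ((x.1, x.2 + f x.2 + γ) : H2) (x.1, x.2 + f x.2 + γ) =
        form 1 (-1) x x + inner ℝ x.2 x.2 -
          inner ℝ (x.2 + f x.2 + γ) (x.2 + f x.2 + γ) := by
      simp only [form_apply, Quaternion.inner_def]
      ring
    rw [h1, ha]
    have hb' := real_inner_comm γ x.2
    have hc' := real_inner_comm (f γ) x.2
    have hs' := real_inner_comm (f x.2) x.2
    rw [hb] at hb'
    rw [hc] at hc'
    rw [hself] at hs'
    have hc'' : inner ℝ γ (f x.2) = (-c : ℝ) := by rw [real_inner_comm, hskew, hc']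
    simp only [inner_add_left, inner_add_right, hf, hd, hb, hb', hs', hself, hc'', hskew x.2 γ, hc']
    push_cast
    linarith
  have hdual3 : ∀ y : ℍ[ℝ], (∀ x, ((0, x) : H2) ∈ Γ → ∃ n : ℤ, inner ℝ y x = (n : ℝ)) →
      ((0, (3 : ℝ) • y) : H2) ∈ Γ := by
    intro y hy
    refine (hΓ.selfDual _).2 fun w hw => ?_
    obtain ⟨n, hn⟩ := hy _ (three_mul_snd_mem hΓ hω h hw)
    refine ⟨-n, ?_⟩
    rw [inner_smul_right] at hn
    have : form 1 (-1) ((0, (3 : ℝ) • y) : H2) w = -(3 * inner ℝ y w.2) := by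
      rw [form_apply]
      simp only [← Quaternion.inner_def, inner_smul_left, inner_zero_left]
      simp
    rw [this, hn]
    push_cast
    ring
  refine ⟨AddSubgroup.toIntSubmodule (glue Γ f), one_pos, one_pos,
    ⟨heven, fun y => ⟨fun hy w hw => exists_int_of_even heven hy hw, fun hy => ?_⟩⟩,
    fun g hg _ => ?_, fun b _ _ _ v => ⟨⟨?_, fun hv => ⟨_, hv, rfl, by simp [show ((0, 0) : H2) =
        0 from rfl]⟩⟩, fun _ => one_mul _⟩⟩
  · have h3 : ((0, (3 : ℝ) • y.2) : H2) ∈ Γ := hdual3 _ fun x hx => by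
      obtain ⟨n, hn⟩ := hy (0, x) ⟨0, Γ.zero_mem, rfl, by simpa using hx⟩
      refine ⟨n, ?_⟩
      rw [← hn, form_apply, Quaternion.inner_def]
      simp
    -- Since (1+f)(f-1) = -2, the element x with right component (f-1)y_R leaves the remainder y_R -
    -- (1+f)(f-1)y_R = 3y_R, which is a right-moving lattice vector.
    have hx : ((y.1, f y.2 - y.2) : H2) ∈ Γ := by
      refine (hΓ.selfDual _).2 fun w hw => ?_
      obtain ⟨n, hn⟩ := hy (w.1, w.2 + f w.2) ⟨w, hw, rfl, by simp [show ((0, 0) : H2) = 0 from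
          rfl]⟩
      refine ⟨n, ?_⟩
      rw [← hn, form_apply, form_apply]
      simp only [← Quaternion.inner_def, inner_add_right, inner_sub_left, hskew]
      ring
    refine ⟨_, hx, rfl, ?_⟩
    have : y.2 - (f y.2 - y.2 + f (f y.2 - y.2)) = (3 : ℝ) • y.2 := by
      rw [map_sub, hff]
      module
    rwa [this]
  · rintro p ⟨x, hx, hx1, hx2⟩
    refine ⟨g * x, hg x hx, by simp [hx1], ?_⟩
    convert hg _ hx2 using 1
    refine Prod.ext ?_ ?_
    · simp
    · simp only [Prod.snd_mul, mul_sub, mul_add, hcomm]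
  · rintro ⟨x, hx, hx1, hx2⟩
    simp only [zero_sub] at hx1 hx2
    -- Both 2x_R = (1-f)(1+f)x_R and 3x_R are right-moving lattice vectors, hence so is x_R.
    have h1 : ((0, x.2 + f x.2) : H2) ∈ Γ := by simpa using Γ.neg_mem hx2
    have h2 := Γ.sub_mem h1 (hfΓ _ h1)
    have h3 := Γ.sub_mem (three_mul_snd_mem hΓ hω h hx) h2
    convert Γ.sub_mem hx h3 using 1
    refine Prod.ext ?_ ?_
    · simp [hx1]
    · simp only [Prod.snd_sub, map_add, hff]
      module

/-- -1 is not a square modulo 3. -/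
lemma three_dvd_of_sq_add_sq {s t n : ℤ} (h : s ^ 2 + t ^ 2 = 3 * n) : 3 ∣ s ∧ 3 ∣ t := by
  have h1 := congrArg (· % 3) h
  have hs : s % 3 = 0 ∨ s % 3 = 1 ∨ s % 3 = 2 := by lia
  have ht : t % 3 = 0 ∨ t % 3 = 1 ∨ t % 3 = 2 := by lia
  rcases hs with hs | hs | hs <;> rcases ht with ht | ht | ht <;>
    (simp [pow_two, Int.add_emod, Int.mul_emod, hs, ht] at h1; try (constructor <;> lia))

/-- The root lattice of type `A₂ + A₂` has no even overlattice in which its roots are orthogonal. -/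
lemma eq_combination_of_roots (hΓ : IsEvenSelfDual (form 1 (-1)) Γ) (hω : IsCubeRoot ω)
    (h : ((1, ω) : H2) ∈ stabilizer Γ) {v w : ℍ[ℝ]} (hv : ((0, v) : H2) ∈ Γ)
    (hw : ((0, w) : H2) ∈ Γ) (hvv : inner ℝ v v = (2 : ℝ)) (hww : inner ℝ w w = (2 : ℝ))
    (hvw : inner ℝ v w = (0 : ℝ)) (hvw' : inner ℝ (ω * v) w = (0 : ℝ)) {x : ℍ[ℝ]}
    (hx : ((0, x) : H2) ∈ Γ) :
    ∃ p q r s : ℤ, x = (p : ℝ) • v + (q : ℝ) • (ω * v) + (r : ℝ) • w + (s : ℝ) • (ω * w) := by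
  have hmem : ∀ u, ((0, u) : H2) ∈ Γ → ((0, ω * u) : H2) ∈ Γ := fun u hu => by
    have := h _ hu
    rwa [Prod.mk_mul_mk, mul_zero] at this
  have hself : ∀ u : ℍ[ℝ], inner ℝ u (ω * u) = -(1 / 2) * (inner ℝ u u : ℝ) := fun u => by
    rw [real_inner_comm, Quaternion.inner_def, Quaternion.inner_def, mul_assoc,
      Quaternion.self_mul_star]
    simp [hω.re]
    ring
  have e1 : inner ℝ v (ω * v) = (-1 : ℝ) := by rw [hself, hvv]; norm_num
  have e2 : inner ℝ (ω * v) v = (-1 : ℝ) := by rw [real_inner_comm, e1]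
  have e3 : inner ℝ (ω * v) (ω * v) = (2 : ℝ) := by rw [inner_mul_mul hω.star_mul, hvv]
  have e4 : inner ℝ w (ω * w) = (-1 : ℝ) := by rw [hself, hww]; norm_num
  have e5 : inner ℝ (ω * w) w = (-1 : ℝ) := by rw [real_inner_comm, e4]
  have e6 : inner ℝ (ω * w) (ω * w) = (2 : ℝ) := by rw [inner_mul_mul hω.star_mul, hww]
  have e7 : inner ℝ w v = (0 : ℝ) := by rw [real_inner_comm, hvw]
  have e8 : inner ℝ w (ω * v) = (0 : ℝ) := by rw [real_inner_comm, hvw']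
  have e9 : inner ℝ v (ω * w) = (0 : ℝ) := by
    rw [inner_mul_right, hω.star_eq, sub_mul, neg_one_mul, inner_sub_left, inner_neg_left, hvw,
      hvw']
    norm_num
  have e10 : inner ℝ (ω * w) v = (0 : ℝ) := by rw [real_inner_comm, e9]
  have e11 : inner ℝ (ω * v) (ω * w) = (0 : ℝ) := by rw [inner_mul_mul hω.star_mul, hvw]
  have e12 : inner ℝ (ω * w) (ω * v) = (0 : ℝ) := by rw [real_inner_comm, e11]
  obtain ⟨a, ha⟩ := exists_int_inner_right hΓ hv hx
  obtain ⟨b, hb⟩ := exists_int_inner_right hΓ (hmem v hv) hx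
  obtain ⟨c, hc⟩ := exists_int_inner_right hΓ hw hx
  obtain ⟨d, hd⟩ := exists_int_inner_right hΓ (hmem w hw) hx
  simp only at ha hb hc hd
  have hli : LinearIndependent ℝ ![v, ω * v, w, ω * w] := by
    rw [Fintype.linearIndependent_iff]
    intro t ht
    rw [Fin.sum_univ_four] at ht
    simp only [Matrix.cons_val] at ht
    have t1 := congrArg (fun z => (inner ℝ v z : ℝ)) ht
    have t2 := congrArg (fun z => (inner ℝ (ω * v) z : ℝ)) ht
    have t3 := congrArg (fun z => (inner ℝ w z : ℝ)) ht
    have t4 := congrArg (fun z => (inner ℝ (ω * w) z : ℝ)) ht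
    simp only [inner_add_right, inner_smul_right, inner_zero_right, hvv, hww, hvw, hvw', e1,
      e2, e3, e4, e5, e6, e7, e8, e9, e10, e11, e12] at t1 t2 t3 t4
    intro i
    fin_cases i
    · show t 0 = 0
      linarith
    · show t 1 = 0
      linarith
    · show t 2 = 0
      linarith
    · show t 3 = 0
      linarith
  have hspan := hli.span_eq_top_of_card_eq_finrank (by
    rw [Quaternion.finrank_eq_four, Fintype.card_fin])
  -- Inverting the A₂ Gram matrix gives the coordinates (2a+b)/3 and (a+2b)/3 along v and ωv, and
  -- likewise for w.
  set z := (3 : ℝ) • x - ((2 * a + b : ℝ) • v + (a + 2 * b : ℝ) • (ω * v) + (2 * c + d : ℝ) • w +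
    (c + 2 * d : ℝ) • (ω * w)) with hz
  have hz0 : z = 0 := by
    have h1 : ∀ u ∈ Submodule.span ℝ (Set.range ![v, ω * v, w, ω * w]), inner ℝ u z = (0 : ℝ) := by
      intro u hu
      induction hu using Submodule.span_induction with
      | mem u hu =>
        obtain ⟨i, rfl⟩ := hu
        fin_cases i
        · show inner ℝ v z = (0 : ℝ)
          simp only [inner_sub_right, inner_add_right, inner_smul_right, *]
          ring
        · show inner ℝ (ω * v) z = (0 : ℝ)
          simp only [inner_sub_right, inner_add_right, inner_smul_right, *]
          ring
        · show inner ℝ w z = (0 : ℝ)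
          simp only [inner_sub_right, inner_add_right, inner_smul_right, *]
          ring
        · show inner ℝ (ω * w) z = (0 : ℝ)
          simp only [inner_sub_right, inner_add_right, inner_smul_right, *]
          ring
      | zero => simp
      | add y z _ _ hy hz => rw [inner_add_left, hy, hz, add_zero]
      | smul c y _ hy => rw [inner_smul_left, hy, mul_zero]
    rw [← inner_self_eq_zero (𝕜 := ℝ)]
    exact h1 _ (hspan ▸ trivial)
  obtain ⟨m, hm⟩ := inner_self_snd_even hΓ hx
  have h3x : (3 : ℝ) • x = (2 * a + b : ℝ) • v + (a + 2 * b : ℝ) • (ω * v) +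
      (2 * c + d : ℝ) • w + (c + 2 * d : ℝ) • (ω * w) := sub_eq_zero.1 hz0
  -- Half of three times the norm of x is a² + ab + b² + c² + cd + d², and a² + ab + b² = (a-b)² +
  -- 3ab. Evenness of x thus makes (a-b)² + (c-d)² divisible by 3.
  have hnorm : (a - b) ^ 2 + (c - d) ^ 2 = 3 * (m - a * b - c * d) := by
    have := congrArg (fun u => (inner ℝ u x : ℝ)) h3x
    simp only [inner_add_left, inner_smul_left, ha, hb, hc, hd, hm] at this
    simp only [conj_trivial] at this
    have h2 : (3 * m : ℝ) = (a ^ 2 + a * b + b ^ 2 + c ^ 2 + c * d + d ^ 2 : ℤ) := by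
      push_cast
      linarith
    have h3 : 3 * m = a ^ 2 + a * b + b ^ 2 + c ^ 2 + c * d + d ^ 2 := by exact_mod_cast h2
    linear_combination -h3
  obtain ⟨⟨k, hk⟩, ⟨l, hl⟩⟩ := three_dvd_of_sq_add_sq hnorm
  refine ⟨b + 2 * k, b + k, d + 2 * l, d + l, ?_⟩
  have ha' : (a : ℝ) = b + 3 * k := by exact_mod_cast (by lia : a = b + 3 * k)
  have hc' : (c : ℝ) = d + 3 * l := by exact_mod_cast (by lia : c = d + 3 * l)
  have h4 : x = (1 / 3 : ℝ) • (3 : ℝ) • x := by rw [smul_smul]; norm_num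
  rw [h4, h3x, ha', hc']
  push_cast
  module

/-- A complex structure is given by right multiplication with the quotient of two orthogonal roots
that span the right-moving sublattice over the Eisenstein integers. -/
lemma exists_isMate_of_cubeRoot (hL : IsFullLattice Γ)
    (hΓ : IsEvenSelfDual (form 1 (-1)) Γ) (hω : IsCubeRoot ω) (h : ((1, ω) : H2) ∈ stabilizer Γ) :
    ∃ M, IsMate Γ M 1 1 := by
  obtain ⟨v, hv, -, -, hvv⟩ := exists_root_orthogonal hL hΓ hω h (v := 0) Γ.zero_mem (Or.inl rfl)
  obtain ⟨w, hw, hvw, hvw', hww⟩ := exists_root_orthogonal hL hΓ hω h hv (Or.inr hvv)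
  have hnv : v * star v = (2 : ℝ) • 1 := by
    rw [Quaternion.self_mul_star, ← Quaternion.inner_self, hvv, ← Quaternion.coe_mul_eq_smul,
      mul_one]
  have hnw : w * star w = (2 : ℝ) • 1 := by
    rw [Quaternion.self_mul_star, ← Quaternion.inner_self, hww, ← Quaternion.coe_mul_eq_smul,
      mul_one]
  have hnv' : star v * v = (2 : ℝ) • 1 := by
    rw [Quaternion.star_mul_self, ← Quaternion.inner_self, hvv, ← Quaternion.coe_mul_eq_smul,
      mul_one]
  -- As v has norm 2, r = v⁻¹w. It is a unit because v and w have equal norm, and imaginary because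
  -- they are orthogonal; so r² = -1, vr = w and wr = -v.
  set r : ℍ[ℝ] := (1 / 2 : ℝ) • (star v * w) with hr
  have hvr : v * r = w := by
    rw [hr, mul_smul_comm, ← mul_assoc, hnv, smul_mul_assoc, one_mul, smul_smul]
    norm_num
  have hrr : r * star r = 1 := by
    rw [hr, Quaternion.star_smul, star_mul, star_star, smul_mul_smul_comm, mul_assoc, ← mul_assoc
        w, hnw,
      smul_mul_assoc, one_mul, mul_smul_comm, hnv', smul_smul, smul_smul]
    norm_num
  have hre : r.re = 0 := by
    have h1 : (star v * w).re = inner ℝ v w := by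
      rw [Quaternion.inner_def]
      simp
    rw [hr, Quaternion.re_smul, h1, hvw, smul_zero]
  have hr2 : r * r = -1 := by
    rw [star_eq_neg hre, mul_neg, neg_eq_iff_eq_neg] at hrr
    exact hrr
  have hwr : w * r = -v := by
    rw [← hvr, mul_assoc, hr2, mul_neg_one]
  have hmem : ∀ u, ((0, u) : H2) ∈ Γ → ((0, ω * u) : H2) ∈ Γ := fun u hu => by
    have := h _ hu
    rwa [Prod.mk_mul_mk, mul_zero] at this
  refine exists_isMate_of_complexStructure hΓ hω h (LinearMap.mulRight ℝ r)
    (fun x y => ?_) (fun x => ?_) (fun x hx => ?_) (fun q x => ?_)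
  · rw [LinearMap.mulRight_apply, LinearMap.mulRight_apply, Quaternion.inner_def,
      Quaternion.inner_def, star_mul, mul_assoc, ← mul_assoc r, hrr, one_mul]
  · rw [LinearMap.mulRight_apply, LinearMap.mulRight_apply, mul_assoc, hr2, mul_neg_one]
  · obtain ⟨p, q, s, t, hpq⟩ := eq_combination_of_roots hΓ hω h hv hw hvv hww hvw hvw' hx
    have h1 := Γ.sub_mem (Γ.add_mem (Γ.smul_mem p hw) (Γ.smul_mem q (hmem w hw)))
      (Γ.add_mem (Γ.smul_mem s hv) (Γ.smul_mem t (hmem v hv)))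
    convert h1 using 1
    refine Prod.ext ?_ ?_
    · simp
    · rw [LinearMap.mulRight_apply, hpq]
      simp only [add_mul, smul_mul_assoc, mul_assoc, hvr, hwr, Int.cast_smul_eq_zsmul,
        Prod.snd_sub, Prod.snd_add, mul_neg, smul_neg]
      simp only [Prod.smul_snd]
      abel
  · rw [LinearMap.mulRight_apply, LinearMap.mulRight_apply, mul_assoc]

end

end TorusModel
end

noncomputable section
namespace TorusModel
open scoped Quaternion

/-! ### Lattices given by explicit integral matrices -/

/-- The coordinates of a vector are its pairings with the basis multiplied by A⁻¹ = A'. As A' is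
integral, integral pairings mean integral coordinates. -/
lemma isEvenSelfDual_span {V : Type*} [AddCommGroup V] [Module ℝ V] {B : V →ₗ[ℝ] V →ₗ[ℝ] ℝ}
    (hsymm : ∀ v w, B v w = B w v) {ι : Type*} [Fintype ι] [DecidableEq ι] [Nonempty ι]
    (hV : Fintype.card ι = Module.finrank ℝ V) (c : ι → V) (A A' : Matrix ι ι ℤ)
    (hc : ∀ i j, B (c i) (c j) = A i j) (hA : A * A' = 1) (heven : ∀ i, Even (A i i)) :
    IsEvenSelfDual B (Submodule.span ℤ (Set.range c)) := by
  have hAA : (A.map (Int.cast : ℤ → ℝ)) * (A'.map (Int.cast : ℤ → ℝ)) = 1 := by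
    have := congrArg (fun M => M.map (Int.castRingHom ℝ)) hA
    rw [Matrix.map_mul] at this
    simpa using this
  have hvec (x : ι → ℝ) (j : ι) :
      B (∑ i, x i • c i) (c j) = (Matrix.vecMul x (A.map (Int.cast : ℤ → ℝ))) j := by
    simp [Matrix.vecMul, dotProduct, hc]
  have hsolve (x : ι → ℝ) : x = Matrix.vecMul
      (fun j => B (∑ i, x i • c i) (c j)) (A'.map (Int.cast : ℤ → ℝ)) := by
    have : (fun j => B (∑ i, x i • c i) (c j)) = Matrix.vecMul x (A.map (Int.cast : ℤ → ℝ)) :=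
      funext (hvec x)
    rw [this, Matrix.vecMul_vecMul, hAA, Matrix.vecMul_one]
  have hli : LinearIndependent ℝ c := by
    rw [Fintype.linearIndependent_iff]
    intro x hx i
    rw [hsolve x, hx]
    simp [Matrix.vecMul, dotProduct]
  have hspan := hli.span_eq_top_of_card_eq_finrank hV
  have hmem (v : V) : v ∈ Submodule.span ℤ (Set.range c) ↔ ∃ n : ι → ℤ, ∑ i, n i • c i = v :=
    Submodule.mem_span_range_iff_exists_fun ℤ
  refine ⟨fun v hv => ?_, fun v => ⟨fun hv w hw => ?_, fun h => ?_⟩⟩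
  · refine Submodule.span_induction (p := fun v _ => ∃ n : ℤ, B v v = 2 * n) ?_ ⟨0, by simp⟩ ?_
      ?_ hv

    · rintro _ ⟨i, rfl⟩
      obtain ⟨n, hn⟩ := heven i
      exact ⟨n, by rw [hc, hn]; push_cast; ring⟩
    · rintro x y hx hy ⟨m, hm⟩ ⟨n, hn⟩
      obtain ⟨a, rfl⟩ := (hmem x).1 hx
      obtain ⟨b, rfl⟩ := (hmem y).1 hy
      refine ⟨m + n + ∑ i, ∑ j, a i * b j * A i j, ?_⟩
      have h1 : B (∑ i, a i • c i) (∑ i, b i • c i)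
          = ((∑ i, ∑ j, a i * b j * A i j : ℤ) : ℝ) := by
        simp only [← Int.cast_smul_eq_zsmul ℝ]
        simp [hc, Finset.mul_sum, mul_assoc, LinearMap.sum_apply]
        try rw [Finset.sum_comm]
        try refine Finset.sum_congr rfl fun i _ => Finset.sum_congr rfl fun j _ => by ring
      rw [map_add, map_add, LinearMap.add_apply, LinearMap.add_apply, hm, hn,
        hsymm (∑ i, b i • c i), h1]
      push_cast
      ring
    · rintro k x hx ⟨m, hm⟩
      refine ⟨k * k * m, ?_⟩
      rw [← Int.cast_smul_eq_zsmul ℝ, map_smul, map_smul, LinearMap.smul_apply, hm]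
      simp
      ring
  · obtain ⟨a, rfl⟩ := (hmem v).1 hv
    obtain ⟨b, rfl⟩ := (hmem w).1 hw
    refine ⟨∑ i, ∑ j, a i * b j * A i j, ?_⟩
    simp only [← Int.cast_smul_eq_zsmul ℝ]
    simp [hc, Finset.mul_sum, mul_assoc, LinearMap.sum_apply]
    try rw [Finset.sum_comm]
    try refine Finset.sum_congr rfl fun i _ => Finset.sum_congr rfl fun j _ => by ring
  · have hv : v ∈ Submodule.span ℝ (Set.range c) := hspan ▸ Submodule.mem_top
    obtain ⟨x, rfl⟩ := (Submodule.mem_span_range_iff_exists_fun ℝ).1 hv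
    choose n hn using fun j => h (c j) (Submodule.subset_span ⟨j, rfl⟩)
    rw [hmem]
    refine ⟨Matrix.vecMul n A', Finset.sum_congr rfl fun i _ => ?_⟩
    rw [← Int.cast_smul_eq_zsmul ℝ]
    congr 1
    rw [hsolve x]
    simp only [Matrix.vecMul, dotProduct, hn, Int.cast_sum, Int.cast_mul, Matrix.map_apply]

/-- The lattice spanned by the rows of `m⁻¹ P` in the frame `Φ`. -/
def frameLattice (m : ℤ) (P : Matrix (Fin 8) (Fin 8) ℤ) (Φ : Fin 8 → H2) : Submodule ℤ H2 :=
  Submodule.span ℤ (Set.range fun i => (m : ℝ)⁻¹ • ∑ k, (P i k : ℝ) • Φ k)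

lemma finrank_H2 : Module.finrank ℝ H2 = 8 := by
  rw [Module.finrank_prod, Quaternion.finrank_eq_four]

lemma isEvenSelfDual_frameLattice {α β : ℝ} {m s : ℤ} (hm : m ≠ 0) (hs : s ≠ 0)
    {P G A A' : Matrix (Fin 8) (Fin 8) ℤ} {Φ : Fin 8 → H2}
    (hΦ : ∀ i j, s * form α β (Φ i) (Φ j) = G i j)
    (hP : P * G * P.transpose = (s * m ^ 2) • A) (hA : A * A' = 1) (heven : ∀ i, Even (A i i)) :
    IsEvenSelfDual (form α β) (frameLattice m P Φ) := by
  refine isEvenSelfDual_span (form_symm α β) (by rw [finrank_H2]; rfl) _ A A' (fun i j => ?_) hA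
    heven
  have hm' : (m : ℝ) ≠ 0 := by exact_mod_cast hm
  have hs' : (s : ℝ) ≠ 0 := by exact_mod_cast hs
  have h1 : ((P * G * P.transpose) i j : ℝ) = s * m ^ 2 * A i j := by
    rw [hP]
    simp
  have h2 : (s : ℝ) * form α β (∑ k, (P i k : ℝ) • Φ k) (∑ k, (P j k : ℝ) • Φ k)
      = ((P * G * P.transpose) i j : ℝ) := by
    simp only [Matrix.mul_apply, Matrix.transpose_apply, Int.cast_sum, Int.cast_mul, ← hΦ]
    simp only [map_sum, map_smul, LinearMap.sum_apply, LinearMap.smul_apply, smul_eq_mul,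
      Finset.mul_sum, Finset.sum_mul]
    refine Finset.sum_congr rfl fun k _ => Finset.sum_congr rfl fun l _ => ?_
    ring
  rw [h1] at h2
  simp only [map_smul, LinearMap.smul_apply, smul_eq_mul]
  have h3 := mul_left_cancel₀ hs' (h2.trans (mul_assoc _ _ _))
  rw [h3]
  field_simp

/-- u acts on the frame by N/t, and P N = t Z P says that it acts on the lattice basis by the
integral matrix Z. -/
lemma mem_stabilizer_frameLattice {m t : ℤ} (ht : t ≠ 0)
    {P N Z : Matrix (Fin 8) (Fin 8) ℤ} {Φ : Fin 8 → H2} {u : H2}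
    (hu : ∀ k, (t : ℝ) • (u * Φ k) = ∑ l, (N k l : ℝ) • Φ l) (hN : P * N = t • (Z * P)) :
    u ∈ stabilizer (frameLattice m P Φ) := by
  intro v hv
  have ht' : (t : ℝ) ≠ 0 := by exact_mod_cast ht
  induction hv using Submodule.span_induction with
  | zero => rw [mul_zero]; exact Submodule.zero_mem _
  | add x y _ _ hx hy => rw [mul_add]; exact Submodule.add_mem _ hx hy
  | smul k x _ hx => rw [mul_smul_comm]; exact Submodule.smul_mem _ _ hx
  | mem x hx =>
    obtain ⟨i, rfl⟩ := hx
    have h1 : (t : ℝ) • (u * ∑ k, (P i k : ℝ) • Φ k)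
        = (t : ℝ) • ∑ j, (Z i j : ℝ) • ∑ k, (P j k : ℝ) • Φ k := by
      have h2 : (t : ℝ) • (u * ∑ k, (P i k : ℝ) • Φ k) = ∑ l, ((P * N) i l : ℝ) • Φ l := by
        simp only [Finset.mul_sum, mul_smul_comm, Finset.smul_sum, smul_comm (t : ℝ), hu,
          Matrix.mul_apply, Int.cast_sum, Int.cast_mul, Finset.sum_smul, mul_smul]
        rw [Finset.sum_comm]
      rw [h2, hN]
      simp only [Matrix.smul_apply, Matrix.mul_apply, smul_eq_mul, Int.cast_mul, Int.cast_sum,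
        mul_smul, Finset.smul_sum, Finset.sum_smul, Finset.mul_sum]
      rw [Finset.sum_comm]
    have h3 := smul_right_injective H2 ht' h1
    have h4 : u * ((m : ℝ)⁻¹ • ∑ k, (P i k : ℝ) • Φ k)
        = ∑ j, Z i j • ((m : ℝ)⁻¹ • ∑ k, (P j k : ℝ) • Φ k) := by
      rw [mul_smul_comm]
      refine (congrArg ((m : ℝ)⁻¹ • ·) h3).trans ?_
      simp only [Finset.smul_sum, ← Int.cast_smul_eq_zsmul ℝ, smul_comm (m : ℝ)⁻¹]
    simp only [h4]
    exact Submodule.sum_mem _ fun j _ =>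
      Submodule.smul_mem _ _ (Submodule.subset_span ⟨j, rfl⟩)

/-- Twice the Gram matrix of the frame ζᵏ, ζᵏf with k < 4. In what follows, `twelfthForm` is the
Gram matrix of the lattice basis `twelfthBasis`; `twelfthMulZeta` and `twelfthMulF` are left
multiplications in the frame, `twelfthZeta` and `twelfthF` the same maps in the lattice basis. The
Hurwitz matrices have the same roles. -/
def twelfthGram : Matrix (Fin 8) (Fin 8) ℤ :=
  !![2, -1, 1, 0, 0, 0, 0, 0;
     -1, 2, -1, 1, 0, 0, 0, 0;
     1, -1, 2, -1, 0, 0, 0, 0;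
     0, 1, -1, 2, 0, 0, 0, 0;
     0, 0, 0, 0, 2, -1, 1, 0;
     0, 0, 0, 0, -1, 2, -1, 1;
     0, 0, 0, 0, 1, -1, 2, -1;
     0, 0, 0, 0, 0, 1, -1, 2]
def twelfthBasis : Matrix (Fin 8) (Fin 8) ℤ :=
  !![1, 0, 0, 0, 1, 0, 0, 0;
     0, 1, 0, 0, 0, 1, 0, 0;
     0, 0, 1, 0, 0, 0, 1, 0;
     0, 0, 0, 1, 0, 0, 0, 1;
     0, 0, 0, 0, 1, 0, 0, 1;
     0, 0, 0, 0, -1, 1, 1, 0;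
     0, 0, 0, 0, 0, -1, 1, 1;
     0, 0, 0, 0, -1, 0, 0, 1]
def twelfthForm : Matrix (Fin 8) (Fin 8) ℤ :=
  !![2, -1, 1, 0, 1, -1, 1, -1;
     -1, 2, -1, 1, 0, 1, -1, 1;
     1, -1, 2, -1, 0, 0, 1, -1;
     0, 1, -1, 2, 1, 0, 0, 1;
     1, 0, 0, 1, 2, -1, 1, 0;
     -1, 1, 0, 0, -1, 2, -1, 1;
     1, -1, 1, 0, 1, -1, 2, -1;
     -1, 1, -1, 1, 0, 1, -1, 2]
def twelfthFormInv : Matrix (Fin 8) (Fin 8) ℤ :=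
  !![2, 1, -1, -1, -1, 0, 1, 1;
     1, 2, 0, -1, -1, -1, 1, 1;
     -1, 0, 2, 1, 0, -1, -1, 0;
     -1, -1, 1, 2, 0, 0, -1, -1;
     -1, -1, 0, 0, 2, 1, -1, -1;
     0, -1, -1, 0, 1, 2, 0, -1;
     1, 1, -1, -1, -1, 0, 2, 1;
     1, 1, 0, -1, -1, -1, 1, 2]
def twelfthMulZeta : Matrix (Fin 8) (Fin 8) ℤ :=
  !![0, 1, 0, 0, 0, 0, 0, 0;
     0, 0, 1, 0, 0, 0, 0, 0;
     0, 0, 0, 1, 0, 0, 0, 0;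
     -1, 0, 1, 0, 0, 0, 0, 0;
     0, 0, 0, 0, 0, 1, 0, 0;
     0, 0, 0, 0, 0, 0, 1, 0;
     0, 0, 0, 0, 0, 0, 0, 1;
     0, 0, 0, 0, -1, 0, 1, 0]
def twelfthMulF : Matrix (Fin 8) (Fin 8) ℤ :=
  !![0, 0, 0, 0, 1, 0, 0, 0;
     0, 0, 0, 0, 0, 1, 0, -1;
     0, 0, 0, 0, 1, 0, -1, 0;
     0, 0, 0, 0, 0, 0, 0, -1;
     -1, 0, 0, 0, 0, 0, 0, 0;
     0, -1, 0, 1, 0, 0, 0, 0;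
     -1, 0, 1, 0, 0, 0, 0, 0;
     0, 0, 0, 1, 0, 0, 0, 0]
def twelfthZeta : Matrix (Fin 8) (Fin 8) ℤ :=
  !![0, 1, 0, 0, 0, 0, 0, 0;
     0, 0, 1, 0, 0, 0, 0, 0;
     0, 0, 0, 1, 0, 0, 0, 0;
     -1, 0, 1, 0, 0, 0, 0, 0;
     0, 0, 0, 0, 0, 1, 0, 0;
     0, 0, 0, 0, 0, 0, 1, 0;
     0, 0, 0, 0, 0, 0, 0, 1;
     0, 0, 0, 0, -1, 0, 1, 0]
def twelfthF : Matrix (Fin 8) (Fin 8) ℤ :=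
  !![-1, 0, 0, 0, 1, 0, 0, -1;
     0, -1, 0, 1, 0, 1, -1, -1;
     -1, 0, 1, 0, 1, -1, -1, 0;
     0, 0, 0, 1, -1, 0, 0, -1;
     -1, 0, 0, 1, 0, 0, 0, -1;
     0, -1, 1, 1, 0, 0, -1, 0;
     -1, 1, 1, 0, 0, -1, 0, 0;
     1, 0, 0, 1, -1, 0, 0, 0]
-- Halved, the rows span the standard E₈ lattice: coordinates all integral or all half-integral,
-- with even sum.
def hurwitzBasis : Matrix (Fin 8) (Fin 8) ℤ :=
  !![1, 1, 1, 1, 1, 1, 1, 1;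
     0, 2, 0, 0, 0, 2, 0, 0;
     0, 0, 2, 0, 0, 0, 2, 0;
     0, 0, 0, 2, 0, 0, 0, 2;
     0, 0, 0, 0, 2, 2, 0, 0;
     0, 0, 0, 0, 2, -2, 0, 0;
     0, 0, 0, 0, 0, 2, -2, 0;
     0, 0, 0, 0, 0, 0, 2, -2]
def hurwitzForm : Matrix (Fin 8) (Fin 8) ℤ :=
  !![2, 1, 1, 1, 1, 0, 0, 0;
     1, 2, 0, 0, 1, -1, 1, 0;
     1, 0, 2, 0, 0, 0, -1, 1;
     1, 0, 0, 2, 0, 0, 0, -1;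
     1, 1, 0, 0, 2, 0, 1, 0;
     0, -1, 0, 0, 0, 2, -1, 0;
     0, 1, -1, 0, 1, -1, 2, -1;
     0, 0, 1, -1, 0, 0, -1, 2]
def hurwitzFormInv : Matrix (Fin 8) (Fin 8) ℤ :=
  !![4, -2, -2, -2, -1, -1, 0, 0;
     -2, 2, 1, 1, 0, 1, 0, 0;
     -2, 1, 2, 1, 0, 1, 1, 0;
     -2, 1, 1, 2, 0, 1, 1, 1;
     -1, 0, 0, 0, 2, -1, -2, -1;
     -1, 1, 1, 1, -1, 2, 2, 1;
     0, 0, 1, 1, -2, 2, 4, 2;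
     0, 0, 0, 1, -1, 1, 2, 2]
def hurwitzMulI : Matrix (Fin 8) (Fin 8) ℤ :=
  !![0, 1, 0, 0, 0, 0, 0, 0;
     -1, 0, 0, 0, 0, 0, 0, 0;
     0, 0, 0, 1, 0, 0, 0, 0;
     0, 0, -1, 0, 0, 0, 0, 0;
     0, 0, 0, 0, 0, 1, 0, 0;
     0, 0, 0, 0, -1, 0, 0, 0;
     0, 0, 0, 0, 0, 0, 0, 1;
     0, 0, 0, 0, 0, 0, -1, 0]
def hurwitzMulJ : Matrix (Fin 8) (Fin 8) ℤ :=
  !![0, 0, 1, 0, 0, 0, 0, 0;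
     0, 0, 0, -1, 0, 0, 0, 0;
     -1, 0, 0, 0, 0, 0, 0, 0;
     0, 1, 0, 0, 0, 0, 0, 0;
     0, 0, 0, 0, 0, 0, 1, 0;
     0, 0, 0, 0, 0, 0, 0, -1;
     0, 0, 0, 0, -1, 0, 0, 0;
     0, 0, 0, 0, 0, 1, 0, 0]
def hurwitzMulSigma : Matrix (Fin 8) (Fin 8) ℤ :=
  !![1, 1, 1, 1, 0, 0, 0, 0;
     -1, 1, 1, -1, 0, 0, 0, 0;
     -1, -1, 1, 1, 0, 0, 0, 0;
     -1, 1, -1, 1, 0, 0, 0, 0;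
     0, 0, 0, 0, 1, 1, 1, 1;
     0, 0, 0, 0, -1, 1, 1, -1;
     0, 0, 0, 0, -1, -1, 1, 1;
     0, 0, 0, 0, -1, 1, -1, 1]
def hurwitzI : Matrix (Fin 8) (Fin 8) ℤ :=
  !![-1, 1, 0, 1, 0, 0, 0, 0;
     -2, 1, 1, 1, 0, 0, 0, 0;
     0, 0, 0, 1, 0, 0, 0, 0;
     0, 0, -1, 0, 0, 0, 0, 0;
     0, 0, 0, 0, 0, -1, 0, 0;
     0, 0, 0, 0, 1, 0, 0, 0;
     0, 0, 0, 0, -1, 0, 1, 1;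
     0, 0, 0, 0, 1, -1, -2, -1]
def hurwitzJ : Matrix (Fin 8) (Fin 8) ℤ :=
  !![-1, 1, 1, 0, 0, 0, 0, 0;
     0, 0, 0, -1, 0, 0, 0, 0;
     -2, 1, 1, 1, 0, 0, 0, 0;
     0, 1, 0, 0, 0, 0, 0, 0;
     0, 0, 0, 0, 0, 0, 0, 1;
     0, 0, 0, 0, 1, -1, -2, -1;
     0, 0, 0, 0, 0, 1, 1, 1;
     0, 0, 0, 0, -1, 0, 0, 0]
def hurwitzSigma : Matrix (Fin 8) (Fin 8) ℤ :=
  !![-1, 1, 1, 1, 0, 0, 0, 0;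
     -1, 1, 1, 0, 0, 0, 0, 0;
     -1, 0, 1, 1, 0, 0, 0, 0;
     -1, 1, 0, 1, 0, 0, 0, 0;
     0, 0, 0, 0, 1, -1, -1, 0;
     0, 0, 0, 0, 1, 0, -1, -1;
     0, 0, 0, 0, 0, 0, 1, 1;
     0, 0, 0, 0, 0, 0, -1, 0]

end TorusModel
end

/-! ### Unit pairs of quaternions as isometries. -/

noncomputable section
namespace TorusModel
open scoped Quaternion

lemma mul_star_eq_one {q : H2} (hq : star q * q = 1) : q * star q = 1 := by
  have h1 := congrArg Prod.fst hq
  have h2 := congrArg Prod.snd hq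
  refine Prod.ext ?_ ?_
  · change q.1 * star q.1 = 1
    rw [Quaternion.self_mul_star, ← Quaternion.star_mul_self]
    exact h1
  · change q.2 * star q.2 = 1
    rw [Quaternion.self_mul_star, ← Quaternion.star_mul_self]
    exact h2

lemma form_unit_mul (α β : ℝ) {u : H2} (hu : star u * u = 1) (v w : H2) :
    form α β (u * v) (u * w) = form α β v w := by
  rw [form_mul_right, ← mul_assoc, hu, one_mul]

lemma form_mul_unit (α β : ℝ) {u : H2} (hu : star u * u = 1) (v w : H2) :
    form α β (v * u) (w * u) = form α β v w := by
  have := mul_star_eq_one hu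
  have h (v w : H2) : form α β v w = α * (v * star w).1.re + β * (v * star w).2.re :=
    form_apply α β v w
  rw [h, star_mul, mul_assoc, ← mul_assoc u, this, one_mul, h]

lemma star_eq_neg_of_re {q : H2} (h1 : q.1.re = 0) (h2 : q.2.re = 0) : star q = -q :=
  Prod.ext (star_eq_neg h1) (star_eq_neg h2)

lemma mul_self_eq_neg_one {q : H2} (hq : star q * q = 1) (h1 : q.1.re = 0) (h2 : q.2.re = 0) :
    q * q = -1 := by
  rw [← hq, star_eq_neg_of_re h1 h2]
  simp

lemma mul_eq_star_mul_of_re {q w : H2} (h1 : q.1.re = 0) (h2 : q.2.re = 0)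
    (h3 : (q * w).1.re = 0) (h4 : (q * w).2.re = 0) : q * w = star w * q :=
  Prod.ext (mul_eq_star_mul h1 h3) (mul_eq_star_mul h2 h4)

lemma realPair_comm (a b : ℝ) (x : H2) : realPair a b * x = x * realPair a b := by
  refine Prod.ext ?_ ?_
  · exact Quaternion.coe_commutes a x.1
  · exact Quaternion.coe_commutes b x.2

lemma mul_self_eq_of_unit {q : H2} (hq : star q * q = 1) :
    q * q = realPair (2 * q.1.re) (2 * q.2.re) * q - 1 := by
  rw [← add_star_eq, add_mul, hq, add_sub_cancel_right]

/-! ### The lattice with a symmetry of order twelve -/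

section

variable {r : ℝ} {ζ f : H2}

def twelfthFrame (ζ f : H2) : Fin 8 → H2 :=
  ![1, ζ * 1, ζ * (ζ * 1), ζ * (ζ * (ζ * 1)), f, ζ * f, ζ * (ζ * f), ζ * (ζ * (ζ * f))]

lemma twelfth_mul_self (hζ : star ζ * ζ = 1) (h1 : 2 * ζ.1.re = r) (h2 : 2 * ζ.2.re = -r) (x : H2) :
    ζ * (ζ * x) = realPair r (-r) * (ζ * x) - x := by
  rw [← mul_assoc, mul_self_eq_of_unit hζ, h1, h2, sub_mul, one_mul, mul_assoc]

lemma twelfth_pow_four (hr : r ^ 2 = 3) (hζ : star ζ * ζ = 1) (h1 : 2 * ζ.1.re = r)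
    (h2 : 2 * ζ.2.re = -r) (x : H2) : ζ * (ζ * (ζ * (ζ * x))) = ζ * (ζ * x) - x := by
  have hs := twelfth_mul_self hζ h1 h2
  have ht : realPair r (-r) * realPair r (-r) = 3 := by
    rw [realPair_mul, neg_mul_neg, ← sq, hr]
    exact_mod_cast realPair_intCast 3
  rw [hs (ζ * (ζ * x)), hs (ζ * x), hs x]
  have h3 : realPair r (-r) * (realPair r (-r) * (realPair r (-r) * (ζ * x) - x) - ζ * x)
      = (realPair r (-r) * realPair r (-r)) * (realPair r (-r) * (ζ * x)) -
        (realPair r (-r) * realPair r (-r)) * x - realPair r (-r) * (ζ * x) := by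
    noncomm_ring
  rw [h3, ht]
  noncomm_ring

lemma twelfth_star (hr : r ^ 2 = 3) (hζ : star ζ * ζ = 1) (h1 : 2 * ζ.1.re = r)
    (h2 : 2 * ζ.2.re = -r) (x : H2) : star ζ * x = ζ * x - ζ * (ζ * (ζ * x)) := by
  have h3 := congrArg (star ζ * ·) (twelfth_pow_four hr hζ h1 h2 x)
  simp only [← mul_assoc, mul_sub, hζ, one_mul] at h3
  simp only [← mul_assoc]
  rw [h3]
  abel

/-- The weights (3 - r)/6 and (3 + r)/6 are conjugate in ℚ(√3), so the form is a rational trace form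
and the frame built from ζ and f has a rational Gram matrix. With fζ = ζ̄f and ζ⁴ = ζ² - 1 all
multiplications are integral in the frame, and the rest is a check of integral matrices. -/
theorem exists_twelfth_lattice (hr : r ^ 2 = 3) (hζ : star ζ * ζ = 1) (h1 : 2 * ζ.1.re = r)
    (h2 : 2 * ζ.2.re = -r) (hf : star f * f = 1) (hf1 : f.1.re = 0) (hf2 : f.2.re = 0)
    (hf3 : (ζ * f).1.re = 0) (hf4 : (ζ * f).2.re = 0) :
    ∃ M : Submodule ℤ H2, IsEvenSelfDual (form ((3 - r) / 6) ((3 + r) / 6)) M ∧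
      ζ ∈ stabilizer M ∧ f ∈ stabilizer M := by
  have hs := twelfth_mul_self hζ h1 h2
  have h4 := twelfth_pow_four hr hζ h1 h2
  have hst := twelfth_star hr hζ h1 h2
  have hff : f * f = -1 := mul_self_eq_neg_one hf hf1 hf2
  have hfζ : f * ζ = star ζ * f := by
    refine mul_eq_star_mul_of_re hf1 hf2 ?_ ?_
    · simp only [Prod.fst_mul, Quaternion.re_mul] at hf3 ⊢
      linarith
    · simp only [Prod.snd_mul, Quaternion.re_mul] at hf4 ⊢
      linarith
  have hfz (x : H2) : f * (ζ * x) = ζ * (f * x) - ζ * (ζ * (ζ * (f * x))) := by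
    rw [← mul_assoc, hfζ, mul_assoc, hst]
  set α := (3 - r) / 6 with hα
  set β := (3 + r) / 6 with hβ
  have e1 (x : H2) : (ζ * (ζ * x)).1.re = r * (ζ * x).1.re - x.1.re := by
    rw [hs]; simp
  have e2 (x : H2) : (ζ * (ζ * x)).2.re = -r * (ζ * x).2.re - x.2.re := by
    rw [hs]; simp
  have z1 : (ζ * 1).1.re = r / 2 := by rw [mul_one]; linarith
  have z2 : (ζ * 1).2.re = - r / 2 := by rw [mul_one]; linarith
  have hone (v : H2) : form α β v 1 = α * v.1.re + β * v.2.re := by simp [form_apply]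
  have hF (v : H2) : form α β v f = -form α β (v * f) 1 := by
    rw [hone, form_apply, star_eq_neg hf1, star_eq_neg hf2]
    simp only [mul_neg, Quaternion.re_neg, Prod.fst_mul, Prod.snd_mul]
    ring
  have u0 : form α β 1 1 = 1 := by
    rw [hone, hα, hβ]; simp; ring
  have u1 : form α β (ζ * 1) 1 = -1 / 2 := by
    rw [hone, z1, z2, hα, hβ]; linear_combination (-1 / 6) * hr
  have u2 : form α β (ζ * (ζ * 1)) 1 = 1 / 2 := by
    rw [hone, e1, e2, z1, z2, hα, hβ]; simp; linear_combination (1 / 2) * hr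
  have u3 : form α β (ζ * (ζ * (ζ * 1))) 1 = 0 := by
    rw [hone, e1, e2, e1, e2, z1, z2, hα, hβ]; simp; linear_combination (- r ^ 2 / 6) * hr
  have v0 : form α β f 1 = 0 := by rw [hone, hf1, hf2]; ring
  have v1 : form α β (ζ * f) 1 = 0 := by rw [hone, hf3, hf4]; ring
  have v2 : form α β (ζ * (ζ * f)) 1 = 0 := by rw [hone, e1, e2, hf1, hf2, hf3, hf4]; ring
  have v3 : form α β (ζ * (ζ * (ζ * f))) 1 = 0 := by
    rw [hone, e1, e2, e1, e2, hf1, hf2, hf3, hf4]; ring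
  have w0 : form α β f f = 1 := by
    rw [← u0]; simpa using form_mul_unit α β hf 1 1
  have w1 : form α β (ζ * f) f = -1 / 2 := by
    rw [← u1]; simpa using form_mul_unit α β hf ζ 1
  have w2 : form α β (ζ * (ζ * f)) f = 1 / 2 := by
    rw [← u2]; simpa [mul_assoc] using form_mul_unit α β hf (ζ * ζ) 1
  have w3 : form α β (ζ * (ζ * (ζ * f))) f = 0 := by
    rw [← u3]; simpa [mul_assoc] using form_mul_unit α β hf (ζ * (ζ * ζ)) 1
  have x1 : form α β (ζ * 1) f = 0 := by rw [hF, mul_one, v1, neg_zero]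
  have x2 : form α β (ζ * (ζ * 1)) f = 0 := by rw [hF, mul_one, mul_assoc, v2, neg_zero]
  have x3 : form α β (ζ * (ζ * (ζ * 1))) f = 0 := by
    rw [hF, mul_one, mul_assoc, mul_assoc, v3, neg_zero]
  have hsym := form_symm α β
  have hu := form_unit_mul α β hζ
  refine ⟨frameLattice 1 twelfthBasis (twelfthFrame ζ f),
    isEvenSelfDual_frameLattice (s := 2) (G := twelfthGram) (A := twelfthForm)
      (A' := twelfthFormInv) one_ne_zero two_ne_zero ?_ (by decide +kernel) (by decide +kernel)
      (by decide +kernel),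
    mem_stabilizer_frameLattice (t := 1) (N := twelfthMulZeta) (Z := twelfthZeta) one_ne_zero ?_
      (by decide +kernel),
    mem_stabilizer_frameLattice (t := 1) (N := twelfthMulF) (Z := twelfthF) one_ne_zero ?_
      (by decide +kernel)⟩
  · have key : ∀ i j : Fin 8, j ≤ i → ((2 : ℤ) : ℝ) * form α β (twelfthFrame ζ f i)
        (twelfthFrame ζ f j) = twelfthGram i j := by
      intro i j hij
      fin_cases i <;> fin_cases j <;> first
        | (exfalso; revert hij; decide)
        | (clear hij
           simp only [twelfthFrame, twelfthGram, Matrix.of_apply, Matrix.cons_val,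
            Matrix.cons_val_zero, Matrix.cons_val_one, Fin.zero_eta, Fin.mk_one, Fin.reduceFinMk,
            hu, u0, u1, u2, u3, v0, v1, v2, v3, w0, w1, w2, w3, x1, x2, x3, hsym f (ζ * _)]
           norm_num)
    intro i j
    rcases le_total j i with h | h
    · exact key i j h
    · rw [hsym, key j i h]
      exact congrArg _ (congrFun (congrFun (by decide +kernel : twelfthGram.transpose =
          twelfthGram) i) j)
  · intro k
    fin_cases k <;>
    simp [twelfthFrame, twelfthMulZeta, Fin.sum_univ_eight, h4, -mul_one] <;> abel
  · intro k
    fin_cases k <;>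
    simp [twelfthFrame, twelfthMulF, Fin.sum_univ_eight, h4, hfz, hff, mul_one f, mul_sub,
        mul_add, -mul_one,
      -sub_right_inj, -sub_left_inj, -neg_inj] <;>
    abel

end

end TorusModel
end

noncomputable section
namespace TorusModel
open scoped Quaternion

/-! ### The lattice with the symmetries of the Hurwitz quaternions -/

/-- A pair of anticommuting imaginary units. -/
structure IsFrame (i j : ℍ[ℝ]) : Prop where
  left : star i * i = 1
  right : star j * j = 1
  re_left : i.re = 0
  re_right : j.re = 0
  re_mul : (i * j).re = 0

namespace IsFrame

variable {i j : ℍ[ℝ]} (h : IsFrame i j)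
include h

lemma star_left : star i = -i := star_eq_neg h.re_left

lemma star_right : star j = -j := star_eq_neg h.re_right

lemma left_mul_self : i * i = -1 := by
  have := h.left
  rw [h.star_left, neg_mul] at this
  rw [← this, neg_neg]

lemma right_mul_self : j * j = -1 := by
  have := h.right
  rw [h.star_right, neg_mul] at this
  rw [← this, neg_neg]

lemma mul_comm_neg : j * i = -(i * j) := by
  rw [mul_eq_star_mul h.re_left h.re_mul, h.star_right, neg_mul, neg_neg]

lemma left_mul (x : ℍ[ℝ]) : i * (i * x) = -x := by
  rw [← mul_assoc, h.left_mul_self, neg_one_mul]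

lemma mul_left_mul (x : ℍ[ℝ]) : j * (i * x) = -(i * (j * x)) := by
  rw [← mul_assoc, h.mul_comm_neg, neg_mul, mul_assoc]

end IsFrame

def hurwitzFrame (I J : H2) : Fin 8 → H2 :=
  ![(1, 0), (I.1, 0), (J.1, 0), (I.1 * J.1, 0), (0, 1), (0, I.2), (0, J.2), (0, I.2 * J.2)]

/-- The frame is orthonormal. I and J permute it up to sign, and 2σ acts on it integrally. -/
theorem exists_hurwitz_lattice {I J : H2} (h1 : IsFrame I.1 J.1) (h2 : IsFrame I.2 J.2) :
    ∃ M : Submodule ℤ H2, IsEvenSelfDual (form 1 1) M ∧ I ∈ stabilizer M ∧ J ∈ stabilizer M ∧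
      ∀ σ : H2, σ + σ = 1 + I + J + I * J → σ ∈ stabilizer M := by
  have hG : ∀ i j, ((1 : ℤ) : ℝ) * form 1 1 (hurwitzFrame I J i) (hurwitzFrame I J j)
      = (1 : Matrix (Fin 8) (Fin 8) ℤ) i j := by
    intro i j
    fin_cases i <;> fin_cases j <;>
    simp [hurwitzFrame, form_apply, h1.star_left, h1.star_right, h2.star_left, h2.star_right,
      mul_assoc, h1.left_mul_self, h1.right_mul_self, h1.mul_comm_neg, h1.left_mul,
      h1.mul_left_mul, h2.left_mul_self, h2.right_mul_self, h2.mul_comm_neg, h2.left_mul,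
      h2.mul_left_mul, h1.re_left, h1.re_right, h2.re_left, h2.re_right,
      h1.re_mul, h2.re_mul, -Quaternion.re_mul]
  refine ⟨frameLattice 2 hurwitzBasis (hurwitzFrame I J),
    isEvenSelfDual_frameLattice (s := 1) (G := 1) (A := hurwitzForm)
      (A' := hurwitzFormInv) two_ne_zero one_ne_zero hG (by decide +kernel) (by decide +kernel)
      (by decide +kernel),
    mem_stabilizer_frameLattice (t := 1) (N := hurwitzMulI) (Z := hurwitzI) one_ne_zero ?_
      (by decide +kernel),
    mem_stabilizer_frameLattice (t := 1) (N := hurwitzMulJ) (Z := hurwitzJ) one_ne_zero ?_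
      (by decide +kernel),
    fun σ hσ => mem_stabilizer_frameLattice (t := 2) (N := hurwitzMulSigma) (Z := hurwitzSigma)
      two_ne_zero ?_ (by decide +kernel)⟩
  · intro k
    fin_cases k <;>
    simp [hurwitzFrame, hurwitzMulI, Fin.sum_univ_eight, h1.left_mul_self, h2.left_mul_self,
      h1.left_mul, h2.left_mul, Prod.ext_iff]
  · intro k
    fin_cases k <;>
    simp [hurwitzFrame, hurwitzMulJ, Fin.sum_univ_eight, h1.right_mul_self, h2.right_mul_self,
      h1.mul_comm_neg, h2.mul_comm_neg, h1.mul_left_mul, h2.mul_left_mul, Prod.ext_iff]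
  · intro k
    have : ((2 : ℤ) : ℝ) • (σ * hurwitzFrame I J k) = (1 + I + J + I * J) * hurwitzFrame I J k := by
      rw [← hσ, add_mul, Int.cast_ofNat, two_smul]
    rw [this]
    fin_cases k <;>
    simp [hurwitzFrame, hurwitzMulSigma, Fin.sum_univ_eight, mul_assoc, add_mul,
      h1.left_mul_self, h1.right_mul_self, h1.mul_comm_neg, h1.left_mul,
      h1.mul_left_mul, h2.left_mul_self, h2.right_mul_self, h2.mul_comm_neg, h2.left_mul,
      h2.mul_left_mul, Prod.ext_iff] <;> abel

end TorusModel
end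

noncomputable section
namespace TorusModel
open scoped Quaternion

/-! ### Symmetries with a real multiplication by `√3` -/

/-- Two orthogonality conditions leave room in ℍ; f is sought in the span of the first two imaginary
units. -/
lemma exists_orthogonal_unit (q : ℍ[ℝ]) :
    ∃ f : ℍ[ℝ], star f * f = 1 ∧ f.re = 0 ∧ (q * f).re = 0 := by
  have key (x y : ℝ) (hxy : x ^ 2 + y ^ 2 = 1) (hq : q.imI * x + q.imJ * y = 0) :
      ∃ f : ℍ[ℝ], star f * f = 1 ∧ f.re = 0 ∧ (q * f).re = 0 := by
    obtain ⟨f, h0, h1, h2, h3⟩ :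
        ∃ f : ℍ[ℝ], f.re = 0 ∧ f.imI = x ∧ f.imJ = y ∧ f.imK = 0 := ⟨⟨0, x, y, 0⟩, rfl, rfl, rfl,
            rfl⟩
    refine ⟨f, ?_, h0, ?_⟩
    · ext <;> simp [h0, h1, h2, h3] <;> linarith
    · simp [h0, h1, h2, h3]
      linarith
  by_cases h : q.imI = 0 ∧ q.imJ = 0
  · exact key 1 0 (by ring) (by simp [h.1])
  · have h0 : 0 < q.imI ^ 2 + q.imJ ^ 2 := by
      by_contra h0
      exact h ⟨by nlinarith [sq_nonneg q.imI, sq_nonneg q.imJ],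
        by nlinarith [sq_nonneg q.imI, sq_nonneg q.imJ]⟩
    set s := Real.sqrt (q.imI ^ 2 + q.imJ ^ 2)
    have hs : s ^ 2 = q.imI ^ 2 + q.imJ ^ 2 := Real.sq_sqrt h0.le
    have hs0 : s ≠ 0 := (Real.sqrt_pos.2 h0).ne'
    refine key (q.imJ / s) (-q.imI / s) ?_ ?_
    · field_simp
      linarith
    · ring

lemma star_mul_self_mul {g h : H2} (hg : star g * g = 1) (hh : star h * h = 1) :
    star (g * h) * (g * h) = 1 := by
  rw [star_mul, mul_assoc, ← mul_assoc (star g), hg, one_mul, hh]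

lemma star_star_mul_self {g : H2} (hg : star g * g = 1) : star (star g) * star g = 1 := by
  rw [star_star]
  exact mul_star_eq_one hg

lemma star_mul_self_fst {g : H2} (hg : star g * g = 1) : star g.1 * g.1 = 1 :=
  congrArg Prod.fst hg

lemma star_mul_self_snd {g : H2} (hg : star g * g = 1) : star g.2 * g.2 = 1 :=
  congrArg Prod.snd hg

lemma re_mul_mul_self {q w : ℍ[ℝ]} (hw : star w * w = 1) :
    (q * w * w).re = 2 * w.re * (q * w).re - q.re := by
  have h := normSq_eq_one hw
  rw [Quaternion.normSq_def'] at h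
  simp
  linear_combination -q.re * h

lemma re_mul_star {q w : ℍ[ℝ]} :
    (q * star w).re = 2 * w.re * q.re - (q * w).re := by
  simp
  ring

/-- If conjugation by x and by y both send q to q̄, conjugation by xy fixes q. If it also sends q to
q̄, then q is real. -/
lemma star_eq_of_mul_comm {q x y : H2} (hq : star q * q = 1) (hx : star x * x = 1)
    (hy : star y * y = 1) (hxq : x * q = star q * x) (hyq : y * q = star q * y)
    (hxy : x * y * q = star q * (x * y)) : star q = q := by
  have h1 : x * star q = q * x := by
    have := congrArg (fun v => q * v * star q) hxq
    simp only [← mul_assoc, mul_star_eq_one hq, one_mul] at this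
    rw [mul_assoc (q * x), mul_star_eq_one hq, mul_one] at this
    exact this.symm
  rw [mul_assoc, hyq, ← mul_assoc, h1] at hxy
  have h2 := mul_star_eq_one (star_mul_self_mul hx hy)
  have h3 := congrArg (· * star (x * y)) hxy
  rw [mul_assoc q, mul_assoc q, h2, mul_assoc (star q), h2, mul_one, mul_one] at h3
  exact h3.symm

lemma re_sq_eq_one_of_star_eq {q : ℍ[ℝ]} (hq : star q * q = 1) (h : star q = q) :
    q.re ^ 2 = 1 := by
  have h2 := normSq_eq_one hq
  rw [Quaternion.normSq_def'] at h2
  have i1 := congrArg (fun q : ℍ[ℝ] => q.imI) h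
  have i2 := congrArg (fun q : ℍ[ℝ] => q.imJ) h
  have i3 := congrArg (fun q : ℍ[ℝ] => q.imK) h
  simp only [Quaternion.imI_star, Quaternion.imJ_star, Quaternion.imK_star] at i1 i2 i3
  rw [show q.imI = 0 by linarith, show q.imJ = 0 by linarith, show q.imK = 0 by linarith] at h2
  linarith

/-- The traces of `h` are the conjugates of `n + k r`. -/
def HasTrace (r : ℝ) (h : H2) (n k : ℤ) : Prop :=
  2 * h.1.re = n + k * r ∧ 2 * h.2.re = n - k * r

section

variable {Γ : Submodule ℤ H2} {r : ℝ} {ζ : H2}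

/-- Multiplication by (r,-r) makes m = r(a - b) an integer with m² = 3D, where D = s² - 4p ≤ 16. So
m is 0, ±3 or ±6; ±3 would give D = 3, not a square mod 4. For m = ±6 the traces are c ± √3, and
|a|, |b| ≤ 2 forces c = 0. -/
lemma exists_hasTrace (hL : IsFullLattice Γ) (hΓ : IsEvenSelfDual (form 1 (-1)) Γ)
    (hr : r ^ 2 = 3) (ht : realPair r (-r) ∈ stabilizer Γ) {h : H2} (hh : h ∈ stabilizer Γ)
    (h1 : star h * h = 1) :
    ∃ n k : ℤ, HasTrace r h n k ∧ (k = 0 ∧ -2 ≤ n ∧ n ≤ 2 ∨ n = 0 ∧ (k = 1 ∨ k = -1)) := by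
  have hm := trace_mem_stabilizer hΓ hh
  have ha := re_sq_le_one (star_mul_self_fst h1)
  have hb := re_sq_le_one (star_mul_self_snd h1)
  unfold HasTrace
  obtain ⟨s, hs⟩ := exists_int_add hL hm
  obtain ⟨p, hp⟩ := exists_int_mul hL hm
  have h2 := (stabilizer Γ).mul_mem ht hm
  rw [realPair_mul] at h2
  obtain ⟨m, hm'⟩ := exists_int_add hL h2
  set a := 2 * h.1.re with ha_def
  set b := 2 * h.2.re with hb_def
  have ha4 : a ^ 2 ≤ 4 := by rw [ha_def]; nlinarith
  have hb4 : b ^ 2 ≤ 4 := by rw [hb_def]; nlinarith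
  have a1 : a ≤ 2 := by nlinarith
  have a2 : -2 ≤ a := by nlinarith
  have b1 : b ≤ 2 := by nlinarith
  have b2 : -2 ≤ b := by nlinarith
  have hD : (a - b) ^ 2 = (s ^ 2 - 4 * p : ℤ) := by push_cast; rw [← hs, ← hp]; ring
  have hmD : m ^ 2 = 3 * (s ^ 2 - 4 * p) := by
    have : ((m ^ 2 : ℤ) : ℝ) = ((3 * (s ^ 2 - 4 * p) : ℤ) : ℝ) := by
      rw [Int.cast_mul, ← hD]
      push_cast
      rw [← hm', ← hr]
      ring
    exact_mod_cast this
  have hm6 : m ^ 2 ≤ 48 := by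
    have : ((m ^ 2 : ℤ) : ℝ) ≤ 48 := by
      rw [hmD]
      push_cast at hD ⊢
      rw [← hD]
      nlinarith
    exact_mod_cast this
  have hm1 : m ≤ 6 := by nlinarith
  have hm2 : -6 ≤ m := by nlinarith
  obtain ⟨c, hc⟩ : ∃ c, s = 2 * c ∨ s = 2 * c + 1 := ⟨s / 2, by lia⟩
  have hsq : s ^ 2 = 4 * c ^ 2 ∧ s = 2 * c ∨ s ^ 2 = 4 * (c ^ 2 + c) + 1 := by
    rcases hc with h | h
    · left; exact ⟨by rw [h]; ring, h⟩
    · right; rw [h]; ring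
  have hcase : (m = 0 ∨ m = 6 ∨ m = -6) ∧ s = 2 * c := by
    interval_cases m <;> lia
  have hr0 : r ≠ 0 := by rintro rfl; norm_num at hr
  have hab : a - b = m * r / 3 := by
    have : r * (r * (a - b)) = r * m := by rw [← hm']; ring
    have h3 : r * (r * (a - b)) = 3 * (a - b) := by rw [← hr]; ring
    linarith
  have hsr : a + b = 2 * c := by rw [hs, hcase.2]; push_cast; ring
  have small (x : ℝ) (hx : a = c + x) (hx' : b = c - x) (hx2 : x ^ 2 = 3) : c = 0 := by
    have e1 : 0 ≤ 1 - (c : ℝ) ^ 2 - 2 * (c * x) := by rw [hx] at ha4; nlinarith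
    have e2 : 0 ≤ 1 - (c : ℝ) ^ 2 + 2 * (c * x) := by rw [hx'] at hb4; nlinarith
    have e3 : 0 ≤ (1 - (c : ℝ) ^ 2) ^ 2 - 12 * c ^ 2 := by
      have := mul_nonneg e1 e2
      linear_combination this - 4 * c ^ 2 * hx2
    have e4 : 0 ≤ (1 - c ^ 2) ^ 2 - 12 * c ^ 2 := by exact_mod_cast e3
    have e5 : c ^ 2 ≤ 1 := by
      have : (c : ℝ) ^ 2 ≤ 1 := by linarith
      exact_mod_cast this
    have e6 : c ≤ 1 := by nlinarith
    have e7 : -1 ≤ c := by nlinarith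
    clear_value a b
    clear hD hsr hx hx' e1 e2 e3 hs hp hm' hab hmD hsq hc hcase
    interval_cases c <;> lia
  rcases hcase.1 with h | h | h
  · rw [h] at hab
    refine ⟨c, 0, ⟨?_, ?_⟩, Or.inl ⟨rfl, ?_, ?_⟩⟩
    · push_cast at *; linarith
    · push_cast at *; linarith
    · have : (-2 : ℝ) ≤ c := by linarith
      exact_mod_cast this
    · have : (c : ℝ) ≤ 2 := by linarith
      exact_mod_cast this
  · have hc0 : c = 0 := by
      rw [h] at hab
      push_cast at hab
      exact small r (by linarith) (by linarith) hr
    rw [h] at hab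
    rw [hc0] at hsr
    refine ⟨0, 1, ⟨?_, ?_⟩, Or.inr ⟨rfl, Or.inl rfl⟩⟩ <;> push_cast at * <;> linarith
  · have hc0 : c = 0 := by
      rw [h] at hab
      push_cast at hab
      exact small (-r) (by linarith) (by linarith) (by rw [neg_sq, hr])
    rw [h] at hab
    rw [hc0] at hsr
    refine ⟨0, -1, ⟨?_, ?_⟩, Or.inr ⟨rfl, Or.inr rfl⟩⟩ <;> push_cast at * <;> linarith

lemma HasTrace.unique (hr : r ^ 2 = 3) {h : H2} {n k n' k' : ℤ} (h1 : HasTrace r h n k)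
    (h2 : HasTrace r h n' k') : n = n' ∧ k = k' := by
  have hr0 : r ≠ 0 := by rintro rfl; norm_num at hr
  obtain ⟨a1, b1⟩ := h1
  obtain ⟨a2, b2⟩ := h2
  have e1 : (n : ℝ) = n' := by linarith
  have e2 : (k : ℝ) = k' := mul_right_cancel₀ hr0 (by linarith)
  exact ⟨by exact_mod_cast e1, by exact_mod_cast e2⟩

/-- From ζ² = (r,-r)ζ - 1 the traces along hζʲ satisfy t_{j+2} = r t_{j+1} - t_j, respectively with
-r on the right. -/
lemma HasTrace.mul_mul (hr : r ^ 2 = 3) (hζ : star ζ * ζ = 1) (h1 : HasTrace r ζ 0 1) {h : H2}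
    {n k n' k' : ℤ} (h2 : HasTrace r h n k) (h3 : HasTrace r (h * ζ) n' k') :
    HasTrace r (h * ζ * ζ) (3 * k' - n) (n' - k) := by
  obtain ⟨z1, z2⟩ := h1
  obtain ⟨a1, b1⟩ := h2
  obtain ⟨a2, b2⟩ := h3
  have e1 := re_mul_mul_self (q := h.1) (star_mul_self_fst hζ)
  have e2 := re_mul_mul_self (q := h.2) (star_mul_self_snd hζ)
  simp only [Prod.fst_mul, Prod.snd_mul] at a2 b2
  constructor
  · change 2 * (h.1 * ζ.1 * ζ.1).re = _
    rw [e1, z1]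
    push_cast
    linear_combination r * a2 - a1 + k' * hr
  · change 2 * (h.2 * ζ.2 * ζ.2).re = _
    rw [e2, z2]
    push_cast
    linear_combination -r * b2 - b1 + k' * hr

lemma HasTrace.mul_star (hr : r ^ 2 = 3) (h1 : HasTrace r ζ 0 1) {h : H2}
    {n k n' k' : ℤ} (h2 : HasTrace r h n k) (h3 : HasTrace r (h * ζ) n' k') :
    HasTrace r (h * star ζ) (3 * k - n') (n - k') := by
  obtain ⟨z1, z2⟩ := h1
  obtain ⟨a1, b1⟩ := h2
  obtain ⟨a2, b2⟩ := h3
  have e1 := re_mul_star (q := h.1) (w := ζ.1)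
  have e2 := re_mul_star (q := h.2) (w := ζ.2)
  simp only [Prod.fst_mul, Prod.snd_mul] at a2 b2
  constructor
  · change 2 * (h.1 * star ζ.1).re = _
    rw [e1, z1]
    push_cast
    linear_combination r * a1 - a2 + k * hr
  · change 2 * (h.2 * star ζ.2).re = _
    rw [e2, z2]
    push_cast
    linear_combination -r * b1 - b2 + k * hr

lemma eq_one_of_trace {h : H2} (h1 : star h * h = 1) (ha : 2 * h.1.re = 2) (hb : 2 * h.2.re = 2) :
    h = 1 :=
  Prod.ext (eq_one_of_re (star_mul_self_fst h1) (by linarith))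
    (eq_one_of_re (star_mul_self_snd h1) (by linarith))

lemma HasTrace.mem_of_two {h : H2} (h1 : star h * h = 1) {n k : ℤ} (h2 : HasTrace r h n k)
    (hk : k = 0) (hn : n = 2 ∨ n = -2) (S : Subring H2) : h ∈ S := by
  subst hk
  obtain ⟨a, b⟩ := h2
  rcases hn with rfl | rfl
  · rw [eq_one_of_trace h1 (by rw [a]; simp) (by rw [b]; simp)]
    exact S.one_mem
  · have : -h = 1 := by
      refine eq_one_of_trace (by simpa using h1) ?_ ?_
      · push_cast at a; simp; linarith
      · push_cast at b; simp; linarith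
    rw [← neg_neg h, this]
    exact S.neg_mem S.one_mem

/-- A symmetry that is not orthogonal to `1` and `ζ` is a power of `ζ` up to sign. -/
lemma mem_or_hasTrace_zero (hL : IsFullLattice Γ) (hΓ : IsEvenSelfDual (form 1 (-1)) Γ)
    (hr : r ^ 2 = 3) (hζΓ : ζ ∈ stabilizer Γ) (hζ : star ζ * ζ = 1) (hζt : HasTrace r ζ 0 1)
    {h : H2} (hh : h ∈ stabilizer Γ) (h1 : star h * h = 1) {S : Subring H2} (hS : ζ ∈ S)
    (hS' : star ζ ∈ S) : h ∈ S ∨ (HasTrace r h 0 0 ∧ HasTrace r (h * ζ) 0 0) := by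
  have ht : realPair r (-r) ∈ stabilizer Γ := by
    have := trace_mem_stabilizer hΓ hζΓ
    rw [hζt.1, hζt.2] at this
    simpa using this
  have hall {x : H2} (hx : x ∈ stabilizer Γ) (hx1 : star x * x = 1) :=
    exists_hasTrace hL hΓ hr ht hx hx1
  have hs := star_mem_stabilizer hΓ hζΓ
  have hs1 := star_star_mul_self hζ
  have p1 := (stabilizer Γ).mul_mem hh hζΓ
  have p2 := (stabilizer Γ).mul_mem p1 hζΓ
  have p3 := (stabilizer Γ).mul_mem p2 hζΓ
  have m1 := (stabilizer Γ).mul_mem hh hs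
  have m2 := (stabilizer Γ).mul_mem m1 hs
  have u1 := star_mul_self_mul h1 hζ
  have u2 := star_mul_self_mul u1 hζ
  have u3 := star_mul_self_mul u2 hζ
  have w1 := star_mul_self_mul h1 hs1
  have w2 := star_mul_self_mul w1 hs1
  obtain ⟨n0, k0, t0, c0⟩ := hall hh h1
  obtain ⟨n1, k1, t1, c1⟩ := hall p1 u1
  obtain ⟨n2, k2, t2, c2⟩ := hall p2 u2
  obtain ⟨n3, k3, t3, c3⟩ := hall p3 u3
  obtain ⟨l1, j1, s1, d1⟩ := hall m1 w1
  obtain ⟨l2, j2, s2, d2⟩ := hall m2 w2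
  have e2 := t2.unique hr (HasTrace.mul_mul hr hζ hζt t0 t1)
  have e3 := t3.unique hr (HasTrace.mul_mul hr hζ hζt t1 t2)
  have f1 := s1.unique hr (HasTrace.mul_star hr hζt t0 t1)
  have hback : h * star ζ * ζ = h := by rw [mul_assoc, hζ, mul_one]
  have f2 := s2.unique hr (HasTrace.mul_star hr hζt s1 (by rw [hback]; exact t0))
  have hdown {x : H2} (hx : x * ζ ∈ S) : x ∈ S := by
    have := S.mul_mem hx hS'
    rwa [mul_assoc, mul_star_eq_one hζ, mul_one] at this
  have hup {x : H2} (hx : x * star ζ ∈ S) : x ∈ S := by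
    have := S.mul_mem hx hS
    rwa [mul_assoc, hζ, mul_one] at this
  -- By the recurrence, either one of hζʲ with -2 ≤ j ≤ 3 has both traces equal to 2 or -2, hence is
  -- ±1, or the traces of h and hζ all vanish.
  have hcases : (k0 = 0 ∧ (n0 = 2 ∨ n0 = -2)) ∨ (k1 = 0 ∧ (n1 = 2 ∨ n1 = -2)) ∨
      (k2 = 0 ∧ (n2 = 2 ∨ n2 = -2)) ∨ (k3 = 0 ∧ (n3 = 2 ∨ n3 = -2)) ∨
      (j1 = 0 ∧ (l1 = 2 ∨ l1 = -2)) ∨ (j2 = 0 ∧ (l2 = 2 ∨ l2 = -2)) ∨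
      (n0 = 0 ∧ k0 = 0 ∧ n1 = 0 ∧ k1 = 0) := by
    obtain ⟨rfl, rfl⟩ := e2
    obtain ⟨rfl, rfl⟩ := e3
    obtain ⟨rfl, rfl⟩ := f1
    obtain ⟨rfl, rfl⟩ := f2
    clear t0 t1 t2 t3 s1 s2
    rcases c0 with ⟨rfl, c0, c0'⟩ | ⟨rfl, rfl | rfl⟩ <;>
      rcases c1 with ⟨rfl, c1, c1'⟩ | ⟨rfl, rfl | rfl⟩ <;> lia
  rcases hcases with ⟨a, b⟩ | ⟨a, b⟩ | ⟨a, b⟩ | ⟨a, b⟩ | ⟨a, b⟩ | ⟨a, b⟩ | ⟨rfl, rfl, rfl, rfl⟩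
  · exact Or.inl (t0.mem_of_two h1 a b S)
  · exact Or.inl (hdown (t1.mem_of_two u1 a b S))
  · exact Or.inl (hdown (hdown (t2.mem_of_two u2 a b S)))
  · exact Or.inl (hdown (hdown (hdown (t3.mem_of_two u3 a b S))))
  · exact Or.inl (hup (s1.mem_of_two w1 a b S))
  · exact Or.inl (hup (hup (s2.mem_of_two w2 a b S)))
  · exact Or.inr ⟨t0, t1⟩

lemma HasTrace.re_fst_eq_zero {h : H2} (h0 : HasTrace r h 0 0) : h.1.re = 0 := by
  have := h0.1
  simpa using this

lemma HasTrace.re_snd_eq_zero {h : H2} (h0 : HasTrace r h 0 0) : h.2.re = 0 := by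
  have := h0.2
  simpa using this

lemma HasTrace.mul_comm_zero {h : H2} (h0 : HasTrace r h 0 0) (h1 : HasTrace r (h * ζ) 0 0) :
    h * ζ = star ζ * h :=
  mul_eq_star_mul_of_re h0.re_fst_eq_zero h0.re_snd_eq_zero h1.re_fst_eq_zero h1.re_snd_eq_zero

/-- A symmetry is ± a power of ζ, or is orthogonal to 1 and ζ̄ and then conjugates ζ to ζ̄. The
product of two of the second kind cannot be of the second kind, so one such f, if there is any,
generates the rest together with ζ and signs, and the lattice of order twelve for (ζ, f) serves. The
condition on fixed vectors is void: a symmetry (1,b) has left trace 2, which is rational, so its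
right trace is 2 too and b = 1. -/
theorem exists_isMate_of_sqrt_three (hL : IsFullLattice Γ) (hΓ : IsEvenSelfDual (form 1 (-1)) Γ)
    (hr : r ^ 2 = 3) (hζΓ : ζ ∈ stabilizer Γ) (hζ : star ζ * ζ = 1) (h1 : 2 * ζ.1.re = r)
    (h2 : 2 * ζ.2.re = -r) : ∃ (M : Submodule ℤ H2) (α β : ℝ), IsMate Γ M α β := by
  have hζt : HasTrace r ζ 0 1 := ⟨by rw [h1]; simp, by rw [h2]; simp⟩
  have ht : realPair r (-r) ∈ stabilizer Γ := by
    have := trace_mem_stabilizer hΓ hζΓ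
    rwa [h1, h2] at this
  have hmate {M : Submodule ℤ H2} (hM : IsEvenSelfDual (form ((3 - r) / 6) ((3 + r) / 6)) M)
      (hs : ∀ g ∈ stabilizer Γ, star g * g = 1 → g ∈ stabilizer M) :
      IsMate Γ M ((3 - r) / 6) ((3 + r) / 6) := by
    refine ⟨by nlinarith, by nlinarith, hM, hs, fun b hb hbΓ hb1 => ?_⟩
    have hu : star ((1, b) : H2) * (1, b) = 1 := by
      refine Prod.ext ?_ hb1
      simp
    obtain ⟨n, k, ⟨t1, t2⟩, c⟩ := exists_hasTrace hL hΓ hr ht hbΓ hu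
    simp only [Quaternion.re_one] at t1 t2
    exfalso
    rcases c with ⟨rfl, -⟩ | ⟨rfl, rfl | rfl⟩
    · refine hb (eq_one_of_re hb1 ?_)
      push_cast at t1 t2
      linarith
    · push_cast at t1; nlinarith
    · push_cast at t1; nlinarith
  have hmul {x y : H2} (hx : HasTrace r x 0 0 ∧ HasTrace r (x * ζ) 0 0)
      (hy : HasTrace r y 0 0 ∧ HasTrace r (y * ζ) 0 0) (hx1 : star x * x = 1)
      (hy1 : star y * y = 1) : ¬(HasTrace r (x * y) 0 0 ∧ HasTrace r (x * y * ζ) 0 0) := by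
    rintro ⟨e1, e2⟩
    have := re_sq_eq_one_of_star_eq (star_mul_self_fst hζ) (congrArg Prod.fst
      (star_eq_of_mul_comm hζ hx1 hy1 (hx.1.mul_comm_zero hx.2) (hy.1.mul_comm_zero hy.2)
        (e1.mul_comm_zero e2)))
    rw [show ζ.1.re = r / 2 by linarith] at this
    linarith
  have hre {f : H2} (h0 : HasTrace r f 0 0) (h0' : HasTrace r (f * ζ) 0 0) :
      (ζ * f).1.re = 0 ∧ (ζ * f).2.re = 0 := by
    have a := h0'.re_fst_eq_zero
    have b := h0'.re_snd_eq_zero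
    simp only [Prod.fst_mul, Prod.snd_mul, Quaternion.re_mul] at a b ⊢
    constructor <;> linarith
  by_cases hex : ∃ f ∈ stabilizer Γ, star f * f = 1 ∧ HasTrace r f 0 0 ∧ HasTrace r (f * ζ) 0 0
  · obtain ⟨f, hfΓ, hf1, hf, hf'⟩ := hex
    obtain ⟨M, hM, hMζ, hMf⟩ := exists_twelfth_lattice hr hζ h1 h2 hf1 hf.re_fst_eq_zero
      hf.re_snd_eq_zero (hre hf hf').1 (hre hf hf').2
    refine ⟨M, _, _, hmate hM fun g hg hg1 => ?_⟩
    rcases mem_or_hasTrace_zero hL hΓ hr hζΓ hζ hζt hg hg1 hMζ (star_mem_stabilizer hM hMζ)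
      with h | h
    · exact h
    · rcases mem_or_hasTrace_zero hL hΓ hr hζΓ hζ hζt ((stabilizer Γ).mul_mem hg hfΓ)
        (star_mul_self_mul hg1 hf1) hMζ (star_mem_stabilizer hM hMζ) with h' | h'
      · have := (stabilizer M).mul_mem h' (star_mem_stabilizer hM hMf)
        rwa [mul_assoc, mul_star_eq_one hf1, mul_one] at this
      · exact absurd h' (hmul h ⟨hf, hf'⟩ hg1 hf1)
  · obtain ⟨f1, a1, a2, a3⟩ := exists_orthogonal_unit ζ.1
    obtain ⟨f2, b1, b2, b3⟩ := exists_orthogonal_unit ζ.2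
    obtain ⟨M, hM, hMζ, -⟩ := exists_twelfth_lattice (f := (f1, f2)) hr hζ h1 h2 (Prod.ext a1 b1)
      a2 b2 a3 b3
    refine ⟨M, _, _, hmate hM fun g hg hg1 => ?_⟩
    rcases mem_or_hasTrace_zero hL hΓ hr hζΓ hζ hζt hg hg1 hMζ (star_mem_stabilizer hM hMζ)
      with h | h
    · exact h
    · exact absurd ⟨g, hg, hg1, h⟩ hex

end

end TorusModel
end

noncomputable section
namespace TorusModel
open scoped Quaternion

/-! ### Symmetries with equal integral traces -/

lemma norm_eq_one_of_star_mul_self {q : ℍ[ℝ]} (hq : star q * q = 1) : ‖q‖ = 1 := by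
  have h := normSq_eq_one hq
  rw [Quaternion.normSq_eq_norm_mul_self] at h
  nlinarith [norm_nonneg q]

namespace IsFrame

variable {i j : ℍ[ℝ]} (h : IsFrame i j)
include h

lemma norm_left : ‖i‖ = 1 := norm_eq_one_of_star_mul_self h.left

lemma norm_right : ‖j‖ = 1 := norm_eq_one_of_star_mul_self h.right

def orthonormalBasis : OrthonormalBasis (Fin 4) ℝ ℍ[ℝ] :=
  have hon : Orthonormal ℝ ![1, i, j, i * j] := by
    rw [orthonormal_iff_ite]
    intro a b
    fin_cases a <;> fin_cases b <;>
    simp [Quaternion.inner_def, h.star_left, h.star_right, mul_assoc, h.norm_left,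
      h.norm_right, h.right_mul_self, h.mul_comm_neg, h.left_mul, h.mul_left_mul, h.re_left,
          h.re_right,
      h.re_mul, -Quaternion.re_mul]
  OrthonormalBasis.mk hon
    (hon.linearIndependent.span_eq_top_of_card_eq_finrank (by simp [Quaternion.finrank_eq_four])).ge

lemma coe_orthonormalBasis : ⇑h.orthonormalBasis = ![1, i, j, i * j] := by
  simp [orthonormalBasis]

lemma re_mul_star_mul (q : ℍ[ℝ]) : (q * star (i * j)).re = -(q * (i * j)).re := by
  rw [star_eq_neg h.re_mul, mul_neg, Quaternion.re_neg]

lemma eq_sum (q : ℍ[ℝ]) : q = q.re • (1 : ℍ[ℝ]) - (q * i).re • i - (q * j).re • j -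
    (q * (i * j)).re • (i * j) := by
  have h1 := h.orthonormalBasis.sum_repr q
  simp only [Fin.sum_univ_four, h.orthonormalBasis.repr_apply_apply, real_inner_comm q,
    Quaternion.inner_def, h.coe_orthonormalBasis, Matrix.cons_val, h.star_left, h.star_right,
    h.re_mul_star_mul, star_one, mul_one, mul_neg, Quaternion.re_neg, neg_smul] at h1
  conv_lhs => rw [← h1]
  module

lemma sum_sq (q : ℍ[ℝ]) : q.re ^ 2 + (q * i).re ^ 2 + (q * j).re ^ 2 + (q * (i * j)).re ^ 2
    = Quaternion.normSq q := by
  have h1 := h.orthonormalBasis.sum_sq_norm_inner_right q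
  simp only [Fin.sum_univ_four, real_inner_comm q, Real.norm_eq_abs, sq_abs,
    Quaternion.inner_def, h.coe_orthonormalBasis, Matrix.cons_val, h.star_left, h.star_right,
    h.re_mul_star_mul, star_one, mul_one, mul_neg, Quaternion.re_neg, neg_sq] at h1
  rw [h1, Quaternion.normSq_eq_norm_mul_self, sq]

end IsFrame

/-- Both traces of `h` are equal to `n`. -/
def HasIntTrace (h : H2) (n : ℤ) : Prop := 2 * h.1.re = n ∧ 2 * h.2.re = n

/-- The pairs of units in the ring have pairs of equal integral traces. -/
structure HasIntTraces (R : Subring H2) : Prop where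
  star_mem : ∀ x ∈ R, star x ∈ R
  exists_trace : ∀ x ∈ R, star x * x = 1 → ∃ n : ℤ, HasIntTrace x n

lemma HasIntTrace.bounds {h : H2} {n : ℤ} (h1 : star h * h = 1) (hn : HasIntTrace h n) :
    -2 ≤ n ∧ n ≤ 2 := by
  have h2 := re_sq_le_one (star_mul_self_fst h1)
  have h3 := hn.1
  have h4 : (n : ℝ) ^ 2 ≤ 4 := by rw [← h3]; nlinarith
  have h5 : n ^ 2 ≤ 4 := by exact_mod_cast h4
  constructor <;> nlinarith

lemma HasIntTrace.eq_one_or {h : H2} (h1 : star h * h = 1) {n : ℤ} (h2 : HasIntTrace h n)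
    (hn : n = 2 ∨ n = -2) : h = 1 ∨ h = -1 := by
  obtain ⟨a, b⟩ := h2
  rcases hn with rfl | rfl
  · exact Or.inl (eq_one_of_trace h1 (by rw [a]; simp) (by rw [b]; simp))
  · right
    rw [← neg_neg h]
    congr 1
    refine eq_one_of_trace (by simpa using h1) ?_ ?_
    · push_cast at a; simp; linarith
    · push_cast at b; simp; linarith

lemma HasIntTrace.isFrame {I J : H2} (hI1 : star I * I = 1) (hJ1 : star J * J = 1)
    (hI : HasIntTrace I 0) (hJ : HasIntTrace J 0) (hIJ : HasIntTrace (I * J) 0) :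
    IsFrame I.1 J.1 ∧ IsFrame I.2 J.2 := by
  simp only [HasIntTrace, Int.cast_zero, mul_eq_zero, OfNat.ofNat_ne_zero, false_or] at hI hJ hIJ
  exact ⟨⟨star_mul_self_fst hI1, star_mul_self_fst hJ1, hI.1, hJ.1, hIJ.1⟩,
    ⟨star_mul_self_snd hI1, star_mul_self_snd hJ1, hI.2, hJ.2, hIJ.2⟩⟩

section

variable {R : Subring H2}

/-- The coefficients of 2g in 1, I, J, IJ are, up to sign, the integral traces of g, gI, gJ, gIJ,
and their squares add up to 4. So they are all even or all odd, and g is an integral combination of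
1, I, J, IJ and the half-sum σ. -/
lemma exists_lattice_of_frame (hR : HasIntTraces R) {I J : H2} (hIR : I ∈ R) (hJR : J ∈ R)
    (hI1 : star I * I = 1) (hJ1 : star J * J = 1)
    (hI : HasIntTrace I 0) (hJ : HasIntTrace J 0) (hIJ : HasIntTrace (I * J) 0) :
    ∃ M : Submodule ℤ H2, IsEvenSelfDual (form 1 1) M ∧
      ∀ g ∈ R, star g * g = 1 → g ∈ stabilizer M := by
  obtain ⟨f1, f2⟩ := HasIntTrace.isFrame hI1 hJ1 hI hJ hIJ
  obtain ⟨M, hM, hMI, hMJ, hMσ⟩ := exists_hurwitz_lattice f1 f2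
  refine ⟨M, hM, fun g hg hg1 => ?_⟩
  have hMK := (stabilizer M).mul_mem hMI hMJ
  obtain ⟨a, ha, ha'⟩ := hR.exists_trace g hg hg1
  obtain ⟨b, hb, hb'⟩ := hR.exists_trace _ (R.mul_mem hg hIR) (star_mul_self_mul hg1 hI1)
  obtain ⟨c, hc, hc'⟩ := hR.exists_trace _ (R.mul_mem hg hJR) (star_mul_self_mul hg1 hJ1)
  obtain ⟨d, hd, hd'⟩ := hR.exists_trace _ (R.mul_mem hg (R.mul_mem hIR hJR))
    (star_mul_self_mul hg1 (star_mul_self_mul hI1 hJ1))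
  have hsum : a ^ 2 + b ^ 2 + c ^ 2 + d ^ 2 = 4 := by
    have h1 := f1.sum_sq g.1
    rw [normSq_eq_one (star_mul_self_fst hg1)] at h1
    simp only [Prod.fst_mul] at hb hc hd
    have : (a : ℝ) ^ 2 + b ^ 2 + c ^ 2 + d ^ 2 = 4 := by
      rw [← ha, ← hb, ← hc, ← hd]
      linarith
    exact_mod_cast this
  have hexp : g + g = (a : H2) - b * I - c * J - d * (I * J) := by
    have key (q i j : ℍ[ℝ]) (f : IsFrame i j) (ha : 2 * q.re = a) (hb : 2 * (q * i).re = b)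
        (hc : 2 * (q * j).re = c) (hd : 2 * (q * (i * j)).re = d) :
        q + q = (a : ℍ[ℝ]) - b * i - c * j - d * (i * j) := by
      have hz (n : ℤ) (x : ℍ[ℝ]) : (n : ℍ[ℝ]) * x = (n : ℝ) • x := by
        rw [← Quaternion.coe_mul_eq_smul, Quaternion.coe_intCast]
      rw [hz, hz, hz, ← mul_one (a : ℍ[ℝ]), hz, ← ha, ← hb, ← hc, ← hd]
      conv_lhs => rw [f.eq_sum q]
      module
    exact Prod.ext (key _ _ _ f1 ha hb hc hd) (key _ _ _ f2 ha' hb' hc' hd')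
  have hint (n : ℤ) : (n : H2) ∈ stabilizer M := intCast_mem _ n
  have hdiv {x y : H2} (hxy : x + x = y + y) (hy : y ∈ stabilizer M) : x ∈ stabilizer M := by
    have : (2 : ℝ) • x = (2 : ℝ) • y := by rw [two_smul, two_smul, hxy]
    rw [smul_right_injective H2 (two_ne_zero (α := ℝ)) this]
    exact hy
  have hcomb (k l m n : ℤ) : (k : H2) - l * I - m * J - n * (I * J) ∈ stabilizer M :=
    sub_mem (sub_mem (sub_mem (hint k) (mul_mem (hint l) hMI)) (mul_mem (hint m) hMJ))
      (mul_mem (hint n) hMK)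
  -- Odd values are rounded down for a and up for b, c, d: the last three enter 2g with a minus
  -- sign, so each remainder is +1 and together they form 2σ.
  obtain ⟨a', ha2⟩ : ∃ k, a = 2 * k ∨ a = 2 * k + 1 := ⟨a / 2, by lia⟩
  obtain ⟨b', hb2⟩ : ∃ k, b = 2 * k ∨ b = 2 * k - 1 := ⟨(b + 1) / 2, by lia⟩
  obtain ⟨c', hc2⟩ : ∃ k, c = 2 * k ∨ c = 2 * k - 1 := ⟨(c + 1) / 2, by lia⟩
  obtain ⟨d', hd2⟩ : ∃ k, d = 2 * k ∨ d = 2 * k - 1 := ⟨(d + 1) / 2, by lia⟩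
  have hsq (x k : ℤ) (hx : x = 2 * k ∨ x = 2 * k + 1 ∨ x = 2 * k - 1) :
      x = 2 * k ∧ x ^ 2 % 4 = 0 ∨ (x = 2 * k + 1 ∨ x = 2 * k - 1) ∧ x ^ 2 % 4 = 1 := by
    rcases hx with rfl | rfl | rfl
    · left; exact ⟨rfl, by ring_nf; lia⟩
    · right; exact ⟨Or.inl rfl, by ring_nf; lia⟩
    · right; exact ⟨Or.inr rfl, by ring_nf; lia⟩
  have hpar : (a = 2 * a' ∧ b = 2 * b' ∧ c = 2 * c' ∧ d = 2 * d') ∨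
      (a = 2 * a' + 1 ∧ b = 2 * b' - 1 ∧ c = 2 * c' - 1 ∧ d = 2 * d' - 1) := by
    have h1 := hsq a a' (by lia)
    have h2 := hsq b b' (by lia)
    have h3 := hsq c c' (by lia)
    have h4 := hsq d d' (by lia)
    generalize a ^ 2 = A at *
    generalize b ^ 2 = B at *
    generalize c ^ 2 = C at *
    generalize d ^ 2 = D at *
    lia
  rcases hpar with ⟨rfl, rfl, rfl, rfl⟩ | ⟨rfl, rfl, rfl, rfl⟩
  · refine hdiv ?_ (hcomb a' b' c' d')
    rw [hexp]
    push_cast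
    noncomm_ring
  · obtain ⟨σ, hσ⟩ : ∃ σ : H2, σ + σ = 1 + I + J + I * J :=
      ⟨(2⁻¹ : ℝ) • (1 + I + J + I * J), by rw [← add_smul]; norm_num⟩
    refine hdiv ?_ (add_mem (hcomb a' b' c' d') (hMσ σ hσ))
    rw [hexp, add_add_add_comm, hσ]
    push_cast
    noncomm_ring

end

end TorusModel
end

/-! ### Groups with equal integral traces and no pair of anticommuting units. -/

noncomputable section
namespace TorusModel
open scoped Quaternion

section

variable {R : Subring H2}

lemma one_neg_one_mem (S : Subring H2) {x : H2} (h : x = 1 ∨ x = -1) : x ∈ S := by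
  rcases h with rfl | rfl
  · exact S.one_mem
  · exact S.neg_mem S.one_mem

lemma HasIntTrace.star_eq_neg {I : H2} (hI : HasIntTrace I 0) : star I = -I := by
  simp only [HasIntTrace, Int.cast_zero, mul_eq_zero, OfNat.ofNat_ne_zero, false_or] at hI
  exact star_eq_neg_of_re hI.1 hI.2

lemma exists_lattice_of_unit {I : H2} (hI1 : star I * I = 1) (hI : HasIntTrace I 0) :
    ∃ M : Submodule ℤ H2, IsEvenSelfDual (form 1 1) M ∧ I ∈ stabilizer M := by
  simp only [HasIntTrace, Int.cast_zero, mul_eq_zero, OfNat.ofNat_ne_zero, false_or] at hI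
  obtain ⟨j1, a1, a2, a3⟩ := exists_orthogonal_unit I.1
  obtain ⟨j2, b1, b2, b3⟩ := exists_orthogonal_unit I.2
  obtain ⟨M, hM, hMI, -⟩ := exists_hurwitz_lattice (I := I) (J := (j1, j2))
    ⟨star_mul_self_fst hI1, a1, hI.1, a2, a3⟩ ⟨star_mul_self_snd hI1, b1, hI.2, b2, b3⟩
  exact ⟨M, hM, hMI⟩

/-- All elements are ±1 or of trace zero. If I and g have trace zero then Ig does not, so Ig = ±1:
the group is generated by -1 and at most one I. -/
lemma exists_lattice_of_even_traces (hR : HasIntTraces R)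
    (hframe : ∀ I ∈ R, ∀ J ∈ R, star I * I = 1 → star J * J = 1 → HasIntTrace I 0 →
      HasIntTrace J 0 → ¬HasIntTrace (I * J) 0)
    (hodd : ∀ g ∈ R, star g * g = 1 → ¬HasIntTrace g (-1)) :
    ∃ M : Submodule ℤ H2, IsEvenSelfDual (form 1 1) M ∧
      ∀ g ∈ R, star g * g = 1 → g ∈ stabilizer M := by
  have htr (g : H2) (hg : g ∈ R) (hg1 : star g * g = 1) :
      HasIntTrace g 0 ∨ g = 1 ∨ g = -1 := by
    obtain ⟨n, hn⟩ := hR.exists_trace g hg hg1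
    obtain ⟨h1, h2⟩ := hn.bounds hg1
    have : n = 0 ∨ n = 1 ∨ n = -1 ∨ (n = 2 ∨ n = -2) := by lia
    rcases this with rfl | rfl | rfl | h
    · exact Or.inl hn
    · exfalso
      refine hodd (-g) (R.neg_mem hg) (by simpa using hg1) ⟨?_, ?_⟩
      · have := hn.1; push_cast at this ⊢; simp; linarith
      · have := hn.2; push_cast at this ⊢; simp; linarith
    · exact absurd hn (hodd g hg hg1)
    · exact Or.inr (hn.eq_one_or hg1 h)
  by_cases hex : ∃ I ∈ R, star I * I = 1 ∧ HasIntTrace I 0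
  · obtain ⟨I, hIR, hI1, hI⟩ := hex
    obtain ⟨M, hM, hMI⟩ := exists_lattice_of_unit hI1 hI
    refine ⟨M, hM, fun g hg hg1 => ?_⟩
    rcases htr g hg hg1 with h | h
    · rcases htr _ (R.mul_mem hIR hg) (star_mul_self_mul hI1 hg1) with h' | h'
      · exact absurd h' (hframe I hIR g hg hI1 hg1 hI h)
      · have : g = -I * (I * g) := by rw [← hI.star_eq_neg, ← mul_assoc, hI1, one_mul]
        rw [this]
        exact mul_mem (neg_mem hMI) (one_neg_one_mem _ h')
    · exact one_neg_one_mem _ h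
  · obtain ⟨f, a1, a2, -⟩ := exists_orthogonal_unit 1
    obtain ⟨M, hM, -⟩ := exists_lattice_of_unit (I := (f, f)) (Prod.ext a1 a1)
      ⟨by simp [a2], by simp [a2]⟩
    refine ⟨M, hM, fun g hg hg1 => ?_⟩
    rcases htr g hg hg1 with h | h
    · exact absurd ⟨g, hg, hg1, h⟩ hex
    · exact one_neg_one_mem _ h

lemma mul_self_of_trace {w : H2} (hw1 : star w * w = 1) (hw : HasIntTrace w (-1)) :
    w * w = -w - 1 := by
  have h1 := hw.1
  have h2 := hw.2
  rw [mul_self_eq_of_unit hw1, h1, h2, realPair_intCast]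
  simp

lemma star_of_trace {w : H2} (hw : HasIntTrace w (-1)) : star w = -1 - w := by
  have h1 := hw.1
  have h2 := hw.2
  have h3 := add_star_eq w
  rw [h1, h2, realPair_intCast] at h3
  rw [← add_sub_cancel_left w (star w), h3]
  simp

lemma HasIntTrace.mul_mul {w h : H2} (hw1 : star w * w = 1) (hw : HasIntTrace w (-1)) {m n : ℤ}
    (hm : HasIntTrace h m) (hn : HasIntTrace (h * w) n) : HasIntTrace (h * w * w) (-m - n) := by
  have : h * w * w = -(h * w) - h := by
    rw [mul_assoc, mul_self_of_trace hw1 hw]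
    noncomm_ring
  rw [this]
  obtain ⟨a1, a2⟩ := hm
  obtain ⟨b1, b2⟩ := hn
  constructor
  · push_cast
    rw [← a1, ← b1, Prod.fst_sub, Prod.fst_neg, Quaternion.re_sub, Quaternion.re_neg]
    ring
  · push_cast
    rw [← a2, ← b2, Prod.snd_sub, Prod.snd_neg, Quaternion.re_sub, Quaternion.re_neg]
    ring

/-- If `I` and `I w` have traces `0` and `±1`, then `I` and its conjugate by `w` are orthogonal. -/
lemma HasIntTrace.conj {I w : H2} (hI1 : star I * I = 1) (hI : HasIntTrace I 0)
    (hw1 : star w * w = 1) (hw : HasIntTrace w (-1)) {n : ℤ} (hn : HasIntTrace (I * w) n)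
    (hn1 : n = 1 ∨ n = -1) :
    HasIntTrace (w * I * star w) 0 ∧ HasIntTrace (I * (w * I * star w)) 0 := by
  have hII : I * I = -1 := by
    have := hI1
    rw [hI.star_eq_neg, neg_mul] at this
    rw [← this, neg_neg]
  have h1 : I * w + star (I * w) = (n : H2) := by
    rw [add_star_eq, hn.1, hn.2, realPair_intCast]
  rw [star_mul, hI.star_eq_neg, star_of_trace hw] at h1
  have h2 : w * I = -I - I * w + n := by
    rw [← h1]
    noncomm_ring
  have hnI : (n : H2) * I = I * n := Int.cast_comm n I
  have hn2 : (n : ℝ) * n = 1 := by rcases hn1 with rfl | rfl <;> norm_num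
  have h3 : I * (w * I * star w) = star w + 1 - n * I - n * (I * w) := by
    rw [h2]
    have : I * ((-I - I * w + n) * star w)
        = -(I * I) * star w - I * I * (w * star w) + n * I * star w := by
      rw [hnI]
      noncomm_ring
    rw [this, hII, mul_star_eq_one hw1]
    nth_rewrite 2 [star_of_trace hw]
    noncomm_ring
  have hn3 (x : H2) : ((n : H2) * x).1.re = n * x.1.re ∧ ((n : H2) * x).2.re = n * x.2.re := by
    constructor <;> simp
  obtain ⟨i1, i2⟩ := hI
  obtain ⟨w1, w2⟩ := hw
  obtain ⟨n1, n2⟩ := hn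
  refine ⟨⟨?_, ?_⟩, ?_⟩
  · have : (w.1 * I.1 * star w.1).re = (star w.1 * w.1 * I.1).re := by simp; ring
    change 2 * (w.1 * I.1 * star w.1).re = _
    rw [this, star_mul_self_fst hw1, one_mul, i1]
  · have : (w.2 * I.2 * star w.2).re = (star w.2 * w.2 * I.2).re := by simp; ring
    change 2 * (w.2 * I.2 * star w.2).re = _
    rw [this, star_mul_self_snd hw1, one_mul, i2]
  · rw [h3]
    constructor
    · simp only [Prod.fst_sub, Prod.fst_add, Quaternion.re_sub, Quaternion.re_add, hn3,
        Prod.fst_star, Quaternion.re_star, Prod.fst_one, Quaternion.re_one]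
      push_cast at *
      linear_combination w1 - n * i1 - n * n1 - hn2
    · simp only [Prod.snd_sub, Prod.snd_add, Quaternion.re_sub, Quaternion.re_add, hn3,
        Prod.snd_star, Quaternion.re_star, Prod.snd_one, Quaternion.re_one]
      push_cast at *
      linear_combination w2 - n * i2 - n * n2 - hn2

/-- A symmetry that is not orthogonal to `1` and `w` is a power of `w` up to sign. -/
lemma mem_or_hasIntTrace_zero (hR : HasIntTraces R)
    (hframe : ∀ I ∈ R, ∀ J ∈ R, star I * I = 1 → star J * J = 1 → HasIntTrace I 0 →
      HasIntTrace J 0 → ¬HasIntTrace (I * J) 0) {w : H2} (hwR : w ∈ R) (hw1 : star w * w = 1)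
    (hw : HasIntTrace w (-1)) {h : H2} (hh : h ∈ R) (h1 : star h * h = 1) {S : Subring H2}
    (hS : w ∈ S) : h ∈ S ∨ (HasIntTrace h 0 ∧ HasIntTrace (h * w) 0) := by
  have hS' : star w ∈ S := by
    rw [star_of_trace hw]
    exact S.sub_mem (S.neg_mem S.one_mem) hS
  have hdown {x : H2} (hx : x * w ∈ S) : x ∈ S := by
    have := S.mul_mem hx hS'
    rwa [mul_assoc, mul_star_eq_one hw1, mul_one] at this
  have hno {I : H2} (hIR : I ∈ R) (hI1 : star I * I = 1) (hI : HasIntTrace I 0) {n : ℤ}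
      (hn : HasIntTrace (I * w) n) : ¬(n = 1 ∨ n = -1) := by
    intro hn1
    obtain ⟨c1, c2⟩ := hI.conj hI1 hw1 hw hn hn1
    exact hframe I hIR _ (R.mul_mem (R.mul_mem hwR hIR) (hR.star_mem w hwR)) hI1
      (star_mul_self_mul (star_mul_self_mul hw1 hI1) (star_star_mul_self hw1)) hI c1 c2
  have p1 := R.mul_mem hh hwR
  have p2 := R.mul_mem p1 hwR
  have u1 := star_mul_self_mul h1 hw1
  have u2 := star_mul_self_mul u1 hw1
  obtain ⟨m, hm⟩ := hR.exists_trace h hh h1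
  obtain ⟨n, hn⟩ := hR.exists_trace _ p1 u1
  have hl := HasIntTrace.mul_mul hw1 hw hm hn
  have hcyc : h * w * w * w = h := by
    rw [mul_assoc, mul_self_of_trace hw1 hw, mul_assoc, mul_sub, mul_neg,
      mul_self_of_trace hw1 hw]
    noncomm_ring
  obtain ⟨a1, a2⟩ := hm.bounds h1
  obtain ⟨b1, b2⟩ := hn.bounds u1
  obtain ⟨c1, c2⟩ := hl.bounds u2
  by_cases d0 : m = 2 ∨ m = -2
  · exact Or.inl (one_neg_one_mem S (hm.eq_one_or h1 d0))
  by_cases d1 : n = 2 ∨ n = -2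
  · exact Or.inl (hdown (one_neg_one_mem S (hn.eq_one_or u1 d1)))
  by_cases d2 : -m - n = 2 ∨ -m - n = -2
  · exact Or.inl (hdown (hdown (one_neg_one_mem S (hl.eq_one_or u2 d2))))
  -- The traces m, n, -m-n of h, hw, hw² add up to zero. If none is ±2 and not all vanish, one is 0
  -- and the next is ±1, which `hno` forbids because it would produce an anticommuting pair.
  by_cases e0 : m = 0
  · by_cases e1 : n = 0
    · exact Or.inr ⟨e0 ▸ hm, e1 ▸ hn⟩
    · exact absurd (by lia) (hno hh h1 (e0 ▸ hm) hn)
  · by_cases e1 : n = 0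
    · exact absurd (by lia) (hno p1 u1 (e1 ▸ hn) hl)
    · have e2 : -m - n = 0 := by lia
      exact absurd (by lia) (hno p2 u2 (e2 ▸ hl) (hcyc.symm ▸ hm))

lemma HasIntTrace.mul_comm_zero {h w : H2} (h0 : HasIntTrace h 0) (h1 : HasIntTrace (h * w) 0) :
    h * w = star w * h := by
  simp only [HasIntTrace, Int.cast_zero, mul_eq_zero, OfNat.ofNat_ne_zero, false_or] at h0 h1
  exact mul_eq_star_mul_of_re h0.1 h0.2 h1.1 h1.2

lemma re_realPair_mul (a b : ℝ) (v : H2) :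
    (realPair a b * v).1.re = a * v.1.re ∧ (realPair a b * v).2.re = b * v.2.re := by
  simp [Quaternion.coe_mul_eq_smul]

/-- The element ζ = (w+2)/√3, with opposite signs on the two sides, is a unit with ζ² = 1 + w and
traces ±√3. It need not come from a symmetry; it makes the lattice of order twelve available, whose
stabilizer contains w = ζ² - 1. As before, at most one further generator f occurs. -/
lemma exists_lattice_of_order_three (hR : HasIntTraces R)
    (hframe : ∀ I ∈ R, ∀ J ∈ R, star I * I = 1 → star J * J = 1 → HasIntTrace I 0 →
      HasIntTrace J 0 → ¬HasIntTrace (I * J) 0) {w : H2} (hwR : w ∈ R) (hw1 : star w * w = 1)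
    (hw : HasIntTrace w (-1)) :
    ∃ M : Submodule ℤ H2, IsEvenSelfDual (form ((3 - √3) / 6) ((3 + √3) / 6)) M ∧
      ∀ g ∈ R, star g * g = 1 → g ∈ stabilizer M := by
  have hr : √3 ^ 2 = (3 : ℝ) := Real.sq_sqrt (by norm_num)
  have hr0 : √3 ≠ (0 : ℝ) := by rw [Real.sqrt_ne_zero']; norm_num
  have hri : (√3)⁻¹ * (√3)⁻¹ = (1 / 3 : ℝ) := by rw [← mul_inv, ← sq, hr]; norm_num
  have hri' : (√3)⁻¹ * 3 = √3 := by field_simp; linarith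
  set t := realPair (√3)⁻¹ (-(√3)⁻¹) with ht
  have htt : t * t = realPair (1 / 3) (1 / 3) := by
    rw [ht, realPair_mul, neg_mul_neg, hri]
  have hcomm (x : H2) : t * x = x * t := realPair_comm _ _ x
  set ζ : H2 := t * (w + 2) with hζ_def
  have hstar2 : star (w + 2) = w * w + 2 := by
    rw [star_add, star_of_trace hw, mul_self_of_trace hw1 hw, star_ofNat]
    abel
  have h3 : (w * w + 2) * (w + 2) = 3 := by
    have e1 : (w * w + 2) * (w + 2) = (w * w) * w + 2 * (w * w) + 2 * w + 2 * 2 := by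
      noncomm_ring
    have e2 : w * w * w = 1 := by
      rw [mul_self_of_trace hw1 hw, sub_mul, neg_mul, mul_self_of_trace hw1 hw]
      noncomm_ring
    have e3 : 1 + 2 * (-w - 1) + 2 * w + 2 * 2 = (2 * 2 - 1 : H2) := by noncomm_ring
    rw [e1, e2, mul_self_of_trace hw1 hw, e3]
    norm_num
  have hthird : realPair (1 / 3) (1 / 3) * 3 = 1 := by
    have : (3 : H2) = realPair 3 3 := by
      have := realPair_intCast 3
      push_cast at this
      exact this.symm
    rw [this, realPair_mul, ← realPair_one]
    norm_num
  have hζ : star ζ * ζ = 1 := by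
    rw [hζ_def, star_mul, ht, star_realPair, ← ht, hstar2, ← hcomm, mul_assoc, ← mul_assoc _ t,
      ← hcomm, mul_assoc, h3, ← mul_assoc, htt, hthird]
  have hζζ : ζ * ζ = 1 + w := by
    have h4 : t * (w + 2) * (t * (w + 2)) = t * t * ((w + 2) * (w + 2)) := by
      rw [mul_assoc, ← mul_assoc (w + 2) t, ← hcomm (w + 2)]
      noncomm_ring
    have h5 : (w + 2) * (w + 2) = 3 * (1 + w) := by
      have : (w + 2) * (w + 2) = w * w + 2 * w + 2 * w + 2 * 2 := by noncomm_ring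
      rw [this, mul_self_of_trace hw1 hw]
      have : -w - 1 + 2 * w + 2 * w + 2 * 2 = (2 * 2 - 1) * 1 + (2 * 2 - 1) * w := by noncomm_ring
      rw [this, mul_add]
      norm_num
    rw [hζ_def, h4, h5, htt, ← mul_assoc, hthird, one_mul]
  obtain ⟨w1, w2⟩ := id hw
  have e1 (x : H2) : (x * ζ).1.re = (√3)⁻¹ * ((x * w).1.re + 2 * x.1.re) := by
    have : x * ζ = t * (x * w + x + x) := by
      rw [hζ_def, ← mul_assoc, ← hcomm, mul_assoc]
      noncomm_ring
    rw [this, ht, (re_realPair_mul _ _ _).1]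
    simp only [Prod.fst_add, Quaternion.re_add]
    ring
  have e2 (x : H2) : (x * ζ).2.re = -(√3)⁻¹ * ((x * w).2.re + 2 * x.2.re) := by
    have : x * ζ = t * (x * w + x + x) := by
      rw [hζ_def, ← mul_assoc, ← hcomm, mul_assoc]
      noncomm_ring
    rw [this, ht, (re_realPair_mul _ _ _).2]
    simp only [Prod.snd_add, Quaternion.re_add]
    ring
  have z1 : 2 * ζ.1.re = √3 := by
    have := e1 1
    simp only [one_mul, Prod.fst_one, Quaternion.re_one] at this
    rw [this]
    push_cast at w1
    linear_combination (√3)⁻¹ * w1 + hri'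
  have z2 : 2 * ζ.2.re = -√3 := by
    have := e2 1
    simp only [one_mul, Prod.snd_one, Quaternion.re_one] at this
    rw [this]
    push_cast at w2
    linear_combination -(√3)⁻¹ * w2 - hri'
  have hmem (M : Submodule ℤ H2) (hM : ζ ∈ stabilizer M) : w ∈ stabilizer M := by
    have : w = ζ * ζ - 1 := by rw [hζζ]; abel
    rw [this]
    exact sub_mem (mul_mem hM hM) (one_mem _)
  by_cases hex : ∃ f ∈ R, star f * f = 1 ∧ HasIntTrace f 0 ∧ HasIntTrace (f * w) 0
  · obtain ⟨f, hfR, hf1, hf, hf'⟩ := hex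
    have g1 := hf
    have g2 := hf'
    simp only [HasIntTrace, Int.cast_zero, mul_eq_zero, OfNat.ofNat_ne_zero, false_or] at g1 g2
    have y1 : (ζ * f).1.re = 0 := by
      have : (ζ * f).1.re = (f * ζ).1.re := by
        simp only [Prod.fst_mul, Quaternion.re_mul]
        ring
      rw [this, e1, g1.1, g2.1]
      ring
    have y2 : (ζ * f).2.re = 0 := by
      have : (ζ * f).2.re = (f * ζ).2.re := by
        simp only [Prod.snd_mul, Quaternion.re_mul]
        ring
      rw [this, e2, g1.2, g2.2]
      ring
    obtain ⟨M, hM, hMζ, hMf⟩ := exists_twelfth_lattice hr hζ z1 z2 hf1 g1.1 g1.2 y1 y2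
    refine ⟨M, hM, fun g hg hg1 => ?_⟩
    rcases mem_or_hasIntTrace_zero hR hframe hwR hw1 hw hg hg1 (hmem M hMζ) with h | h
    · exact h
    · rcases mem_or_hasIntTrace_zero hR hframe hwR hw1 hw (R.mul_mem hg hfR)
        (star_mul_self_mul hg1 hf1) (hmem M hMζ) with h' | h'
      · have := (stabilizer M).mul_mem h' (star_mem_stabilizer hM hMf)
        rwa [mul_assoc, mul_star_eq_one hf1, mul_one] at this
      · have := re_sq_eq_one_of_star_eq (star_mul_self_fst hw1) (congrArg Prod.fst
          (star_eq_of_mul_comm hw1 hg1 hf1 (h.1.mul_comm_zero h.2) (hf.mul_comm_zero hf')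
            (h'.1.mul_comm_zero h'.2)))
        push_cast at w1
        rw [show w.1.re = -1 / 2 by linarith] at this
        norm_num at this
  · obtain ⟨f1, a1, a2, a3⟩ := exists_orthogonal_unit ζ.1
    obtain ⟨f2, b1, b2, b3⟩ := exists_orthogonal_unit ζ.2
    obtain ⟨M, hM, hMζ, -⟩ := exists_twelfth_lattice (f := (f1, f2)) hr hζ z1 z2 (Prod.ext a1 b1)
      a2 b2 a3 b3
    refine ⟨M, hM, fun g hg hg1 => ?_⟩
    rcases mem_or_hasIntTrace_zero hR hframe hwR hw1 hw hg hg1 (hmem M hMζ) with h | h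
    · exact h
    · exact absurd ⟨g, hg, hg1, h⟩ hex

theorem HasIntTraces.exists_lattice (hR : HasIntTraces R) :
    ∃ (M : Submodule ℤ H2) (α β : ℝ), 0 < α ∧ 0 < β ∧ IsEvenSelfDual (form α β) M ∧
      ∀ g ∈ R, star g * g = 1 → g ∈ stabilizer M := by
  by_cases hframe : ∃ I ∈ R, ∃ J ∈ R, star I * I = 1 ∧ star J * J = 1 ∧ HasIntTrace I 0 ∧
      HasIntTrace J 0 ∧ HasIntTrace (I * J) 0
  · obtain ⟨I, hIR, J, hJR, hI1, hJ1, hI, hJ, hIJ⟩ := hframe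
    obtain ⟨M, hM, hM'⟩ := exists_lattice_of_frame hR hIR hJR hI1 hJ1 hI hJ hIJ
    exact ⟨M, 1, 1, one_pos, one_pos, hM, hM'⟩
  have hframe' : ∀ I ∈ R, ∀ J ∈ R, star I * I = 1 → star J * J = 1 → HasIntTrace I 0 →
      HasIntTrace J 0 → ¬HasIntTrace (I * J) 0 :=
    fun I hIR J hJR hI1 hJ1 hI hJ hIJ => hframe ⟨I, hIR, J, hJR, hI1, hJ1, hI, hJ, hIJ⟩
  by_cases hodd : ∃ w ∈ R, star w * w = 1 ∧ HasIntTrace w (-1)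
  · obtain ⟨w, hwR, hw1, hw⟩ := hodd
    obtain ⟨M, hM, hM'⟩ := exists_lattice_of_order_three hR hframe' hwR hw1 hw
    have h1 : √3 < 3 := by
      rw [Real.sqrt_lt' (by norm_num)]
      norm_num
    have h2 := Real.sqrt_nonneg 3
    exact ⟨M, _, _, by linarith, by linarith, hM, hM'⟩
  · obtain ⟨M, hM, hM'⟩ := exists_lattice_of_even_traces hR hframe'
      fun g hg hg1 hg2 => hodd ⟨g, hg, hg1, hg2⟩
    exact ⟨M, 1, 1, one_pos, one_pos, hM, hM'⟩

end

end TorusModel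
end

noncomputable section
namespace TorusModel
open scoped Quaternion

/-! ### Every Narain lattice has a mate -/

lemma isFullLattice_comap {E : Type*} [NormedAddCommGroup E] [NormedSpace ℝ E]
    (e : H2 ≃L[ℝ] E) (L : Submodule ℤ E) (hd : DiscreteTopology L)
    (hs : Submodule.span ℝ (L : Set E) = ⊤) :
    IsFullLattice (ZLattice.comap ℝ L e.toLinearMap) := by
  have : IsZLattice ℝ L := ⟨hs⟩
  exact ⟨inferInstance, (instIsZLatticeComap ℝ L e).span_top⟩

/-- The lattice with left and right exchanged. -/
def swapLattice (L : Submodule ℤ H2) : Submodule ℤ H2 :=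
  ZLattice.comap ℝ L (ContinuousLinearEquiv.prodComm ℝ ℍ[ℝ] ℍ[ℝ]).toLinearMap

section

variable {L Γ : Submodule ℤ H2} {α β : ℝ}

lemma mem_swapLattice {v : H2} : v ∈ swapLattice L ↔ v.swap ∈ L := Iff.rfl

lemma form_swap (v w : H2) : form α β v.swap w.swap = form β α v w := by
  simp only [form_apply, Prod.fst_swap, Prod.snd_swap]
  ring

lemma IsFullLattice.swap (hL : IsFullLattice L) : IsFullLattice (swapLattice L) :=
  isFullLattice_comap _ L hL.discrete hL.span_eq_top

lemma IsEvenSelfDual.swap (hL : IsEvenSelfDual (form α β) L) :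
    IsEvenSelfDual (form β α) (swapLattice L) := by
  refine ⟨fun v hv => ?_, fun v => ?_⟩
  · rw [← form_swap]
    exact hL.even _ hv
  · rw [mem_swapLattice, hL.selfDual]
    constructor
    · intro h w hw
      rw [← form_swap]
      exact h _ hw
    · intro h w hw
      have := h w.swap (by rwa [mem_swapLattice, Prod.swap_swap])
      rwa [← form_swap, Prod.swap_swap] at this

lemma mem_stabilizer_swapLattice {x : H2} :
    x ∈ stabilizer (swapLattice L) ↔ x.swap ∈ stabilizer L := by
  constructor
  · intro h v hv
    have := h v.swap (by rwa [mem_swapLattice, Prod.swap_swap])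
    rwa [mem_swapLattice, Prod.swap_mul, Prod.swap_swap] at this
  · intro h v hv
    rw [mem_swapLattice, Prod.swap_mul]
    exact h _ hv

/-- Otherwise a and b are consecutive integers, and combining (a,b) with an integer puts the
idempotent (0,1) in the stabilizer, so Γ would split. -/
lemma sub_sq_ne_one (hL : IsFullLattice Γ) (hΓ : IsEvenSelfDual (form 1 (-1)) Γ) {a b : ℝ}
    (h : realPair a b ∈ stabilizer Γ) : (a - b) ^ 2 ≠ 1 := by
  intro h1
  obtain ⟨s, hs⟩ := exists_int_add hL h
  obtain ⟨p, hp⟩ := exists_int_mul hL h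
  have hD : s ^ 2 - 4 * p = 1 := by
    have : ((s ^ 2 - 4 * p : ℤ) : ℝ) = 1 := by push_cast; rw [← hs, ← hp, ← h1]; ring
    exact_mod_cast this
  obtain ⟨k, hk⟩ : ∃ k, s = 2 * k + 1 := by
    rcases Int.even_or_odd s with ⟨k, rfl⟩ | ⟨k, rfl⟩
    · ring_nf at hD
      lia
    · exact ⟨k, rfl⟩
  have h01 := realPair_zero_one_notMem hL (by simpa using hΓ.neg)
  have hint (n : ℤ) : realPair n n ∈ stabilizer Γ := by
    rw [realPair_intCast]
    exact intCast_mem _ n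
  rw [hk] at hs
  push_cast at hs
  have hfac : (a - b - 1) * (a - b + 1) = 0 := by linear_combination h1
  rcases mul_eq_zero.1 hfac with h2 | h2
  · apply h01
    have := sub_mem (hint (k + 1)) h
    rw [sub_eq_add_neg, realPair_neg, realPair_add] at this
    convert this using 2 <;> push_cast <;> linarith
  · apply h01
    have := sub_mem h (hint k)
    rw [sub_eq_add_neg, realPair_neg, realPair_add] at this
    convert this using 2 <;> linarith

/-- Apart from four cases, both traces of a symmetry are equal. -/
lemma hasIntTrace_or (hL : IsFullLattice Γ) (hΓ : IsEvenSelfDual (form 1 (-1)) Γ)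
    (n1 : ¬∃ g ∈ stabilizer Γ, ∃ c : ℤ, (c + 2 * g.1.re) * (c + 2 * g.2.re) = -1)
    (n2 : ¬∃ g ∈ stabilizer Γ, star g * g = 1 ∧ (2 * g.1.re) ^ 2 = 3 ∧ 2 * g.2.re = -(2 * g.1.re))
    (n3 : realPair 1 (-1) ∉ stabilizer Γ) {g : H2} (hg : g ∈ stabilizer Γ)
    (hg1 : star g * g = 1) :
    (∃ n, HasIntTrace g n) ∨ ∃ h ∈ stabilizer Γ, star h * h = 1 ∧
      (g = h ∨ g = -h) ∧ (h.1 = 1 ∧ IsCubeRoot h.2 ∨ IsCubeRoot h.1 ∧ h.2 = 1) := by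
  have ht := trace_mem_stabilizer hΓ hg
  obtain ⟨s, hs⟩ := exists_int_add hL ht
  obtain ⟨p, hp⟩ := exists_int_mul hL ht
  have ha := re_sq_le_one (star_mul_self_fst hg1)
  have hb := re_sq_le_one (star_mul_self_snd hg1)
  have htr := tracePair_of_int hs hp (by linarith) (by linarith) (sub_sq_ne_one hL hΓ ht)
  have hng : star (-g) * -g = 1 := by simpa using hg1
  have one_mem' : realPair 1 1 ∈ stabilizer Γ := by
    rw [realPair_one]
    exact one_mem _
  have hn3 : realPair (-1) 1 ∉ stabilizer Γ := by
    intro h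
    apply n3
    have := neg_mem h
    rwa [realPair_neg, neg_neg] at this
  have root {h : H2} (hh1 : star h * h = 1) (h1 : 2 * h.1.re = 2)
      (h2 : 2 * h.2.re = -1) : h.1 = 1 ∧ IsCubeRoot h.2 :=
    ⟨eq_one_of_re (star_mul_self_fst hh1) (by linarith), star_mul_self_snd hh1, by linarith⟩
  have root' {h : H2} (hh1 : star h * h = 1) (h1 : 2 * h.1.re = -1)
      (h2 : 2 * h.2.re = 2) : IsCubeRoot h.1 ∧ h.2 = 1 :=
    ⟨⟨star_mul_self_fst hh1, by linarith⟩, eq_one_of_re (star_mul_self_snd hh1) (by linarith)⟩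
  have neg_re : 2 * (-g).1.re = -(2 * g.1.re) ∧ 2 * (-g).2.re = -(2 * g.2.re) := by
    simp
  generalize haa : 2 * g.1.re = a at *
  generalize hbb : 2 * g.2.re = b at *
  cases htr with
  | twist _ _ c h => exact absurd ⟨g, hg, c, by rw [haa, hbb]; exact h⟩ n1
  | sqrt_three _ h => exact absurd ⟨g, hg, hg1, by rw [haa]; exact h, by rw [hbb, haa]⟩ n2
  | diag i => exact Or.inl ⟨i, haa, hbb⟩
  | left_zero =>
    exfalso; apply n3
    have := sub_mem ht one_mem'
    rw [sub_eq_add_neg, realPair_neg, realPair_add] at this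
    norm_num at this; exact this
  | neg_left_zero =>
    exfalso; apply hn3
    have := add_mem ht one_mem'
    rw [realPair_add] at this
    norm_num at this; exact this
  | right_zero =>
    exfalso; apply hn3
    have := sub_mem ht one_mem'
    rw [sub_eq_add_neg, realPair_neg, realPair_add] at this
    norm_num at this; exact this
  | neg_right_zero =>
    exfalso; apply n3
    have := add_mem ht one_mem'
    rw [realPair_add] at this
    norm_num at this; exact this
  | left_one => exact Or.inr ⟨g, hg, hg1, Or.inl rfl, Or.inl (root hg1 haa hbb)⟩
  | neg_left_one =>
    exact Or.inr ⟨-g, neg_mem hg, hng, Or.inr (neg_neg g).symm,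
      Or.inl (root hng (by rw [neg_re.1]; norm_num) (by rw [neg_re.2]))⟩
  | right_one => exact Or.inr ⟨g, hg, hg1, Or.inl rfl, Or.inr (root' hg1 haa hbb)⟩
  | neg_right_one =>
    exact Or.inr ⟨-g, neg_mem hg, hng, Or.inr (neg_neg g).symm,
      Or.inr (root' hng (by rw [neg_re.1]) (by rw [neg_re.2]; norm_num))⟩
  | antidiag =>
    exfalso; apply n3
    have e1 := eq_one_of_re (star_mul_self_fst hg1) (by linarith)
    have e2 := eq_one_of_re (star_mul_self_snd hng) (by linarith)
    have : g = realPair 1 (-1) := by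
      refine Prod.ext (by rw [e1]; simp) ?_
      rw [Prod.snd_neg] at e2
      rw [← neg_neg g.2, e2]
      simp
    rwa [← this]
  | neg_antidiag =>
    exfalso; apply hn3
    have e1 := eq_one_of_re (star_mul_self_fst hng) (by linarith)
    have e2 := eq_one_of_re (star_mul_self_snd hg1) (by linarith)
    have : g = realPair (-1) 1 := by
      refine Prod.ext ?_ (by rw [e2]; simp)
      rw [Prod.fst_neg] at e1
      rw [← neg_neg g.1, e1]
      simp
    rwa [← this]

/-- The cases are taken in an order in which each may use the failure of the earlier ones. When no
twist, no √3, no (1,-1) and no (1,ω) occur, no symmetry (1,b) with b ≠ 1 is left; then any definite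
even unimodular lattice with the same symmetries is a mate. -/
theorem exists_isMate (hL : IsFullLattice Γ) (hΓ : IsEvenSelfDual (form 1 (-1)) Γ) :
    ∃ (M : Submodule ℤ H2) (α β : ℝ), IsMate Γ M α β := by
  by_cases n1 : ∃ g ∈ stabilizer Γ, ∃ c : ℤ, (c + 2 * g.1.re) * (c + 2 * g.2.re) = -1
  · obtain ⟨g, hg, c, hc⟩ := n1
    rcases lt_trichotomy 0 (c + 2 * g.1.re) with h | h | h
    · exact ⟨_, _, _, isMate_twist hL hΓ hg h hc⟩
    · rw [← h] at hc
      norm_num at hc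
    · have hneg : (2 * (-g).1.re = -(2 * g.1.re)) ∧ (2 * (-g).2.re = -(2 * g.2.re)) := by simp
      refine ⟨_, _, _, isMate_twist (c := -c) hL hΓ (neg_mem hg) ?_ ?_⟩
      · rw [hneg.1]; push_cast; linarith
      · rw [hneg.1, hneg.2]; push_cast; linarith
  by_cases n2 : ∃ g ∈ stabilizer Γ, star g * g = 1 ∧ (2 * g.1.re) ^ 2 = 3 ∧
      2 * g.2.re = -(2 * g.1.re)
  · obtain ⟨g, hg, hg1, h1, h2⟩ := n2
    exact exists_isMate_of_sqrt_three hL hΓ h1 hg hg1 rfl h2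
  by_cases n3 : realPair 1 (-1) ∈ stabilizer Γ
  · obtain ⟨M, hM⟩ := exists_isMate_of_two hL hΓ n3
    exact ⟨M, _, _, hM⟩
  by_cases n4 : ∃ ω : ℍ[ℝ], IsCubeRoot ω ∧ ((1, ω) : H2) ∈ stabilizer Γ
  · obtain ⟨ω, hω, h⟩ := n4
    obtain ⟨M, hM⟩ := exists_isMate_of_cubeRoot hL hΓ hω h
    exact ⟨M, _, _, hM⟩
  -- Equal traces force Re b = 1. Otherwise (1,b) is, up to sign, of the form (1,ω), which is
  -- excluded, or (ω,1), which is impossible because Re ω = -1/2.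
  have hfix {b : ℍ[ℝ]} (hb : b ≠ 1) (hbΓ : ((1, b) : H2) ∈ stabilizer Γ)
      (hb1 : star b * b = 1) : False := by
    have hg1 : star ((1, b) : H2) * (1, b) = 1 := Prod.ext (by simp) hb1
    rcases hasIntTrace_or hL hΓ n1 n2 n3 hbΓ hg1 with
      ⟨n, h1, h2⟩ | ⟨h, hh, -, hgh, ⟨a, c⟩ | ⟨a, -⟩⟩
    · refine hb (eq_one_of_re hb1 ?_)
      simp only [Quaternion.re_one] at h1 h2
      linarith
    · exact n4 ⟨h.2, c, by rw [← a]; exact hh⟩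
    · have h1 := a.re
      rcases hgh with rfl | hgh
      · norm_num at h1
      · rw [← neg_eq_iff_eq_neg.2 hgh] at h1
        norm_num at h1
  by_cases n5 : ∃ ω : ℍ[ℝ], IsCubeRoot ω ∧ ((ω, 1) : H2) ∈ stabilizer Γ
  · obtain ⟨ω, hω, h⟩ := n5
    have hneg : IsEvenSelfDual (form (-1) 1) Γ := by simpa using hΓ.neg
    obtain ⟨M, hM⟩ := exists_isMate_of_cubeRoot hL.swap hneg.swap hω
      (mem_stabilizer_swapLattice.2 h)
    refine ⟨swapLattice M, 1, 1, one_pos, one_pos, hM.evenSelfDual.swap, fun g hg hg1 => ?_,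
      fun b hb hbΓ hb1 => (hfix hb hbΓ hb1).elim⟩
    rw [mem_stabilizer_swapLattice]
    refine hM.stable _ (mem_stabilizer_swapLattice.2 (by rwa [Prod.swap_swap])) ?_
    exact Prod.ext (star_mul_self_snd hg1) (star_mul_self_fst hg1)
  have hR : HasIntTraces (stabilizer Γ) := by
    refine ⟨fun x hx => star_mem_stabilizer hΓ hx, fun g hg hg1 => ?_⟩
    rcases hasIntTrace_or hL hΓ n1 n2 n3 hg hg1 with h | ⟨h, hh, -, -, ⟨a, b⟩ | ⟨a, b⟩⟩
    · exact h
    · exact absurd ⟨h.2, b, by rw [← a]; exact hh⟩ n4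
    · exact absurd ⟨h.1, a, by rw [← b]; exact hh⟩ n5
  obtain ⟨M, α, β, hα, hβ, hM, hs⟩ := hR.exists_lattice
  exact ⟨M, α, β, hα, hβ, hM, hs, fun b hb hbΓ hb1 => (hfix hb hbΓ hb1).elim⟩

end

end TorusModel
end

noncomputable section
namespace TorusModel
open scoped Quaternion

/-! ### Quaternionic coordinates -/

/-- The quaternion `x₀ + j x₁`. -/
def toQuat (x : FourSpace) : ℍ[ℝ] := ⟨(x 0).re, (x 0).im, (x 1).re, -(x 1).im⟩

@[simp] lemma re_toQuat (x : FourSpace) : (toQuat x).re = (x 0).re := rfl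
@[simp] lemma imI_toQuat (x : FourSpace) : (toQuat x).imI = (x 0).im := rfl
@[simp] lemma imJ_toQuat (x : FourSpace) : (toQuat x).imJ = (x 1).re := rfl
@[simp] lemma imK_toQuat (x : FourSpace) : (toQuat x).imK = -(x 1).im := rfl

def quatEquiv : FourSpace ≃L[ℝ] ℍ[ℝ] :=
  LinearEquiv.toContinuousLinearEquiv
    { toFun := toQuat
      map_add' := fun x y => by ext <;> simp; ring
      map_smul' := fun c x => by ext <;> simp
      invFun := fun q => ![⟨q.re, q.imI⟩, ⟨q.imJ, -q.imK⟩]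
      left_inv := fun x => by
        funext i
        fin_cases i <;> apply Complex.ext <;> simp
      right_inv := fun q => by ext <;> simp }

@[simp] lemma re_quatEquiv (x : FourSpace) : (quatEquiv x).re = (x 0).re := rfl
@[simp] lemma imI_quatEquiv (x : FourSpace) : (quatEquiv x).imI = (x 0).im := rfl
@[simp] lemma imJ_quatEquiv (x : FourSpace) : (quatEquiv x).imJ = (x 1).re := rfl
@[simp] lemma imK_quatEquiv (x : FourSpace) : (quatEquiv x).imK = -(x 1).im := rfl

lemma dot_eq_re (x y : FourSpace) : dot x y = (quatEquiv x * star (quatEquiv y)).re := by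
  simp [dot, Fin.sum_univ_two]
  ring

/-- The unit quaternion of a matrix in `SU(2)`. -/
def quat (A : SU2) : ℍ[ℝ] := quatEquiv fun i => A.1 i 0

/-- The conjugate transpose and the adjugate are both the inverse. -/
lemma SU2.entries (A : SU2) : A.1 1 1 = conj (A.1 0 0) ∧ A.1 0 1 = -conj (A.1 1 0) := by
  have h1 : star A.1 * A.1 = 1 :=
    Matrix.mem_unitaryGroup_iff'.1 (Matrix.specialUnitaryGroup_le_unitaryGroup A.2)
  have h2 : A.1.det = 1 := (Matrix.mem_specialUnitaryGroup_iff.1 A.2).2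
  have h3 : A.1 * A.1.adjugate = 1 := by rw [Matrix.mul_adjugate, h2, one_smul]
  have h4 : star A.1 = A.1.adjugate := left_inv_eq_right_inv h1 h3
  rw [Matrix.adjugate_fin_two] at h4
  have h5 := congrFun (congrFun h4 0) 0
  have h6 := congrFun (congrFun h4 0) 1
  simp at h5 h6
  exact ⟨h5.symm, by rw [h6, neg_neg]⟩

lemma quatEquiv_mulVec (A : SU2) (x : FourSpace) :
    quatEquiv (A.1.mulVec x) = quat A * quatEquiv x := by
  obtain ⟨h1, h2⟩ := SU2.entries A
  ext <;> simp [quat, h1, h2] <;> ring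

lemma quat_star_mul_self (A : SU2) : star (quat A) * quat A = 1 := by
  obtain ⟨h1, h2⟩ := SU2.entries A
  have h3 : A.1.det = 1 := (Matrix.mem_specialUnitaryGroup_iff.1 A.2).2
  rw [Matrix.det_fin_two, h1, h2] at h3
  have h4 := congrArg Complex.re h3
  simp at h4
  ext <;> simp [quat] <;> linarith

lemma quat_eq_one_iff {A : SU2} : quat A = 1 ↔ A = 1 := by
  constructor
  · intro h
    have h1 : ∀ x, A.1.mulVec x = x := fun x => quatEquiv.injective (by
      rw [quatEquiv_mulVec, h, one_mul])
    refine Subtype.ext (Matrix.ext_of_mulVec_single fun i => ?_)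
    rw [h1]
    exact (Matrix.one_mulVec _).symm
  · rintro rfl
    ext <;> simp [quat]

/-- ℍ has no zero divisors, so a unit other than 1 fixes only 0. -/
lemma quat_mul_eq_self {A : SU2} (hA : A ≠ 1) {x : FourSpace} (h : A.1.mulVec x = x) : x = 0 := by
  have h1 := congrArg quatEquiv h
  rw [quatEquiv_mulVec] at h1
  have h2 : (quat A - 1) * quatEquiv x = 0 := by rw [sub_mul, h1, one_mul, sub_self]
  rcases mul_eq_zero.1 h2 with h3 | h3
  · exact absurd (quat_eq_one_iff.1 (sub_eq_zero.1 h3)) hA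
  · simpa using h3

def ambientEquiv : Ambient ≃L[ℝ] H2 := quatEquiv.prodCongr quatEquiv

lemma ambientEquiv_apply (v : Ambient) : ambientEquiv v = (quatEquiv v.1, quatEquiv v.2) := rfl

def quatPair (g : SU2 × SU2) : H2 := (quat g.1, quat g.2)

lemma ambientEquiv_act (g : SU2 × SU2) (v : Ambient) :
    ambientEquiv (act g v) = quatPair g * ambientEquiv v :=
  Prod.ext (quatEquiv_mulVec _ _) (quatEquiv_mulVec _ _)

lemma quatPair_star_mul_self (g : SU2 × SU2) : star (quatPair g) * quatPair g = 1 :=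
  Prod.ext (quat_star_mul_self _) (quat_star_mul_self _)

lemma form_ambientEquiv (α β : ℝ) (v w : Ambient) :
    form α β (ambientEquiv v) (ambientEquiv w) = α * dot v.1 w.1 + β * dot v.2 w.2 := by
  rw [form_apply, dot_eq_re, dot_eq_re]
  rfl

lemma dot_self_eq (x : FourSpace) : dot x x = Quaternion.normSq (quatEquiv x) := by
  rw [dot_eq_re, Quaternion.self_mul_star]
  simp

lemma dot_self_nonneg (x : FourSpace) : 0 ≤ dot x x := by
  rw [dot_self_eq]
  exact Quaternion.normSq_nonneg

lemma dot_self_eq_zero {x : FourSpace} : dot x x = 0 ↔ x = 0 := by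
  rw [dot_self_eq, Quaternion.normSq_eq_zero]
  simp

/-- The Euclidean form as a bilinear form. -/
def euclideanBilin : Ambient →ₗ[ℝ] Ambient →ₗ[ℝ] ℝ :=
  (form 1 1).compl₁₂ ambientEquiv.toLinearMap ambientEquiv.toLinearMap

lemma euclideanBilin_apply (v w : Ambient) : euclideanBilin v w = euclideanForm v w := by
  have := form_ambientEquiv 1 1 v w
  rw [one_mul, one_mul] at this
  exact this

lemma isE8Lattice_of_evenSelfDual {Λ : Submodule ℤ Ambient}
    (h : IsEvenSelfDual euclideanBilin Λ) : IsE8Lattice Λ := by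
  obtain ⟨b, hb⟩ := exists_cartan_basis_of_even_selfDual (B := euclideanBilin)
    (by rw [ambientEquiv.toLinearEquiv.finrank_eq, finrank_H2])
    (fun v w => by
      rw [euclideanBilin_apply, euclideanBilin_apply]
      simp only [euclideanForm, dot_eq_re]
      simp
      ring)
    (fun v hv => by
      rw [euclideanBilin_apply, euclideanForm]
      rcases (dot_self_nonneg v.1).lt_or_eq with h1 | h1
      · linarith [dot_self_nonneg v.2]
      · rcases (dot_self_nonneg v.2).lt_or_eq with h2 | h2
        · linarith
        · exact absurd (Prod.ext (dot_self_eq_zero.1 h1.symm) (dot_self_eq_zero.1 h2.symm)) hv)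
    Λ h.even h.selfDual
  exact ⟨b, fun i j => by rw [← hb, euclideanBilin_apply]⟩

lemma discreteTopology_of_evenSelfDual {Λ : Submodule ℤ Ambient}
    (h : IsEvenSelfDual euclideanBilin Λ) : DiscreteTopology Λ := by
  refine discreteTopology_iff_isOpen_singleton_zero.2 ?_
  have hc : Continuous fun k : Λ => euclideanForm (k : Ambient) k := by
    unfold euclideanForm dot
    fun_prop
  convert isOpen_lt hc (continuous_const (y := (2 : ℝ))) using 1
  ext k
  simp only [Set.mem_singleton_iff, Set.mem_ofPred_eq]
  constructor
  · rintro rfl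
    simp [euclideanForm, dot]
  · intro hk
    obtain ⟨n, hn⟩ := h.even k k.2
    rw [euclideanBilin_apply] at hn
    have h1 := dot_self_nonneg (k : Ambient).1
    have h2 := dot_self_nonneg (k : Ambient).2
    have h3 : euclideanForm (k : Ambient) k = 0 := by
      have h4 : (n : ℝ) < 1 := by linarith
      have h5 : (-1 : ℝ) < n := by
        unfold euclideanForm at hn
        linarith
      have h4' : n < 1 := by exact_mod_cast h4
      have h5' : -1 < n := by exact_mod_cast h5
      rw [hn, show n = 0 by lia]
      simp
    unfold euclideanForm at h3
    exact Subtype.ext (Prod.ext (dot_self_eq_zero.1 (by linarith)) (dot_self_eq_zero.1 (by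
        linarith)))

/-- The mate in ℍ × ℍ is rescaled by (√α, √β), which makes its form Euclidean. Real pairs are
central, so rescaling respects the symmetries. -/
theorem exists_e8_lattice {Γ : Submodule ℤ Ambient} (hΓ : IsNarainLattice Γ) :
    ∃ Λ : Submodule ℤ Ambient, IsEvenSelfDual euclideanBilin Λ ∧ G0 Γ ≤ latticeSymmetries Λ ∧
      ∀ g ∈ G0 Γ, g.2 ≠ 1 → ∀ v, act g v = v → v.2 = 0 ∧ (v ∈ Λ ↔ v ∈ Γ) := by
  set Γ' : Submodule ℤ H2 := ZLattice.comap ℝ Γ ambientEquiv.symm.toLinearMap with hΓ'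
  have hmem' (v : Ambient) : ambientEquiv v ∈ Γ' ↔ v ∈ Γ := by
    change ambientEquiv.symm (ambientEquiv v) ∈ Γ ↔ _
    rw [ContinuousLinearEquiv.symm_apply_apply]
  have hL : IsFullLattice Γ' := isFullLattice_comap _ _ hΓ.discrete hΓ.span_eq_top
  have hform (v w : Ambient) :
      form 1 (-1) (ambientEquiv v) (ambientEquiv w) = narainForm v w := by
    rw [form_ambientEquiv, narainForm]
    ring
  have hself : IsEvenSelfDual (form 1 (-1)) Γ' := by
    refine ⟨fun v hv => ?_, fun v => ?_⟩
    · obtain ⟨v, rfl⟩ := ambientEquiv.surjective v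
      rw [hform]
      exact hΓ.even v ((hmem' v).1 hv)
    · obtain ⟨v, rfl⟩ := ambientEquiv.surjective v
      rw [hmem', hΓ.selfDual]
      constructor
      · intro h w hw
        obtain ⟨w, rfl⟩ := ambientEquiv.surjective w
        rw [hform]
        exact h w ((hmem' w).1 hw)
      · intro h w hw
        rw [← hform]
        exact h _ ((hmem' w).2 hw)
  have hstab {g : SU2 × SU2} (hg : g ∈ G0 Γ) : quatPair g ∈ stabilizer Γ' := by
    intro v hv
    obtain ⟨v, rfl⟩ := ambientEquiv.surjective v
    rw [← ambientEquiv_act, hmem']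
    exact (hg v).2 ((hmem' v).1 hv)
  obtain ⟨M, α, β, hM⟩ := exists_isMate hL hself
  have hα := Real.sqrt_pos.2 hM.pos_left
  have hβ := Real.sqrt_pos.2 hM.pos_right
  have hα2 := Real.sq_sqrt hM.pos_left.le
  have hβ2 := Real.sq_sqrt hM.pos_right.le
  set r : H2 := realPair (√α)⁻¹ (√β)⁻¹ with hr
  set s : H2 := realPair (√α) (√β) with hs
  have hrs : r * s = 1 := by
    rw [hr, hs, realPair_mul, inv_mul_cancel₀ hα.ne', inv_mul_cancel₀ hβ.ne', realPair_one]
  let φ : Ambient →ₗ[ℝ] H2 := LinearMap.mulLeft ℝ r ∘ₗ ambientEquiv.toLinearMap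
  have hφ (v : Ambient) : φ v = r * ambientEquiv v := rfl
  have hφs (w : H2) : ∃ v, φ v = w :=
    ⟨ambientEquiv.symm (s * w), by
      rw [hφ, ContinuousLinearEquiv.apply_symm_apply, ← mul_assoc, hrs, one_mul]⟩
  have hφform (v w : Ambient) : form α β (φ v) (φ w) = euclideanBilin v w := by
    rw [hφ, hφ, form_realPair_mul, form_symm, form_realPair_mul, form_ambientEquiv,
      euclideanBilin_apply, euclideanForm]
    have e1 : α * (√α)⁻¹ * (√α)⁻¹ = 1 := by
      rw [← hα2, Real.sqrt_sq hα.le]; field_simp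
    have e2 : β * (√β)⁻¹ * (√β)⁻¹ = 1 := by
      rw [← hβ2, Real.sqrt_sq hβ.le]; field_simp
    rw [e1, e2, one_mul, one_mul, dot_eq_re, dot_eq_re, dot_eq_re, dot_eq_re]
    simp
    ring
  let Λ : Submodule ℤ Ambient := ZLattice.comap ℝ M φ
  have hmem (v : Ambient) : v ∈ Λ ↔ φ v ∈ M := Iff.rfl
  have hle : G0 Γ ≤ latticeSymmetries Λ := by
    have key {g : SU2 × SU2} (hg : g ∈ G0 Γ) {v : Ambient} (hv : v ∈ Λ) : act g v ∈ Λ := by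
      rw [hmem, hφ, ambientEquiv_act, ← mul_assoc, hr, realPair_comm, ← hr, mul_assoc, ← hφ]
      exact hM.stable _ (hstab hg) (quatPair_star_mul_self g) _ hv
    intro g hg v
    refine ⟨fun h => ?_, fun h => key hg h⟩
    have := key ((G0 Γ).inv_mem hg) h
    rwa [← act_mul, inv_mul_cancel, act_one] at this
  refine ⟨Λ, ⟨fun v hv => ?_, fun v => ?_⟩, hle, fun g hg hg2 v hv => ?_⟩
  · rw [← hφform]
    exact hM.evenSelfDual.even _ hv
  · rw [hmem, hM.evenSelfDual.selfDual]
    constructor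
    · intro h w hw
      rw [← hφform]
      exact h _ hw
    · intro h w hw
      obtain ⟨w, rfl⟩ := hφs w
      rw [hφform]
      exact h w hw
  · have h2 : v.2 = 0 := quat_mul_eq_self hg2 (congrArg Prod.snd hv)
    refine ⟨h2, ?_⟩
    obtain ⟨v, w⟩ := v
    obtain rfl : w = 0 := h2
    by_cases hg1 : g.1 = 1
    · have hg' : ((1, quat g.2) : H2) ∈ stabilizer Γ' := by
        have := hstab hg
        rwa [quatPair, hg1, quat_eq_one_iff.2 rfl] at this
      have hfix := hM.fixed (quat g.2) (fun h => hg2 (quat_eq_one_iff.1 h)) hg'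
        (quat_star_mul_self _)
      have he (x : FourSpace) : ambientEquiv (x, 0) = (quatEquiv x, 0) := by
        rw [ambientEquiv_apply, map_zero]
      have hφ0 (x : FourSpace) : φ (x, 0) = ((√α)⁻¹ • quatEquiv x, 0) := by
        rw [hφ, he, hr, realPair]
        refine Prod.ext ?_ ?_
        · exact Quaternion.coe_mul_eq_smul _ _
        · simp
      rw [hmem, hφ0, (hfix _).1, ← hmem', he]
      -- If α ≠ 1, the norm condition of the mate leaves no nonzero left-moving vector in Γ, so the
      -- rescaling does no harm.
      by_cases h1 : α = 1
      · rw [h1, Real.sqrt_one, inv_one, one_smul]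
      · have hzero {x : ℍ[ℝ]} (hx : ((x, 0) : H2) ∈ Γ') : x = 0 := by
          have := (hfix x).2 hx
          rw [← Quaternion.normSq_eq_zero]
          by_contra hne
          exact h1 (mul_right_cancel₀ hne (by rw [this, one_mul]))
        constructor
        · intro h
          have := hzero h
          rw [smul_eq_zero_iff_right (inv_ne_zero hα.ne')] at this
          rw [this]
          exact zero_mem _
        · intro h
          rw [hzero h, smul_zero]
          exact zero_mem _
    · obtain rfl : v = 0 := quat_mul_eq_self hg1 (congrArg Prod.fst hv)
      exact ⟨fun _ => zero_mem _, fun _ => zero_mem _⟩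

end TorusModel
end

noncomputable section
namespace TorusModel

/-! ### Traces on joint eigenspaces -/

section

variable {ι κ V : Type*} [AddCommGroup V] [Module ℂ V] (b : Module.Basis ι ℂ V)

lemma repr_of_diagonal {S : V →ₗ[ℂ] V} {σ : ι → ℂ} (hS : ∀ x, S (b x) = σ x • b x) (v : V)
    (x : ι) : b.repr (S v) x = σ x * b.repr v x := by
  have h : (Finsupp.lapply x ∘ₗ b.repr.toLinearMap) ∘ₗ S
      = σ x • (Finsupp.lapply x ∘ₗ b.repr.toLinearMap) := by
    refine b.ext fun y => ?_
    by_cases hxy : y = x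
    · subst hxy
      simp [hS]
    · simp [hS, hxy]
  exact LinearMap.congr_fun h v

/-- A joint eigenspace of operators diagonal in `b` is spanned by the basis vectors with the right
eigenvalues. `T` sends basis vectors to multiples of basis vectors, and only those it keeps in place
enter the trace. -/
theorem trace_restrict_eq_sum {T : V →ₗ[ℂ] V} {c : ι → ℂ} {π : ι → ι} [DecidableEq ι]
    (hT : ∀ x, T (b x) = c x • b (π x)) {P : Set κ} {S : κ → V →ₗ[ℂ] V} {σ : ι → κ → ℂ}
    (hS : ∀ p x, S p (b x) = σ x p • b x) {χ : κ → ℂ} {W : Submodule ℂ V}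
    (hW : ∀ v, v ∈ W ↔ ∀ p ∈ P, S p v = χ p • v) (hTW : ∀ v ∈ W, T v ∈ W) {s : Finset ι}
    (hs : ∀ x, x ∈ s ↔ ∀ p ∈ P, σ x p = χ p) :
    LinearMap.trace ℂ _ (T.restrict hTW) = ∑ x ∈ s, if π x = x then c x else 0 := by
  have hspan : W = Submodule.span ℂ (Set.range fun x : s => b x) := by
    have hr : (Set.range fun x : s => b x) = b '' s := by
      ext v
      simp
    rw [hr]
    ext w
    rw [b.mem_span_image, hW]
    constructor
    · intro hw y hy
      rw [Finset.mem_coe, hs]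
      intro p hp
      have h1 := repr_of_diagonal b (hS p) w y
      rw [hw p hp, map_smul, Finsupp.smul_apply, smul_eq_mul] at h1
      exact (mul_right_cancel₀ (Finsupp.mem_support_iff.1 hy) h1).symm
    · intro hw p hp
      refine b.repr.injective (Finsupp.ext fun y => ?_)
      rw [repr_of_diagonal b (hS p), map_smul, Finsupp.smul_apply, smul_eq_mul]
      by_cases hy : b.repr w y = 0
      · rw [hy, mul_zero, mul_zero]
      · rw [(hs y).1 (hw (Finsupp.mem_support_iff.2 hy)) p hp]
  have hli : LinearIndependent ℂ fun x : s => b x := b.linearIndependent.comp _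
      Subtype.val_injective
  let bW : Module.Basis s ℂ W := (Module.Basis.span hli).map (LinearEquiv.ofEq _ _ hspan.symm)
  have hbW (x : s) : (bW x : V) = b x := by
    simp [bW, Module.Basis.span_apply]
  have hrepr (w : W) (x : s) : bW.repr w x = b.repr w x := by
    have h : Finsupp.lapply x ∘ₗ bW.repr.toLinearMap
        = (Finsupp.lapply (x : ι) ∘ₗ b.repr.toLinearMap) ∘ₗ W.subtype := by
      refine bW.ext fun y => ?_
      simp only [LinearMap.comp_apply, LinearEquiv.coe_coe, Finsupp.lapply_apply,
        Module.Basis.repr_self, Submodule.subtype_apply, hbW]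
      by_cases hyx : y = x
      · rw [hyx, Finsupp.single_eq_same, Finsupp.single_eq_same]
      · rw [Finsupp.single_eq_of_ne (Ne.symm hyx), Finsupp.single_eq_of_ne
          fun h => hyx (Subtype.ext h.symm)]
    exact LinearMap.congr_fun h w
  rw [LinearMap.trace_eq_matrix_trace ℂ bW, Matrix.trace, ← Finset.sum_coe_sort s]
  refine Finset.sum_congr rfl fun x _ => ?_
  rw [Matrix.diag_apply, LinearMap.toMatrix_apply, hrepr, LinearMap.coe_restrict_apply, hbW, hT,
    map_smul, Module.Basis.repr_self, Finsupp.smul_apply, Finsupp.single_apply]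
  simp

end

/-! ### The basis of the Fock space -/

lemma map_exteriorAlgebra_basis {I R M : Type*} [LinearOrder I] [CommRing R] [AddCommGroup M]
    [Module R M] (b : Module.Basis I R M) {f : M →ₗ[R] M} (d : I → R)
    (hf : ∀ i, f (b i) = d i • b i) (s : Finset I) :
    ExteriorAlgebra.map f (b.ExteriorAlgebra s) = (∏ i ∈ s, d i) • b.ExteriorAlgebra s := by
  let t : Set.powersetCard I s.card := Set.powersetCard.ofCard rfl
  let φ : Fin s.card ↪o I := Set.powersetCard.ofFinEmbEquiv.symm t
  have hbasis : b.ExteriorAlgebra s = ExteriorAlgebra.ιMulti R s.card (b ∘ φ) :=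
    ExteriorAlgebra.basis_apply_ofCard b rfl
  have hmap : Finset.univ.map φ.toEmbedding = s := by
    ext x
    have h := Set.powersetCard.mem_range_ofFinEmbEquiv_symm_iff_mem t x
    rw [Finset.mem_map]
    constructor
    · rintro ⟨y, -, hy⟩
      exact h.1 ⟨y, hy⟩
    · intro hx
      obtain ⟨y, hy⟩ := h.2 hx
      exact ⟨y, Finset.mem_univ _, hy⟩
  have h1 : f ∘ b ∘ φ = fun i => d (φ i) • (b ∘ φ) i := funext fun i => hf (φ i)
  rw [hbasis, ExteriorAlgebra.map_apply_ιMulti, h1, AlternatingMap.map_smul_univ]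
  congr 1
  conv_rhs => rw [← hmap, Finset.prod_map]
  rfl

/-- A fermionic creation operator. -/
abbrev FermionIndex := FermionMode × Fin 2

/-- A bosonic creation operator. -/
abbrev BosonIndex := BosonMode × Fin 2

/-- The occupation numbers of a state of the oscillators. -/
abbrev Occupation := Finset FermionIndex × (BosonIndex →₀ ℕ)

-- An arbitrary order, needed only to index a basis of the exterior algebra by finite sets.
@[reducible] def fermionOrder : LinearOrder FermionIndex :=
  Classical.choice ⟨IsWellOrder.linearOrder WellOrderingRel⟩

def fermionBasis : Module.Basis (Finset FermionIndex) ℂ FermionSpace :=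
  letI := fermionOrder
  (Finsupp.basisSingleOne (R := ℂ) (ι := FermionIndex)).ExteriorAlgebra

lemma fermionOneParticle_diagonal (d : FermionMode → Fin 2 → ℂ) (x : FermionIndex) :
    fermionOneParticle (fun m => Matrix.diagonal (d m)) (Finsupp.single x 1)
      = d x.1 x.2 • Finsupp.single x 1 := by
  obtain ⟨m, i⟩ := x
  fin_cases i <;> simp [fermionOneParticle, Fin.sum_univ_two]

lemma fermionOp_diagonal (d : FermionMode → Fin 2 → ℂ) (F : Finset FermionIndex) :
    fermionOp (fun m => Matrix.diagonal (d m)) (fermionBasis F)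
      = (∏ x ∈ F, d x.1 x.2) • fermionBasis F := by
  let := fermionOrder
  exact map_exteriorAlgebra_basis _ (fun x => d x.1 x.2) (fun x => by
    rw [Finsupp.coe_basisSingleOne]
    exact fermionOneParticle_diagonal d x) F

lemma bosonOp_diagonal (d : BosonMode → Fin 2 → ℂ) (n : BosonIndex →₀ ℕ) :
    bosonOp (fun m => Matrix.diagonal (d m)) (MvPolynomial.basisMonomials BosonIndex ℂ n)
      = (n.prod fun x k => d x.1 x.2 ^ k) • MvPolynomial.basisMonomials BosonIndex ℂ n := by
  rw [MvPolynomial.coe_basisMonomials, bosonOp, AlgHom.toLinearMap_apply,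
    MvPolynomial.aeval_monomial, map_one, one_mul]
  have h (x : BosonIndex) : (∑ i, MvPolynomial.C (Matrix.diagonal (d x.1) i x.2) *
      (MvPolynomial.X (x.1, i) : BosonSpace)) = MvPolynomial.C (d x.1 x.2) * MvPolynomial.X x := by
    obtain ⟨m, i⟩ := x
    fin_cases i <;> simp [Fin.sum_univ_two]
  simp only [h, mul_pow, Finsupp.prod_mul]
  rw [MvPolynomial.monomial_eq, map_one, one_mul, MvPolynomial.smul_eq_C_mul, map_finsuppProd]
  simp

def fockBasis (L : Submodule ℤ Ambient) :
    Module.Basis (L × Occupation) ℂ (StateSpace L) :=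
  (Finsupp.basisSingleOne (R := ℂ) (ι := L)).tensorProduct
    (fermionBasis.tensorProduct (MvPolynomial.basisMonomials BosonIndex ℂ))

end TorusModel
end

noncomputable section
namespace TorusModel

/-! ### Diagonalization of the symmetries -/

/-- If v is an eigenvector for μ, then (-v̄₁, v̄₀) is one for μ̄, and the two columns have
determinant |v|². -/
lemma exists_diagonalization (A : SU2) :
    ∃ (U V : Matrix (Fin 2) (Fin 2) ℂ) (d : Fin 2 → ℂ), U * V = 1 ∧ V * U = 1 ∧
      A.1 * U = U * Matrix.diagonal d ∧ ∀ i, ‖d i‖ = 1 := by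
  obtain ⟨h1, h2⟩ := SU2.entries A
  obtain ⟨μ, hμ⟩ := Module.End.exists_eigenvalue (Matrix.toLin' A.1)
  obtain ⟨v, hv⟩ := hμ.exists_hasEigenvector
  have hv1 : A.1.mulVec v = μ • v := by
    rw [← Matrix.toLin'_apply]
    exact hv.apply_eq_smul
  have hv0 : v ≠ 0 := hv.2
  have e0 : A.1 0 0 * v 0 + A.1 0 1 * v 1 = μ * v 0 := by
    have := congrFun hv1 0
    simpa [Matrix.mulVec, dotProduct, Fin.sum_univ_two] using this
  have e1 : A.1 1 0 * v 0 + A.1 1 1 * v 1 = μ * v 1 := by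
    have := congrFun hv1 1
    simpa [Matrix.mulVec, dotProduct, Fin.sum_univ_two] using this
  rw [h2] at e0
  rw [h1] at e1
  have hdot : dot v v ≠ 0 := fun h => hv0 (dot_self_eq_zero.1 h)
  have hμ1 : ‖μ‖ = 1 := by
    have h3 := dot_mulVec A v
    rw [hv1] at h3
    have h4 : dot (μ • v) (μ • v) = ‖μ‖ ^ 2 * dot v v := by
      rw [← Complex.normSq_eq_norm_sq, Complex.normSq_apply]
      simp [dot, Fin.sum_univ_two]
      ring
    rw [h4] at h3
    have h5 : ‖μ‖ ^ 2 = 1 := mul_right_cancel₀ hdot (by rw [h3, one_mul])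
    nlinarith [norm_nonneg μ]
  set U : Matrix (Fin 2) (Fin 2) ℂ := !![v 0, -conj (v 1); v 1, conj (v 0)] with hU
  have hdet : U.det = (dot v v : ℂ) := by
    rw [Matrix.det_fin_two]
    apply Complex.ext <;> simp [hU, dot, Fin.sum_univ_two] <;> ring
  have hunit : IsUnit U.det := by
    rw [hdet]
    exact isUnit_iff_ne_zero.2 (by exact_mod_cast hdot)
  refine ⟨U, U⁻¹, ![μ, conj μ], Matrix.mul_nonsing_inv U hunit, Matrix.nonsing_inv_mul U hunit,
    ?_, ?_⟩
  · have c0 := congrArg conj e0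
    have c1 := congrArg conj e1
    simp only [map_add, map_mul, map_neg, Complex.conj_conj] at c0 c1
    ext i j
    fin_cases i <;> fin_cases j <;> simp [hU, Matrix.mul_apply, Fin.sum_univ_two, h1, h2]
    · linear_combination e0
    · linear_combination -c1
    · linear_combination e1
    · linear_combination c0
  · intro i
    fin_cases i <;> simp [hμ1]

/-- The eigenvalues of a symmetry on the doublets of oscillators. -/
structure IsDiagonalization (g : SU2 × SU2) (U V : Side → Matrix (Fin 2) (Fin 2) ℂ)
    (d : Side → Fin 2 → ℂ) : Prop where
  mul_inv : ∀ s, U s * V s = 1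
  inv_mul : ∀ s, V s * U s = 1
  comm : ∀ s, component g s * U s = U s * Matrix.diagonal (d s)
  norm_eq_one : ∀ s i, ‖d s i‖ = 1

lemma exists_isDiagonalization (g : SU2 × SU2) : ∃ U V d, IsDiagonalization g U V d := by
  obtain ⟨U, V, d, h1, h2, h3, h4⟩ := exists_diagonalization g.1
  obtain ⟨U', V', d', h1', h2', h3', h4'⟩ := exists_diagonalization g.2
  refine ⟨fun | .left => U | .right => U', fun | .left => V | .right => V',
    fun | .left => d | .right => d', ?_, ?_, ?_, ?_⟩
  · rintro (_ | _) <;> assumption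
  · rintro (_ | _) <;> assumption
  · rintro (_ | _) <;> assumption
  · rintro (_ | _) <;> assumption

lemma IsDiagonalization.right_eq_one {g : SU2 × SU2} {U V : Side → Matrix (Fin 2) (Fin 2) ℂ}
    {d : Side → Fin 2 → ℂ} (h : IsDiagonalization g U V d) (hg : g.2 = 1) (i : Fin 2) :
    d .right i = 1 := by
  have h1 := h.comm .right
  have h2 : component g .right = 1 := by simp [component, hg]
  rw [h2, one_mul] at h1
  have h3 := congrArg (V .right * ·) h1
  simp only [← mul_assoc, h.inv_mul, one_mul] at h3
  have h4 := congrFun (congrFun h3 i) i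
  simpa using h4.symm

/-- The value on the modes `χ` or `j`, and its conjugate on `χ*` or `j*`. -/
def fermionValue {α : Type*} (f : α → α) (a : Side → α) : FermionMode → α
  | .chi s _ => a s
  | .chiStar s _ => f (a s)

def bosonValue {α : Type*} (f : α → α) (a : Side → α) : BosonMode → α
  | .j s _ => a s
  | .jStar s _ => f (a s)

def fermionEigenvalue (d : Side → Fin 2 → ℂ) : FermionMode → Fin 2 → ℂ :=
  fermionValue (fun e i => conj (e i)) d

def bosonEigenvalue (d : Side → Fin 2 → ℂ) : BosonMode → Fin 2 → ℂ :=
  bosonValue (fun e i => conj (e i)) d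

/-- The eigenvalue of `g (-1)^F` on an oscillator state. -/
def occupationTrace (d : Side → Fin 2 → ℂ) (o : Occupation) : ℂ :=
  (∏ x ∈ o.1, -fermionEigenvalue d x.1 x.2) * o.2.prod fun x k => bosonEigenvalue d x.1 x.2 ^ k

/-- The eigenvalue of `t^{L₀} u^{L̃₀} y^{J₀³}` on a state. -/
def stateWeight (t u y : ℝ) (k : Ambient) (o : Occupation) : ℝ :=
  t ^ (1 / 4 : ℝ) * u ^ (1 / 4 : ℝ) * y⁻¹ * (latticeWeight t u k *
    ((∏ x ∈ o.1, fermionWeight t u y x.1) * o.2.prod fun x k => bosonWeight t u x.1 ^ k))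

lemma conj_map_mul (A B : Matrix (Fin 2) (Fin 2) ℂ) :
    (A * B).map conj = A.map conj * B.map conj :=
  Matrix.map_mul (f := starRingEnd ℂ)

lemma conj_map_diagonal (d : Fin 2 → ℂ) :
    (Matrix.diagonal d).map conj = Matrix.diagonal fun i => conj (d i) :=
  Matrix.diagonal_map (map_zero _)

lemma fermionOp_one : fermionOp (fun _ => 1) = LinearMap.id := by
  have : fermionOneParticle (fun _ => 1) = LinearMap.id := by
    refine Finsupp.lhom_ext' fun p => LinearMap.ext_ring ?_
    obtain ⟨m, i⟩ := p
    fin_cases i <;> simp [fermionOneParticle, Fin.sum_univ_two]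
  rw [fermionOp, this, ExteriorAlgebra.map_id]
  rfl

lemma bosonOp_one : bosonOp (fun _ => 1) = LinearMap.id := by
  have : (MvPolynomial.aeval fun p : BosonMode × Fin 2 =>
      ∑ i, MvPolynomial.C ((1 : Matrix (Fin 2) (Fin 2) ℂ) i p.2) *
        (MvPolynomial.X (p.1, i) : BosonSpace)) = AlgHom.id ℂ BosonSpace := by
    refine MvPolynomial.algHom_ext fun p => ?_
    obtain ⟨m, i⟩ := p
    fin_cases i <;> simp [Fin.sum_univ_two]
  rw [bosonOp, this]
  rfl

section

variable {g : SU2 × SU2} {U V : Side → Matrix (Fin 2) (Fin 2) ℂ} {d : Side → Fin 2 → ℂ}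
  {L : Submodule ℤ Ambient}

/-- The change of basis of the oscillators. -/
def fockMap (L : Submodule ℤ Ambient) (U : Side → Matrix (Fin 2) (Fin 2) ℂ) :
    StateSpace L →ₗ[ℂ] StateSpace L :=
  TensorProduct.map LinearMap.id
    (TensorProduct.map (fermionOp (fermionValue (fun A => A.map conj) U))
      (bosonOp (bosonValue (fun A => A.map conj) U)))

lemma fockMap_comp (h : ∀ s, U s * V s = 1) : fockMap L U ∘ₗ fockMap L V = LinearMap.id := by
  have h1 : (fun m => fermionValue (fun A => A.map conj) U m *
      fermionValue (fun A => A.map conj) V m) = fun _ => 1 := by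
    funext m
    cases m <;> simp [fermionValue, h, ← conj_map_mul]
  have h2 : (fun m => bosonValue (fun A => A.map conj) U m *
      bosonValue (fun A => A.map conj) V m) = fun _ => 1 := by
    funext m
    cases m <;> simp [bosonValue, h, ← conj_map_mul]
  rw [fockMap, fockMap, ← TensorProduct.map_comp, ← TensorProduct.map_comp, fermionOp_comp,
    bosonOp_comp, h1, h2, fermionOp_one, bosonOp_one]
  simp

lemma twiningOp_comp_fockMap (h : IsDiagonalization g U V d) (hg : g ∈ latticeSymmetries L)
    (ξ : L → Circle) :
    twiningOp hg ξ ∘ₗ fockMap L U = fockMap L U ∘ₗ TensorProduct.map (latticeOp hg ξ)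
      (TensorProduct.map (fermionOp fun m => Matrix.diagonal fun i => -fermionEigenvalue d m i)
        (bosonOp fun m => Matrix.diagonal (bosonEigenvalue d m))) := by
  rw [twiningOp, symmetryOp, parityOp, fockMap, ← TensorProduct.map_comp, ← TensorProduct.map_comp,
    ← TensorProduct.map_comp, ← TensorProduct.map_comp, ← TensorProduct.map_comp,
    ← TensorProduct.map_comp, fermionOp_comp, fermionOp_comp, fermionOp_comp, LinearMap.comp_id,
    LinearMap.comp_id, LinearMap.comp_id, LinearMap.id_comp, bosonOp_comp, bosonOp_comp]
  congr 3
  · funext m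
    have hneg (e : Fin 2 → ℂ) : (Matrix.diagonal fun i => -e i) = -Matrix.diagonal e :=
      (Matrix.diagonal_neg e).symm
    cases m with
    | chi s n =>
      change component g s * -1 * U s = U s * Matrix.diagonal fun i => -d s i
      rw [hneg, mul_neg_one, neg_mul, mul_neg, h.comm]
    | chiStar s n =>
      change (component g s).map conj * -1 * (U s).map conj
        = (U s).map conj * Matrix.diagonal fun i => -conj (d s i)
      rw [hneg, mul_neg_one, neg_mul, mul_neg, ← conj_map_mul, h.comm, conj_map_mul,
        conj_map_diagonal]
  · funext m
    cases m with
    | j s n => exact h.comm s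
    | jStar s n =>
      change (component g s).map conj * (U s).map conj
        = (U s).map conj * Matrix.diagonal fun i => conj (d s i)
      rw [← conj_map_mul, h.comm, conj_map_mul, conj_map_diagonal]

lemma scalingOp_comp_fockMap (t u y : ℝ) :
    scalingOp L t u y ∘ₗ fockMap L U = fockMap L U ∘ₗ scalingOp L t u y := by
  simp only [scalingOp, fockMap, LinearMap.smul_comp,
    LinearMap.comp_smul, ← TensorProduct.map_comp, LinearMap.comp_id, LinearMap.id_comp,
    fermionOp_comp, bosonOp_comp, smul_mul_assoc, mul_smul_comm, one_mul, mul_one]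

/-- The weights are scalars on each doublet of modes, so rotating every doublet to an eigenbasis of
g, with the conjugate rotation on starred modes, commutes with the scaling operators. -/
theorem exists_eigenbasis (h : IsDiagonalization g U V d) (hg : g ∈ latticeSymmetries L)
    (ξ : L → Circle) :
    ∃ b : Module.Basis (L × Occupation) ℂ (StateSpace L),
      (∀ x, twiningOp hg ξ (b x)
        = ((ξ x.1 : ℂ) * occupationTrace d x.2) • b (latticeAct hg x.1, x.2)) ∧
      ∀ t u y x, scalingOp L t u y (b x) = (stateWeight t u y x.1 x.2 : ℂ) • b x := by
  let e : StateSpace L ≃ₗ[ℂ] StateSpace L :=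
    LinearEquiv.ofLinearMap (fockMap L U) (fockMap L V) (fockMap_comp h.mul_inv) (fockMap_comp
        h.inv_mul)
  have hbasis (x : L × Occupation) : fockBasis L x
      = Finsupp.single x.1 1 ⊗ₜ (fermionBasis x.2.1 ⊗ₜ MvPolynomial.basisMonomials _ ℂ x.2.2) := by
    simp [fockBasis, Module.Basis.tensorProduct_apply']
  refine ⟨(fockBasis L).map e, fun x => ?_, fun t u y x => ?_⟩
  · have h1 := LinearMap.congr_fun (twiningOp_comp_fockMap h hg ξ) (fockBasis L x)
    rw [LinearMap.comp_apply, LinearMap.comp_apply] at h1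
    rw [Module.Basis.map_apply, Module.Basis.map_apply]
    refine h1.trans ?_
    rw [hbasis, hbasis, TensorProduct.map_tmul, TensorProduct.map_tmul, fermionOp_diagonal,
      bosonOp_diagonal, latticeOp, Finsupp.linearCombination_single, one_smul,
      ← mul_one (ξ x.1 : ℂ), ← smul_eq_mul (ξ x.1 : ℂ), ← Finsupp.smul_single]
    simp only [← TensorProduct.smul_tmul', TensorProduct.tmul_smul, smul_smul, map_smul]
    rw [occupationTrace, smul_eq_mul]
    congr 1
    ring
  · have h1 := LinearMap.congr_fun (scalingOp_comp_fockMap (L := L) (U := U) t u y) (fockBasis L x)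
    rw [LinearMap.comp_apply, LinearMap.comp_apply] at h1
    rw [Module.Basis.map_apply]
    refine h1.trans ?_
    have hf : (fun m => (fermionWeight t u y m : ℂ) • (1 : Matrix (Fin 2) (Fin 2) ℂ))
        = fun m => Matrix.diagonal fun _ => (fermionWeight t u y m : ℂ) := by
      funext m
      rw [Matrix.smul_one_eq_diagonal]
    have hb : (fun m => (bosonWeight t u m : ℂ) • (1 : Matrix (Fin 2) (Fin 2) ℂ))
        = fun m => Matrix.diagonal fun _ => (bosonWeight t u m : ℂ) := by
      funext m
      rw [Matrix.smul_one_eq_diagonal]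
    rw [hbasis, scalingOp, LinearMap.smul_apply, TensorProduct.map_tmul, TensorProduct.map_tmul,
      hf, hb, fermionOp_diagonal, bosonOp_diagonal, latticeScaling,
      Finsupp.linearCombination_single, one_smul, ← mul_one (latticeWeight t u x.1 : ℂ),
      ← smul_eq_mul (latticeWeight t u x.1 : ℂ), ← Finsupp.smul_single]
    simp only [← TensorProduct.smul_tmul', TensorProduct.tmul_smul, smul_smul, map_smul]
    change _ • fockMap L U _ = _ • fockMap L U _
    congr 1
    rw [stateWeight, Finsupp.prod, Finsupp.prod]
    push_cast
    ring

end

end TorusModel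
end

noncomputable section
namespace TorusModel

/-! ### Convergence -/

lemma norm_sq_le_dot_self (x : FourSpace) : ‖x‖ ^ 2 ≤ dot x x := by
  have h : dot x x = ‖x 0‖ ^ 2 + ‖x 1‖ ^ 2 := by
    rw [← Complex.normSq_eq_norm_sq, ← Complex.normSq_eq_norm_sq, Complex.normSq_apply,
      Complex.normSq_apply]
    simp [dot, Fin.sum_univ_two]
  have h1 : ‖x‖ ≤ √(dot x x) := by
    rw [pi_norm_le_iff_of_nonneg (Real.sqrt_nonneg _)]
    intro i
    refine Real.le_sqrt_of_sq_le ?_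
    rw [h]
    fin_cases i
    · exact le_add_of_nonneg_right (sq_nonneg _)
    · exact le_add_of_nonneg_left (sq_nonneg _)
  rw [← Real.sq_sqrt (dot_self_nonneg x)]
  exact pow_le_pow_left₀ (norm_nonneg _) h1 2

lemma norm_sq_le (v : Ambient) : ‖v‖ ^ 2 ≤ dot v.1 v.1 + dot v.2 v.2 := by
  have h1 := norm_sq_le_dot_self v.1
  have h2 := norm_sq_le_dot_self v.2
  have h3 := dot_self_nonneg v.1
  have h4 := dot_self_nonneg v.2
  rw [Prod.norm_def]
  rcases max_choice ‖v.1‖ ‖v.2‖ with h | h <;> rw [h] <;> linarith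

lemma latticeWeight_self {t : ℝ} (ht : 0 < t) (k : Ambient) :
    latticeWeight t t k = t ^ ((dot k.1 k.1 + dot k.2 k.2) / 2) := by
  rw [latticeWeight, ← Real.rpow_add ht]
  ring_nf

lemma latticeWeight_pos {t u : ℝ} (ht : 0 < t) (hu : 0 < u) (k : Ambient) :
    0 < latticeWeight t u k :=
  mul_pos (Real.rpow_pos_of_pos ht _) (Real.rpow_pos_of_pos hu _)

/-- Gaussian decay is compared with a power: exp(-x) ≤ n!/xⁿ for x = c|k|², and n exceeds the rank,
so the sum of |k|^(-2n) over the lattice converges. -/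
lemma summable_latticeWeight {L : Submodule ℤ Ambient} (hL : DiscreteTopology L) {t : ℝ}
    (ht : 0 < t) (ht1 : t < 1) : Summable fun k : L => latticeWeight t t k := by
  set n := Module.finrank ℤ L + 1 with hn
  set c := -Real.log t / 2 with hc_def
  have hc : 0 < c := by
    have := Real.log_neg ht ht1
    rw [hc_def]
    linarith
  have hs := (ZLattice.summable_norm_rpow L (-(2 * n : ℕ)) (by
    rw [hn, neg_lt_neg_iff]
    push_cast
    linarith [(Nat.cast_nonneg (Module.finrank ℤ L) : (0 : ℝ) ≤ _)])).mul_left (n.factorial / c ^ n)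
  refine Summable.of_norm_bounded_eventually hs ?_
  refine (Set.finite_singleton (0 : L)).subset fun k hk => ?_
  by_contra hk0
  apply hk
  rw [Set.mem_ofPred_eq]
  have hk1 : 0 < ‖(k : Ambient)‖ := norm_pos_iff.2 fun h => hk0 (Subtype.ext h)
  have hN := norm_sq_le (k : Ambient)
  rw [Real.norm_of_nonneg (latticeWeight_pos ht ht _).le, latticeWeight_self ht,
    Real.rpow_def_of_pos ht]
  have h1 : Real.exp (Real.log t * ((dot (k : Ambient).1 (k : Ambient).1 +
      dot (k : Ambient).2 (k : Ambient).2) / 2)) ≤ Real.exp (-(c * ‖(k : Ambient)‖ ^ 2)) := by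
    apply Real.exp_le_exp.2
    rw [hc_def] at *
    nlinarith
  refine h1.trans ?_
  have hpos : 0 < c * ‖(k : Ambient)‖ ^ 2 := by positivity
  have h2 := Real.pow_div_factorial_le_exp _ hpos.le n
  rw [Real.exp_neg, show ‖k‖ = ‖(k : Ambient)‖ from rfl, Real.rpow_neg hk1.le, Real.rpow_natCast]
  have h3 : 0 < (c * ‖(k : Ambient)‖ ^ 2) ^ n / n.factorial := by positivity
  refine (inv_anti₀ h3 h2).trans (le_of_eq ?_)
  rw [mul_pow, ← pow_mul]
  field_simp

/-- A finitely supported function is determined by its graph over its support, a finite subset of `I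
× ℕ`. So the family is part of the expansion of Π (1 + f). -/
lemma summable_prod_pow {I : Type*} {f : I × ℕ → ℝ} (hf : ∀ x, 0 ≤ f x) (hs : Summable f) :
    Summable fun n : I →₀ ℕ => n.prod fun i k => f (i, k) := by
  classical
  have hmem (n : I →₀ ℕ) (x : I × ℕ) :
      x ∈ n.support.image (fun i => (i, n i)) ↔ n x.1 ≠ 0 ∧ n x.1 = x.2 := by
    rw [Finset.mem_image]
    constructor
    · rintro ⟨i, hi, rfl⟩
      exact ⟨Finsupp.mem_support_iff.1 hi, rfl⟩
    · rintro ⟨h1, h2⟩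
      exact ⟨x.1, Finsupp.mem_support_iff.2 h1, Prod.ext rfl h2⟩
  have hinj : Function.Injective fun n : I →₀ ℕ => n.support.image fun i => (i, n i) := by
    have key (m n : I →₀ ℕ) (h : m.support.image (fun i => (i, m i))
        = n.support.image fun i => (i, n i)) (i : I) (hi : m i ≠ 0) : m i = n i := by
      have h1 := (hmem m (i, m i)).2 ⟨hi, rfl⟩
      rw [h] at h1
      exact ((hmem n _).1 h1).2.symm
    intro m n h
    ext i
    by_cases hm : m i = 0
    · by_cases hn : n i = 0
      · rw [hm, hn]
      · exact (key n m h.symm i hn).symm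
    · exact key m n h i hm
  have h := (summable_finsetProd_of_summable_nonneg hf hs).comp_injective hinj
  refine h.congr fun n => ?_
  rw [Function.comp_apply, Finset.prod_image fun i _ j _ h => (Prod.ext_iff.1 h).1]
  rfl

/-- The kind of a mode and its index. -/
def FermionMode.code : FermionMode → Fin 4 × ℕ
  | .chi .left n => (0, n)
  | .chi .right n => (1, n)
  | .chiStar .left n => (2, n)
  | .chiStar .right n => (3, n)

def BosonMode.code : BosonMode → Fin 4 × ℕ
  | .j .left n => (0, n)
  | .j .right n => (1, n)
  | .jStar .left n => (2, n)
  | .jStar .right n => (3, n)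

lemma FermionMode.code_injective : Function.Injective FermionMode.code := by
  rintro (⟨_ | _, m⟩ | ⟨_ | _, m⟩) (⟨_ | _, n⟩ | ⟨_ | _, n⟩) h <;>
    simp_all [FermionMode.code]

lemma BosonMode.code_injective : Function.Injective BosonMode.code := by
  rintro (⟨_ | _, m⟩ | ⟨_ | _, m⟩) (⟨_ | _, n⟩ | ⟨_ | _, n⟩) h <;>
    simp_all [BosonMode.code]

lemma fermionWeight_pos {t u y : ℝ} (ht : 0 < t) (hu : 0 < u) (hy : 0 < y) (m : FermionMode) :
    0 < fermionWeight t u y m := by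
  rcases m with ⟨_ | _, n⟩ | ⟨_ | _, n⟩ <;> simp only [fermionWeight] <;> positivity

lemma bosonWeight_pos {t u : ℝ} (ht : 0 < t) (hu : 0 < u) (m : BosonMode) :
    0 < bosonWeight t u m := by
  rcases m with ⟨_ | _, n⟩ | ⟨_ | _, n⟩ <;> simp only [bosonWeight] <;> positivity

lemma summable_geometric_fintype {α : Type*} [Finite α] {t : ℝ} (ht : 0 < t) (ht1 : t < 1) :
    Summable fun x : α × ℕ => t ^ x.2 := by
  have h := Summable.mul_of_nonneg (f := fun _ : α => (1 : ℝ)) (.of_finite)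
    (summable_geometric_of_lt_one ht.le ht1) (fun _ => zero_le_one) (fun n => by positivity)
  simpa using h

lemma summable_fermionWeight {t y : ℝ} (ht : 0 < t) (ht1 : t < 1) (hy : 0 < y) :
    Summable fun x : FermionIndex => fermionWeight t t y x.1 := by
  have h0 := (summable_geometric_fintype (α := Fin 4) ht ht1).comp_injective
    FermionMode.code_injective
  have h1 : Summable fun m => fermionWeight t t y m := by
    refine Summable.of_nonneg_of_le (fun m => (fermionWeight_pos ht ht hy m).le) (fun m => ?_)
      (h0.mul_left (1 + y + y⁻¹))
    have hyi : 0 < y⁻¹ := inv_pos.2 hy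
    have ht0 (n : ℕ) : 0 < t ^ n := by positivity
    rcases m with ⟨_ | _, n⟩ | ⟨_ | _, n⟩ <;>
      simp only [fermionWeight, Function.comp_apply, FermionMode.code, pow_succ]
    · nlinarith [mul_pos (ht0 n) hyi, ht0 n]
    · nlinarith [mul_pos (ht0 n) hyi, mul_pos (ht0 n) hy]
    · nlinarith [mul_pos (ht0 n) hyi, mul_pos (ht0 n) hy, ht0 n]
    · nlinarith [mul_pos (ht0 n) hyi, mul_pos (ht0 n) hy, ht0 n]
  have h2 := h1.mul_of_nonneg (g := fun _ : Fin 2 => (1 : ℝ)) .of_finite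
    (fun m => (fermionWeight_pos ht ht hy m).le) (fun _ => zero_le_one)
  simpa using h2

lemma summable_bosonWeight {t : ℝ} (ht : 0 < t) (ht1 : t < 1) :
    Summable fun n : BosonIndex →₀ ℕ => n.prod fun x k => bosonWeight t t x.1 ^ k := by
  have h0 := (summable_geometric_fintype (α := Fin 4) ht ht1).comp_injective
    BosonMode.code_injective
  have hcode (m : BosonMode) : bosonWeight t t m = t * t ^ m.code.2 := by
    rcases m with ⟨_ | _, n⟩ | ⟨_ | _, n⟩ <;> simp only [bosonWeight, BosonMode.code] <;> ring
  have h1 : Summable fun m => bosonWeight t t m :=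
    (h0.mul_left t).congr fun m => (hcode m).symm
  have h2 := h1.mul_of_nonneg (g := fun _ : Fin 2 => (1 : ℝ)) .of_finite
    (fun m => (bosonWeight_pos ht ht m).le) (fun _ => zero_le_one)
  have h3 := h2.mul_of_nonneg (summable_geometric_of_lt_one ht.le ht1)
    (fun x => mul_nonneg (bosonWeight_pos ht ht x.1).le zero_le_one) (fun n => by positivity)
  have hw (m : BosonMode) : bosonWeight t t m ≤ t := by
    rw [hcode]
    exact mul_le_of_le_one_right ht.le (pow_le_one₀ ht.le ht1.le)
  -- Occupation number 0 never occurs in a support and is given the value 0. For k ≥ 1 the weight w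
  -- ≤ t gives wᵏ ≤ t^(k-1) w.
  have h4 : Summable fun x : BosonIndex × ℕ =>
      if x.2 = 0 then 0 else bosonWeight t t x.1.1 ^ x.2 := by
    refine Summable.of_nonneg_of_le (fun x => ?_) (fun x => ?_) (h3.mul_left t⁻¹)
    · have := bosonWeight_pos ht ht x.1.1
      split_ifs <;> positivity
    · have hp := bosonWeight_pos ht ht x.1.1
      obtain ⟨x, k⟩ := x
      rcases k with _ | k
      · simp only [if_true]
        positivity
      · simp only [Nat.add_eq_zero_iff, one_ne_zero, and_false, if_false, mul_one]
        have : t⁻¹ * (bosonWeight t t x.1 * t ^ (k + 1)) = t ^ k * bosonWeight t t x.1 := by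
          rw [pow_succ]
          field_simp
        rw [this, pow_succ]
        exact mul_le_mul_of_nonneg_right (pow_le_pow_left₀ hp.le (hw _) k) hp.le
  refine (summable_prod_pow (fun x => ?_) h4).congr fun n => ?_
  · have := bosonWeight_pos ht ht x.1.1
    split_ifs <;> positivity
  · refine Finset.prod_congr rfl fun x hx => ?_
    exact if_neg (Finsupp.mem_support_iff.1 hx)

theorem summable_stateWeight {L : Submodule ℤ Ambient} (hL : DiscreteTopology L) {t y : ℝ}
    (ht : 0 < t) (ht1 : t < 1) (hy : 0 < y) :
    Summable fun x : L × Occupation => stateWeight t t y x.1 x.2 := by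
  have h1 := summable_finsetProd_of_summable_nonneg
    (fun x : FermionIndex => (fermionWeight_pos ht ht hy x.1).le) (summable_fermionWeight ht ht1 hy)
  have h2 := h1.mul_of_nonneg (summable_bosonWeight ht ht1)
    (fun F => Finset.prod_nonneg fun x _ => (fermionWeight_pos ht ht hy x.1).le)
    (fun n => Finset.prod_nonneg fun x _ => pow_nonneg (bosonWeight_pos ht ht x.1).le _)
  have h3 := (summable_latticeWeight hL ht ht1).mul_of_nonneg h2
    (fun k => (latticeWeight_pos ht ht k).le) (fun o => mul_nonneg
      (Finset.prod_nonneg fun x _ => (fermionWeight_pos ht ht hy x.1).le)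
      (Finset.prod_nonneg fun x _ => pow_nonneg (bosonWeight_pos ht ht x.1).le _))
  exact h3.mul_left _

end TorusModel
end

noncomputable section
namespace TorusModel

/-! ### Cancellation between bosons and fermions -/

instance : DecidableEq FermionMode := Classical.decEq _

/-- The fermionic mode with the same energy and the same transformation as a bosonic mode. -/
def BosonMode.partner : BosonMode → FermionMode
  | .j s n => .chi s (n + 1)
  | .jStar s n => .chiStar s n

/-- The fermionic partner of a bosonic creation operator. -/
def partner (x : BosonIndex) : FermionIndex := (x.1.partner, x.2)

lemma partner_injective : Function.Injective partner := by
  rintro ⟨m, i⟩ ⟨m', i'⟩ h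
  cases m <;> cases m' <;> simp_all [partner, BosonMode.partner]

/-- Exchange a fermion with a boson of the same energy. -/
def exchange (x : BosonIndex) (o : Occupation) : Occupation :=
  if partner x ∈ o.1 then (o.1.erase (partner x), o.2 + Finsupp.single x 1)
  else (insert (partner x) o.1, o.2 - Finsupp.single x 1)

/-- The mode `x` or its partner is excited. -/
def IsExcited (x : BosonIndex) (o : Occupation) : Prop := partner x ∈ o.1 ∨ o.2 x ≠ 0

lemma IsExcited.partner_mem_exchange {x : BosonIndex} {o : Occupation} (h : partner x ∉ o.1) :
    partner x ∈ (exchange x o).1 := by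
  simp [exchange, h]

lemma IsExcited.exchange_exchange {x : BosonIndex} {o : Occupation} (h : IsExcited x o) :
    exchange x (exchange x o) = o := by
  obtain ⟨F, n⟩ := o
  by_cases hx : partner x ∈ F
  · have h1 : exchange x (F, n) = (F.erase (partner x), n + Finsupp.single x 1) := if_pos hx
    rw [h1, exchange, if_neg (by simp)]
    refine Prod.ext ?_ ?_
    · simp [hx]
    · simp
  · have h1 : exchange x (F, n) = (insert (partner x) F, n - Finsupp.single x 1) := if_neg hx
    have h2 : n x ≠ 0 := h.resolve_left hx
    rw [h1, exchange, if_pos (by simp)]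
    refine Prod.ext ?_ ?_
    · simp [hx]
    · refine tsub_add_cancel_of_le ?_
      rw [Finsupp.single_le_iff]
      exact Nat.one_le_iff_ne_zero.2 h2

lemma isExcited_exchange_iff {x z : BosonIndex} {o : Occupation} (h : IsExcited x o) :
    IsExcited z (exchange x o) ↔ IsExcited z o := by
  obtain ⟨F, n⟩ := o
  by_cases hzx : z = x
  · subst hzx
    refine iff_of_true ?_ h
    by_cases hx : partner z ∈ F
    · right
      simp [exchange, hx]
    · exact Or.inl (IsExcited.partner_mem_exchange hx)
  · have h1 : partner z ≠ partner x := fun h => hzx (partner_injective h)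
    have h2 : Finsupp.single x 1 z = 0 := Finsupp.single_eq_of_ne hzx
    by_cases hx : partner x ∈ F
    · simp [IsExcited, exchange, hx, h1, h2]
    · simp [IsExcited, exchange, hx, h1, h2]

section

variable {M : Type*} [CommRing M]

/-- A multiplicative function of the occupation numbers. -/
def multWeight (a : FermionIndex → M) (b : BosonIndex → M) (o : Occupation) : M :=
  (∏ x ∈ o.1, a x) * o.2.prod fun x k => b x ^ k

/-- Used with ε = -1 for eigenvalues of g(-1)^F and with ε = 1 for energies and charges. -/
lemma multWeight_exchange {a : FermionIndex → M} {b : BosonIndex → M} {ε : M} (hε : ε * ε = 1)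
    {x : BosonIndex} (hx : a (partner x) = ε * b x) {o : Occupation} (ho : IsExcited x o) :
    multWeight a b (exchange x o) = ε * multWeight a b o := by
  have key {o : Occupation} (h : partner x ∈ o.1) :
      multWeight a b (exchange x o) = ε * multWeight a b o := by
    obtain ⟨F, n⟩ := o
    have h1 : exchange x (F, n) = (F.erase (partner x), n + Finsupp.single x 1) := if_pos h
    have h2 : (n + Finsupp.single x 1).prod (fun x k => b x ^ k)
        = (n.prod fun x k => b x ^ k) * b x := by
      rw [Finsupp.prod_add_index' (by simp) (by simp [pow_add]), Finsupp.prod_single_index (by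
          simp),
        pow_one]
    rw [h1, multWeight, multWeight, h2, ← Finset.mul_prod_erase F a h, hx]
    linear_combination (-(∏ x ∈ F.erase (partner x), a x) * (n.prod fun x k => b x ^ k) * b x) * hε
  by_cases h : partner x ∈ o.1
  · exact key h
  · have h1 := key (IsExcited.partner_mem_exchange h)
    rw [ho.exchange_exchange] at h1
    rw [h1, ← mul_assoc, hε, one_mul]

end

lemma sum_eq_zero_of_involution {K : Type*} {I : Finset (K × Occupation)} {φ : Occupation →
    Occupation}
    (hφ : ∀ x ∈ I, φ (φ x.2) = x.2) (hmem : ∀ x ∈ I, (x.1, φ x.2) ∈ I) {v : K × Occupation → ℂ}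
    (hneg : ∀ x ∈ I, v (x.1, φ x.2) = -v x) : ∑ x ∈ I, v x = 0 := by
  have h : ∑ x ∈ I, v x = ∑ x ∈ I, -v x := by
    refine Finset.sum_bij' (fun x _ => (x.1, φ x.2)) (fun x _ => (x.1, φ x.2)) hmem hmem
      (fun x hx => Prod.ext rfl (hφ x hx)) (fun x hx => Prod.ext rfl (hφ x hx)) fun x hx => ?_
    rw [hneg x hx, neg_neg]
  rw [Finset.sum_neg_distrib] at h
  exact self_eq_neg.1 h

def BosonMode.IsRight : BosonMode → Prop
  | .j .right _ => True
  | .jStar .right _ => True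
  | _ => False

/-- No right-moving oscillator of positive energy is excited. -/
def IsRightVacuum (o : Occupation) : Prop := ∀ x : BosonIndex, x.1.IsRight → ¬IsExcited x o

/-- Signed sums over states with excited right-moving oscillators vanish. -/
lemma sum_eq_zero_of_not_isRightVacuum {K : Type*} {I : Finset (K × Occupation)}
    (hI : ∀ x ∈ I, ¬IsRightVacuum x.2)
    (hmem : ∀ x ∈ I, ∀ z : BosonIndex, z.1.IsRight → IsExcited z x.2 → (x.1, exchange z x.2) ∈ I)
    {v : K × Occupation → ℂ}
    (hneg : ∀ x ∈ I, ∀ z : BosonIndex, z.1.IsRight → IsExcited z x.2 →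
      v (x.1, exchange z x.2) = -v x) : ∑ x ∈ I, v x = 0 := by
  classical
  let A (o : Occupation) : Set BosonIndex := {z | z.1.IsRight ∧ IsExcited z o}
  -- The chosen mode depends only on the set of excited right-moving modes, which the exchange does
  -- not alter; hence the same mode is chosen again and the map is an involution. The default is
  -- never reached on `I`.
  let pick (S : Set BosonIndex) : BosonIndex :=
    if h : S.Nonempty then h.some else (.j .right 0, 0)
  have hpick {x : K × Occupation} (hx : x ∈ I) : pick (A x.2) ∈ A x.2 := by
    have h : (A x.2).Nonempty := by
      have := hI x hx
      simp only [IsRightVacuum, not_forall, not_not] at this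
      obtain ⟨z, hz, hz'⟩ := this
      exact ⟨z, hz, hz'⟩
    simp only [pick, dif_pos h]
    exact h.some_mem
  refine sum_eq_zero_of_involution (φ := fun o => exchange (pick (A o)) o) (fun x hx => ?_)
    (fun x hx => hmem x hx _ (hpick hx).1 (hpick hx).2)
    (fun x hx => hneg x hx _ (hpick hx).1 (hpick hx).2)
  have hA : A (exchange (pick (A x.2)) x.2) = A x.2 :=
    Set.ext fun z => and_congr_right fun _ => isExcited_exchange_iff (hpick hx).2
  simp only [hA]
  exact (hpick hx).2.exchange_exchange

/-! ### The zero modes -/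

/-- This mode carries no energy and no J₀³ charge, so toggling it changes a state's trace only
through (-1)^F and its g-eigenvalue. -/
def zeroMode : FermionIndex := (.chi .right 0, 0)

/-- Create or annihilate a right-moving zero mode. -/
def toggleZeroMode (o : Occupation) : Occupation :=
  if zeroMode ∈ o.1 then (o.1.erase zeroMode, o.2) else (insert zeroMode o.1, o.2)

lemma toggleZeroMode_toggleZeroMode (o : Occupation) : toggleZeroMode (toggleZeroMode o) = o := by
  by_cases h : zeroMode ∈ o.1
  · have h1 : toggleZeroMode o = (o.1.erase zeroMode, o.2) := if_pos h
    rw [h1, toggleZeroMode, if_neg (by simp)]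
    exact Prod.ext (Finset.insert_erase h) rfl
  · have h1 : toggleZeroMode o = (insert zeroMode o.1, o.2) := if_neg h
    rw [h1, toggleZeroMode, if_pos (by simp)]
    exact Prod.ext (Finset.erase_insert h) rfl

lemma multWeight_toggleZeroMode {M : Type*} [CommRing M] {a : FermionIndex → M}
    {b : BosonIndex → M} (h : a zeroMode * a zeroMode = 1) (o : Occupation) :
    multWeight a b (toggleZeroMode o) = a zeroMode * multWeight a b o := by
  by_cases h0 : zeroMode ∈ o.1
  · have h1 : toggleZeroMode o = (o.1.erase zeroMode, o.2) := if_pos h0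
    rw [h1, multWeight, multWeight, ← Finset.mul_prod_erase o.1 a h0]
    linear_combination -(∏ x ∈ o.1.erase zeroMode, a x) * (o.2.prod fun x k => b x ^ k) * h
  · have h1 : toggleZeroMode o = (insert zeroMode o.1, o.2) := if_neg h0
    rw [h1, multWeight, multWeight, Finset.prod_insert h0, mul_assoc]

/-! ### Weights and traces of states -/

lemma occupationTrace_eq (d : Side → Fin 2 → ℂ) (o : Occupation) :
    occupationTrace d o = multWeight (fun x => -fermionEigenvalue d x.1 x.2)
      (fun x => bosonEigenvalue d x.1 x.2) o := rfl

lemma stateWeight_eq (t u y : ℝ) (k : Ambient) (o : Occupation) :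
    stateWeight t u y k o = t ^ (1 / 4 : ℝ) * u ^ (1 / 4 : ℝ) * y⁻¹ * (latticeWeight t u k *
      multWeight (fun x => fermionWeight t u y x.1) (fun x => bosonWeight t u x.1) o) := rfl

lemma occupationTrace_exchange (d : Side → Fin 2 → ℂ) {x : BosonIndex} {o : Occupation}
    (ho : IsExcited x o) : occupationTrace d (exchange x o) = -occupationTrace d o := by
  rw [occupationTrace_eq, occupationTrace_eq, multWeight_exchange (ε := -1) (by norm_num) ?_ ho,
    neg_one_mul]
  obtain ⟨m, i⟩ := x
  cases m <;>
  simp [partner, BosonMode.partner, fermionEigenvalue, bosonEigenvalue, fermionValue, bosonValue]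

lemma stateWeight_exchange (t u y : ℝ) (k : Ambient) {x : BosonIndex} (hx : x.1.IsRight)
    {o : Occupation} (ho : IsExcited x o) :
    stateWeight t u y k (exchange x o) = stateWeight t u y k o := by
  rw [stateWeight_eq, stateWeight_eq, multWeight_exchange (ε := 1) (by norm_num) ?_ ho, one_mul]
  rw [one_mul]
  obtain ⟨m, i⟩ := x
  rcases m with ⟨_ | _, n⟩ | ⟨_ | _, n⟩
  · exact hx.elim
  · rfl
  · exact hx.elim
  · rfl

lemma occupationTrace_toggleZeroMode {d : Side → Fin 2 → ℂ} (hd : d .right 0 = 1)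
    (o : Occupation) : occupationTrace d (toggleZeroMode o) = -occupationTrace d o := by
  have h : -fermionEigenvalue d zeroMode.1 zeroMode.2 = -1 := by
    rw [← hd]
    rfl
  rw [occupationTrace_eq, occupationTrace_eq,
    multWeight_toggleZeroMode (by simp only [h]; norm_num), h, neg_one_mul]

lemma stateWeight_toggleZeroMode (t u y : ℝ) (k : Ambient) (o : Occupation) :
    stateWeight t u y k (toggleZeroMode o) = stateWeight t u y k o := by
  have h : fermionWeight t u y zeroMode.1 = 1 := pow_zero u
  rw [stateWeight_eq, stateWeight_eq, multWeight_toggleZeroMode (by simp only [h]; norm_num), h,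
    one_mul]

lemma norm_occupationTrace {g : SU2 × SU2} {U V : Side → Matrix (Fin 2) (Fin 2) ℂ}
    {d : Side → Fin 2 → ℂ} (h : IsDiagonalization g U V d) (o : Occupation) :
    ‖occupationTrace d o‖ = 1 := by
  have h1 (x : FermionIndex) : ‖fermionEigenvalue d x.1 x.2‖ = 1 := by
    obtain ⟨m, i⟩ := x
    cases m <;> simp [fermionEigenvalue, fermionValue, h.norm_eq_one]
  have h2 (x : BosonIndex) : ‖bosonEigenvalue d x.1 x.2‖ = 1 := by
    obtain ⟨m, i⟩ := x
    cases m <;> simp [bosonEigenvalue, bosonValue, h.norm_eq_one]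
  simp [occupationTrace, norm_prod, Finsupp.prod, h1, h2]

/-- Without right-moving excitations, the right-moving energy is that of the ground states. -/
lemma stateWeight_of_isRightVacuum {t u y : ℝ} {k : Ambient} (hk : k.2 = 0) {o : Occupation}
    (ho : IsRightVacuum o) :
    stateWeight t u y k o = u ^ (1 / 4 : ℝ) * stateWeight t 1 y k o := by
  have h1 : ∏ x ∈ o.1, fermionWeight t u y x.1 = ∏ x ∈ o.1, fermionWeight t 1 y x.1 := by
    refine Finset.prod_congr rfl fun x hx => ?_
    obtain ⟨m, i⟩ := x
    rcases m with ⟨_ | _, n⟩ | ⟨_ | _, n⟩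
    · rfl
    · rcases n with _ | n
      · simp [fermionWeight]
      · exact absurd (Or.inl hx) (ho (.j .right n, i) trivial)
    · rfl
    · exact absurd (Or.inl hx) (ho (.jStar .right n, i) trivial)
  have h2 : (o.2.prod fun x k => bosonWeight t u x.1 ^ k)
      = o.2.prod fun x k => bosonWeight t 1 x.1 ^ k := by
    refine Finset.prod_congr rfl fun x hx => ?_
    have hx' := Finsupp.mem_support_iff.1 hx
    obtain ⟨m, i⟩ := x
    rcases m with ⟨_ | _, n⟩ | ⟨_ | _, n⟩
    · rfl
    · exact absurd (Or.inr hx') (ho (.j .right n, i) trivial)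
    · rfl
    · exact absurd (Or.inr hx') (ho (.jStar .right n, i) trivial)
  rw [stateWeight, stateWeight, h1, h2, latticeWeight, latticeWeight, hk]
  simp [dot]
  ring

end TorusModel
end

noncomputable section
namespace TorusModel

/-! ### Traces on the weight spaces -/

lemma finite_of_summable {X : Type*} {f : X → ℝ} (hf : Summable f) {c : ℝ} (hc : 0 < c)
    {S : Set X} (hS : ∀ x ∈ S, f x = c) : S.Finite := by
  have h := (hf.tendsto_cofinite_zero.eventually_lt_const hc)
  refine (Filter.eventually_cofinite.1 h).subset fun x hx => ?_
  rw [Set.mem_ofPred_eq, hS x hx]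
  exact lt_irrefl c

/-- The sets `I w` are disjoint, so the bounds are partial sums of a regrouped summable family. -/
lemma summable_of_norm_le_sum {X W : Type*} {f : X → ℝ} (hf : Summable f) {I : W → Finset X}
    (hI : ∀ w w' x, x ∈ I w → x ∈ I w' → w = w') {a : W → ℂ} {C : ℝ}
    (ha : ∀ w, ‖a w‖ ≤ C * ∑ x ∈ I w, f x) : Summable a := by
  have hinj : Function.Injective fun p : Σ w, I w => (p.2 : X) := by
    rintro ⟨w, x, hx⟩ ⟨w', x', hx'⟩ h
    obtain rfl : x = x' := h
    obtain rfl := hI w w' x hx hx'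
    rfl
  have h := (hf.comp_injective hinj).sigma
  refine Summable.of_norm_bounded (h.mul_left C) fun w => (ha w).trans (le_of_eq ?_)
  rw [← Finset.tsum_subtype]
  rfl

variable {L : Submodule ℤ Ambient} {g : SU2 × SU2}

/-- The states with `L₀ = h`, `L̃₀ = h'`, `J₀³ = j`, where `w = (h, h', j)`. -/
def weightStates (L : Submodule ℤ Ambient) (w : ℝ × ℝ × ℤ) : Set (L × Occupation) :=
  {x | ∀ t u y : ℝ, 0 < t → 0 < u → 0 < y →
    stateWeight t u y x.1 x.2 = t ^ w.1 * u ^ w.2.1 * y ^ w.2.2}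

/-- The states with `L₀ + L̃₀ = h`, `J₀³ = j`, where `w = (h, j)`. -/
def chiralStates (L : Submodule ℤ Ambient) (w : ℝ × ℤ) : Set (L × Occupation) :=
  {x | ∀ t y : ℝ, 0 < t → 0 < y → stateWeight t t y x.1 x.2 = t ^ w.1 * y ^ w.2}

lemma weightStates_finite (hL : DiscreteTopology L) (w : ℝ × ℝ × ℤ) :
    (weightStates L w).Finite :=
  finite_of_summable (summable_stateWeight hL (t := 1 / 2) (y := 1) (by norm_num) (by norm_num)
    (by norm_num)) (by positivity) fun x hx =>
      hx (1 / 2) (1 / 2) 1 (by norm_num) (by norm_num) (by norm_num)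

lemma chiralStates_finite (hL : DiscreteTopology L) (w : ℝ × ℤ) : (chiralStates L w).Finite :=
  finite_of_summable (summable_stateWeight hL (t := 1 / 2) (y := 1) (by norm_num) (by norm_num)
    (by norm_num)) (by positivity) fun x hx => hx (1 / 2) 1 (by norm_num) (by norm_num)

lemma rpow_two_injective {a b : ℝ} (h : (2 : ℝ) ^ a = 2 ^ b) : a = b :=
  (Real.rpow_right_inj (by norm_num) (by norm_num)).1 h

lemma zpow_two_injective {a b : ℤ} (h : (2 : ℝ) ^ a = 2 ^ b) : a = b :=
  zpow_right_injective₀ (by norm_num) (by norm_num) h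

lemma eq_of_mem_weightStates {w w' : ℝ × ℝ × ℤ} {x : L × Occupation} (h : x ∈ weightStates L w)
    (h' : x ∈ weightStates L w') : w = w' := by
  have h1 := (h 2 1 1 two_pos one_pos one_pos).symm.trans (h' 2 1 1 two_pos one_pos one_pos)
  have h2 := (h 1 2 1 one_pos two_pos one_pos).symm.trans (h' 1 2 1 one_pos two_pos one_pos)
  have h3 := (h 1 1 2 one_pos one_pos two_pos).symm.trans (h' 1 1 2 one_pos one_pos two_pos)
  simp only [Real.one_rpow, one_zpow, mul_one, one_mul] at h1 h2 h3
  exact Prod.ext (rpow_two_injective h1) (Prod.ext (rpow_two_injective h2) (zpow_two_injective h3))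

lemma eq_of_mem_chiralStates {w w' : ℝ × ℤ} {x : L × Occupation} (h : x ∈ chiralStates L w)
    (h' : x ∈ chiralStates L w') : w = w' := by
  have h1 := (h 2 1 two_pos one_pos).symm.trans (h' 2 1 two_pos one_pos)
  have h2 := (h 1 2 one_pos two_pos).symm.trans (h' 1 2 one_pos two_pos)
  simp only [Real.one_rpow, one_zpow, mul_one, one_mul] at h1 h2
  exact Prod.ext (rpow_two_injective h1) (zpow_two_injective h2)

open scoped Classical in
/-- The diagonal matrix element of `g (-1)^F` on a state. -/
def diagonalElement (hg : g ∈ latticeSymmetries L) (d : Side → Fin 2 → ℂ) (x : L × Occupation) :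
    ℂ :=
  if latticeAct hg x.1 = x.1 then occupationTrace d x.2 else 0

section

variable {U V : Side → Matrix (Fin 2) (Fin 2) ℂ} {d : Side → Fin 2 → ℂ}

lemma norm_diagonalElement_le (h : IsDiagonalization g U V d) (hg : g ∈ latticeSymmetries L)
    (x : L × Occupation) : ‖diagonalElement hg d x‖ ≤ 1 := by
  rw [diagonalElement]
  split_ifs
  · exact (norm_occupationTrace h x.2).le
  · simp

lemma diagonalElement_eq (hg : g ∈ latticeSymmetries L) {ξ : L → Circle}
    (hξ : ∀ v, latticeAct hg v = v → ξ v = 1) [DecidableEq (L × Occupation)]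
    (x : L × Occupation) :
    (if (latticeAct hg x.1, x.2) = x then (ξ x.1 : ℂ) * occupationTrace d x.2 else 0)
      = diagonalElement hg d x := by
  have h1 : (latticeAct hg x.1, x.2) = x ↔ latticeAct hg x.1 = x.1 :=
    ⟨fun h => congrArg Prod.fst h, fun h => Prod.ext h rfl⟩
  rw [diagonalElement]
  by_cases h : latticeAct hg x.1 = x.1
  · rw [if_pos (h1.2 h), if_pos h, hξ _ h, Circle.coe_one, one_mul]
  · rw [if_neg (fun h' => h (h1.1 h')), if_neg h]

lemma trace_weightSpace (h : IsDiagonalization g U V d) (hg : g ∈ latticeSymmetries L)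
    {ξ : L → Circle} (hξ : ∀ v, latticeAct hg v = v → ξ v = 1) (w : ℝ × ℝ × ℤ)
    {s : Finset (L × Occupation)} (hs : ∀ x, x ∈ s ↔ x ∈ weightStates L w) :
    LinearMap.trace ℂ _
      ((twiningOp hg ξ).restrict (twiningOp_mem_weightSpace hg ξ w.1 w.2.1 w.2.2))
      = ∑ x ∈ s, diagonalElement hg d x := by
  classical
  obtain ⟨b, hb, hb'⟩ := exists_eigenbasis h hg ξ
  have hW (v : StateSpace L) : v ∈ weightSpace L w.1 w.2.1 w.2.2 ↔
      ∀ p ∈ {p : ℝ × ℝ × ℝ | 0 < p.1 ∧ 0 < p.2.1 ∧ 0 < p.2.2}, scalingOp L p.1 p.2.1 p.2.2 v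
        = ((p.1 ^ w.1 * p.2.1 ^ w.2.1 * p.2.2 ^ w.2.2 : ℝ) : ℂ) • v :=
    ⟨fun hv p hp => hv _ _ _ hp.1 hp.2.1 hp.2.2,
      fun hv t u y ht hu hy => hv (t, u, y) ⟨ht, hu, hy⟩⟩
  refine (trace_restrict_eq_sum (V := StateSpace L) (T := twiningOp hg ξ)
    (W := weightSpace L w.1 w.2.1 w.2.2) b hb
    (σ := fun x (p : ℝ × ℝ × ℝ) => (stateWeight p.1 p.2.1 p.2.2 x.1 x.2 : ℂ))
    (fun p x => hb' _ _ _ x) hW (twiningOp_mem_weightSpace hg ξ _ _ _) (s := s) fun x => (hs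
        x).trans ?_).trans
    (Finset.sum_congr rfl fun x _ => diagonalElement_eq hg hξ x)
  exact ⟨fun hx p hp => congrArg _ (hx _ _ _ hp.1 hp.2.1 hp.2.2),
      fun hx t u y ht hu hy => Complex.ofReal_injective (hx (t, u, y) ⟨ht, hu, hy⟩)⟩

lemma trace_chiralWeightSpace (h : IsDiagonalization g U V d) (hg : g ∈ latticeSymmetries L)
    {ξ : L → Circle} (hξ : ∀ v, latticeAct hg v = v → ξ v = 1) (w : ℝ × ℤ)
    {s : Finset (L × Occupation)} (hs : ∀ x, x ∈ s ↔ x ∈ chiralStates L w) :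
    LinearMap.trace ℂ _
      ((twiningOp hg ξ).restrict (twiningOp_mem_chiralWeightSpace hg ξ w.1 w.2))
      = ∑ x ∈ s, diagonalElement hg d x := by
  classical
  obtain ⟨b, hb, hb'⟩ := exists_eigenbasis h hg ξ
  have hW (v : StateSpace L) : v ∈ chiralWeightSpace L w.1 w.2 ↔
      ∀ p ∈ {p : ℝ × ℝ | 0 < p.1 ∧ 0 < p.2}, scalingOp L p.1 p.1 p.2 v
        = ((p.1 ^ w.1 * p.2 ^ w.2 : ℝ) : ℂ) • v :=
    ⟨fun hv p hp => hv _ _ hp.1 hp.2, fun hv t y ht hy => hv (t, y) ⟨ht, hy⟩⟩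
  refine (trace_restrict_eq_sum (V := StateSpace L) (T := twiningOp hg ξ)
    (W := chiralWeightSpace L w.1 w.2) b hb
    (σ := fun x (p : ℝ × ℝ) => (stateWeight p.1 p.1 p.2 x.1 x.2 : ℂ))
    (fun p x => hb' _ _ _ x) hW (twiningOp_mem_chiralWeightSpace hg ξ _ _) (s := s) fun x => (hs
        x).trans ?_).trans
    (Finset.sum_congr rfl fun x _ => diagonalElement_eq hg hξ x)
  exact ⟨fun hx p hp => congrArg _ (hx _ _ hp.1 hp.2),
      fun hx t y ht hy => Complex.ofReal_injective (hx (t, y) ⟨ht, hy⟩)⟩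

lemma diagonalElement_toggleZeroMode (hd : d .right 0 = 1) (hg : g ∈ latticeSymmetries L)
    (x : L × Occupation) :
    diagonalElement hg d (x.1, toggleZeroMode x.2) = -diagonalElement hg d x := by
  simp only [diagonalElement, occupationTrace_toggleZeroMode hd]
  split_ifs <;> simp

lemma diagonalElement_exchange (hg : g ∈ latticeSymmetries L) (x : L × Occupation)
    {z : BosonIndex} (hz : IsExcited z x.2) :
    diagonalElement hg d (x.1, exchange z x.2) = -diagonalElement hg d x := by
  simp only [diagonalElement, occupationTrace_exchange d hz]
  split_ifs <;> simp

lemma sum_diagonalElement_eq_zero (hd : d .right 0 = 1) (hg : g ∈ latticeSymmetries L)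
    {s : Finset (L × Occupation)} (hs : ∀ x ∈ s, (x.1, toggleZeroMode x.2) ∈ s) :
    ∑ x ∈ s, diagonalElement hg d x = 0 :=
  sum_eq_zero_of_involution (fun x _ => toggleZeroMode_toggleZeroMode x.2) hs
    fun x _ => diagonalElement_toggleZeroMode hd hg x

open scoped Classical in
/-- Only the invariant states without right-moving excitations contribute to the traces. -/
lemma sum_diagonalElement_eq (hg : g ∈ latticeSymmetries L) {s : Finset (L × Occupation)}
    (hs : ∀ x ∈ s, ∀ z : BosonIndex, z.1.IsRight → IsExcited z x.2 → (x.1, exchange z x.2) ∈ s) :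
    ∑ x ∈ s, diagonalElement hg d x
      = ∑ x ∈ s with latticeAct hg x.1 = x.1 ∧ IsRightVacuum x.2, occupationTrace d x.2 := by
  have h0 : ∑ x ∈ s with ¬IsRightVacuum x.2, diagonalElement hg d x = 0 := by
    refine sum_eq_zero_of_not_isRightVacuum (fun x hx => (Finset.mem_filter.1 hx).2)
      (fun x hx z hz hzx => ?_) fun x _ z _ hzx => diagonalElement_exchange hg x hzx
    obtain ⟨hx1, hx2⟩ := Finset.mem_filter.1 hx
    refine Finset.mem_filter.2 ⟨hs x hx1 z hz hzx, fun hv => ?_⟩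
    exact hv z hz ((isExcited_exchange_iff hzx).2 hzx)
  rw [← Finset.sum_filter_add_sum_filter_not s (fun x => IsRightVacuum x.2), h0, add_zero,
    ← Finset.filter_filter, Finset.filter_comm, Finset.sum_filter (s := s.filter _)]
  rfl

lemma exchange_mem_weightStates {w : ℝ × ℝ × ℤ} {x : L × Occupation} (hx : x ∈ weightStates L w)
    {z : BosonIndex} (hz : z.1.IsRight) (hzx : IsExcited z x.2) :
    (x.1, exchange z x.2) ∈ weightStates L w := fun t u y ht hu hy => by
  rw [stateWeight_exchange t u y _ hz hzx]
  exact hx t u y ht hu hy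

lemma exchange_mem_chiralStates {w : ℝ × ℤ} {x : L × Occupation} (hx : x ∈ chiralStates L w)
    {z : BosonIndex} (hz : z.1.IsRight) (hzx : IsExcited z x.2) :
    (x.1, exchange z x.2) ∈ chiralStates L w := fun t y ht hy => by
  rw [stateWeight_exchange t t y _ hz hzx]
  exact hx t y ht hy

end

/-- Momentum and oscillators contribute nothing on the right, and the zero modes cost no energy; the
ground-state value 1/4 remains. -/
lemma right_energy_eq {k : L} (hk : (k : Ambient).2 = 0) {o : Occupation} (ho : IsRightVacuum o)
    {w : ℝ × ℝ × ℤ} (hx : (k, o) ∈ weightStates L w) : w.2.1 = 1 / 4 := by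
  have h1 := hx 1 1 1 one_pos one_pos one_pos
  have h2 := hx 1 2 1 one_pos two_pos one_pos
  rw [stateWeight_of_isRightVacuum hk ho] at h1 h2
  simp only [Real.one_rpow, one_zpow, mul_one, one_mul] at h1 h2
  rw [h1, mul_one] at h2
  exact (rpow_two_injective h2).symm

lemma mem_weightStates_iff {k : L} (hk : (k : Ambient).2 = 0) {o : Occupation}
    (ho : IsRightVacuum o) {h : ℝ} {j : ℤ} :
    (k, o) ∈ weightStates L (h, 1 / 4, j) ↔
      ∀ t y : ℝ, 0 < t → 0 < y → stateWeight t 1 y k o = t ^ h * y ^ j := by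
  constructor
  · intro hx t y ht hy
    simpa using hx t 1 y ht one_pos hy
  · intro hx t u y ht hu hy
    rw [stateWeight_of_isRightVacuum hk ho, hx t y ht hy]
    ring

lemma mem_chiralStates_iff {k : L} (hk : (k : Ambient).2 = 0) {o : Occupation}
    (ho : IsRightVacuum o) {h : ℝ} {j : ℤ} :
    (k, o) ∈ chiralStates L (h + 1 / 4, j) ↔
      ∀ t y : ℝ, 0 < t → 0 < y → stateWeight t 1 y k o = t ^ h * y ^ j := by
  refine forall₄_congr fun t y ht hy => ?_
  rw [stateWeight_of_isRightVacuum hk ho, Real.rpow_add ht]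
  have : t ^ (1 / 4 : ℝ) ≠ 0 := (Real.rpow_pos_of_pos ht _).ne'
  rw [mul_comm (t ^ h), mul_assoc, mul_right_inj' this]

/-! ### Convergence of the twined traces -/

lemma norm_exp_mul (τ : ℂ) (a : ℝ) :
    ‖Complex.exp (2 * Real.pi * Complex.I * τ * a)‖ = Real.exp (-2 * Real.pi * τ.im) ^ a := by
  rw [Complex.norm_exp, ← Real.exp_mul]
  congr 1
  simp [Complex.mul_re, Complex.mul_im]

lemma norm_exp_conj_mul (τ : ℂ) (a : ℝ) :
    ‖Complex.exp (-2 * Real.pi * Complex.I * conj τ * a)‖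
      = Real.exp (-2 * Real.pi * τ.im) ^ a := by
  rw [Complex.norm_exp, ← Real.exp_mul]
  congr 1
  simp [Complex.mul_re, Complex.mul_im]

lemma norm_exp_mul_int (z : ℂ) (j : ℤ) :
    ‖Complex.exp (2 * Real.pi * Complex.I * z * j)‖ = Real.exp (-2 * Real.pi * z.im) ^ j := by
  have h := norm_exp_mul z j
  rw [Real.rpow_intCast] at h
  rw [← h]
  push_cast
  rfl

section

variable {U V : Side → Matrix (Fin 2) (Fin 2) ℂ} {d : Side → Fin 2 → ℂ}

lemma norm_sum_diagonalElement_mul_le (h : IsDiagonalization g U V d)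
    (hg : g ∈ latticeSymmetries L) {s : Finset (L × Occupation)} {f : L × Occupation → ℝ}
    {c C : ℝ} (hc : 0 ≤ c) (hf : ∀ x ∈ s, c = C * f x) :
    ‖∑ x ∈ s, diagonalElement hg d x‖ * c ≤ C * ∑ x ∈ s, f x := by
  rw [Finset.mul_sum, ← Finset.sum_congr rfl hf]
  refine (mul_le_mul_of_nonneg_right (norm_sum_le_of_le s fun x _ =>
    norm_diagonalElement_le h hg x) hc).trans (le_of_eq ?_)
  rw [Finset.sum_mul, one_mul]

lemma exp_im_lt_one {τ : ℂ} (hτ : 0 < τ.im) : Real.exp (-2 * Real.pi * τ.im) < 1 := by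
  rw [Real.exp_lt_one_iff]
  have := mul_pos Real.pi_pos hτ
  linarith

/-- Diagonal elements have norm at most 1, so a term is bounded by t^(-1/2) times the total weight
of its states at t = u = |q| and y = |e^{2πiz}|; the exponent is -6/24 - 6/24. -/
lemma summable_genusTerm (hL : DiscreteTopology L) (h : IsDiagonalization g U V d)
    (hg : g ∈ latticeSymmetries L) {ξ : L → Circle} (hξ : ∀ v, latticeAct hg v = v → ξ v = 1)
    {τ : ℂ} (hτ : 0 < τ.im) (z : ℂ) : Summable (genusTerm hg ξ τ z) := by
  set t := Real.exp (-2 * Real.pi * τ.im) with ht_def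
  set y := Real.exp (-2 * Real.pi * z.im) with hy_def
  have ht : 0 < t := Real.exp_pos _
  have hy : 0 < y := Real.exp_pos _
  refine summable_of_norm_le_sum (summable_stateWeight hL ht (exp_im_lt_one hτ) hy)
    (I := fun w => (weightStates_finite hL w).toFinset) (C := t ^ (-(1 / 2) : ℝ))
    (fun w w' x hx hx' => eq_of_mem_weightStates ((Set.Finite.mem_toFinset _).1 hx)
      ((Set.Finite.mem_toFinset _).1 hx')) fun w => ?_
  rw [genusTerm, trace_weightSpace h hg hξ w (s := (weightStates_finite hL w).toFinset)
    fun x => Set.Finite.mem_toFinset _, norm_mul, norm_mul, norm_mul, norm_exp_mul,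
    norm_exp_conj_mul, norm_exp_mul_int, mul_assoc, mul_assoc]
  refine norm_sum_diagonalElement_mul_le h hg (by positivity) fun x hx => ?_
  have h1 : t ^ (w.1 - 6 / 24) * t ^ (w.2.1 - 6 / 24) = t ^ (-(1 / 2) : ℝ) * (t ^ w.1 * t ^
      w.2.1) := by
    rw [← Real.rpow_add ht, ← Real.rpow_add ht, ← Real.rpow_add ht]
    ring_nf
  rw [(Set.Finite.mem_toFinset _).1 hx t t y ht ht hy, h1]
  ring

lemma summable_traceTerm (hL : DiscreteTopology L) (h : IsDiagonalization g U V d)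
    (hg : g ∈ latticeSymmetries L) {ξ : L → Circle} (hξ : ∀ v, latticeAct hg v = v → ξ v = 1)
    {τ : ℂ} (hτ : 0 < τ.im) (z : ℂ) : Summable (traceTerm hg ξ τ z) := by
  set t := Real.exp (-2 * Real.pi * τ.im) with ht_def
  set y := Real.exp (-2 * Real.pi * z.im) with hy_def
  have ht : 0 < t := Real.exp_pos _
  have hy : 0 < y := Real.exp_pos _
  refine summable_of_norm_le_sum (summable_stateWeight hL ht (exp_im_lt_one hτ) hy)
    (I := fun w => (chiralStates_finite hL w).toFinset) (C := t ^ (-(1 / 2) : ℝ))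
    (fun w w' x hx hx' => eq_of_mem_chiralStates ((Set.Finite.mem_toFinset _).1 hx)
      ((Set.Finite.mem_toFinset _).1 hx')) fun w => ?_
  rw [traceTerm, trace_chiralWeightSpace h hg hξ w (s := (chiralStates_finite hL w).toFinset)
    fun x => Set.Finite.mem_toFinset _, norm_mul, norm_mul, norm_exp_mul, norm_exp_mul_int,
    mul_assoc]
  refine norm_sum_diagonalElement_mul_le h hg (by positivity) fun x hx => ?_
  have h1 : t ^ (w.1 - 12 / 24) = t ^ (-(1 / 2) : ℝ) * t ^ w.1 := by
    rw [← Real.rpow_add ht]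
    ring_nf
  rw [(Set.Finite.mem_toFinset _).1 hx t y ht hy, h1]
  ring

/-! ### Comparison of the twined traces -/

/-- For trivial g_R the right-moving zero mode pairs states of equal weight and opposite sign. -/
lemma genusTerm_eq_zero (hL : DiscreteTopology L) (h : IsDiagonalization g U V d)
    (hg : g ∈ latticeSymmetries L) {ξ : L → Circle} (hξ : ∀ v, latticeAct hg v = v → ξ v = 1)
    (hd : d .right 0 = 1) (τ z : ℂ) (w : ℝ × ℝ × ℤ) : genusTerm hg ξ τ z w = 0 := by
  rw [genusTerm, trace_weightSpace h hg hξ w (s := (weightStates_finite hL w).toFinset)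
    fun x => Set.Finite.mem_toFinset _, sum_diagonalElement_eq_zero hd hg, zero_mul, zero_mul,
    zero_mul]
  intro x hx
  rw [Set.Finite.mem_toFinset] at hx ⊢
  intro t u y ht hu hy
  rw [stateWeight_toggleZeroMode]
  exact hx t u y ht hu hy

lemma traceTerm_eq_zero (hL : DiscreteTopology L) (h : IsDiagonalization g U V d)
    (hg : g ∈ latticeSymmetries L) {ξ : L → Circle} (hξ : ∀ v, latticeAct hg v = v → ξ v = 1)
    (hd : d .right 0 = 1) (τ z : ℂ) (w : ℝ × ℤ) : traceTerm hg ξ τ z w = 0 := by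
  rw [traceTerm, trace_chiralWeightSpace h hg hξ w (s := (chiralStates_finite hL w).toFinset)
    fun x => Set.Finite.mem_toFinset _, sum_diagonalElement_eq_zero hd hg, zero_mul, zero_mul]
  intro x hx
  rw [Set.Finite.mem_toFinset] at hx ⊢
  intro t y ht hy
  rw [stateWeight_toggleZeroMode]
  exact hx t y ht hy

lemma act_eq_of_latticeAct_eq (hg : g ∈ latticeSymmetries L) {k : L} :
    latticeAct hg k = k ↔ act g k = k :=
  ⟨fun h => congrArg Subtype.val h, fun h => Subtype.ext h⟩

lemma genusTerm_eq_zero_of_ne (hL : DiscreteTopology L) (h : IsDiagonalization g U V d)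
    (hg : g ∈ latticeSymmetries L) {ξ : L → Circle} (hξ : ∀ v, latticeAct hg v = v → ξ v = 1)
    (hfix : ∀ v, act g v = v → v.2 = 0) (τ z : ℂ) {w : ℝ × ℝ × ℤ} (hw : w.2.1 ≠ 1 / 4) :
    genusTerm hg ξ τ z w = 0 := by
  classical
  rw [genusTerm, trace_weightSpace h hg hξ w (s := (weightStates_finite hL w).toFinset)
    fun x => Set.Finite.mem_toFinset _, sum_diagonalElement_eq hg, Finset.sum_eq_zero, zero_mul,
    zero_mul, zero_mul]
  · intro x hx
    obtain ⟨hx1, hx2, hx3⟩ := Finset.mem_filter.1 hx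
    exact absurd (right_energy_eq (hfix _ ((act_eq_of_latticeAct_eq hg).1 hx2)) hx3
      ((Set.Finite.mem_toFinset _).1 hx1)) hw
  · intro x hx z hz hzx
    rw [Set.Finite.mem_toFinset] at hx ⊢
    exact exchange_mem_weightStates hx hz hzx

/-- At right-moving energy 1/4 = 6/24 the factor in q̄ is 1, and the shift of the chiral energy by
1/4 accounts for 12/24 in place of 6/24. The surviving states on both sides are fixed left-moving
vectors, common to both lattices, with the same oscillators. -/
lemma traceTerm_eq_genusTerm {L' : Submodule ℤ Ambient} (hL : DiscreteTopology L)
    (hL' : DiscreteTopology L') (h : IsDiagonalization g U V d)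
    (hg : g ∈ latticeSymmetries L) (hg' : g ∈ latticeSymmetries L') {ξ : L → Circle}
    (hξ : ∀ v, latticeAct hg v = v → ξ v = 1) {ξ' : L' → Circle}
    (hξ' : ∀ v, latticeAct hg' v = v → ξ' v = 1)
    (hfix : ∀ v, act g v = v → v.2 = 0 ∧ (v ∈ L' ↔ v ∈ L)) (τ z : ℂ) (e : ℝ) (j : ℤ) :
    traceTerm hg' ξ' τ z (e + 1 / 4, j) = genusTerm hg ξ τ z (e, 1 / 4, j) := by
  classical
  rw [genusTerm, traceTerm,
    trace_weightSpace h hg hξ (e, 1 / 4, j) (s := (weightStates_finite hL _).toFinset)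
      fun x => Set.Finite.mem_toFinset _,
    trace_chiralWeightSpace h hg' hξ' (e + 1 / 4, j) (s := (chiralStates_finite hL' _).toFinset)
      fun x => Set.Finite.mem_toFinset _,
    sum_diagonalElement_eq hg, sum_diagonalElement_eq hg']
  · have h1 : ((1 / 4 : ℝ) - 6 / 24 : ℝ) = 0 := by norm_num
    have h2 : (e + 1 / 4 - 12 / 24 : ℝ) = e - 6 / 24 := by ring
    simp only [h1, h2, Complex.ofReal_zero, mul_zero, Complex.exp_zero, mul_one]
    congr 2
    refine Finset.sum_bij' (fun x hx => (⟨x.1, ?_⟩, x.2)) (fun x hx => (⟨x.1, ?_⟩, x.2)) ?_ ?_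
      (fun _ _ => rfl) (fun _ _ => rfl) (fun _ _ => rfl)
    · exact (hfix _ ((act_eq_of_latticeAct_eq hg').1 (Finset.mem_filter.1 hx).2.1)).2.1 x.1.2
    · exact (hfix _ ((act_eq_of_latticeAct_eq hg).1 (Finset.mem_filter.1 hx).2.1)).2.2 x.1.2
    · rintro ⟨k, o⟩ hx
      obtain ⟨hx1, hx2, hx3⟩ := Finset.mem_filter.1 hx
      have hk := (act_eq_of_latticeAct_eq hg').1 hx2
      rw [Set.Finite.mem_toFinset, mem_chiralStates_iff (hfix _ hk).1 hx3] at hx1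
      refine Finset.mem_filter.2 ⟨?_, (act_eq_of_latticeAct_eq hg).2 hk, hx3⟩
      rw [Set.Finite.mem_toFinset]
      exact (mem_weightStates_iff (hfix _ hk).1 hx3).2 hx1
    · rintro ⟨k, o⟩ hx
      obtain ⟨hx1, hx2, hx3⟩ := Finset.mem_filter.1 hx
      have hk := (act_eq_of_latticeAct_eq hg).1 hx2
      rw [Set.Finite.mem_toFinset, mem_weightStates_iff (hfix _ hk).1 hx3] at hx1
      refine Finset.mem_filter.2 ⟨?_, (act_eq_of_latticeAct_eq hg').2 hk, hx3⟩
      rw [Set.Finite.mem_toFinset]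
      exact (mem_chiralStates_iff (hfix _ hk).1 hx3).2 hx1
  · intro x hx z hz hzx
    rw [Set.Finite.mem_toFinset] at hx ⊢
    exact exchange_mem_chiralStates hx hz hzx
  · intro x hx z hz hzx
    rw [Set.Finite.mem_toFinset] at hx ⊢
    exact exchange_mem_weightStates hx hz hzx

end

/-- If the fixed vectors of `g` in the two lattices agree and are purely left-moving, the twined
traces agree. -/
theorem twinedTrace_eq_twinedEllipticGenus {L' : Submodule ℤ Ambient} (hL : DiscreteTopology L)
    (hL' : DiscreteTopology L') (hg : g ∈ latticeSymmetries L) (hg' : g ∈ latticeSymmetries L')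
    {ξ : L → Circle} (hξ : ∀ v, latticeAct hg v = v → ξ v = 1) {ξ' : L' → Circle}
    (hξ' : ∀ v, latticeAct hg' v = v → ξ' v = 1)
    (hfix : g.2 ≠ 1 → ∀ v, act g v = v → v.2 = 0 ∧ (v ∈ L' ↔ v ∈ L)) (τ z : ℂ) :
    twinedTrace hg' ξ' τ z = twinedEllipticGenus hg ξ τ z := by
  obtain ⟨U, V, d, h⟩ := exists_isDiagonalization g
  rw [twinedTrace, twinedEllipticGenus]
  -- For g_R = 1 the fixed vectors of the two lattices need not agree, but both traces vanish.
  by_cases hg2 : g.2 = 1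
  · have hd := h.right_eq_one hg2 0
    simp only [genusTerm_eq_zero hL h hg hξ hd, traceTerm_eq_zero hL' h hg' hξ' hd, tsum_zero]
  · replace hfix := hfix hg2
    have hinj : Function.Injective fun p : ℝ × ℤ => ((p.1, 1 / 4, p.2) : ℝ × ℝ × ℤ) :=
      fun p q hpq => Prod.ext (congrArg (fun x : ℝ × ℝ × ℤ => x.1) hpq)
        (congrArg (fun x : ℝ × ℝ × ℤ => x.2.2) hpq)
    have h1 : Function.support (genusTerm hg ξ τ z)
        ⊆ Set.range fun p : ℝ × ℤ => ((p.1, 1 / 4, p.2) : ℝ × ℝ × ℤ) := by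
      intro w hw
      by_contra hne
      refine hw (genusTerm_eq_zero_of_ne hL h hg hξ (fun v hv => (hfix v hv).1) τ z fun h4 => ?_)
      exact hne ⟨(w.1, w.2.2), Prod.ext rfl (Prod.ext h4.symm rfl)⟩
    -- The genus is supported on right-moving energy 1/4, so its sum runs over (h, j), matched with
    -- (h + 1/4, j) on the chiral side.
    rw [← hinj.tsum_eq h1,
      ← (Equiv.prodCongr (Equiv.addRight (1 / 4 : ℝ)) (Equiv.refl ℤ)).tsum_eq (traceTerm hg' ξ' τ
          z)]
    exact tsum_congr fun p => traceTerm_eq_genusTerm hL hL' h hg hg' hξ hξ' hfix τ z p.1 p.2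

end TorusModel
end

/-! ### The theorem. -/

theorem theorem4p1 (Γ : Submodule ℤ TorusModel.Ambient) (hΓ : TorusModel.IsNarainLattice Γ) :
    ∃ Λ : Submodule ℤ TorusModel.Ambient, TorusModel.IsE8Lattice Λ ∧
      ∃ hle : TorusModel.G0 Γ ≤ TorusModel.latticeSymmetries Λ,
        ∀ (g : TorusModel.SU2 × TorusModel.SU2) (hg : g ∈ TorusModel.G0 Γ)
          (ε : Γ → Γ → Circle) (ξ : Γ → Circle) (ε' : Λ → Λ → Circle) (ξ' : Λ → Circle),
          TorusModel.IsCocycle TorusModel.narainForm Γ ε →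
          TorusModel.IsStandardLift ε hg ξ →
          TorusModel.IsCocycle TorusModel.euclideanForm Λ ε' →
          TorusModel.IsStandardLift ε' (hle hg) ξ' →
          ∀ τ z : ℂ, 0 < τ.im →
            Summable (TorusModel.genusTerm hg ξ τ z) ∧
            Summable (TorusModel.traceTerm (hle hg) ξ' τ z) ∧
            TorusModel.twinedTrace (hle hg) ξ' τ z =
              TorusModel.twinedEllipticGenus hg ξ τ z := by
  obtain ⟨Λ, hΛ, hle, hfix⟩ := TorusModel.exists_e8_lattice hΓ
  have hL := TorusModel.discreteTopology_of_evenSelfDual hΛ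
  refine ⟨Λ, TorusModel.isE8Lattice_of_evenSelfDual hΛ, hle, ?_⟩
  intro g hg ε ξ ε' ξ' _ hξ _ hξ' τ z hτ
  obtain ⟨U, V, d, h⟩ := TorusModel.exists_isDiagonalization g
  exact ⟨TorusModel.summable_genusTerm hΓ.discrete h hg hξ.fixed hτ z,
    TorusModel.summable_traceTerm hL h (hle hg) hξ'.fixed hτ z,
    TorusModel.twinedTrace_eq_twinedEllipticGenus hΓ.discrete hL hg (hle hg) hξ.fixed hξ'.fixed
      (hfix g hg) τ z⟩
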